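/- Let $(\Omega,\mathscr F,(\mathscr F_t)_{t\ge 0},\mathsf Q)$ be a filtered probability space such that $\mathscr F_0$ consists exactly of the events of $\mathsf Q$-probability $0$ or $1$. Let $0=T_0<T_1<\dots<T_N$, $\theta_j=T_j-T_{j-1}$, and let $\gamma_j(t)=1$ for $t\le T_{j-1}$, $\gamma_j(t)=(T_j-t)/(T_j-T_{j-1})$ for $T_{j-1}<t\le T_j$, $\gamma_j(t)=0$ for $t>T_j$. Let $[\rho_{ij}]_{0\le i,j\le N}$ be a constant correlation matrix and let $(W^0,W^1,\dots,W^N)$ be a Brownian motion with respect to $(\mathscr F_t)$ under $\mathsf Q$ with $\langle W^i,W^j\rangle_t=\rho_{ij}t$. For $j=1,\dots,N$ let $\xi_j:[0,\infty)\to(0,\infty)$ and $\zeta_j:(0,\infty)\to(0,\infty)$ be continuous with $\int_0^t\zeta_j(s)^2\,\mathrm ds<\infty$ for all $t>0$, and let $\eta_j$ be a real function that is positive and continuous on $(0,\infty)$. Suppose that $(R^1,\dots,R^N)$, with variance processes $V^1,\dots,V^N$, solves the rough SABR forward market model under $\mathsf Q$: each $R^j$ is continuous and adapted, each $V^j$ is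 positive and progressively measurable, and $$\mathrm dR^j_t=\gamma_j(t)\,\eta_j(R^j_t)\sqrt{V^j_t}\,\mathrm dW^{j\dagger}_t,\qquad \log V^j_t=\log\xi_j(t)-\frac12\int_0^t\zeta_j(t-s)^2\,\mathrm ds+\int_0^t\zeta_j(t-s)\,\mathrm d\bar W_s,$$ where $$W^{j\dagger}=W^j+\sum_{i=1}^j\int_0^{\cdot}\frac{\theta_i}{1+\theta_iR^i_t}\gamma_i(t)\eta_i(R^i_t)\sqrt{V^i_t}\,\rho_{ij}\,\mathrm dt,\qquad \bar W=W^0+\sum_{i=1}^N\int_0^{\cdot}\frac{\theta_i}{1+\theta_iR^i_t}\gamma_i(t)\eta_i(R^i_t)\sqrt{V^i_t}\,\rho_{i0}\,\mathrm dt .$$ Assume that $R^i_0>0$, $\sup_{r>0}\eta_i(r)/r<\infty$ and $\rho_{0i}\le 0$ for all $i=1,\dots,N$. Then, for each $j=1,\dots,N$: 1. almost surely, for all $t\ge0$, $$R^j_t=R^j_0\exp\left(\int_0^t\frac{\eta_j(R^j_s)}{R^j_s}\gamma_j(s)\sqrt{V^j_s}\,\mathrm dW^{j\dagger}_s-\frac12\int_0^t\left|\frac{\eta_j(R^j_s)}{R^j_s}\gamma_j(s)\right|^2V^j_s\,\mathrm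 ds\right),$$ where both integrals are well defined; 2. for every $t\ge0$, almost surely, $$V^j_t=\xi_j(t)\exp\left(\int_0^t\zeta_j(t-s)\,\mathrm d\bar W_s-\frac12\int_0^t\zeta_j(t-s)^2\,\mathrm ds\right);$$ 3. the $T_j$-forward measure $$\mathsf Q^{T_j}(F)=\frac{1}{P_0(T_j)}\,\mathsf E_{\mathsf Q}\left[\frac1{M_{T_j}};F\right],\qquad P_0(T_j)=\prod_{i=1}^j\frac1{1+\theta_iR^i_0},\qquad \frac1{M_{T_j}}=\prod_{i=1}^j\frac1{1+\theta_iR^i_{T_j}},$$ is a probability measure, and $R^j$ is a martingale under $\mathsf Q^{T_j}$ with respect to $(\mathscr F_t)$. -/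

import Mathlib

open MeasureTheory ProbabilityTheory Filter Topology
open scoped NNReal ENNReal

namespace RoughFMM

noncomputable section

/-! ### Stochastic integration -/

/-- Lebesgue measure on the time axis `[0, ∞)`. -/
def leb : Measure ℝ≥0 := Measure.comap (fun t : ℝ≥0 => (t : ℝ)) volume

/-- Convergence to `0` in probability of a sequence of `[0, ∞]`-valued functions. -/
def TendstoZeroInProb {Ω : Type*} [MeasurableSpace Ω] (Q : Measure Ω)
    (f : ℕ → Ω → ℝ≥0∞) : Prop :=
  ∀ ε : ℝ≥0∞, 0 < ε → Tendsto (fun n => Q {ω | ε ≤ f n ω}) atTop (𝓝 0)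

/-- A simple predictable process `∑_{k < n} c_k 1_{(t_k, t_{k+1}]}`, where `t_0 ≤ t_1 ≤ …` and
`c_k` is bounded and `ℱ_{t_k}`-measurable. -/
structure SimpleProcess {Ω : Type*} [mΩ : MeasurableSpace Ω] (ℱ : Filtration ℝ≥0 mΩ) where
  n : ℕ
  t : ℕ → ℝ≥0
  mono : Monotone t
  c : ℕ → Ω → ℝ
  measurable_c : ∀ k, StronglyMeasurable[ℱ (t k)] (c k)
  bounded_c : ∀ k, ∃ C : ℝ, ∀ ω, |c k ω| ≤ C

/-- The value at time `s` of a simple predictable process. -/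
def SimpleProcess.value {Ω : Type*} [mΩ : MeasurableSpace Ω] {ℱ : Filtration ℝ≥0 mΩ}
    (K : SimpleProcess ℱ) (s : ℝ≥0) (ω : Ω) : ℝ :=
  ∑ k ∈ Finset.range K.n, (Set.Ioc (K.t k) (K.t (k + 1))).indicator (fun _ => K.c k ω) s

/-- The elementary integral `∫_0^u K dZ` of a simple predictable process. -/
def SimpleProcess.integral {Ω : Type*} [mΩ : MeasurableSpace Ω] {ℱ : Filtration ℝ≥0 mΩ}
    (K : SimpleProcess ℱ) (Z : ℝ≥0 → Ω → ℝ) (u : ℝ≥0) (ω : Ω) : ℝ :=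
  ∑ k ∈ Finset.range K.n, K.c k ω * (Z (min u (K.t (k + 1))) ω - Z (min u (K.t k)) ω)

/-- `I` is (a version of) the Itô integral process `∫_0^· H dB` with respect to the Brownian motion
`B`: `I` is adapted with continuous paths, `H` is progressively measurable (up to null sets), and
there are simple predictable processes `K_n` with `∫_0^t |K_n - H|² ds → 0` in probability and
`∫_0^· K_n dB → I` uniformly on `[0, t]` in probability, for each `t`. Such an `I` exists if and
only if (a progressively measurable) `H` satisfies `∫_0^t H² ds < ∞` a.s. for each `t`, and it is
then unique up to indistinguishability. -/
structure IsItoIntegral {Ω : Type*} [mΩ : MeasurableSpace Ω] (Q : Measure Ω)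
    (ℱ : Filtration ℝ≥0 mΩ) (B H I : ℝ≥0 → Ω → ℝ) : Prop where
  adapted : StronglyAdapted ℱ I
  continuous : ∀ᵐ ω ∂Q, Continuous fun t => I t ω
  progressive : ∃ H' : ℝ≥0 → Ω → ℝ, IsStronglyProgressive ℱ H' ∧
    ∀ᵐ ω ∂Q, ∀ᵐ s ∂leb, H' s ω = H s ω
  approx : ∃ K : ℕ → SimpleProcess ℱ, ∀ t : ℝ≥0,
    TendstoZeroInProb Q
      (fun n ω => ∫⁻ s in Set.Iic t, ENNReal.ofReal (((K n).value s ω - H s ω) ^ 2) ∂leb) ∧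
    TendstoZeroInProb Q
      (fun n ω => ⨆ s ∈ Set.Iic t, ENNReal.ofReal |(K n).integral B s ω - I s ω|)

/-- `X` is (a version of) the stochastic integral process `∫_0^· H dZ` with respect to the Itô
process `Z = B + ∫_0^· a ds`, where `B` is a Brownian motion, that is
`X_t = ∫_0^t H dB + ∫_0^t H a ds`, both integrals being well defined. -/
def IsStochIntegral {Ω : Type*} [mΩ : MeasurableSpace Ω] (Q : Measure Ω)
    (ℱ : Filtration ℝ≥0 mΩ) (B a H X : ℝ≥0 → Ω → ℝ) : Prop :=
  ∃ I : ℝ≥0 → Ω → ℝ, IsItoIntegral Q ℱ B H I ∧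
    (∀ᵐ ω ∂Q, ∀ t : ℝ≥0, IntegrableOn (fun s => H s ω * a s ω) (Set.Iic t) leb) ∧
    ∀ᵐ ω ∂Q, ∀ t : ℝ≥0, X t ω = I t ω + (∫ s in Set.Iic t, H s ω * a s ω ∂leb)

/-- `W` is a correlated Brownian motion with respect to the filtration `ℱ` with
`⟨W^i, W^j⟩_t = ρ_{ij} t`: each component is adapted, starts at `0` and has continuous paths, and
for `s ≤ t` the increment `W_t - W_s` is independent of `ℱ_s` and centred Gaussian with covariance
matrix `(t - s) ρ`. -/
structure IsCorrelatedBM {Ω ι : Type*} [mΩ : MeasurableSpace Ω] [Fintype ι] [DecidableEq ι]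
    (Q : Measure Ω) (ℱ : Filtration ℝ≥0 mΩ) (ρ : Matrix ι ι ℝ) (W : ι → ℝ≥0 → Ω → ℝ) : Prop where
  adapted : ∀ k, StronglyAdapted ℱ (W k)
  zero : ∀ k, ∀ᵐ ω ∂Q, W k 0 ω = 0
  continuous : ∀ k, ∀ᵐ ω ∂Q, Continuous fun t => W k t ω
  law : ∀ s t : ℝ≥0, s ≤ t →
    HasLaw (fun ω => WithLp.toLp 2 fun k => W k t ω - W k s ω)
      (multivariateGaussian 0 (((t : ℝ) - (s : ℝ)) • ρ)) Q
  indep : ∀ s t : ℝ≥0, s ≤ t →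
    Indep (MeasurableSpace.comap (fun ω k => W k t ω - W k s ω) MeasurableSpace.pi) (ℱ s) Q

/-! ### The rough SABR forward market model -/

/-- The deterministic data of the model with tenor structure `0 = T_0 < T_1 < … < T_N`. Rates are
indexed by `j : Fin N`, the rate `j` being that for the period `(T j.castSucc, T j.succ]`; the
Brownian motions are indexed by `Fin (N + 1)`, where `0` is the common volatility factor and
`j.succ` drives the rate `j`. -/
structure Model (N : ℕ) where
  /-- tenor dates -/
  T : Fin (N + 1) → ℝ≥0
  T_zero : T 0 = 0
  T_strictMono : StrictMono T
  /-- correlation matrix -/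
  ρ : Matrix (Fin (N + 1)) (Fin (N + 1)) ℝ
  ρ_posSemidef : ρ.PosSemidef
  ρ_diag : ∀ k, ρ k k = 1
  /-- forward variance curves -/
  ξ : Fin N → ℝ≥0 → ℝ
  ξ_pos : ∀ j t, 0 < ξ j t
  ξ_continuous : ∀ j, Continuous (ξ j)
  /-- local volatility functions; nothing is required of their values outside `(0, ∞)` -/
  η : Fin N → ℝ → ℝ
  η_pos : ∀ j r, 0 < r → 0 < η j r
  η_continuousOn : ∀ j, ContinuousOn (η j) (Set.Ioi 0)
  /-- Volterra kernels, with domain `(0, ∞)` -/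
  ζ : Fin N → ℝ → ℝ
  ζ_pos : ∀ j s, 0 < s → 0 < ζ j s
  ζ_continuousOn : ∀ j, ContinuousOn (ζ j) (Set.Ioi 0)
  ζ_sq_integrable : ∀ j (t : ℝ), 0 < t → IntegrableOn (fun s => ζ j s ^ 2) (Set.Ioc 0 t)

namespace Model

variable {N : ℕ} {Ω : Type*}

/-- The accrual length `θ_j = T_j - T_{j-1}`. -/
def θ (M : Model N) (j : Fin N) : ℝ := (M.T j.succ : ℝ) - (M.T j.castSucc : ℝ)

/-- `γ_j(t)` is `1` for `t ≤ T_{j-1}`, `(T_j - t) / (T_j - T_{j-1})` for `T_{j-1} < t ≤ T_j`, and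
`0` for `t > T_j`. -/
def γ (M : Model N) (j : Fin N) (t : ℝ≥0) : ℝ :=
  if t ≤ M.T j.castSucc then 1
  else if t ≤ M.T j.succ then
    ((M.T j.succ : ℝ) - (t : ℝ)) / ((M.T j.succ : ℝ) - (M.T j.castSucc : ℝ))
  else 0

/-- The diffusion coefficient `γ_j(t) η_j(R^j_t) √V^j_t` of the rate `R^j`. -/
def vol (M : Model N) (R V : Fin N → ℝ≥0 → Ω → ℝ) (j : Fin N) (t : ℝ≥0) (ω : Ω) : ℝ :=
  M.γ j t * M.η j (R j t ω) * √(V j t ω)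

/-- The summand `θ_i / (1 + θ_i R^i_t) · γ_i(t) η_i(R^i_t) √V^i_t · ρ_{ik}`; here `k` is an index
of a Brownian motion. -/
def driftTerm (M : Model N) (R V : Fin N → ℝ≥0 → Ω → ℝ) (i : Fin N) (k : Fin (N + 1))
    (t : ℝ≥0) (ω : Ω) : ℝ :=
  M.θ i / (1 + M.θ i * R i t ω) * M.vol R V i t ω * M.ρ i.succ k

/-- The drift of `W^{j†} = W^j + ∑_{i ≤ j} ∫_0^· driftTerm_{ij} dt`. -/
def driftDagger (M : Model N) (R V : Fin N → ℝ≥0 → Ω → ℝ) (j : Fin N) (t : ℝ≥0) (ω : Ω) : ℝ :=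
  ∑ i ∈ Finset.Iic j, M.driftTerm R V i j.succ t ω

/-- The drift of `W̄ = W^0 + ∑_{i = 1}^N ∫_0^· driftTerm_{i0} dt`. -/
def driftBar (M : Model N) (R V : Fin N → ℝ≥0 → Ω → ℝ) (t : ℝ≥0) (ω : Ω) : ℝ :=
  ∑ i : Fin N, M.driftTerm R V i 0 t ω

/-- The integrand `s ↦ ζ_j(t - s) 1_{s < t}` of the Volterra integral at time `t`. -/
def kernel (M : Model N) (j : Fin N) (t : ℝ≥0) (s : ℝ≥0) (_ω : Ω) : ℝ :=
  if s < t then M.ζ j ((t : ℝ) - (s : ℝ)) else 0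

/-- `X = ∫_0^· H dW^{j†}`. -/
def IsIntegralDagger [mΩ : MeasurableSpace Ω] (M : Model N) (Q : Measure Ω)
    (ℱ : Filtration ℝ≥0 mΩ) (W : Fin (N + 1) → ℝ≥0 → Ω → ℝ) (R V : Fin N → ℝ≥0 → Ω → ℝ)
    (j : Fin N) (H X : ℝ≥0 → Ω → ℝ) : Prop :=
  IsStochIntegral Q ℱ (W j.succ) (M.driftDagger R V j) H X

/-- `Y = ∫_0^· H dW̄`. -/
def IsIntegralBar [mΩ : MeasurableSpace Ω] (M : Model N) (Q : Measure Ω)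
    (ℱ : Filtration ℝ≥0 mΩ) (W : Fin (N + 1) → ℝ≥0 → Ω → ℝ) (R V : Fin N → ℝ≥0 → Ω → ℝ)
    (H Y : ℝ≥0 → Ω → ℝ) : Prop :=
  IsStochIntegral Q ℱ (W 0) (M.driftBar R V) H Y

/-- `(R^1, …, R^N)`, with variance processes `V^1, …, V^N`, solves
`dR^j = γ_j η_j(R^j) √V^j dW^{j†}` and
`log V^j_t = log ξ_j(t) - ½ ∫_0^t ζ_j(t-s)² ds + ∫_0^t ζ_j(t-s) dW̄_s` under `Q`. -/
structure IsSolution [mΩ : MeasurableSpace Ω] (M : Model N) (Q : Measure Ω)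
    (ℱ : Filtration ℝ≥0 mΩ) (W : Fin (N + 1) → ℝ≥0 → Ω → ℝ)
    (R V : Fin N → ℝ≥0 → Ω → ℝ) : Prop where
  brownian : IsCorrelatedBM Q ℱ M.ρ W
  adapted_R : ∀ j, StronglyAdapted ℱ (R j)
  continuous_R : ∀ j, ∀ᵐ ω ∂Q, Continuous fun t => R j t ω
  progressive_V : ∀ j, IsStronglyProgressive ℱ (V j)
  pos_V : ∀ j t, ∀ᵐ ω ∂Q, 0 < V j t ω
  /-- the processes `W^{j†}` are well defined -/
  driftDagger_integrable : ∀ j, ∀ᵐ ω ∂Q, ∀ t : ℝ≥0,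
    IntegrableOn (fun s => M.driftDagger R V j s ω) (Set.Iic t) leb
  /-- the process `W̄` is well defined -/
  driftBar_integrable : ∀ᵐ ω ∂Q, ∀ t : ℝ≥0,
    IntegrableOn (fun s => M.driftBar R V s ω) (Set.Iic t) leb
  eq_R : ∀ j, ∃ X : ℝ≥0 → Ω → ℝ, M.IsIntegralDagger Q ℱ W R V j (M.vol R V j) X ∧
    ∀ᵐ ω ∂Q, ∀ t : ℝ≥0, R j t ω = R j 0 ω + X t ω
  eq_V : ∀ j t, ∃ Y : ℝ≥0 → Ω → ℝ, M.IsIntegralBar Q ℱ W R V (M.kernel j t) Y ∧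
    ∀ᵐ ω ∂Q, Real.log (V j t ω) =
      Real.log (M.ξ j t) - 1 / 2 * (∫ s in (0 : ℝ)..t, M.ζ j ((t : ℝ) - s) ^ 2) + Y t ω

/-- The price `P_t(T_j)` of the zero-coupon bond in units of the money market account `M_t`. As
`P_t(T_0) = M_t` and `1 + θ_i R^i_t = P_t(T_{i-1}) / P_t(T_i)`, it is
`∏_{i ≤ j} (1 + θ_i R^i_t)⁻¹`. -/
def discountedBond (M : Model N) (R : Fin N → ℝ≥0 → Ω → ℝ) (j : Fin N) (t : ℝ≥0) (ω : Ω) : ℝ :=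
  ∏ i ∈ Finset.Iic j, (1 + M.θ i * R i t ω)⁻¹

/-- The `T_j`-forward measure `Q^{T_j}(F) = P_0(T_j)⁻¹ E_Q[1 / M_{T_j}; F]`. Here `P_0(T_j)` is
the discounted bond price at time `0` (as `M_0 = 1`), and `1 / M_{T_j}` is the discounted bond
price at time `T_j` (as `P_{T_j}(T_j) = 1`). -/
def forwardMeasure [MeasurableSpace Ω] (M : Model N) (Q : Measure Ω)
    (R : Fin N → ℝ≥0 → Ω → ℝ) (j : Fin N) : Measure Ω :=
  Q.withDensity fun ω => ENNReal.ofReal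
    ((M.discountedBond R j 0 ω)⁻¹ * M.discountedBond R j (M.T j.succ) ω)

end Model

end

end RoughFMM

/-!
The theorem rests on one fact: the forward rates stay strictly positive (`ae_rate_pos`). Once this
is known, each of the three claims is an application of Itô's formula.

*Stochastic calculus.* An Itô process (`IsIto`) is defined pathwise, as a limit of elementary Itô
processes on dyadic grids: almost surely, paths converge locally uniformly, diffusion coefficients
in `L²` and drifts in `L¹`. For elementary processes, Itô's formula is a second-order Taylor
expansion along the grid (`Elem.exists_ito`), and it passes to the limit because all the operations
involved are continuous for these modes of convergence (`IsIto.ito`, and by polarization the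
product rule `IsIto.mul`). The Itô integrals of the model are Itô processes in this sense
(`IsIto.of_isItoIntegral`, `IsIto.of_isStochIntegral`), and conversely the martingale part of an
Itô process that is driven by one Brownian motion is an Itô integral
(`IsIto.exists_isItoIntegral`). With bounded characteristics, `Y - ∫ b` is a martingale
(`IsIto.setIntegral_sub_eq_zero`). Stopping times are never used: instead, `Y` is multiplied by a
smooth cutoff of the clock `∫ (|H|² + |b|)`, which is itself an Itô process, so that the product
rule applies. As `ℱ 0` is trivial, the initial values are constants.

*Positivity.* While all rates are positive, `ρ₀ᵢ ≤ 0` makes the drift of `W̄` nonpositive, so that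
`V j t` is at most `ξ j t` times the stochastic exponential of a Wiener integral, which has mean at
most `1` (`lintegral_exp_le_one`, `lintegral_variance_le`). On the other hand, by the linear growth
of `η`, the drift of the barrier function `∑ i, log (1 + 1 / (R i ^ 2 + e))` is bounded by a multiple
of `∑ i, V i`, uniformly in `e` (`exists_barrier_drift_bound`). Hence the barrier function has
bounded mean up to the time at which a rate comes below `√e`. As it exceeds `log (1 + 1 / (2 e))`
there, the probability that a rate comes below `√e` before `t` tends to `0` with `e`
(`IsIto.measure_pos_le`).

*Representations.* The formula for `R j` is Itô's formula for its logarithm, and the formula for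
`V j` is the exponential of the defining equation.

*The forward measure.* The change of drift from `W j` to `W† j` is exactly such that the discounted
bonds `∏ i ≤ j, (1 + θ i * R i)⁻¹` have no drift (`isIto_bond`). They take values in `[0, 1]`, hence
they are true martingales, and they are constant after maturity, where the volatilities of the
rates involved vanish (`ae_bond_eq_of_le`). So the density of the forward measure may be replaced by
the bond price at the current time, and `R j` times that price is a multiple of the difference of
two bond prices (`rate_mul_bond`), hence a martingale under the original measure
(`forwardMeasure_martingale`).
-/

namespace ItoCalculus

open RoughFMM (leb)

/-! ### Lebesgue measure on the half-line and pathwise convergence -/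

lemma coe_measurableEmbedding : MeasurableEmbedding (fun t : ℝ≥0 => (t : ℝ)) :=
  MeasurableEmbedding.subtype_coe measurableSet_Ici

lemma leb_apply (s : Set ℝ≥0) : leb s = volume ((fun t : ℝ≥0 => (t : ℝ)) '' s) :=
  coe_measurableEmbedding.comap_apply _ _

lemma image_coe_Ioc (a b : ℝ≥0) :
    (fun t : ℝ≥0 => (t : ℝ)) '' Set.Ioc a b = Set.Ioc (a : ℝ) b := by
  ext x
  constructor
  · rintro ⟨t, ⟨h1, h2⟩, rfl⟩
    exact ⟨by exact_mod_cast h1, by exact_mod_cast h2⟩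
  · rintro ⟨h1, h2⟩
    have h0 : (x.toNNReal : ℝ) = x := Real.coe_toNNReal x (a.2.trans h1.le)
    exact ⟨x.toNNReal, ⟨NNReal.coe_lt_coe.1 (by rwa [h0]), NNReal.coe_le_coe.1 (by rwa [h0])⟩, h0⟩

lemma image_coe_Iic (b : ℝ≥0) :
    (fun t : ℝ≥0 => (t : ℝ)) '' Set.Iic b = Set.Icc (0 : ℝ) b := by
  ext x
  constructor
  · rintro ⟨t, h2, rfl⟩
    exact ⟨t.2, by exact_mod_cast h2⟩
  · rintro ⟨h1, h2⟩
    have h0 : (x.toNNReal : ℝ) = x := Real.coe_toNNReal x h1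
    exact ⟨x.toNNReal, NNReal.coe_le_coe.1 (by rwa [h0]), h0⟩

lemma leb_Ioc (a b : ℝ≥0) : leb (Set.Ioc a b) = ENNReal.ofReal (b - a) := by
  rw [leb_apply, image_coe_Ioc, Real.volume_Ioc]

lemma leb_Iic (b : ℝ≥0) : leb (Set.Iic b) = b := by
  rw [leb_apply, image_coe_Iic, Real.volume_Icc]; simp

instance : NullSingletonClass leb := ⟨fun x => by rw [leb_apply]; simp⟩

instance : SigmaFinite leb := by
  refine ⟨⟨⟨fun n : ℕ => Set.Iic (n : ℝ≥0), fun _ => trivial, fun n => ?_, ?_⟩⟩⟩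
  · rw [leb_Iic]; exact ENNReal.coe_lt_top
  · ext x
    simpa using exists_nat_ge x

/-- Lebesgue measure on `[0, T]`. -/
noncomputable abbrev lebT (T : ℝ≥0) : Measure ℝ≥0 := leb.restrict (Set.Iic T)

instance (T : ℝ≥0) : IsFiniteMeasure (lebT T) :=
  ⟨by rw [Measure.restrict_apply_univ, leb_Iic]; exact ENNReal.coe_lt_top⟩

lemma lebT_univ (T : ℝ≥0) : lebT T Set.univ = T := by
  rw [Measure.restrict_apply_univ, leb_Iic]

lemma lebT_mono {S T : ℝ≥0} (h : S ≤ T) : lebT S ≤ lebT T :=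
  Measure.restrict_mono (Set.Iic_subset_Iic.2 h) le_rfl

lemma map_coe_lebT (t : ℝ≥0) :
    (lebT t).map (fun t : ℝ≥0 => (t : ℝ)) = volume.restrict (Set.Icc (0 : ℝ) t) := by
  ext s hs
  rw [Measure.map_apply coe_measurableEmbedding.measurable hs,
    Measure.restrict_apply (coe_measurableEmbedding.measurable hs), leb_apply,
    Measure.restrict_apply hs, Set.inter_comm, Set.image_inter_preimage, image_coe_Iic,
    Set.inter_comm]

lemma setIntegral_leb_Iic (g : ℝ → ℝ) (t : ℝ≥0) :
    ∫ s in Set.Iic t, g s ∂leb = ∫ s in (0 : ℝ)..(t : ℝ), g s := by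
  rw [intervalIntegral.integral_of_le t.coe_nonneg, ← integral_Icc_eq_integral_Ioc, ← map_coe_lebT,
    coe_measurableEmbedding.integral_map]

/-- Convergence in `L^p` on each bounded time interval. -/
structure LConv (p : ℝ≥0∞) (f : ℕ → ℝ≥0 → ℝ) (g : ℝ≥0 → ℝ) : Prop where
  meas : ∀ n, AEStronglyMeasurable (f n) leb
  memLp : ∀ T, MemLp g p (lebT T)
  tendsto : ∀ T, Tendsto (fun n => eLpNorm (f n - g) p (lebT T)) atTop (𝓝 0)

/-- Uniform convergence on each bounded time interval. -/
def LUnif (f : ℕ → ℝ≥0 → ℝ) (g : ℝ≥0 → ℝ) : Prop :=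
  ∀ T, TendstoUniformlyOn f g atTop (Set.Iic T)

lemma aestronglyMeasurable_of_lebT {g : ℝ≥0 → ℝ}
    (h : ∀ T, AEStronglyMeasurable g (lebT T)) : AEStronglyMeasurable g leb := by
  have hU : (⋃ n : ℕ, Set.Iic (n : ℝ≥0)) = Set.univ := by
    ext x
    simpa using exists_nat_ge x
  have := (aestronglyMeasurable_iUnion_iff (μ := leb) (f := g)
    (s := fun n : ℕ => Set.Iic (n : ℝ≥0))).2 fun n => h n
  rwa [hU, Measure.restrict_univ] at this

lemma LConv.const_seq {p : ℝ≥0∞} {g : ℝ≥0 → ℝ} (h : ∀ T, MemLp g p (lebT T)) :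
    LConv p (fun _ => g) g :=
  ⟨fun _ => aestronglyMeasurable_of_lebT fun T => (h T).1, h, fun T => by simp⟩

lemma LConv.congr {p : ℝ≥0∞} {f : ℕ → ℝ≥0 → ℝ} {g g' : ℝ≥0 → ℝ} (h : LConv p f g)
    (hg : g =ᵐ[leb] g') : LConv p f g' := by
  refine ⟨h.meas, fun T => (memLp_congr_ae (ae_restrict_of_ae hg)).1 (h.memLp T), fun T => ?_⟩
  refine (h.tendsto T).congr fun n => eLpNorm_congr_ae ?_
  filter_upwards [ae_restrict_of_ae hg] with s hs
  simp [hs]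

lemma LConv.add {p : ℝ≥0∞} (hp : 1 ≤ p) {f f' : ℕ → ℝ≥0 → ℝ} {g g' : ℝ≥0 → ℝ}
    (h : LConv p f g) (h' : LConv p f' g') :
    LConv p (fun n s => f n s + f' n s) (fun s => g s + g' s) := by
  refine ⟨fun n => (h.meas n).add (h'.meas n), fun T => (h.memLp T).add (h'.memLp T), fun T => ?_⟩
  have := (h.tendsto T).add (h'.tendsto T)
  rw [add_zero] at this
  refine tendsto_of_tendsto_of_tendsto_of_le_of_le tendsto_const_nhds this (fun _ => zero_le) fun n => ?_
  have e : (fun s => f n s + f' n s) - (fun s => g s + g' s) = (f n - g) + (f' n - g') := by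
    ext s; simp; ring
  rw [e]
  exact eLpNorm_add_le ((h.meas n).restrict.sub (h.memLp T).1)
    ((h'.meas n).restrict.sub (h'.memLp T).1) hp

lemma LConv.const_mul {p : ℝ≥0∞} {f : ℕ → ℝ≥0 → ℝ} {g : ℝ≥0 → ℝ} (c : ℝ) (h : LConv p f g) :
    LConv p (fun n s => c * f n s) (fun s => c * g s) := by
  refine ⟨fun n => (h.meas n).const_mul c, fun T => (h.memLp T).const_mul c, fun T => ?_⟩
  have := ENNReal.Tendsto.const_mul (h.tendsto T) (Or.inr (enorm_ne_top (x := c)))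
  rw [mul_zero] at this
  refine this.congr fun n => ?_
  rw [← eLpNorm_const_smul]
  congr 1
  ext s; simp; ring

lemma LConv.finset_sum {κ : Type*} {p : ℝ≥0∞} (hp : 1 ≤ p) (S : Finset κ)
    {f : κ → ℕ → ℝ≥0 → ℝ} {g : κ → ℝ≥0 → ℝ} (h : ∀ k ∈ S, LConv p (f k) (g k)) :
    LConv p (fun n s => ∑ k ∈ S, f k n s) (fun s => ∑ k ∈ S, g k s) := by
  classical
  induction S using Finset.induction_on with
  | empty => simpa using LConv.const_seq (p := p) (g := fun _ => (0 : ℝ)) fun T => MemLp.zero'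
  | insert a S ha ih =>
    simp only [Finset.sum_insert ha]
    exact (h a (by simp)).add hp (ih fun k hk => h k (by simp [hk]))

lemma LConv.abs {p : ℝ≥0∞} {f : ℕ → ℝ≥0 → ℝ} {g : ℝ≥0 → ℝ} (h : LConv p f g) :
    LConv p (fun n s => |f n s|) (fun s => |g s|) := by
  refine ⟨fun n => (h.meas n).norm, fun T => (h.memLp T).norm, fun T => ?_⟩
  refine tendsto_of_tendsto_of_tendsto_of_le_of_le tendsto_const_nhds (h.tendsto T)
    (fun _ => zero_le) fun n => ?_
  refine eLpNorm_mono fun s => ?_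
  simpa using abs_abs_sub_abs_le_abs_sub (f n s) (g s)

lemma LConv.mono {p q : ℝ≥0∞} (hpq : p ≤ q) {f : ℕ → ℝ≥0 → ℝ} {g : ℝ≥0 → ℝ} (h : LConv q f g) :
    LConv p f g := by
  refine ⟨h.meas, fun T => (h.memLp T).mono_exponent hpq, fun T => ?_⟩
  by_cases hp0 : p = 0
  · simp [hp0]
  set e := 1 / p.toReal - 1 / q.toReal
  have he : 0 ≤ e := by
    rw [sub_nonneg]
    rcases eq_or_ne q ∞ with rfl | hq
    · simp
    · have hp : p ≠ ∞ := ne_top_of_le_ne_top hq hpq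
      exact one_div_le_one_div_of_le (ENNReal.toReal_pos hp0 hp) (ENNReal.toReal_mono hq hpq)
  have := ENNReal.Tendsto.mul_const (b := lebT T Set.univ ^ e) (h.tendsto T)
    (Or.inr (ENNReal.rpow_ne_top_of_nonneg he (measure_ne_top _ _)))
  rw [zero_mul] at this
  exact tendsto_of_tendsto_of_tendsto_of_le_of_le tendsto_const_nhds this (fun _ => zero_le)
    fun n => eLpNorm_le_eLpNorm_mul_rpow_measure_univ hpq ((h.meas n).restrict.sub (h.memLp T).1)

lemma LConv.mul {p q r : ℝ≥0∞} (hr : 1 ≤ r) [ENNReal.HolderTriple p q r]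
    {f f' : ℕ → ℝ≥0 → ℝ} {g g' : ℝ≥0 → ℝ} (h : LConv p f g) (h' : LConv q f' g') :
    LConv r (fun n s => f n s * f' n s) (fun s => g s * g' s) := by
  refine ⟨fun n => (h.meas n).mul (h'.meas n), fun T => (h'.memLp T).mul (h.memLp T), fun T => ?_⟩
  set a := fun n => eLpNorm (f n - g) p (lebT T)
  set b := fun n => eLpNorm (f' n - g') q (lebT T)
  set A := eLpNorm g p (lebT T)
  set B := eLpNorm g' q (lebT T)
  have ha : Tendsto a atTop (𝓝 0) := h.tendsto T
  have hb : Tendsto b atTop (𝓝 0) := h'.tendsto T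
  have hA : A ≠ ∞ := (h.memLp T).2.ne
  have hB : B ≠ ∞ := (h'.memLp T).2.ne
  have h1 : Tendsto (fun n => a n * b n + a n * B + A * b n) atTop (𝓝 0) := by
    have t1 := ENNReal.Tendsto.mul ha (Or.inr ENNReal.zero_ne_top) hb (Or.inr ENNReal.zero_ne_top)
    have t2 := ENNReal.Tendsto.mul_const (b := B) ha (Or.inr hB)
    have t3 := ENNReal.Tendsto.const_mul (a := A) hb (Or.inr hA)
    simpa using (t1.add t2).add t3
  refine tendsto_of_tendsto_of_tendsto_of_le_of_le tendsto_const_nhds h1 (fun _ => zero_le)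
    fun n => ?_
  have e : (fun s => f n s * f' n s) - (fun s => g s * g' s)
      = (f n - g) • (f' n - g') + (f n - g) • g' + g • (f' n - g') := by
    ext s; simp; ring
  have m1 : AEStronglyMeasurable (f n - g) (lebT T) := (h.meas n).restrict.sub (h.memLp T).1
  have m2 : AEStronglyMeasurable (f' n - g') (lebT T) := (h'.meas n).restrict.sub (h'.memLp T).1
  rw [e]
  refine (eLpNorm_add_le ((m1.smul m2).add (m1.smul (h'.memLp T).1))
    ((h.memLp T).1.smul m2) hr).trans ?_
  refine add_le_add ((eLpNorm_add_le (m1.smul m2) (m1.smul (h'.memLp T).1) hr).trans ?_) ?_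
  · exact add_le_add (eLpNorm_smul_le_mul_eLpNorm m2 m1)
      (eLpNorm_smul_le_mul_eLpNorm (h'.memLp T).1 m1)
  · exact eLpNorm_smul_le_mul_eLpNorm m2 (h.memLp T).1

lemma LUnif.lconv {f : ℕ → ℝ≥0 → ℝ} {g : ℝ≥0 → ℝ} (h : LUnif f g) (hg : Continuous g)
    (hf : ∀ n, AEStronglyMeasurable (f n) leb) : LConv ∞ f g := by
  refine ⟨hf, fun T => ?_, fun T => ?_⟩
  · have hK : IsCompact (Set.Iic T) := by rw [← Set.Icc_bot]; exact isCompact_Icc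
    obtain ⟨C, hC⟩ := hK.exists_bound_of_continuousOn hg.continuousOn
    exact memLp_top_of_bound hg.aestronglyMeasurable C
      ((ae_restrict_iff' measurableSet_Iic).2 (ae_of_all _ hC))
  · rw [ENNReal.tendsto_nhds_zero]
    intro ε hε
    rcases eq_or_ne ε ∞ with rfl | hε'
    · exact Eventually.of_forall fun _ => le_top
    have hpos : 0 < ε.toReal := ENNReal.toReal_pos hε.ne' hε'
    filter_upwards [Metric.tendstoUniformlyOn_iff.1 (h T) _ hpos] with n hn
    rw [eLpNorm_exponent_top]
    refine eLpNormEssSup_le_of_ae_enorm_bound ((ae_restrict_iff' measurableSet_Iic).2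
      (ae_of_all _ fun s hs => ?_))
    have := hn s hs
    rw [dist_comm, Real.dist_eq] at this
    rw [← ofReal_norm, ← ENNReal.ofReal_toReal hε']
    exact ENNReal.ofReal_le_ofReal this.le

/-- Composition with functions `G n`, where `G n` agrees with `F` on a given compact subset of `U`
for all large `n`. -/
lemma LUnif.comp_seq {f : ℕ → ℝ≥0 → ℝ} {g : ℝ≥0 → ℝ} (h : LUnif f g) (hg : Continuous g)
    {U : Set ℝ} (hU : IsOpen U) (hgU : ∀ s, g s ∈ U) {F : ℝ → ℝ} (hF : ContinuousOn F U)
    {G : ℕ → ℝ → ℝ} (hG : ∀ K : Set ℝ, IsCompact K → K ⊆ U → ∀ᶠ n in atTop, Set.EqOn (G n) F K) :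
    LUnif (fun n s => G n (f n s)) (fun s => F (g s)) := by
  intro T
  have hK : IsCompact (Set.Iic T) := by rw [← Set.Icc_bot]; exact isCompact_Icc
  have hK0 : IsCompact (g '' Set.Iic T) := hK.image hg
  obtain ⟨δ, hδ, hsub⟩ := hK0.exists_cthickening_subset_open hU (by rintro _ ⟨s, _, rfl⟩; exact hgU s)
  have hK1 : IsCompact (Metric.cthickening δ (g '' Set.Iic T)) := hK0.cthickening
  have huc := hK1.uniformContinuousOn_of_continuous (hF.mono hsub)
  rw [Metric.tendstoUniformlyOn_iff]
  intro ε hε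
  obtain ⟨η, hη, hη'⟩ := Metric.uniformContinuousOn_iff.1 huc ε hε
  filter_upwards [hG _ hK1 hsub, Metric.tendstoUniformlyOn_iff.1 (h T) _ (lt_min hη hδ)]
    with n h1 h2 s hs
  have h3 := h2 s hs
  have m1 : g s ∈ g '' Set.Iic T := ⟨s, hs, rfl⟩
  have m2 : f n s ∈ Metric.cthickening δ (g '' Set.Iic T) :=
    Metric.mem_cthickening_of_dist_le _ _ _ _ m1
      (by rw [dist_comm]; exact (h3.trans_le (min_le_right _ _)).le)
  rw [h1 m2]
  exact hη' _ (Metric.self_subset_cthickening _ m1) _ m2 (h3.trans_le (min_le_left _ _))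

lemma LUnif.tendsto {f : ℕ → ℝ≥0 → ℝ} {g : ℝ≥0 → ℝ} (h : LUnif f g) (t : ℝ≥0) :
    Tendsto (fun n => f n t) atTop (𝓝 (g t)) :=
  (h t).tendsto_at (Set.mem_Iic.2 le_rfl)

lemma LUnif.add {f f' : ℕ → ℝ≥0 → ℝ} {g g' : ℝ≥0 → ℝ} (h : LUnif f g) (h' : LUnif f' g') :
    LUnif (fun n s => f n s + f' n s) (fun s => g s + g' s) :=
  fun T => (h T).add (h' T)

lemma LUnif.const_mul {f : ℕ → ℝ≥0 → ℝ} {g : ℝ≥0 → ℝ} (c : ℝ) (h : LUnif f g) :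
    LUnif (fun n s => c * f n s) (fun s => c * g s) := by
  intro T
  exact (uniformContinuous_const_smul c (X := ℝ)).comp_tendstoUniformlyOn (h T)

lemma LConv.integrableOn {g : ℝ≥0 → ℝ} {f : ℕ → ℝ≥0 → ℝ} (h : LConv 1 f g) (T : ℝ≥0) :
    IntegrableOn g (Set.Iic T) leb := memLp_one_iff_integrable.1 (h.memLp T)

lemma LConv.lunif_integral {f : ℕ → ℝ≥0 → ℝ} {g : ℝ≥0 → ℝ} (h : LConv 1 f g)
    (hf : ∀ n T, IntegrableOn (f n) (Set.Iic T) leb) :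
    LUnif (fun n t => ∫ s in Set.Iic t, f n s ∂leb) (fun t => ∫ s in Set.Iic t, g s ∂leb) := by
  intro T
  rw [Metric.tendstoUniformlyOn_iff]
  intro ε hε
  have := (ENNReal.tendsto_nhds_zero.1 (h.tendsto T)) (ENNReal.ofReal (ε / 2)) (by simpa)
  filter_upwards [this] with n hn t ht
  rw [dist_comm, Real.dist_eq, ← integral_sub (hf n t) (h.integrableOn t)]
  have h1 : eLpNorm (f n - g) 1 (lebT t) ≤ ENNReal.ofReal (ε / 2) :=
    (eLpNorm_mono_measure _ (lebT_mono ht)).trans hn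
  rw [eLpNorm_one_eq_lintegral_enorm] at h1
  have h2 : ‖∫ s in Set.Iic t, (f n s - g s) ∂leb‖ₑ ≤ ENNReal.ofReal (ε / 2) :=
    (enorm_integral_le_lintegral_enorm _).trans h1
  rw [← ofReal_norm, ENNReal.ofReal_le_ofReal_iff (by linarith)] at h2
  exact (h2.trans_lt (by linarith))

end ItoCalculus

namespace ItoCalculus

open RoughFMM (leb)

/-! ### Dyadic grids -/

/-- The grid point `l / 2 ^ m`. -/
noncomputable def pt (m l : ℕ) : ℝ≥0 := l / 2 ^ m

/-- The index `l` of the grid cell `(l / 2 ^ m, (l + 1) / 2 ^ m]` that contains `s > 0`. -/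
noncomputable def cell (m : ℕ) (s : ℝ≥0) : ℕ := ⌈s * 2 ^ m⌉₊ - 1

@[simp] lemma pt_zero (m : ℕ) : pt m 0 = 0 := by simp [pt]

lemma pt_mono (m : ℕ) : Monotone (pt m) := fun a b h => by unfold pt; gcongr

lemma pt_strictMono (m : ℕ) : StrictMono (pt m) := fun a b h => by
  unfold pt; gcongr

lemma coe_pt (m l : ℕ) : (pt m l : ℝ) = l / 2 ^ m := by simp [pt]

lemma pt_succ_sub (m l : ℕ) : (pt m (l + 1) : ℝ) - pt m l = (2 ^ m)⁻¹ := by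
  rw [coe_pt, coe_pt]; push_cast; field_simp; ring

lemma pt_add_mul (m d l : ℕ) : pt (m + d) (l * 2 ^ d) = pt m l := by
  unfold pt; push_cast; rw [pow_add]; field_simp

lemma pt_mul_pow (m T : ℕ) : pt m (T * 2 ^ m) = T := by
  unfold pt; push_cast; field_simp

lemma cell_eq {m l : ℕ} {s : ℝ≥0} (h1 : pt m l < s) (h2 : s ≤ pt m (l + 1)) : cell m s = l := by
  have h3 : (l : ℝ≥0) < s * 2 ^ m := by
    unfold pt at h1; rwa [div_lt_iff₀ (by positivity)] at h1
  have h4 : s * 2 ^ m ≤ ((l + 1 : ℕ) : ℝ≥0) := by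
    unfold pt at h2; rwa [le_div_iff₀ (by positivity)] at h2
  have h5 : ⌈s * 2 ^ m⌉₊ = l + 1 := by
    rw [Nat.ceil_eq_iff (by omega)]
    exact ⟨by simpa using h3, h4⟩
  rw [cell, h5]; rfl

lemma cell_spec {m : ℕ} {s : ℝ≥0} (hs : 0 < s) :
    pt m (cell m s) < s ∧ s ≤ pt m (cell m s + 1) := by
  have h0 : 0 < s * 2 ^ m := by positivity
  have hc : 0 < ⌈s * 2 ^ m⌉₊ := Nat.ceil_pos.2 h0
  have e : cell m s + 1 = ⌈s * 2 ^ m⌉₊ := by unfold cell; omega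
  constructor
  · unfold pt
    rw [div_lt_iff₀ (by positivity)]
    have := (Nat.ceil_eq_iff (by omega : ⌈s * 2 ^ m⌉₊ ≠ 0)).1 rfl
    exact this.1
  · rw [e]; unfold pt
    rw [le_div_iff₀ (by positivity)]
    exact Nat.le_ceil _

@[simp] lemma cell_zero (m : ℕ) : cell m 0 = 0 := by simp [cell]

lemma pt_cell_le (m : ℕ) (s : ℝ≥0) : pt m (cell m s) ≤ s := by
  rcases eq_or_ne s 0 with rfl | h
  · simp
  · exact (cell_spec (pos_iff_ne_zero.2 h)).1.le

lemma le_pt_cell_succ (m : ℕ) (s : ℝ≥0) : s ≤ pt m (cell m s + 1) := by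
  rcases eq_or_ne s 0 with rfl | h
  · simp
  · exact (cell_spec (pos_iff_ne_zero.2 h)).2

lemma cell_refine (m d : ℕ) (s : ℝ≥0) : cell m s = cell (m + d) s / 2 ^ d := by
  rcases eq_or_ne s 0 with rfl | h
  · simp
  obtain ⟨h1, h2⟩ := cell_spec (m := m + d) (pos_iff_ne_zero.2 h)
  set c := cell (m + d) s
  have h3 : c / 2 ^ d * 2 ^ d ≤ c := Nat.div_mul_le_self _ _
  have h4 : c + 1 ≤ (c / 2 ^ d + 1) * 2 ^ d := by
    have := Nat.lt_div_mul_add (a := c) (b := 2 ^ d) (by positivity)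
    rw [add_mul, one_mul]; omega
  refine cell_eq ?_ ?_
  · rw [← pt_add_mul m d]; exact (pt_mono _ h3).trans_lt h1
  · rw [← pt_add_mul m d]; exact h2.trans (pt_mono _ h4)

lemma measurable_cell (m : ℕ) : Measurable (cell m) := by
  unfold cell
  exact (measurable_of_countable (fun n : ℕ => n - 1)).comp
    (Nat.measurable_ceil.comp (measurable_id.mul_const _))

/-! ### Brownian motions and elementary Itô processes -/

variable {Ω ι : Type*} [mΩ : MeasurableSpace Ω]

/-- The properties of a correlated Brownian motion with respect to `ℱ` that the Itô calculus uses: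
independent increments with the first, second and fourth moments of Gaussian ones. -/
structure BM (Q : Measure Ω) (ℱ : Filtration ℝ≥0 mΩ) (ρ : ι → ι → ℝ)
    (W : ι → ℝ≥0 → Ω → ℝ) : Prop where
  adapted : ∀ k, StronglyAdapted ℱ (W k)
  continuous : ∀ᵐ ω ∂Q, ∀ k, Continuous fun t => W k t ω
  indep : ∀ s t : ℝ≥0, s ≤ t →
    Indep (MeasurableSpace.comap (fun ω k => W k t ω - W k s ω) MeasurableSpace.pi) (ℱ s) Q
  symm : ∀ k l, ρ k l = ρ l k
  mean : ∀ k, ∀ s t : ℝ≥0, s ≤ t → ∫ ω, (W k t ω - W k s ω) ∂Q = 0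
  cov : ∀ k l, ∀ s t : ℝ≥0, s ≤ t →
    ∫ ω, (W k t ω - W k s ω) * (W l t ω - W l s ω) ∂Q = ((t : ℝ) - s) * ρ k l
  memLp : ∀ k, ∀ s t : ℝ≥0, s ≤ t → MemLp (fun ω => W k t ω - W k s ω) 4 Q
  moment : ∃ C : ℝ, 0 ≤ C ∧ ∀ k, ∀ s t : ℝ≥0, s ≤ t →
    ∫ ω, (W k t ω - W k s ω) ^ 4 ∂Q ≤ C * ((t : ℝ) - s) ^ 2

variable [Fintype ι]

/-- An elementary Itô process: on each cell of a dyadic grid, `dY = ∑ k, κ k dW k + β dt` with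
bounded coefficients that are known at the left end point of the cell. -/
structure Elem (ℱ : Filtration ℝ≥0 mΩ) (W : ι → ℝ≥0 → Ω → ℝ) where
  m : ℕ
  κ : ℕ → ι → Ω → ℝ
  β : ℕ → Ω → ℝ
  Y : ℝ≥0 → Ω → ℝ
  κ_meas : ∀ l k, StronglyMeasurable[ℱ (pt m l)] (κ l k)
  β_meas : ∀ l, StronglyMeasurable[ℱ (pt m l)] (β l)
  κ_bdd : ∃ C : ℝ, ∀ l k ω, |κ l k ω| ≤ C
  β_bdd : ∃ C : ℝ, ∀ l ω, |β l ω| ≤ C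
  Y_adapted : StronglyAdapted ℱ Y
  step : ∀ l ω u, pt m l ≤ u → u ≤ pt m (l + 1) → Y u ω = Y (pt m l) ω +
    ∑ k, κ l k ω * (W k u ω - W k (pt m l) ω) + β l ω * ((u : ℝ) - pt m l)

namespace Elem

variable {ℱ : Filtration ℝ≥0 mΩ} {W : ι → ℝ≥0 → Ω → ℝ}

/-- The diffusion coefficients as functions of time. -/
noncomputable def kap (E : Elem ℱ W) (k : ι) (s : ℝ≥0) (ω : Ω) : ℝ := E.κ (cell E.m s) k ω

/-- The drift coefficient as a function of time. -/
noncomputable def bet (E : Elem ℱ W) (s : ℝ≥0) (ω : Ω) : ℝ := E.β (cell E.m s) ω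

lemma measurable_kap (E : Elem ℱ W) (k : ι) (ω : Ω) : Measurable fun s => E.kap k s ω :=
  (measurable_of_countable fun l => E.κ l k ω).comp (measurable_cell _)

lemma measurable_bet (E : Elem ℱ W) (ω : Ω) : Measurable fun s => E.bet s ω :=
  (measurable_of_countable fun l => E.β l ω).comp (measurable_cell _)

lemma exists_bound (E : Elem ℱ W) : ∃ C : ℝ, 1 ≤ C ∧ (∀ l k ω, |E.κ l k ω| ≤ C) ∧
    ∀ l ω, |E.β l ω| ≤ C := by
  obtain ⟨C, hC⟩ := E.κ_bdd
  obtain ⟨D, hD⟩ := E.β_bdd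
  exact ⟨max 1 (max C D), le_max_left _ _,
    fun l k ω => (hC l k ω).trans ((le_max_left _ _).trans (le_max_right _ _)),
    fun l ω => (hD l ω).trans ((le_max_right _ _).trans (le_max_right _ _))⟩

lemma eq_sum (E : Elem ℱ W) (ω : Ω) (L : ℕ) (u : ℝ≥0) (hu : u ≤ pt E.m L) :
    E.Y u ω = E.Y 0 ω + ∑ l ∈ Finset.range L,
      (∑ k, E.κ l k ω * (W k (min u (pt E.m (l + 1))) ω - W k (min u (pt E.m l)) ω)
        + E.β l ω * ((min u (pt E.m (l + 1)) : ℝ≥0) - (min u (pt E.m l) : ℝ≥0) : ℝ)) := by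
  induction L generalizing u with
  | zero =>
    have : u = 0 := by simpa using hu
    simp [this]
  | succ L ih =>
    rw [Finset.sum_range_succ]
    rcases le_total u (pt E.m L) with h | h
    · rw [ih u h, min_eq_left h, min_eq_left (h.trans (pt_mono _ (Nat.le_succ L)))]
      simp
    · rw [E.step L ω u h hu, ih _ le_rfl, min_eq_left hu, min_eq_right h]
      rw [add_assoc, add_assoc]
      congr 2
      refine Finset.sum_congr rfl fun l hl => ?_
      have h1 : pt E.m (l + 1) ≤ pt E.m L := pt_mono _ (by simpa using hl)
      have h2 : pt E.m l ≤ pt E.m L := pt_mono _ (by have := Finset.mem_range.1 hl; omega)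
      rw [min_eq_right h1, min_eq_right h2, min_eq_right (h1.trans h), min_eq_right (h2.trans h)]

lemma continuous (E : Elem ℱ W) {ω : Ω} (hW : ∀ k, Continuous fun t => W k t ω) :
    Continuous fun t => E.Y t ω := by
  rw [continuous_iff_continuousAt]
  intro t
  obtain ⟨L, hL⟩ : ∃ L, t < pt E.m L := by
    refine ⟨cell E.m t + 2, (le_pt_cell_succ E.m t).trans_lt (pt_strictMono _ (by omega))⟩
  have : ContinuousOn (fun t => E.Y t ω) (Set.Iio (pt E.m L)) := by
    refine ContinuousOn.congr (Continuous.continuousOn ?_)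
      (fun u hu => E.eq_sum ω L u (le_of_lt hu))
    have hW' := fun k (a : ℝ≥0) => (hW k).comp (continuous_id.min (continuous_const (y := a)))
    refine continuous_const.add (continuous_finsetSum _ fun l _ => ?_)
    refine (continuous_finsetSum _ fun k _ => ?_).add ?_
    · exact continuous_const.mul ((hW' k _).sub (hW' k _))
    · fun_prop
  exact this.continuousAt (Iio_mem_nhds hL)

/-- The elementary process with given coefficients and initial value. -/
noncomputable def ofCoef (hW : ∀ k, StronglyAdapted ℱ (W k)) (m : ℕ) (κ : ℕ → ι → Ω → ℝ)
    (β : ℕ → Ω → ℝ) (Y₀ : Ω → ℝ)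
    (hκ : ∀ l k, StronglyMeasurable[ℱ (pt m l)] (κ l k))
    (hβ : ∀ l, StronglyMeasurable[ℱ (pt m l)] (β l))
    (hκb : ∃ C : ℝ, ∀ l k ω, |κ l k ω| ≤ C) (hβb : ∃ C : ℝ, ∀ l ω, |β l ω| ≤ C)
    (hY : StronglyMeasurable[ℱ 0] Y₀) : Elem ℱ W where
  m := m
  κ := κ
  β := β
  Y u ω := Y₀ ω + ∑ l ∈ Finset.range (cell m u + 1),
      (∑ k, κ l k ω * (W k (min u (pt m (l + 1))) ω - W k (min u (pt m l)) ω)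
        + β l ω * ((min u (pt m (l + 1)) : ℝ≥0) - (min u (pt m l) : ℝ≥0) : ℝ))
  κ_meas := hκ
  β_meas := hβ
  κ_bdd := hκb
  β_bdd := hβb
  Y_adapted := by
    intro u
    refine (hY.mono (ℱ.mono zero_le)).add (Finset.stronglyMeasurable_fun_sum _ fun l hl => ?_)
    have h1 : pt m l ≤ u :=
      (pt_mono m (Nat.lt_succ_iff.1 (Finset.mem_range.1 hl))).trans (pt_cell_le m u)
    refine StronglyMeasurable.add (Finset.stronglyMeasurable_fun_sum _ fun k _ => ?_)
      (((hβ l).mono (ℱ.mono h1)).mul_const _)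
    exact ((hκ l k).mono (ℱ.mono h1)).mul
      (((hW k _).mono (ℱ.mono (min_le_left _ _))).sub ((hW k _).mono (ℱ.mono (min_le_left _ _))))
  step := by
    intro l ω u h1 h2
    set F : ℝ≥0 → ℕ → ℝ := fun u l =>
      (∑ k, κ l k ω * (W k (min u (pt m (l + 1))) ω - W k (min u (pt m l)) ω)
        + β l ω * ((min u (pt m (l + 1)) : ℝ≥0) - (min u (pt m l) : ℝ≥0) : ℝ)) with hF
    have key : ∀ v L, v ≤ pt m L → ∑ i ∈ Finset.range (cell m v + 1), F v i =
        ∑ i ∈ Finset.range L, F v i := by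
      intro v L hv
      have hz : ∀ i, cell m v + 1 ≤ i → F v i = 0 := by
        intro i hi
        have a1 : v ≤ pt m i := (le_pt_cell_succ m v).trans (pt_mono m hi)
        have a2 : v ≤ pt m (i + 1) := a1.trans (pt_mono m (Nat.le_succ i))
        simp only [hF, min_eq_left a1, min_eq_left a2, sub_self, mul_zero, Finset.sum_const_zero,
          add_zero]
      have hz' : ∀ i, L ≤ i → F v i = 0 := by
        intro i hi
        have a1 : v ≤ pt m i := hv.trans (pt_mono m hi)
        have a2 : v ≤ pt m (i + 1) := a1.trans (pt_mono m (Nat.le_succ i))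
        simp only [hF, min_eq_left a1, min_eq_left a2, sub_self, mul_zero, Finset.sum_const_zero,
          add_zero]
      rcases le_total (cell m v + 1) L with h | h
      · refine Finset.sum_subset (Finset.range_mono h) fun i _ hi => hz i (by simpa using hi)
      · exact (Finset.sum_subset (Finset.range_mono h) fun i _ hi => hz' i (by simpa using hi)).symm
    change Y₀ ω + ∑ i ∈ Finset.range (cell m u + 1), F u i =
      Y₀ ω + ∑ i ∈ Finset.range (cell m (pt m l) + 1), F (pt m l) i + _ + _
    rw [key u (l + 1) h2, key (pt m l) l le_rfl, Finset.sum_range_succ]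
    have e1 : ∑ i ∈ Finset.range l, F u i = ∑ i ∈ Finset.range l, F (pt m l) i := by
      refine Finset.sum_congr rfl fun i hi => ?_
      have a1 : pt m (i + 1) ≤ pt m l := pt_mono _ (by simpa using hi)
      have a2 : pt m i ≤ pt m l := pt_mono _ (by have := Finset.mem_range.1 hi; omega)
      simp only [hF]
      rw [min_eq_right a1, min_eq_right a2, min_eq_right (a1.trans h1), min_eq_right (a2.trans h1)]
    have e2 : F u l = ∑ k, κ l k ω * (W k u ω - W k (pt m l) ω) + β l ω * ((u : ℝ) - pt m l) := by
      simp only [hF]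
      rw [min_eq_left h2, min_eq_right h1]
    rw [e1, e2]; ring

lemma ofCoef_zero (hW : ∀ k, StronglyAdapted ℱ (W k)) (m : ℕ) (κ : ℕ → ι → Ω → ℝ)
    (β : ℕ → Ω → ℝ) (Y₀ : Ω → ℝ) (h1 h2 h3 h4 h5) (ω : Ω) :
    (ofCoef hW m κ β Y₀ h1 h2 h3 h4 h5).Y 0 ω = Y₀ ω := by
  simp [ofCoef]

/-- The same elementary process on a finer grid. -/
noncomputable def refine (E : Elem ℱ W) (d : ℕ) : Elem ℱ W where
  m := E.m + d
  κ l := E.κ (l / 2 ^ d)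
  β l := E.β (l / 2 ^ d)
  Y := E.Y
  κ_meas l k := (E.κ_meas _ k).mono (ℱ.mono (by
    rw [← pt_add_mul E.m d]; exact pt_mono _ (Nat.div_mul_le_self _ _)))
  β_meas l := (E.β_meas _).mono (ℱ.mono (by
    rw [← pt_add_mul E.m d]; exact pt_mono _ (Nat.div_mul_le_self _ _)))
  κ_bdd := E.κ_bdd.imp fun C h l k ω => h _ k ω
  β_bdd := E.β_bdd.imp fun C h l ω => h _ ω
  Y_adapted := E.Y_adapted
  step := by
    intro l ω u h1 h2
    set c := l / 2 ^ d
    have h3 : pt E.m c ≤ pt (E.m + d) l := by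
      rw [← pt_add_mul E.m d]; exact pt_mono _ (Nat.div_mul_le_self _ _)
    have h4 : pt (E.m + d) (l + 1) ≤ pt E.m (c + 1) := by
      rw [← pt_add_mul E.m d]
      refine pt_mono _ ?_
      have := Nat.lt_div_mul_add (a := l) (b := 2 ^ d) (by positivity)
      rw [add_mul, one_mul]; simp only [c]; omega
    rw [E.step c ω u (h3.trans h1) (h2.trans h4),
      E.step c ω (pt (E.m + d) l) h3 ((h1.trans h2).trans h4)]
    have : ∀ k, E.κ c k ω * (W k u ω - W k (pt E.m c) ω) =
      E.κ c k ω * (W k (pt (E.m + d) l) ω - W k (pt E.m c) ω) +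
      E.κ c k ω * (W k u ω - W k (pt (E.m + d) l) ω) := fun k => by ring
    simp only [this, Finset.sum_add_distrib]
    ring

lemma refine_kap (E : Elem ℱ W) (d : ℕ) : (E.refine d).kap = E.kap := by
  ext k s ω
  simp only [kap, refine, ← cell_refine]

lemma refine_bet (E : Elem ℱ W) (d : ℕ) : (E.refine d).bet = E.bet := by
  ext s ω
  simp only [bet, refine, ← cell_refine]

/-- Linear combinations of elementary processes on the same grid. -/
noncomputable def lin (E F : Elem ℱ W) (h : E.m = F.m) (a b : ℝ) : Elem ℱ W where
  m := E.m
  κ l k ω := a * E.κ l k ω + b * F.κ l k ω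
  β l ω := a * E.β l ω + b * F.β l ω
  Y u ω := a * E.Y u ω + b * F.Y u ω
  κ_meas l k := ((E.κ_meas l k).const_mul a).add (((h ▸ F.κ_meas l k :)).const_mul b)
  β_meas l := ((E.β_meas l).const_mul a).add (((h ▸ F.β_meas l :)).const_mul b)
  κ_bdd := by
    obtain ⟨C, hC⟩ := E.κ_bdd
    obtain ⟨D, hD⟩ := F.κ_bdd
    refine ⟨|a| * C + |b| * D, fun l k ω => (abs_add_le _ _).trans ?_⟩
    rw [abs_mul, abs_mul]
    gcongr
    exacts [hC l k ω, hD l k ω]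
  β_bdd := by
    obtain ⟨C, hC⟩ := E.β_bdd
    obtain ⟨D, hD⟩ := F.β_bdd
    refine ⟨|a| * C + |b| * D, fun l ω => (abs_add_le _ _).trans ?_⟩
    rw [abs_mul, abs_mul]
    gcongr
    exacts [hC l ω, hD l ω]
  Y_adapted u := ((E.Y_adapted u).const_mul a).add ((F.Y_adapted u).const_mul b)
  step := by
    intro l ω u h1 h2
    rw [E.step l ω u h1 h2, F.step l ω u (h ▸ h1) (h ▸ h2), ← h]
    simp only [add_mul, Finset.sum_add_distrib, mul_assoc, ← Finset.mul_sum]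
    ring

/-- On `[0, T]`, up to errors of size `ε`, the elementary process `E` has path `y`, diffusion
coefficients `h` and drift `b`. -/
def Close (E : Elem ℱ W) (T : ℝ≥0) (ε : ℝ) (ω : Ω) (y : ℝ≥0 → ℝ) (h : ι → ℝ≥0 → ℝ)
    (b : ℝ≥0 → ℝ) : Prop :=
  (∀ u ≤ T, |E.Y u ω - y u| ≤ ε) ∧
  (∀ k, eLpNorm ((fun s => E.kap k s ω) - h k) 2 (lebT T) ≤ ENNReal.ofReal ε) ∧
  eLpNorm ((fun s => E.bet s ω) - b) 1 (lebT T) ≤ ENNReal.ofReal ε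

end Elem

/-- `Y` is an Itô process, `dY = ∑ k, H k dW k + b dt`: almost surely its path and its coefficients
are the limits of those of a sequence of elementary Itô processes, uniformly, in `L²` and in `L¹`
on bounded time intervals. -/
def IsIto (Q : Measure Ω) (ℱ : Filtration ℝ≥0 mΩ) (W : ι → ℝ≥0 → Ω → ℝ)
    (Y : ℝ≥0 → Ω → ℝ) (H : ι → ℝ≥0 → Ω → ℝ) (b : ℝ≥0 → Ω → ℝ) : Prop :=
  ∃ E : ℕ → Elem ℱ W, ∀ᵐ ω ∂Q,
    (∀ k, LConv 2 (fun n s => (E n).kap k s ω) (fun s => H k s ω)) ∧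
    LConv 1 (fun n s => (E n).bet s ω) (fun s => b s ω) ∧
    LUnif (fun n s => (E n).Y s ω) (fun s => Y s ω)

variable {Q : Measure Ω} {ℱ : Filtration ℝ≥0 mΩ} {W : ι → ℝ≥0 → Ω → ℝ}

/-- It suffices to approximate, in probability, a sequence of triples that converges almost surely:
the errors of a diagonal sequence are summable, so that Borel-Cantelli applies. -/
lemma IsIto.of_approx {Y : ℝ≥0 → Ω → ℝ} {H : ι → ℝ≥0 → Ω → ℝ} {b : ℝ≥0 → Ω → ℝ}
    {Y' : ℕ → ℝ≥0 → Ω → ℝ} {H' : ℕ → ι → ℝ≥0 → Ω → ℝ} {b' : ℕ → ℝ≥0 → Ω → ℝ}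
    (hconv : ∀ᵐ ω ∂Q, (∀ k, LConv 2 (fun n s => H' n k s ω) (fun s => H k s ω)) ∧
      LConv 1 (fun n s => b' n s ω) (fun s => b s ω) ∧
      LUnif (fun n s => Y' n s ω) (fun s => Y s ω))
    (happ : ∀ n, ∀ ε : ℝ, 0 < ε → ∀ T : ℕ, ∃ E : Elem ℱ W,
      Q {ω | ¬ E.Close T ε ω (fun s => Y' n s ω) (fun k s => H' n k s ω) fun s => b' n s ω}
        ≤ ENNReal.ofReal ε) :
    IsIto Q ℱ W Y H b := by
  choose E hE using fun n => happ n ((1 / 2) ^ n) (by positivity) n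
  refine ⟨E, ?_⟩
  have hsum : ∑' n, Q {ω | ¬ (E n).Close n ((1 / 2) ^ n) ω (fun s => Y' n s ω)
      (fun k s => H' n k s ω) fun s => b' n s ω} ≠ ∞ := by
    refine ne_top_of_le_ne_top ?_ (ENNReal.tsum_le_tsum hE)
    rw [← ENNReal.ofReal_tsum_of_nonneg (fun n => by positivity) summable_geometric_two]
    exact ENNReal.ofReal_ne_top
  have hz : Tendsto (fun n : ℕ => ENNReal.ofReal ((1 / 2 : ℝ) ^ n)) atTop (𝓝 0) := by
    rw [← ENNReal.ofReal_zero]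
    exact ENNReal.tendsto_ofReal
      (tendsto_pow_atTop_nhds_zero_of_lt_one (by norm_num) (by norm_num))
  filter_upwards [hconv, ae_eventually_notMem hsum] with ω ⟨hH, hb, hY⟩ hev
  have hev' : ∀ᶠ n in atTop, (E n).Close n ((1 / 2) ^ n) ω (fun s => Y' n s ω)
      (fun k s => H' n k s ω) fun s => b' n s ω := hev.mono fun n hn => not_not.1 hn
  have aux : ∀ {p : ℝ≥0∞} (_ : 1 ≤ p) {f g : ℕ → ℝ≥0 → ℝ} {h : ℝ≥0 → ℝ}
      (_ : ∀ n, Measurable (f n)) (_ : LConv p g h)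
      (_ : ∀ᶠ n : ℕ in atTop, eLpNorm (f n - g n) p (lebT n) ≤ ENNReal.ofReal ((1 / 2) ^ n)),
      LConv p f h := by
    intro p hp f g h hf hg hfg
    refine ⟨fun n => (hf n).aestronglyMeasurable, hg.memLp, fun T => ?_⟩
    have hlim := hz.add (hg.tendsto T)
    rw [add_zero] at hlim
    refine tendsto_of_tendsto_of_tendsto_of_le_of_le' tendsto_const_nhds hlim
      (Eventually.of_forall fun _ => zero_le) ?_
    filter_upwards [hfg, eventually_ge_atTop ⌈T⌉₊] with n hn hnT
    have hT : T ≤ n := (Nat.le_ceil T).trans (by exact_mod_cast hnT)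
    have e : f n - h = (f n - g n) + (g n - h) := by abel
    rw [e]
    refine (eLpNorm_add_le ((hf n).aestronglyMeasurable.sub (hg.meas n).restrict)
      ((hg.meas n).restrict.sub (hg.memLp T).1) hp).trans ?_
    gcongr
    exact (eLpNorm_mono_measure _ (lebT_mono hT)).trans hn
  refine ⟨fun k => aux one_le_two (fun n => (E n).measurable_kap k ω) (hH k) ?_,
    aux le_rfl (fun n => (E n).measurable_bet ω) hb ?_, ?_⟩
  · exact hev'.mono fun n hn => hn.2.1 k
  · exact hev'.mono fun n hn => hn.2.2
  · intro T
    rw [Metric.tendstoUniformlyOn_iff]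
    intro ε hε
    have h1 := (tendsto_pow_atTop_nhds_zero_of_lt_one (r := (1 / 2 : ℝ)) (by norm_num)
      (by norm_num)).eventually (gt_mem_nhds (half_pos hε))
    filter_upwards [hev', eventually_ge_atTop ⌈T⌉₊,
      Metric.tendstoUniformlyOn_iff.1 (hY T) _ (half_pos hε), h1] with n hn hnT hYn hpow u hu
    have hT : T ≤ n := (Nat.le_ceil T).trans (by exact_mod_cast hnT)
    have a1 := hYn u hu
    have a2 := hn.1 u (le_trans hu hT)
    rw [Real.dist_eq] at a1 ⊢
    have := abs_sub_le (Y u ω) (Y' n u ω) ((E n).Y u ω)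
    rw [abs_sub_comm] at a2
    linarith

end ItoCalculus

namespace ItoCalculus

open RoughFMM (leb)

/-! ### Increments of the Brownian motion -/

variable {Ω ι : Type*} [mΩ : MeasurableSpace Ω] {Q : Measure Ω} [IsProbabilityMeasure Q]
  {ℱ : Filtration ℝ≥0 mΩ} {ρ : ι → ι → ℝ} {W : ι → ℝ≥0 → Ω → ℝ}

set_option linter.unusedSectionVars false

lemma BM.integral_mul_comp (hB : BM Q ℱ ρ W) {s t : ℝ≥0} (hst : s ≤ t) {Z : Ω → ℝ}
    (hZ : StronglyMeasurable[ℱ s] Z) {g : (ι → ℝ) → ℝ} (hg : Measurable g) :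
    ∫ ω, Z ω * g (fun k => W k t ω - W k s ω) ∂Q =
      (∫ ω, Z ω ∂Q) * ∫ ω, g (fun k => W k t ω - W k s ω) ∂Q := by
  have hD : Measurable fun ω k => W k t ω - W k s ω := measurable_pi_lambda _ fun k =>
    (((hB.adapted k t).mono (ℱ.le t)).sub ((hB.adapted k s).mono (ℱ.le s))).measurable
  have h1 : IndepFun (fun ω k => W k t ω - W k s ω) Z Q :=
    indep_of_indep_of_le_right (hB.indep s t hst) hZ.measurable.comap_le
  have h2 : IndepFun Z (g ∘ fun ω k => W k t ω - W k s ω) Q :=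
    (h1.comp hg measurable_id).symm
  exact h2.integral_fun_mul_eq_mul_integral (hZ.mono (ℱ.le s)).aestronglyMeasurable
    (hg.comp hD).aestronglyMeasurable

lemma BM.integral_mul_incr (hB : BM Q ℱ ρ W) {s t : ℝ≥0} (hst : s ≤ t) {Z : Ω → ℝ}
    (hZ : StronglyMeasurable[ℱ s] Z) (k : ι) : ∫ ω, Z ω * (W k t ω - W k s ω) ∂Q = 0 := by
  have := hB.integral_mul_comp hst hZ (g := fun x => x k) (measurable_pi_apply k)
  rw [this, hB.mean k s t hst, mul_zero]

lemma BM.integral_mul_incr_mul_incr (hB : BM Q ℱ ρ W) {s t : ℝ≥0} (hst : s ≤ t) {Z : Ω → ℝ}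
    (hZ : StronglyMeasurable[ℱ s] Z) (k l : ι) :
    ∫ ω, Z ω * ((W k t ω - W k s ω) * (W l t ω - W l s ω)) ∂Q =
      ((t : ℝ) - s) * ρ k l * ∫ ω, Z ω ∂Q := by
  have := hB.integral_mul_comp hst hZ (g := fun x => x k * x l)
    ((measurable_pi_apply k).mul (measurable_pi_apply l))
  rw [this, hB.cov k l s t hst, mul_comm]

variable [Fintype ι]

/-- The instantaneous covariation `∑ k l, ρ k l a k b l`. -/
def qcov (ρ : ι → ι → ℝ) (a b : ι → ℝ) : ℝ := ∑ k, ∑ l, ρ k l * (a k * b l)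

lemma abs_qcov_le (ρ : ι → ι → ℝ) {a b : ι → ℝ} {C D : ℝ} (ha : ∀ k, |a k| ≤ C)
    (hb : ∀ k, |b k| ≤ D) : |qcov ρ a b| ≤ (∑ k, ∑ l, |ρ k l|) * (C * D) := by
  unfold qcov
  rw [Finset.sum_mul]
  refine (Finset.abs_sum_le_sum_abs _ _).trans (Finset.sum_le_sum fun k _ => ?_)
  rw [Finset.sum_mul]
  refine (Finset.abs_sum_le_sum_abs _ _).trans (Finset.sum_le_sum fun l _ => ?_)
  rw [abs_mul, abs_mul]
  have : 0 ≤ C := (abs_nonneg _).trans (ha k)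
  gcongr
  exacts [ha k, hb l]

/-- The fourth moments of the increments of an elementary stochastic integral. -/
lemma BM.exists_moment_bound (hB : BM Q ℱ ρ W) (C : ℝ) : ∃ D : ℝ, 0 ≤ D ∧
    ∀ (s t : ℝ≥0), s ≤ t → ∀ κ : ι → Ω → ℝ, (∀ k, StronglyMeasurable[ℱ s] (κ k)) →
      (∀ k ω, |κ k ω| ≤ C) →
      MemLp (fun ω => ∑ k, κ k ω * (W k t ω - W k s ω)) 4 Q ∧
      ∫ ω, (∑ k, κ k ω * (W k t ω - W k s ω)) ^ 4 ∂Q ≤ D * ((t : ℝ) - s) ^ 2 := by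
  obtain ⟨M, hM0, hM⟩ := hB.moment
  set n : ℝ := (Fintype.card ι : ℝ)
  refine ⟨n ^ 3 * (n * (C ^ 4 * M)), by positivity, fun s t hst κ hκ hκC => ?_⟩
  have hmem : ∀ k, MemLp (fun ω => κ k ω * (W k t ω - W k s ω)) 4 Q := by
    intro k
    refine (hB.memLp k s t hst).of_le_mul (c := C)
      (((hκ k).mono (ℱ.le s)).aestronglyMeasurable.mul (hB.memLp k s t hst).1)
      (ae_of_all _ fun ω => ?_)
    rw [norm_mul]
    gcongr
    exact hκC k ω
  have hmemS : MemLp (fun ω => ∑ k, κ k ω * (W k t ω - W k s ω)) 4 Q :=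
    memLp_finsetSum _ fun k _ => hmem k
  have hint : ∀ {X : Ω → ℝ}, MemLp X 4 Q → Integrable (fun ω => X ω ^ 4) Q := by
    intro X hX
    have := hX.integrable_norm_pow (p := 4) (by norm_num)
    refine this.congr (ae_of_all _ fun ω => ?_)
    simp only [Real.norm_eq_abs]
    exact (by decide : Even 4).pow_abs _
  refine ⟨hmemS, ?_⟩
  have hpt : ∀ ω, (∑ k, κ k ω * (W k t ω - W k s ω)) ^ 4 ≤
      n ^ 3 * ∑ k, C ^ 4 * (W k t ω - W k s ω) ^ 4 := by
    intro ω
    have h1 : (∑ k, κ k ω * (W k t ω - W k s ω)) ^ 4 ≤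
        (∑ k, |κ k ω * (W k t ω - W k s ω)|) ^ 4 := by
      rw [← (by decide : Even 4).pow_abs]
      exact pow_le_pow_left₀ (abs_nonneg _) (Finset.abs_sum_le_sum_abs _ _) 4
    rcases isEmpty_or_nonempty ι with he | he
    · simp
    have hn : 0 < n ^ 3 := pow_pos (Nat.cast_pos.2 Fintype.card_pos) 3
    have h2 := pow_sum_div_card_le_sum_pow (s := Finset.univ)
      (f := fun k => |κ k ω * (W k t ω - W k s ω)|) (fun k _ => abs_nonneg _) 3
    rw [div_le_iff₀ (by rw [Finset.card_univ]; exact hn), mul_comm] at h2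
    refine h1.trans (h2.trans ?_)
    rw [Finset.card_univ]
    refine mul_le_mul_of_nonneg_left (Finset.sum_le_sum fun k _ => ?_) hn.le
    rw [(by decide : Even 4).pow_abs, mul_pow, ← (by decide : Even 4).pow_abs (κ k ω)]
    have := hκC k ω
    gcongr
  calc _ ≤ ∫ ω, n ^ 3 * ∑ k, C ^ 4 * (W k t ω - W k s ω) ^ 4 ∂Q :=
        integral_mono (hint hmemS) ((integrable_finsetSum _ fun k _ =>
          (hint (hB.memLp k s t hst)).const_mul _).const_mul _) hpt
    _ = n ^ 3 * ∑ k, C ^ 4 * ∫ ω, (W k t ω - W k s ω) ^ 4 ∂Q := by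
        rw [integral_const_mul, integral_finsetSum _ fun k _ =>
          (hint (hB.memLp k s t hst)).const_mul _]
        simp only [integral_const_mul]
    _ ≤ n ^ 3 * ∑ k : ι, C ^ 4 * (M * ((t : ℝ) - s) ^ 2) := by
        gcongr with k
        exact hM k s t hst
    _ = _ := by
        rw [Finset.sum_const, Finset.card_univ, nsmul_eq_mul]; ring

/-- A maximal inequality for sums of square-integrable martingale differences. -/
lemma max_ineq {𝒢 : Filtration ℕ mΩ} {ξ : ℕ → Ω → ℝ}
    (hmeas : ∀ l, StronglyMeasurable[𝒢 (l + 1)] (ξ l)) (hL2 : ∀ l, MemLp (ξ l) 2 Q)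
    (hort : ∀ l (A : Set Ω), MeasurableSet[𝒢 l] A → ∫ ω in A, ξ l ω ∂Q = 0) {v : ℝ}
    (hvar : ∀ l, ∫ ω, ξ l ω ^ 2 ∂Q ≤ v) (n : ℕ) {ε : ℝ} (hε : 0 < ε) :
    Q {ω | ∃ L ≤ n, ε ≤ |∑ l ∈ Finset.range L, ξ l ω|} ≤ ENNReal.ofReal (n * v / ε ^ 2) := by
  set S : ℕ → Ω → ℝ := fun L ω => ∑ l ∈ Finset.range L, ξ l ω with hS
  have hSad : StronglyAdapted 𝒢 S := fun L => Finset.stronglyMeasurable_fun_sum _ fun l hl =>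
    (hmeas l).mono (𝒢.mono (by simpa using hl))
  have hSL2 : ∀ L, MemLp (S L) 2 Q := fun L => memLp_finsetSum _ fun l _ => hL2 l
  have hSsq : ∀ L, Integrable (fun ω => S L ω ^ 2) Q := fun L => (hSL2 L).integrable_sq
  have hcross : ∀ L, Integrable (fun ω => S L ω * ξ L ω) Q := fun L =>
    (hSL2 L).integrable_mul (hL2 L)
  have hcond : ∀ l, Q[ξ l | 𝒢 l] =ᵐ[Q] 0 := by
    intro l
    refine (ae_eq_condExp_of_forall_setIntegral_eq (𝒢.le l) ((hL2 l).integrable one_le_two)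
      (fun s _ _ => integrableOn_zero) (fun s hs _ => ?_)
      (stronglyMeasurable_zero.aestronglyMeasurable)).symm
    rw [hort l s hs]; simp
  have hz : ∀ L (A : Set Ω), MeasurableSet[𝒢 L] A → ∫ ω in A, S L ω * ξ L ω ∂Q = 0 := by
    intro L A hA
    have h1 : Q[S L * ξ L | 𝒢 L] =ᵐ[Q] S L * Q[ξ L | 𝒢 L] :=
      condExp_mul_of_stronglyMeasurable_left (hSad L) (hcross L) ((hL2 L).integrable one_le_two)
    have h2 : ∫ ω in A, (Q[S L * ξ L | 𝒢 L]) ω ∂Q = ∫ ω in A, (S L * ξ L) ω ∂Q :=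
      setIntegral_condExp (𝒢.le L) (hcross L) hA
    change ∫ ω in A, (S L * ξ L) ω ∂Q = 0
    rw [← h2]
    have h3 : Q[S L * ξ L | 𝒢 L] =ᵐ[Q] 0 := by
      filter_upwards [h1, hcond L] with ω a b
      rw [a]; simp [b]
    rw [setIntegral_congr_ae (g := fun _ => (0 : ℝ)) (𝒢.le L A hA) (h3.mono fun ω h _ => h)]
    simp
  have hstep : ∀ L (A : Set Ω), MeasurableSet[𝒢 L] A → ∫ ω in A, S (L + 1) ω ^ 2 ∂Q =
      ∫ ω in A, S L ω ^ 2 ∂Q + ∫ ω in A, ξ L ω ^ 2 ∂Q := by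
    intro L A hA
    have e : ∀ ω, S (L + 1) ω ^ 2 = S L ω ^ 2 + ξ L ω ^ 2 + 2 * (S L ω * ξ L ω) := by
      intro ω
      simp only [hS, Finset.sum_range_succ]; ring
    simp only [e]
    have i1 : Integrable (fun ω => S L ω ^ 2) (Q.restrict A) := (hSsq L).restrict
    have i2 : Integrable (fun ω => ξ L ω ^ 2) (Q.restrict A) := (hL2 L).integrable_sq.restrict
    have i3 : Integrable (fun ω => 2 * (S L ω * ξ L ω)) (Q.restrict A) :=
      ((hcross L).const_mul 2).restrict
    have i12 : Integrable (fun ω => S L ω ^ 2 + ξ L ω ^ 2) (Q.restrict A) := i1.add i2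
    rw [integral_add i12 i3, integral_add i1 i2, integral_const_mul, hz L A hA]
    ring
  have hsub : Submartingale (fun L ω => S L ω ^ 2) 𝒢 Q := by
    refine submartingale_of_setIntegral_le_succ (fun L => (hSad L).pow 2) hSsq fun L A hA => ?_
    rw [hstep L A hA]
    have : 0 ≤ ∫ ω in A, ξ L ω ^ 2 ∂Q := integral_nonneg fun ω => sq_nonneg _
    linarith
  have hES : ∀ L : ℕ, ∫ ω, S L ω ^ 2 ∂Q ≤ L * v := by
    intro L
    induction L with
    | zero => simp [hS]
    | succ L ih =>
      have := hstep L Set.univ MeasurableSet.univ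
      simp only [setIntegral_univ] at this
      rw [this]
      push_cast
      linarith [hvar L]
  have hmax := maximal_ineq hsub (fun L ω => sq_nonneg (S L ω)) (ε := (ε ^ 2).toNNReal) n
  have hε2 : ((ε ^ 2).toNNReal : ℝ) = ε ^ 2 := Real.coe_toNNReal _ (by positivity)
  have hsubset : {ω | ∃ L ≤ n, ε ≤ |S L ω|} ⊆ {ω | (((ε ^ 2).toNNReal : ℝ≥0) : ℝ) ≤
      (Finset.range (n + 1)).sup' Finset.nonempty_range_add_one fun k => S k ω ^ 2} := by
    rintro ω ⟨L, hL, h⟩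
    rw [Set.mem_ofPred_eq, hε2, Finset.le_sup'_iff]
    refine ⟨L, by simpa using Nat.lt_succ_of_le hL, ?_⟩
    rw [← sq_abs (S L ω)]
    exact pow_le_pow_left₀ hε.le h 2
  refine (measure_mono hsubset).trans ?_
  rw [ENNReal.ofReal_div_of_pos (by positivity),
    ENNReal.le_div_iff_mul_le (Or.inl (by simpa using hε.ne')) (Or.inl ENNReal.ofReal_ne_top),
    mul_comm]
  refine hmax.trans (ENNReal.ofReal_le_ofReal ?_)
  refine (setIntegral_le_integral (hSsq n) (ae_of_all _ fun ω => sq_nonneg _)).trans (hES n)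

/-- The modulus of continuity of the Brownian paths is small in probability. -/
lemma BM.modulus (hB : BM Q ℱ ρ W) (T : ℝ≥0) {δ : ℝ} (hδ : 0 < δ) {ε : ℝ≥0∞} (hε : 0 < ε) :
    ∀ᶠ m : ℕ in atTop, Q {ω | ∃ k, ∃ u ≤ T, ∃ v ≤ T, |(u : ℝ) - v| ≤ (2 ^ m)⁻¹ ∧
      δ < |W k u ω - W k v ω|} ≤ ε := by
  set x : ℕ → ℝ≥0 := fun i => min (TopologicalSpace.denseSeq ℝ≥0 i) T
  set D : ℕ → Set Ω := fun m => {ω | ∃ k i j, |(x i : ℝ) - x j| < 2 * (2 ^ m)⁻¹ ∧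
      δ < |W k (x i) ω - W k (x j) ω|} with hDdef
  have hDm : ∀ m, MeasurableSet (D m) := by
    intro m
    have : D m = ⋃ k, ⋃ i, ⋃ j, {ω | |(x i : ℝ) - x j| < 2 * (2 ^ m)⁻¹ ∧
      δ < |W k (x i) ω - W k (x j) ω|} := by
      ext ω; simp [hDdef]
    rw [this]
    refine MeasurableSet.iUnion fun k => MeasurableSet.iUnion fun i => MeasurableSet.iUnion fun j => ?_
    have h1 := ((hB.adapted k (x i)).mono (ℱ.le _)).measurable
    have h2 := ((hB.adapted k (x j)).mono (ℱ.le _)).measurable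
    exact (MeasurableSet.const _).inter (measurableSet_lt measurable_const (h1.sub h2).norm)
  have hanti : Antitone D := by
    intro a b hab ω
    rintro ⟨k, i, j, h1, h2⟩
    refine ⟨k, i, j, h1.trans_le ?_, h2⟩
    have : ((2 : ℝ) ^ b)⁻¹ ≤ (2 ^ a)⁻¹ :=
      inv_anti₀ (by positivity) (pow_le_pow_right₀ one_le_two hab)
    linarith
  have hnull : Q (⋂ m, D m) = 0 := by
    rw [← nonpos_iff_eq_zero, ← (ae_iff.1 hB.continuous)]
    refine measure_mono fun ω hω hc => ?_
    rw [Set.mem_iInter] at hω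
    have hK : IsCompact (Set.Iic T) := by rw [← Set.Icc_bot]; exact isCompact_Icc
    have : ∀ k, ∃ η > 0, ∀ a ∈ Set.Iic T, ∀ b ∈ Set.Iic T, dist a b < η →
        dist (W k a ω) (W k b ω) < δ := fun k => Metric.uniformContinuousOn_iff.1
      (hK.uniformContinuousOn_of_continuous (hc k).continuousOn) δ hδ
    choose η hη hη' using this
    obtain ⟨η0, hη0, hη0'⟩ : ∃ η0 > 0, ∀ k, η0 ≤ η k := by
      rcases isEmpty_or_nonempty ι with he | he
      · exact ⟨1, one_pos, fun k => (he.false k).elim⟩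
      · exact ⟨Finset.univ.inf' Finset.univ_nonempty η, by simpa [Finset.lt_inf'_iff] using hη,
          fun k => Finset.inf'_le _ (Finset.mem_univ k)⟩
    obtain ⟨m, hm⟩ := exists_pow_lt_of_lt_one (half_pos hη0) (by norm_num : (1 / 2 : ℝ) < 1)
    obtain ⟨k, i, j, h1, h2⟩ := hω m
    have h3 := hη' k (x i) (Set.mem_Iic.2 (min_le_right _ _)) (x j)
      (Set.mem_Iic.2 (min_le_right _ _)) (by
      rw [NNReal.dist_eq]
      refine h1.trans_le (le_trans ?_ (hη0' k))
      rw [one_div, inv_pow] at hm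
      linarith)
    rw [Real.dist_eq] at h3
    linarith
  have hlim := tendsto_measure_iInter_atTop (μ := Q) (fun m => (hDm m).nullMeasurableSet) hanti
    ⟨0, measure_ne_top _ _⟩
  rw [hnull] at hlim
  filter_upwards [(ENNReal.tendsto_nhds_zero.1 hlim) ε hε] with m hm
  refine le_trans (measure_mono_ae ?_) hm
  filter_upwards [hB.continuous] with ω hc
  rintro ⟨k, u, hu, v, hv, huv, hd⟩
  have hopen : IsOpen {p : ℝ≥0 × ℝ≥0 | |((min p.1 T : ℝ≥0) : ℝ) - (min p.2 T : ℝ≥0)| < 2 * (2 ^ m)⁻¹ ∧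
      δ < |W k (min p.1 T) ω - W k (min p.2 T) ω|} := by
    have c1 : Continuous fun p : ℝ≥0 × ℝ≥0 => min p.1 T := continuous_fst.min continuous_const
    have c2 : Continuous fun p : ℝ≥0 × ℝ≥0 => min p.2 T := continuous_snd.min continuous_const
    refine IsOpen.and (isOpen_lt ?_ continuous_const) (isOpen_lt continuous_const ?_)
    · exact ((NNReal.continuous_coe.comp c1).sub (NNReal.continuous_coe.comp c2)).abs
    · exact (((hc k).comp c1).sub ((hc k).comp c2)).abs
  have hdense : DenseRange (Prod.map (TopologicalSpace.denseSeq ℝ≥0) (TopologicalSpace.denseSeq ℝ≥0)) :=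
    (TopologicalSpace.denseRange_denseSeq _).prodMap (TopologicalSpace.denseRange_denseSeq _)
  obtain ⟨⟨i, j⟩, hij⟩ := hdense.exists_mem_open hopen ⟨(u, v), by
    simp only [Set.mem_ofPred_eq, min_eq_left hu, min_eq_left hv]
    have : (0 : ℝ) < (2 ^ m)⁻¹ := by positivity
    exact ⟨by linarith, hd⟩⟩
  exact ⟨k, i, j, hij⟩

/-! ### Second-order Taylor expansion -/

/-- `f` is twice differentiable with derivatives `f₁` and `f₂`, which are bounded and Lipschitz with
constant `C`. -/
structure SmoothBdd (f f₁ f₂ : ℝ → ℝ) (C : ℝ) : Prop where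
  deriv₁ : ∀ x, HasDerivAt f (f₁ x) x
  deriv₂ : ∀ x, HasDerivAt f₁ (f₂ x) x
  bdd₁ : ∀ x, |f₁ x| ≤ C
  bdd₂ : ∀ x, |f₂ x| ≤ C
  lip : ∀ x y, |f₂ y - f₂ x| ≤ C * |y - x|

namespace SmoothBdd

variable {f f₁ f₂ : ℝ → ℝ} {C : ℝ}

lemma mono {D : ℝ} (h : SmoothBdd f f₁ f₂ C) (hCD : C ≤ D) : SmoothBdd f f₁ f₂ D :=
  ⟨h.deriv₁, h.deriv₂, fun x => (h.bdd₁ x).trans hCD, fun x => (h.bdd₂ x).trans hCD,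
    fun x y => (h.lip x y).trans (by gcongr)⟩

lemma lip₀ (h : SmoothBdd f f₁ f₂ C) (x y : ℝ) : |f y - f x| ≤ C * |y - x| :=
  Convex.norm_image_sub_le_of_norm_hasDerivWithin_le (s := Set.univ)
    (fun z _ => (h.deriv₁ z).hasDerivWithinAt) (fun z _ => h.bdd₁ z) convex_univ trivial trivial

lemma lip₁ (h : SmoothBdd f f₁ f₂ C) (x y : ℝ) : |f₁ y - f₁ x| ≤ C * |y - x| :=
  Convex.norm_image_sub_le_of_norm_hasDerivWithin_le (s := Set.univ)
    (fun z _ => (h.deriv₂ z).hasDerivWithinAt) (fun z _ => h.bdd₂ z) convex_univ trivial trivial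

lemma nonneg (h : SmoothBdd f f₁ f₂ C) : 0 ≤ C := (abs_nonneg _).trans (h.bdd₁ 0)

lemma taylor (h : SmoothBdd f f₁ f₂ C) (x y : ℝ) :
    |f y - f x - f₁ x * (y - x) - 1 / 2 * f₂ x * (y - x) ^ 2| ≤ C * |y - x| ^ 3 := by
  have hC := h.nonneg
  have hmem : ∀ z ∈ Set.uIcc x y, |z - x| ≤ |y - x| := fun z hz =>
    Set.abs_sub_left_of_mem_uIcc hz
  have k1 : ∀ z ∈ Set.uIcc x y, |f₁ z - f₁ x - f₂ x * (z - x)| ≤ C * |y - x| ^ 2 := by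
    intro z hz
    have hd : ∀ w ∈ Set.uIcc x y, HasDerivWithinAt (fun w => f₁ w - f₁ x - f₂ x * (w - x))
        (f₂ w - f₂ x) (Set.uIcc x y) w := by
      intro w _
      have := (((h.deriv₂ w).sub_const (f₁ x)).sub
        (((hasDerivAt_id w).sub_const x).const_mul (f₂ x)))
      rw [mul_one] at this
      exact this.hasDerivWithinAt
    have hb : ∀ w ∈ Set.uIcc x y, ‖f₂ w - f₂ x‖ ≤ C * |y - x| := fun w hw =>
      (h.lip x w).trans (mul_le_mul_of_nonneg_left (hmem w hw) hC)
    have := Convex.norm_image_sub_le_of_norm_hasDerivWithin_le hd hb (convex_uIcc x y)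
      Set.left_mem_uIcc hz
    simp only [sub_self, mul_zero, sub_zero] at this
    refine this.trans ?_
    rw [Real.norm_eq_abs, pow_two, ← mul_assoc]
    exact mul_le_mul_of_nonneg_left (hmem z hz) (by positivity)
  have hd : ∀ w ∈ Set.uIcc x y, HasDerivWithinAt
      (fun w => f w - f x - f₁ x * (w - x) - 1 / 2 * f₂ x * (w - x) ^ 2)
      (f₁ w - f₁ x - f₂ x * (w - x)) (Set.uIcc x y) w := by
    intro w _
    have := ((((h.deriv₁ w).sub_const (f x)).sub
      (((hasDerivAt_id w).sub_const x).const_mul (f₁ x)))).sub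
      ((((hasDerivAt_id w).sub_const x).pow 2).const_mul (1 / 2 * f₂ x))
    refine (this.hasDerivWithinAt).congr_deriv ?_
    simp; ring
  have := Convex.norm_image_sub_le_of_norm_hasDerivWithin_le hd k1 (convex_uIcc x y)
      Set.left_mem_uIcc Set.right_mem_uIcc
  simp only [sub_self, mul_zero] at this
  refine le_trans (le_of_eq ?_) (this.trans (le_of_eq ?_))
  · rw [Real.norm_eq_abs]; norm_num
  · rw [Real.norm_eq_abs]; ring

end SmoothBdd

end ItoCalculus

namespace ItoCalculus

open RoughFMM (leb)

/-! ### The Itô formula for elementary processes -/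

variable {Ω ι : Type*} [mΩ : MeasurableSpace Ω] {Q : Measure Ω} [IsProbabilityMeasure Q]
  {ℱ : Filtration ℝ≥0 mΩ} {ρ : ι → ι → ℝ} {W : ι → ℝ≥0 → Ω → ℝ} [Fintype ι]

set_option linter.unusedSectionVars false

lemma BM.integrable_mul_incr (hB : BM Q ℱ ρ W) {s t : ℝ≥0} (hst : s ≤ t) (k l : ι) :
    Integrable (fun ω => (W k t ω - W k s ω) * (W l t ω - W l s ω)) Q :=
  ((hB.memLp k s t hst).mono_exponent (p := 2) (by norm_num)).integrable_mul
    ((hB.memLp l s t hst).mono_exponent (p := 2) (by norm_num))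

lemma BM.integral_mul_sq_sub (hB : BM Q ℱ ρ W) {s t : ℝ≥0} (hst : s ≤ t) {κ : ι → Ω → ℝ} {C B : ℝ}
    (hκ : ∀ k, StronglyMeasurable[ℱ s] (κ k)) (hκC : ∀ k ω, |κ k ω| ≤ C) {Z : Ω → ℝ}
    (hZ : StronglyMeasurable[ℱ s] Z) (hZB : ∀ ω, |Z ω| ≤ B) :
    ∫ ω, Z ω * ((∑ k, κ k ω * (W k t ω - W k s ω)) ^ 2 -
      ((t : ℝ) - s) * qcov ρ (fun k => κ k ω) (fun k => κ k ω)) ∂Q = 0 := by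
  have hm : ∀ k l, StronglyMeasurable[ℱ s] fun ω => Z ω * (κ k ω * κ l ω) := fun k l =>
    hZ.mul ((hκ k).mul (hκ l))
  have hb : ∀ k l ω, ‖Z ω * (κ k ω * κ l ω)‖ ≤ B * (C * C) := by
    intro k l ω
    rw [norm_mul, norm_mul]
    have : 0 ≤ C := (abs_nonneg _).trans (hκC k ω)
    have : 0 ≤ B := (abs_nonneg _).trans (hZB ω)
    gcongr
    exacts [hZB ω, hκC k ω, hκC l ω]
  have hi1 : ∀ k l, Integrable (fun ω => Z ω * (κ k ω * κ l ω)) Q := fun k l =>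
    Integrable.of_bound ((hm k l).mono (ℱ.le s)).aestronglyMeasurable _ (ae_of_all _ (hb k l))
  have hi2 : ∀ k l, Integrable (fun ω => Z ω * (κ k ω * κ l ω) *
      ((W k t ω - W k s ω) * (W l t ω - W l s ω))) Q := fun k l =>
    (hB.integrable_mul_incr hst k l).bdd_mul ((hm k l).mono (ℱ.le s)).aestronglyMeasurable
      (ae_of_all _ (hb k l))
  have e : ∀ ω, Z ω * ((∑ k, κ k ω * (W k t ω - W k s ω)) ^ 2 -
      ((t : ℝ) - s) * qcov ρ (fun k => κ k ω) (fun k => κ k ω)) =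
      ∑ k, ∑ l, (Z ω * (κ k ω * κ l ω) * ((W k t ω - W k s ω) * (W l t ω - W l s ω)) -
        ((t : ℝ) - s) * ρ k l * (Z ω * (κ k ω * κ l ω))) := by
    intro ω
    rw [qcov, pow_two, Finset.sum_mul_sum, Finset.mul_sum, ← Finset.sum_sub_distrib, Finset.mul_sum]
    refine Finset.sum_congr rfl fun k _ => ?_
    rw [Finset.mul_sum, ← Finset.sum_sub_distrib, Finset.mul_sum]
    refine Finset.sum_congr rfl fun l _ => ?_
    ring
  simp only [e]
  have hi3 : ∀ k l, Integrable (fun ω => Z ω * (κ k ω * κ l ω) *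
      ((W k t ω - W k s ω) * (W l t ω - W l s ω)) -
        ((t : ℝ) - s) * ρ k l * (Z ω * (κ k ω * κ l ω))) Q := fun k l =>
    (hi2 k l).sub ((hi1 k l).const_mul _)
  rw [integral_finsetSum _ fun k _ => integrable_finsetSum _ fun l _ => hi3 k l]
  refine Finset.sum_eq_zero fun k _ => ?_
  rw [integral_finsetSum _ fun l _ => hi3 k l]
  refine Finset.sum_eq_zero fun l _ => ?_
  rw [integral_sub (hi2 k l) ((hi1 k l).const_mul _), integral_const_mul,
    hB.integral_mul_incr_mul_incr hst (hm k l) k l, sub_self]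

namespace SmoothBdd

variable {f f₁ f₂ : ℝ → ℝ} {C : ℝ}

lemma continuous₀ (h : SmoothBdd f f₁ f₂ C) : Continuous f :=
  continuous_iff_continuousAt.2 fun x => (h.deriv₁ x).continuousAt

lemma continuous₁ (h : SmoothBdd f f₁ f₂ C) : Continuous f₁ :=
  continuous_iff_continuousAt.2 fun x => (h.deriv₂ x).continuousAt

lemma continuous₂ (h : SmoothBdd f f₁ f₂ C) : Continuous f₂ := by
  have : LipschitzWith C.toNNReal f₂ := LipschitzWith.of_dist_le_mul fun x y => by
    rw [Real.dist_eq, Real.dist_eq, Real.coe_toNNReal _ h.nonneg]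
    exact h.lip y x
  exact this.continuous

end SmoothBdd

namespace Elem

variable {f f₁ f₂ : ℝ → ℝ} {C : ℝ}

/-- The Brownian part of the increment over a grid cell. -/
noncomputable def noise (E : Elem ℱ W) (l : ℕ) (ω : Ω) : ℝ :=
  ∑ k, E.κ l k ω * (W k (pt E.m (l + 1)) ω - W k (pt E.m l) ω)

/-- The instantaneous variance on a grid cell. -/
noncomputable def var (ρ : ι → ι → ℝ) (E : Elem ℱ W) (l : ℕ) (ω : Ω) : ℝ :=
  qcov ρ (fun k => E.κ l k ω) (fun k => E.κ l k ω)

lemma stronglyMeasurable_var (E : Elem ℱ W) (l : ℕ) :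
    StronglyMeasurable[ℱ (pt E.m l)] (E.var ρ l) :=
  Finset.stronglyMeasurable_fun_sum _ fun k _ => Finset.stronglyMeasurable_fun_sum _ fun j _ =>
    ((E.κ_meas l k).mul (E.κ_meas l j)).const_mul _

lemma stronglyMeasurable_noise (hW : ∀ k, StronglyAdapted ℱ (W k)) (E : Elem ℱ W) (l : ℕ) :
    StronglyMeasurable[ℱ (pt E.m (l + 1))] (E.noise l) :=
  Finset.stronglyMeasurable_fun_sum _ fun k _ =>
    ((E.κ_meas l k).mono (ℱ.mono (pt_mono _ (Nat.le_succ l)))).mul ((hW k _).sub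
      ((hW k _).mono (ℱ.mono (pt_mono _ (Nat.le_succ l)))))

/-- The coefficients given by Itô's formula for `f(Y)`, frozen at the left end points of the grid
cells, and the elementary process that they generate. -/
noncomputable def itoStep (hW : ∀ k, StronglyAdapted ℱ (W k)) (ρ : ι → ι → ℝ) (E : Elem ℱ W)
    (hf : SmoothBdd f f₁ f₂ C) : Elem ℱ W :=
  ofCoef hW E.m (fun l k ω => f₁ (E.Y (pt E.m l) ω) * E.κ l k ω)
    (fun l ω => f₁ (E.Y (pt E.m l) ω) * E.β l ω + 1 / 2 * f₂ (E.Y (pt E.m l) ω) * E.var ρ l ω)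
    (fun ω => f (E.Y 0 ω))
    (fun l k => (hf.continuous₁.comp_stronglyMeasurable (E.Y_adapted _)).mul (E.κ_meas l k))
    (fun l => ((hf.continuous₁.comp_stronglyMeasurable (E.Y_adapted _)).mul (E.β_meas l)).add
      (((hf.continuous₂.comp_stronglyMeasurable (E.Y_adapted _)).const_mul _).mul
        (E.stronglyMeasurable_var l)))
    (by
      obtain ⟨D, hD1, hD, hD'⟩ := E.exists_bound
      refine ⟨C * D, fun l k ω => ?_⟩
      have := hf.nonneg
      rw [abs_mul]
      gcongr
      exacts [hf.bdd₁ _, hD l k ω])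
    (by
      obtain ⟨D, hD1, hD, hD'⟩ := E.exists_bound
      refine ⟨C * D + 1 / 2 * C * ((∑ k, ∑ l, |ρ k l|) * (D * D)), fun l ω => ?_⟩
      have := hf.nonneg
      refine (abs_add_le _ _).trans ?_
      rw [abs_mul, abs_mul, abs_mul, abs_of_pos (by norm_num : (0 : ℝ) < 1 / 2)]
      gcongr
      exacts [hf.bdd₁ _, hD' l ω, hf.bdd₂ _, abs_qcov_le ρ (hD l · ω) (hD l · ω)])
    (hf.continuous₀.comp_stronglyMeasurable (E.Y_adapted 0))

/-- The martingale part of the error of the second-order Taylor expansion over a grid cell. -/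
noncomputable def err (ρ : ι → ι → ℝ) (E : Elem ℱ W) (f₂ : ℝ → ℝ) (l : ℕ) (ω : Ω) : ℝ :=
  1 / 2 * f₂ (E.Y (pt E.m l) ω) * (E.noise l ω ^ 2 - (2 ^ E.m)⁻¹ * E.var ρ l ω)

/-- A bound for the remaining error over a grid cell of length `h`, where `s = √h`. -/
noncomputable def rem (E : Elem ℱ W) (C : ℝ) (l : ℕ) (ω : Ω) : ℝ :=
  10 * C ^ 4 * (E.noise l ω ^ 2 * √((2 ^ E.m)⁻¹) + E.noise l ω ^ 4 / √((2 ^ E.m)⁻¹)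
    + √((2 ^ E.m)⁻¹) ^ 3)

/-- The error of the second-order expansion over a cell of length `h = s ^ 2`, where `N` is the
increment of the martingale part and `β * h` that of the drift. As `N` is of order `s`, all the
terms on the right are of order `s ^ 3`, while there are only `s ^ (-2)` cells. -/
lemma taylor_error {C N h s β : ℝ} (hC : 1 ≤ C) (hs : 0 < s) (hs1 : s ≤ 1) (hh : h = s ^ 2)
    (hβ : |β| ≤ C) : C * |N + β * h| ^ 3 + 1 / 2 * C * |(N + β * h) ^ 2 - N ^ 2| ≤
      10 * C ^ 4 * (N ^ 2 * s + N ^ 4 / s + s ^ 3) := by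
  set x := |N|
  have hx : 0 ≤ x := abs_nonneg _
  have e2 : N ^ 2 = x ^ 2 := (sq_abs N).symm
  have e4 : N ^ 4 = x ^ 4 := ((by decide : Even 4).pow_abs N).symm
  have h0 : 0 < h := hh ▸ by positivity
  have hbh : |β * h| ≤ C * h := by rw [abs_mul, abs_of_pos h0]; gcongr
  have a1 : |N + β * h| ≤ x + C * h := (abs_add_le _ _).trans (by gcongr)
  have a2 : |(N + β * h) ^ 2 - N ^ 2| ≤ (2 * x + C * h) * (C * h) := by
    have : (N + β * h) ^ 2 - N ^ 2 = (2 * N + β * h) * (β * h) := by ring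
    rw [this, abs_mul]
    gcongr
    refine (abs_add_le _ _).trans ?_
    rw [abs_mul, abs_two]; gcongr
  set A := x ^ 2 * s + x ^ 4 / s + s ^ 3 with hA
  have b0 : 0 ≤ x ^ 4 / s := by positivity
  have b0' : 0 ≤ x ^ 2 * s := by positivity
  have b0'' : 0 ≤ s ^ 3 := by positivity
  -- the arithmetic-geometric mean inequality bounds the intermediate powers
  have b1 : x ^ 3 ≤ A := by
    have : 2 * x ^ 3 ≤ x ^ 2 * s + x ^ 4 / s := by
      have h1 : x ^ 2 * s + x ^ 4 / s - 2 * x ^ 3 = x ^ 2 * (s - x) ^ 2 / s := by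
        field_simp; ring
      have h2 : 0 ≤ x ^ 2 * (s - x) ^ 2 / s := by positivity
      linarith
    have : 0 ≤ x ^ 3 := by positivity
    linarith
  have b2 : x * h ≤ A := by
    have : 2 * (x * h) ≤ x ^ 2 * s + s ^ 3 := by
      have h1 : x ^ 2 * s + s ^ 3 - 2 * (x * h) = s * (x - s) ^ 2 := by rw [hh]; ring
      have h2 : 0 ≤ s * (x - s) ^ 2 := by positivity
      linarith
    have : 0 ≤ x * h := by positivity
    linarith
  have b3 : h ^ 2 ≤ A := by
    have : h ^ 2 ≤ s ^ 3 := by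
      rw [hh, ← pow_mul]; exact pow_le_pow_of_le_one hs.le hs1 (by norm_num)
    linarith
  have b4 : h ^ 3 ≤ A := by
    have : h ^ 3 ≤ s ^ 3 := by
      rw [hh, ← pow_mul]; exact pow_le_pow_of_le_one hs.le hs1 (by norm_num)
    linarith
  have c1 : |N + β * h| ^ 3 ≤ 4 * (x ^ 3 + (C * h) ^ 3) := by
    refine (pow_le_pow_left₀ (abs_nonneg _) a1 3).trans ?_
    have : 0 ≤ C * h := by positivity
    nlinarith [mul_nonneg (add_nonneg hx this) (sq_nonneg (x - C * h))]
  have hC0 : 0 ≤ C := by linarith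
  have hC2 : C ^ 2 ≤ C ^ 4 := pow_le_pow_right₀ hC (by norm_num)
  have hC3 : C ^ 3 ≤ C ^ 4 := pow_le_pow_right₀ hC (by norm_num)
  have hC1 : C ≤ C ^ 4 := le_self_pow₀ hC (by norm_num)
  have hA0 : 0 ≤ A := by positivity
  rw [show N ^ 2 * s + N ^ 4 / s + s ^ 3 = A by rw [hA, e2, e4]]
  calc _ ≤ C * (4 * (x ^ 3 + (C * h) ^ 3)) + 1 / 2 * C * ((2 * x + C * h) * (C * h)) := by gcongr
    _ = 4 * C * x ^ 3 + 4 * C ^ 4 * h ^ 3 + C ^ 2 * (x * h) + 1 / 2 * C ^ 3 * h ^ 2 := by ring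
    _ ≤ 4 * C * A + 4 * C ^ 4 * A + C ^ 2 * A + 1 / 2 * C ^ 3 * A := by gcongr
    _ ≤ 4 * C ^ 4 * A + 4 * C ^ 4 * A + C ^ 4 * A + C ^ 4 * A := by
        gcongr
        linarith
    _ = _ := by ring

set_option maxHeartbeats 1000000 in
/-- The deterministic part of Itô's formula: if the errors `err` and `rem` have small sums and the
Brownian paths oscillate little over a cell, then `itoStep` approximates `f (E.Y)` and its
characteristics. -/
lemma itoStep_close (hW : ∀ k, StronglyAdapted ℱ (W k)) (E : Elem ℱ W)
    (hf : SmoothBdd f f₁ f₂ C) (hC : 1 ≤ C) (hκ : ∀ l k ω, |E.κ l k ω| ≤ C)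
    (hβ : ∀ l ω, |E.β l ω| ≤ C) (T : ℕ) {ε δ : ℝ} {ω : Ω} (hδ : 0 ≤ δ)
    (h1 : ∀ L ≤ T * 2 ^ E.m, |∑ l ∈ Finset.range L, E.err ρ f₂ l ω| ≤ ε / 4)
    (h2 : ∑ l ∈ Finset.range (T * 2 ^ E.m), E.rem C l ω ≤ ε / 4)
    (h3 : ∀ k, ∀ u ≤ (T : ℝ≥0), ∀ v ≤ (T : ℝ≥0), |(u : ℝ) - v| ≤ (2 ^ E.m)⁻¹ →
      |W k u ω - W k v ω| ≤ δ)
    (h4 : (2 * C ^ 2 + C ^ 3 * ∑ k, ∑ l, |ρ k l|) *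
      (((Fintype.card ι : ℝ) + 1) * C * (δ + (2 ^ E.m)⁻¹)) * (T + 1) ≤ ε / 4) :
    (E.itoStep hW ρ hf).Close T ε ω (fun s => f (E.Y s ω)) (fun k s => f₁ (E.Y s ω) * E.kap k s ω)
      (fun s => f₁ (E.Y s ω) * E.bet s ω + 1 / 2 * f₂ (E.Y s ω) *
        qcov ρ (fun k => E.kap k s ω) (fun k => E.kap k s ω)) := by
  set m := E.m with hm
  set h : ℝ := (2 ^ m)⁻¹ with hh
  have hh0 : 0 < h := by positivity
  have hh1 : h ≤ 1 := inv_le_one_of_one_le₀ (one_le_pow₀ one_le_two)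
  set R := ∑ k, ∑ l, |ρ k l| with hR
  have hR0 : 0 ≤ R := Finset.sum_nonneg fun k _ => Finset.sum_nonneg fun l _ => abs_nonneg _
  set a : ℝ := ((Fintype.card ι : ℝ) + 1) * C * (δ + h) with ha
  have hC0 : 0 ≤ C := by linarith
  have ha0 : 0 ≤ a := by positivity
  have hah : C * h ≤ a := by
    rw [ha]
    have : 0 ≤ (Fintype.card ι : ℝ) * C * (δ + h) := by positivity
    nlinarith [mul_nonneg hC0 hδ]
  have hsumW : ∀ (c : ι → ℝ) (D : ℝ), 0 ≤ D → (∀ k, |c k| ≤ D) → ∀ u v : ℝ≥0, u ≤ T → v ≤ T →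
      |(u : ℝ) - v| ≤ h → |∑ k, c k * (W k u ω - W k v ω)| ≤ (Fintype.card ι : ℝ) * D * δ := by
    intro c D hD hc u v hu hv huv
    refine (Finset.abs_sum_le_sum_abs _ _).trans ?_
    calc _ ≤ ∑ k : ι, D * δ := by
          refine Finset.sum_le_sum fun k _ => ?_
          rw [abs_mul]
          gcongr
          exacts [hc k, h3 k u hu v hv huv]
      _ = _ := by rw [Finset.sum_const, Finset.card_univ, nsmul_eq_mul]; ring
  have hcov : ∀ l, |E.var ρ l ω| ≤ R * (C * C) := fun l => abs_qcov_le ρ (hκ l · ω) (hκ l · ω)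
  have hY : ∀ l u, pt m l ≤ u → u ≤ pt m (l + 1) → u ≤ T → |E.Y u ω - E.Y (pt m l) ω| ≤ a ∧
      |(E.itoStep hW ρ hf).Y u ω - (E.itoStep hW ρ hf).Y (pt m l) ω| ≤ (C + C ^ 2 * R) * a := by
    intro l u h5 h6 h7
    have h8 : |(u : ℝ) - pt m l| ≤ h := by
      rw [abs_of_nonneg (sub_nonneg.2 (NNReal.coe_le_coe.2 h5)), hh, ← pt_succ_sub m l]
      have := NNReal.coe_le_coe.2 h6
      linarith
    have h9 : pt m l ≤ T := h5.trans h7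
    constructor
    · rw [E.step l ω u h5 h6]
      have e : E.Y (pt E.m l) ω + ∑ k, E.κ l k ω * (W k u ω - W k (pt E.m l) ω) +
          E.β l ω * ((u : ℝ) - pt E.m l) - E.Y (pt m l) ω =
          ∑ k, E.κ l k ω * (W k u ω - W k (pt m l) ω) + E.β l ω * ((u : ℝ) - pt m l) := by
        rw [← hm]; ring
      rw [e]
      refine (abs_add_le _ _).trans ?_
      have t1 := hsumW (fun k => E.κ l k ω) C hC0 (hκ l · ω) u (pt m l) h7 h9 h8
      have t2 : |E.β l ω * ((u : ℝ) - pt m l)| ≤ C * h := by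
        rw [abs_mul]; gcongr; exact hβ l ω
      rw [ha]
      nlinarith [mul_nonneg hC0 hδ, mul_nonneg (mul_nonneg (Nat.cast_nonneg (α := ℝ) (Fintype.card ι)) hC0) hh0.le]
    · have := (E.itoStep hW ρ hf).step l ω u h5 h6
      change (E.itoStep hW ρ hf).Y u ω = (E.itoStep hW ρ hf).Y (pt m l) ω +
        ∑ k, (f₁ (E.Y (pt m l) ω) * E.κ l k ω) * (W k u ω - W k (pt m l) ω) +
        (f₁ (E.Y (pt m l) ω) * E.β l ω + 1 / 2 * f₂ (E.Y (pt m l) ω) * E.var ρ l ω) *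
          ((u : ℝ) - pt m l) at this
      rw [this, add_assoc, add_sub_cancel_left]
      refine (abs_add_le _ _).trans ?_
      have t1 := hsumW (fun k => f₁ (E.Y (pt m l) ω) * E.κ l k ω) (C * C) (by positivity) (by
        intro k
        rw [abs_mul]; gcongr
        exacts [hf.bdd₁ _, hκ l k ω]) u (pt m l) h7 h9 h8
      have t2 : |(f₁ (E.Y (pt m l) ω) * E.β l ω + 1 / 2 * f₂ (E.Y (pt m l) ω) * E.var ρ l ω) *
          ((u : ℝ) - pt m l)| ≤ (C * C + 1 / 2 * C * (R * (C * C))) * h := by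
        rw [abs_mul]
        gcongr
        refine (abs_add_le _ _).trans ?_
        rw [abs_mul, abs_mul, abs_mul, abs_of_pos (by norm_num : (0 : ℝ) < 1 / 2)]
        gcongr
        exacts [hf.bdd₁ _, hβ l ω, hf.bdd₂ _, hcov l]
      have t3 : (Fintype.card ι : ℝ) * (C * C) * δ + C * C * h ≤ C * a := by
        rw [ha]
        nlinarith [mul_nonneg (mul_nonneg hC0 hC0) hδ,
          mul_nonneg (mul_nonneg (Nat.cast_nonneg (α := ℝ) (Fintype.card ι)) (mul_nonneg hC0 hC0)) hh0.le]
      have t4 : C ^ 2 * R * (C * h) ≤ C ^ 2 * R * a := by gcongr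
      have t5 : 0 ≤ C ^ 2 * R * (C * h) := by positivity
      nlinarith
  have htel : ∀ L ≤ T * 2 ^ m, |f (E.Y (pt m L) ω) - (E.itoStep hW ρ hf).Y (pt m L) ω -
      ∑ l ∈ Finset.range L, E.err ρ f₂ l ω| ≤ ∑ l ∈ Finset.range L, E.rem C l ω := by
    intro L hL
    induction L with
    | zero =>
      have : (E.itoStep hW ρ hf).Y 0 ω = f (E.Y 0 ω) := ofCoef_zero ..
      simp [this]
    | succ L ih =>
      have ih := ih (by omega)
      rw [Finset.sum_range_succ, Finset.sum_range_succ]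
      have hle : pt m L ≤ pt m (L + 1) := pt_mono _ (Nat.le_succ L)
      have s1 : E.Y (pt m (L + 1)) ω = E.Y (pt m L) ω + (E.noise L ω + E.β L ω * h) := by
        rw [E.step L ω _ hle le_rfl, ← hm, pt_succ_sub, ← hh, add_assoc]
        rfl
      have s2 : (E.itoStep hW ρ hf).Y (pt m (L + 1)) ω = (E.itoStep hW ρ hf).Y (pt m L) ω +
          (f₁ (E.Y (pt m L) ω) * E.noise L ω + (f₁ (E.Y (pt m L) ω) * E.β L ω +
            1 / 2 * f₂ (E.Y (pt m L) ω) * E.var ρ L ω) * h) := by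
        rw [(E.itoStep hW ρ hf).step L ω _ hle le_rfl]
        change (E.itoStep hW ρ hf).Y (pt m L) ω + ∑ k, (f₁ (E.Y (pt m L) ω) * E.κ L k ω) *
          (W k (pt m (L + 1)) ω - W k (pt m L) ω) +
          (f₁ (E.Y (pt m L) ω) * E.β L ω + 1 / 2 * f₂ (E.Y (pt m L) ω) * E.var ρ L ω) *
          ((pt m (L + 1) : ℝ) - pt m L) = _
        rw [pt_succ_sub, ← hh, add_assoc, noise, Finset.mul_sum]
        simp only [mul_assoc, ← hm]
      set y := E.Y (pt m L) ω with hy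
      set N := E.noise L ω with hN
      set b := E.β L ω with hb
      have ht := hf.taylor y (y + (N + b * h))
      rw [add_sub_cancel_left] at ht
      have hte := taylor_error (C := C) (N := N) (h := h) (s := √h) (β := b) hC
        (Real.sqrt_pos.2 hh0) (Real.sqrt_le_one.2 hh1) (Real.sq_sqrt hh0.le).symm (hβ L ω)
      have h6 : |1 / 2 * f₂ y * ((N + b * h) ^ 2 - N ^ 2)| ≤
          1 / 2 * C * |(N + b * h) ^ 2 - N ^ 2| := by
        rw [abs_mul, abs_mul, abs_of_pos (by norm_num : (0 : ℝ) < 1 / 2)]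
        gcongr
        exact hf.bdd₂ y
      have h7 : E.err ρ f₂ L ω = 1 / 2 * f₂ y * (N ^ 2 - h * E.var ρ L ω) := rfl
      have h8 : E.rem C L ω = 10 * C ^ 4 * (N ^ 2 * √h + N ^ 4 / √h + √h ^ 3) := rfl
      rw [s1, s2, h7, h8]
      have e : f (y + (N + b * h)) - ((E.itoStep hW ρ hf).Y (pt m L) ω +
          (f₁ y * N + (f₁ y * b + 1 / 2 * f₂ y * E.var ρ L ω) * h)) -
          (∑ l ∈ Finset.range L, E.err ρ f₂ l ω + 1 / 2 * f₂ y * (N ^ 2 - h * E.var ρ L ω)) =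
          (f y - (E.itoStep hW ρ hf).Y (pt m L) ω - ∑ l ∈ Finset.range L, E.err ρ f₂ l ω) +
          ((f (y + (N + b * h)) - f y - f₁ y * (N + b * h) - 1 / 2 * f₂ y * (N + b * h) ^ 2) +
            1 / 2 * f₂ y * ((N + b * h) ^ 2 - N ^ 2)) := by ring
      rw [e]
      refine (abs_add_le _ _).trans (add_le_add ih ((abs_add_le _ _).trans ?_))
      linarith
  have hrem0 : ∀ l, 0 ≤ E.rem C l ω := fun l => by
    unfold rem
    have : 0 ≤ E.noise l ω ^ 4 := (by decide : Even 4).pow_nonneg _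
    positivity
  have hT1 : (1 : ℝ) ≤ T + 1 := by simp
  have hKa : (2 * C ^ 2 + C ^ 3 * R) * a ≤ ε / 4 := by
    refine le_trans ?_ h4
    exact le_mul_of_one_le_right (by positivity) hT1
  have hε : 0 ≤ ε := by
    have : 0 ≤ (2 * C ^ 2 + C ^ 3 * R) * a := by positivity
    linarith
  have hCC : C ≤ C ^ 2 := le_self_pow₀ hC (by norm_num)
  have hC23 : C ^ 2 ≤ C ^ 3 := pow_le_pow_right₀ hC (by norm_num)
  have hcellT : ∀ u : ℝ≥0, u ≤ T → cell m u + 1 ≤ T * 2 ^ m ∨ u = 0 := by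
    intro u hu
    rcases eq_or_ne u 0 with h0 | h0
    · exact Or.inr h0
    · left
      by_contra hcon
      have h5 := (cell_spec (m := m) (pos_iff_ne_zero.2 h0)).1
      have h6 : pt m (T * 2 ^ m) ≤ pt m (cell m u) := pt_mono m (by omega)
      rw [pt_mul_pow] at h6
      exact absurd (h6.trans_lt h5) (not_lt.2 hu)
  refine ⟨fun u hu => ?_, fun k => ?_, ?_⟩
  · rcases hcellT u hu with hc | rfl
    · set l := cell m u
      have hl := hY l u (pt_cell_le m u) (le_pt_cell_succ m u) hu
      have b1 := htel l (by omega)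
      have b2 := h1 l (by omega)
      have b3 : ∑ i ∈ Finset.range l, E.rem C i ω ≤ ε / 4 :=
        (Finset.sum_le_sum_of_subset_of_nonneg (Finset.range_mono (by omega))
          fun i _ _ => hrem0 i).trans h2
      have b4 := (hf.lip₀ (E.Y (pt m l) ω) (E.Y u ω)).trans (mul_le_mul_of_nonneg_left hl.1 hC0)
      have b5 := hl.2
      have b6 : (C + C ^ 2 * R) * a + C * a ≤ ε / 4 := by
        refine le_trans ?_ hKa
        have : C ^ 2 * R * a ≤ C ^ 3 * R * a := by gcongr
        have : C * a ≤ C ^ 2 * a := by gcongr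
        nlinarith
      rw [abs_le] at b1 b2 b4 b5 ⊢
      constructor <;> linarith [b1.1, b1.2, b2.1, b2.2, b4.1, b4.2, b5.1, b5.2]
    · have : (E.itoStep hW ρ hf).Y 0 ω = f (E.Y 0 ω) := ofCoef_zero ..
      simpa [this] using hε
  · have hb : ∀ s ∈ Set.Iic (T : ℝ≥0), ‖((fun s => (E.itoStep hW ρ hf).kap k s ω) -
        fun s => f₁ (E.Y s ω) * E.kap k s ω) s‖ ≤ C ^ 2 * a := by
      intro s hs
      change |f₁ (E.Y (pt m (cell m s)) ω) * E.κ (cell m s) k ω -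
        f₁ (E.Y s ω) * E.κ (cell m s) k ω| ≤ _
      rw [← sub_mul, abs_mul, abs_sub_comm]
      have := (hf.lip₁ (E.Y (pt m (cell m s)) ω) (E.Y s ω)).trans (mul_le_mul_of_nonneg_left
        (hY (cell m s) s (pt_cell_le m s) (le_pt_cell_succ m s) hs).1 hC0)
      calc _ ≤ C * a * C := by gcongr; exact hκ _ _ _
        _ = _ := by ring
    refine (eLpNorm_le_of_ae_bound ((ae_restrict_iff' measurableSet_Iic).2 (ae_of_all _ hb))).trans ?_
    rw [lebT_univ]
    have h5 : (((T : ℝ≥0) : ℝ≥0∞) ^ (2 : ℝ≥0∞).toReal⁻¹) ≤ ENNReal.ofReal (T + 1) := by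
      have : ENNReal.ofReal ((T : ℝ) + 1) = ((T : ℝ≥0∞) + 1) := by
        rw [ENNReal.ofReal_add (by positivity) zero_le_one]; simp
      rw [this]
      calc (((T : ℝ≥0) : ℝ≥0∞) ^ (2 : ℝ≥0∞).toReal⁻¹)
          ≤ ((T : ℝ≥0∞) + 1) ^ (2 : ℝ≥0∞).toReal⁻¹ := by
            gcongr; simp
        _ ≤ ((T : ℝ≥0∞) + 1) ^ (1 : ℝ) :=
            ENNReal.rpow_le_rpow_of_exponent_le (by simp) (by norm_num)
        _ = _ := ENNReal.rpow_one _
    refine (mul_le_mul_left h5 _).trans ?_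
    rw [← ENNReal.ofReal_mul (by positivity)]
    refine ENNReal.ofReal_le_ofReal ?_
    have : C ^ 2 * a ≤ (2 * C ^ 2 + C ^ 3 * R) * a := by
      gcongr
      nlinarith [mul_nonneg (pow_nonneg hC0 3) hR0, sq_nonneg C]
    calc ((T : ℝ) + 1) * (C ^ 2 * a) ≤ (T + 1) * ((2 * C ^ 2 + C ^ 3 * R) * a) := by gcongr
      _ = (2 * C ^ 2 + C ^ 3 * R) * a * (T + 1) := mul_comm _ _
      _ ≤ ε / 4 := h4
      _ ≤ ε := by linarith
  · have hb : ∀ s ∈ Set.Iic (T : ℝ≥0), ‖((fun s => (E.itoStep hW ρ hf).bet s ω) -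
        fun s => f₁ (E.Y s ω) * E.bet s ω + 1 / 2 * f₂ (E.Y s ω) *
        qcov ρ (fun k => E.kap k s ω) (fun k => E.kap k s ω)) s‖ ≤
        (2 * C ^ 2 + C ^ 3 * R) * a := by
      intro s hs
      change |f₁ (E.Y (pt m (cell m s)) ω) * E.β (cell m s) ω +
        1 / 2 * f₂ (E.Y (pt m (cell m s)) ω) * E.var ρ (cell m s) ω -
        (f₁ (E.Y s ω) * E.β (cell m s) ω + 1 / 2 * f₂ (E.Y s ω) * E.var ρ (cell m s) ω)| ≤ _
      have k0 := (hY (cell m s) s (pt_cell_le m s) (le_pt_cell_succ m s) hs).1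
      have k1 := (hf.lip₁ (E.Y (pt m (cell m s)) ω) (E.Y s ω)).trans (mul_le_mul_of_nonneg_left k0 hC0)
      have k2 := (hf.lip (E.Y (pt m (cell m s)) ω) (E.Y s ω)).trans (mul_le_mul_of_nonneg_left k0 hC0)
      rw [abs_sub_comm] at k1 k2
      have e : f₁ (E.Y (pt m (cell m s)) ω) * E.β (cell m s) ω +
        1 / 2 * f₂ (E.Y (pt m (cell m s)) ω) * E.var ρ (cell m s) ω -
        (f₁ (E.Y s ω) * E.β (cell m s) ω + 1 / 2 * f₂ (E.Y s ω) * E.var ρ (cell m s) ω) =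
        (f₁ (E.Y (pt m (cell m s)) ω) - f₁ (E.Y s ω)) * E.β (cell m s) ω +
        (f₂ (E.Y (pt m (cell m s)) ω) - f₂ (E.Y s ω)) * (1 / 2 * E.var ρ (cell m s) ω) := by ring
      rw [e]
      refine (abs_add_le _ _).trans ?_
      rw [abs_mul, abs_mul, abs_mul (1 / 2), abs_of_pos (by norm_num : (0 : ℝ) < 1 / 2)]
      calc _ ≤ C * a * C + C * a * (1 / 2 * (R * (C * C))) := by
            gcongr
            exacts [hβ _ _, hcov _]
        _ ≤ _ := by
            have : 0 ≤ C ^ 3 * R * a := by positivity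
            have : 0 ≤ C ^ 2 * a := by positivity
            nlinarith
    refine (eLpNorm_le_of_ae_bound ((ae_restrict_iff' measurableSet_Iic).2 (ae_of_all _ hb))).trans ?_
    rw [lebT_univ]
    have h5 : (((T : ℝ≥0) : ℝ≥0∞) ^ (1 : ℝ≥0∞).toReal⁻¹) ≤ ENNReal.ofReal (T + 1) := by
      have : ENNReal.ofReal ((T : ℝ) + 1) = ((T : ℝ≥0∞) + 1) := by
        rw [ENNReal.ofReal_add (by positivity) zero_le_one]; simp
      rw [this]
      simp
    refine (mul_le_mul_left h5 _).trans ?_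
    rw [← ENNReal.ofReal_mul (by positivity)]
    refine ENNReal.ofReal_le_ofReal ?_
    rw [mul_comm]
    exact h4.trans (by linarith)

end Elem

end ItoCalculus

namespace ItoCalculus

open RoughFMM (leb)

variable {Ω ι : Type*} [mΩ : MeasurableSpace Ω] {Q : Measure Ω} [IsProbabilityMeasure Q]
  {ℱ : Filtration ℝ≥0 mΩ} {ρ : ι → ι → ℝ} {W : ι → ℝ≥0 → Ω → ℝ} [Fintype ι]

set_option linter.unusedSectionVars false

lemma integrable_pow_four {X : Ω → ℝ} (hX : MemLp X 4 Q) : Integrable (fun ω => X ω ^ 4) Q := by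
  refine (hX.integrable_norm_pow (p := 4) (by norm_num)).congr (ae_of_all _ fun ω => ?_)
  simp only [Real.norm_eq_abs]
  exact (by decide : Even 4).pow_abs _

lemma measure_lt_le_of_integral {X : Ω → ℝ} (hX : Integrable X Q) (h0 : ∀ ω, 0 ≤ X ω) {a c : ℝ}
    (hc : 0 < c) (ha : ∫ ω, X ω ∂Q ≤ a) : Q {ω | c < X ω} ≤ ENNReal.ofReal (a / c) := by
  have h1 := mul_meas_ge_le_integral_of_nonneg (ae_of_all Q h0) hX c
  have h2 : Q.real {ω | c ≤ X ω} ≤ a / c := by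
    rw [le_div_iff₀ hc, mul_comm]; exact h1.trans ha
  calc Q {ω | c < X ω} ≤ Q {ω | c ≤ X ω} :=
        measure_mono (Set.ofPred_subset_ofPred.2 fun ω h => le_of_lt h)
    _ = ENNReal.ofReal (Q.real {ω | c ≤ X ω}) := (ofReal_measureReal).symm
    _ ≤ _ := ENNReal.ofReal_le_ofReal h2

namespace Elem

variable {f f₁ f₂ : ℝ → ℝ} {C D : ℝ}

/-- The discrete filtration of a dyadic grid. -/
noncomputable def gridFiltration (ℱ : Filtration ℝ≥0 mΩ) (m : ℕ) : Filtration ℕ mΩ where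
  seq l := ℱ (pt m l)
  mono' _ _ h := ℱ.mono (pt_mono m h)
  le' _ := ℱ.le _

lemma integrable_noise_sq (E : Elem ℱ W) {l : ℕ} (h : MemLp (E.noise l) 4 Q) :
    Integrable (fun ω => E.noise l ω ^ 2) Q :=
  (h.mono_exponent (p := 2) (by norm_num)).integrable_sq

lemma integral_noise_sq_le (E : Elem ℱ W) {l : ℕ} (h : MemLp (E.noise l) 4 Q)
    (hD : ∫ ω, E.noise l ω ^ 4 ∂Q ≤ D * ((2 ^ E.m)⁻¹) ^ 2) :
    ∫ ω, E.noise l ω ^ 2 ∂Q ≤ (1 + D) * (2 ^ E.m)⁻¹ := by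
  set t : ℝ := (2 ^ E.m)⁻¹
  have ht : 0 < t := by positivity
  have hpt : ∀ ω, E.noise l ω ^ 2 ≤ t + E.noise l ω ^ 4 / t := fun ω => by
    have h1 : t + E.noise l ω ^ 4 / t - 2 * E.noise l ω ^ 2 = (t - E.noise l ω ^ 2) ^ 2 / t := by
      field_simp; ring
    have h2 : 0 ≤ (t - E.noise l ω ^ 2) ^ 2 / t := by positivity
    have h3 : 0 ≤ E.noise l ω ^ 2 := by positivity
    linarith
  have hi := (integrable_pow_four h).div_const t
  calc _ ≤ ∫ ω, (t + E.noise l ω ^ 4 / t) ∂Q :=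
        integral_mono (E.integrable_noise_sq h) ((integrable_const _).add hi) hpt
    _ = t + (∫ ω, E.noise l ω ^ 4 ∂Q) / t := by
        rw [integral_add (integrable_const _) hi, integral_div]; simp
    _ ≤ t + D * t ^ 2 / t := by gcongr
    _ = _ := by field_simp

lemma integral_rem_le (E : Elem ℱ W) {l : ℕ} (h : MemLp (E.noise l) 4 Q)
    (hD : ∫ ω, E.noise l ω ^ 4 ∂Q ≤ D * ((2 ^ E.m)⁻¹) ^ 2) :
    Integrable (E.rem C l) Q ∧
      ∫ ω, E.rem C l ω ∂Q ≤ 20 * C ^ 4 * (1 + D) * √((2 ^ E.m)⁻¹) * (2 ^ E.m)⁻¹ := by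
  have h2 := E.integral_noise_sq_le h hD
  set t : ℝ := (2 ^ E.m)⁻¹ with htdef
  have ht : 0 < t := by positivity
  set s := √t with hs
  have hs0 : 0 < s := Real.sqrt_pos.2 ht
  have hst : t = s ^ 2 := (Real.sq_sqrt ht.le).symm
  have i1 : Integrable (fun ω => E.noise l ω ^ 2 * s) Q := (E.integrable_noise_sq h).mul_const s
  have i2 : Integrable (fun ω => E.noise l ω ^ 4 / s) Q := (integrable_pow_four h).div_const s
  have i12 : Integrable (fun ω => E.noise l ω ^ 2 * s + E.noise l ω ^ 4 / s) Q := i1.add i2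
  have i3 : Integrable (fun ω => E.noise l ω ^ 2 * s + E.noise l ω ^ 4 / s + s ^ 3) Q :=
    i12.add (integrable_const _)
  refine ⟨i3.const_mul _, ?_⟩
  have e : ∫ ω, E.rem C l ω ∂Q = 10 * C ^ 4 * ((∫ ω, E.noise l ω ^ 2 ∂Q) * s +
      (∫ ω, E.noise l ω ^ 4 ∂Q) / s + s ^ 3) := by
    unfold rem
    rw [← htdef, ← hs, integral_const_mul, integral_add i12 (integrable_const _),
      integral_add i1 i2, integral_mul_const, integral_div]
    simp
  rw [e]
  have h5 : (∫ ω, E.noise l ω ^ 4 ∂Q) / s ≤ D * s ^ 3 := by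
    rw [div_le_iff₀ hs0]
    refine hD.trans (le_of_eq ?_)
    rw [hst]; ring
  have h6 : (∫ ω, E.noise l ω ^ 2 ∂Q) * s ≤ (1 + D) * s ^ 3 := by
    calc _ ≤ (1 + D) * t * s := by gcongr
      _ = _ := by rw [hst]; ring
  have h7 : 20 * C ^ 4 * (1 + D) * s * t = 10 * C ^ 4 * ((1 + D) * s ^ 3 + D * s ^ 3 + s ^ 3) := by
    rw [hst]; ring
  rw [h7]
  have : 0 ≤ C ^ 4 := (by decide : Even 4).pow_nonneg _
  gcongr

lemma stronglyMeasurable_err (hW : ∀ k, StronglyAdapted ℱ (W k)) (E : Elem ℱ W)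
    (hf : SmoothBdd f f₁ f₂ C) (l : ℕ) :
    StronglyMeasurable[ℱ (pt E.m (l + 1))] (E.err ρ f₂ l) := by
  have hle := ℱ.mono (pt_mono E.m (Nat.le_succ l))
  exact (((hf.continuous₂.comp_stronglyMeasurable (E.Y_adapted _)).const_mul _).mono hle).mul
    (((E.stronglyMeasurable_noise hW l).pow 2).sub
      (((E.stronglyMeasurable_var l).mono hle).const_mul _))

lemma integral_err_sq_le (hW : ∀ k, StronglyAdapted ℱ (W k)) (E : Elem ℱ W)
    (hf : SmoothBdd f f₁ f₂ C) (hκ : ∀ l k ω, |E.κ l k ω| ≤ C) {l : ℕ}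
    (h : MemLp (E.noise l) 4 Q) (hD : ∫ ω, E.noise l ω ^ 4 ∂Q ≤ D * ((2 ^ E.m)⁻¹) ^ 2) :
    MemLp (E.err ρ f₂ l) 2 Q ∧ ∫ ω, E.err ρ f₂ l ω ^ 2 ∂Q ≤
      C ^ 2 * (D + ((∑ k, ∑ l, |ρ k l|) * (C * C)) ^ 2) * ((2 ^ E.m)⁻¹) ^ 2 := by
  set t : ℝ := (2 ^ E.m)⁻¹ with htdef
  set R := (∑ k, ∑ l, |ρ k l|) * (C * C)
  have hpt : ∀ ω, E.err ρ f₂ l ω ^ 2 ≤ C ^ 2 * (E.noise l ω ^ 4 + R ^ 2 * t ^ 2) := by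
    intro ω
    have h1 : |f₂ (E.Y (pt E.m l) ω)| ≤ C := hf.bdd₂ _
    have h2 : |E.var ρ l ω| ≤ R := abs_qcov_le ρ (hκ l · ω) (hκ l · ω)
    have h3 : f₂ (E.Y (pt E.m l) ω) ^ 2 ≤ C ^ 2 := sq_le_sq' (abs_le.1 h1).1 (abs_le.1 h1).2
    have h4 : E.var ρ l ω ^ 2 ≤ R ^ 2 := sq_le_sq' (abs_le.1 h2).1 (abs_le.1 h2).2
    have h5 : (E.noise l ω ^ 2 - t * E.var ρ l ω) ^ 2 ≤ 2 * (E.noise l ω ^ 4 + R ^ 2 * t ^ 2) := by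
      have h6 : t ^ 2 * E.var ρ l ω ^ 2 ≤ t ^ 2 * R ^ 2 := by gcongr
      nlinarith [sq_nonneg (E.noise l ω ^ 2 + t * E.var ρ l ω)]
    unfold err
    rw [mul_pow, mul_pow]
    have h6 : 0 ≤ E.noise l ω ^ 4 + R ^ 2 * t ^ 2 := by
      have : 0 ≤ E.noise l ω ^ 4 := (by decide : Even 4).pow_nonneg _
      positivity
    calc (1 / 2 : ℝ) ^ 2 * f₂ (E.Y (pt E.m l) ω) ^ 2 * (E.noise l ω ^ 2 - t * E.var ρ l ω) ^ 2
        ≤ (1 / 2 : ℝ) ^ 2 * C ^ 2 * (2 * (E.noise l ω ^ 4 + R ^ 2 * t ^ 2)) := by gcongr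
      _ ≤ _ := by nlinarith [mul_nonneg (sq_nonneg C) h6]
  have hi : Integrable (fun ω => C ^ 2 * (E.noise l ω ^ 4 + R ^ 2 * t ^ 2)) Q :=
    ((integrable_pow_four h).add (integrable_const _)).const_mul _
  have hm : AEStronglyMeasurable (E.err ρ f₂ l) Q :=
    ((E.stronglyMeasurable_err hW hf l).mono (ℱ.le _)).aestronglyMeasurable
  have hsq : Integrable (fun ω => E.err ρ f₂ l ω ^ 2) Q :=
    hi.mono' (hm.pow 2) (ae_of_all _ fun ω => by
      rw [Real.norm_of_nonneg (sq_nonneg _)]; exact hpt ω)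
  refine ⟨(memLp_two_iff_integrable_sq hm).2 hsq, (integral_mono hsq hi hpt).trans ?_⟩
  rw [integral_const_mul, integral_add (integrable_pow_four h) (integrable_const _)]
  simp only [integral_const, probReal_univ, one_smul]
  calc C ^ 2 * (∫ ω, E.noise l ω ^ 4 ∂Q + R ^ 2 * t ^ 2)
      ≤ C ^ 2 * (D * t ^ 2 + R ^ 2 * t ^ 2) := by gcongr
    _ = _ := by ring

lemma setIntegral_err (hB : BM Q ℱ ρ W) (E : Elem ℱ W)
    (hf : SmoothBdd f f₁ f₂ C) (hκ : ∀ l k ω, |E.κ l k ω| ≤ C) (l : ℕ) {A : Set Ω}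
    (hA : MeasurableSet[ℱ (pt E.m l)] A) : ∫ ω in A, E.err ρ f₂ l ω ∂Q = 0 := by
  rw [← integral_indicator (ℱ.le _ A hA)]
  have hZ : StronglyMeasurable[ℱ (pt E.m l)]
      (A.indicator fun ω => 1 / 2 * f₂ (E.Y (pt E.m l) ω)) :=
    ((hf.continuous₂.comp_stronglyMeasurable (E.Y_adapted _)).const_mul _).indicator hA
  have hZb : ∀ ω, |A.indicator (fun ω => 1 / 2 * f₂ (E.Y (pt E.m l) ω)) ω| ≤ C := by
    intro ω
    have := hf.nonneg
    by_cases h : ω ∈ A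
    · rw [Set.indicator_of_mem h, abs_mul, abs_of_pos (by norm_num : (0 : ℝ) < 1 / 2)]
      linarith [hf.bdd₂ (E.Y (pt E.m l) ω)]
    · rw [Set.indicator_of_notMem h]; simpa
  have := hB.integral_mul_sq_sub (pt_mono E.m (Nat.le_succ l)) (E.κ_meas l) (hκ l) hZ hZb
  rw [← this]
  refine integral_congr_ae (ae_of_all _ fun ω => ?_)
  by_cases h : ω ∈ A
  · simp only [Set.indicator_of_mem h, pt_succ_sub]; rfl
  · simp [Set.indicator_of_notMem h]

/-- Itô's formula for an elementary process, up to an error that is small in probability. -/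
theorem exists_ito (hB : BM Q ℱ ρ W) (E : Elem ℱ W) (hf : SmoothBdd f f₁ f₂ C) {ε : ℝ}
    (hε : 0 < ε) (T : ℕ) : ∃ E' : Elem ℱ W, Q {ω | ¬ E'.Close T ε ω (fun s => f (E.Y s ω))
      (fun k s => f₁ (E.Y s ω) * E.kap k s ω)
      (fun s => f₁ (E.Y s ω) * E.bet s ω + 1 / 2 * f₂ (E.Y s ω) *
        qcov ρ (fun k => E.kap k s ω) (fun k => E.kap k s ω))} ≤ ENNReal.ofReal ε := by
  obtain ⟨C₀, hC₀, hκ₀, hβ₀⟩ := E.exists_bound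
  set A := max C C₀
  have hA1 : 1 ≤ A := hC₀.trans (le_max_right _ _)
  replace hf := hf.mono (le_max_left C C₀)
  have hκ : ∀ l k ω, |E.κ l k ω| ≤ A := fun l k ω => (hκ₀ l k ω).trans (le_max_right _ _)
  have hβ : ∀ l ω, |E.β l ω| ≤ A := fun l ω => (hβ₀ l ω).trans (le_max_right _ _)
  obtain ⟨D, hD0, hD⟩ := hB.exists_moment_bound A
  set R := ∑ k, ∑ l, |ρ k l| with hR
  have hR0 : 0 ≤ R := Finset.sum_nonneg fun k _ => Finset.sum_nonneg fun l _ => abs_nonneg _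
  set K := (2 * A ^ 2 + A ^ 3 * R) * (((Fintype.card ι : ℝ) + 1) * A) * (T + 1) with hK
  have hK0 : 0 < K := by positivity
  set δ := ε / (8 * K) with hδ
  have hδ0 : 0 < δ := by positivity
  have hlim : Tendsto (fun m : ℕ => ((2 : ℝ) ^ m)⁻¹) atTop (𝓝 0) :=
    tendsto_inv_atTop_zero.comp (tendsto_pow_atTop_atTop_of_one_lt one_lt_two)
  have hlims : Tendsto (fun m : ℕ => √(((2 : ℝ) ^ m)⁻¹)) atTop (𝓝 0) := by
    simpa using hlim.sqrt
  set v := A ^ 2 * (D + (R * (A * A)) ^ 2) with hv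
  have ev1 : ∀ᶠ m : ℕ in atTop, ((2 : ℝ) ^ m)⁻¹ ≤ δ := (hlim.eventually_lt_const hδ0).mono
    fun _ h => h.le
  have ev2 : ∀ᶠ m : ℕ in atTop, T * v * 16 / ε ^ 2 * ((2 : ℝ) ^ m)⁻¹ ≤ ε / 3 :=
    ((hlim.const_mul _).eventually_lt_const (by rw [mul_zero]; positivity)).mono fun _ h => h.le
  have ev3 : ∀ᶠ m : ℕ in atTop, T * (20 * A ^ 4 * (1 + D)) * 4 / ε * √(((2 : ℝ) ^ m)⁻¹) ≤ ε / 3 :=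
    ((hlims.const_mul _).eventually_lt_const (by rw [mul_zero]; positivity)).mono fun _ h => h.le
  have ev4 := hB.modulus T hδ0 (ε := ENNReal.ofReal (ε / 3)) (by simpa)
  -- the formula holds up to an error `ε` on every sufficiently fine grid
  obtain ⟨M, hM, e1, e2, e3, e4⟩ :=
    ((eventually_ge_atTop E.m).and (ev1.and (ev2.and (ev3.and ev4)))).exists
  obtain ⟨d, rfl⟩ := Nat.exists_eq_add_of_le hM
  set F := E.refine d with hF
  have hFm : F.m = E.m + d := rfl
  have hFκ : ∀ l k ω, |F.κ l k ω| ≤ A := fun l k ω => hκ _ k ω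
  have hFβ : ∀ l ω, |F.β l ω| ≤ A := fun l ω => hβ _ ω
  have hnoise : ∀ l, MemLp (F.noise l) 4 Q ∧ ∫ ω, F.noise l ω ^ 4 ∂Q ≤ D * ((2 ^ F.m)⁻¹) ^ 2 := by
    intro l
    have := hD (pt F.m l) (pt F.m (l + 1)) (pt_mono _ (Nat.le_succ l)) (F.κ l) (F.κ_meas l) (hFκ l)
    rw [pt_succ_sub] at this
    exact this
  refine ⟨F.itoStep hB.adapted ρ hf, ?_⟩
  rw [← hFm] at e1 e2 e3 e4
  set t : ℝ := (2 ^ F.m)⁻¹ with ht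
  have ht0 : 0 < t := by positivity
  set n := T * 2 ^ F.m with hn
  have hnt : (n : ℝ) * t = T := by rw [hn, ht]; push_cast; field_simp
  have b1 : Q {ω | ∃ L ≤ n, ε / 4 ≤ |∑ l ∈ Finset.range L, F.err ρ f₂ l ω|} ≤
      ENNReal.ofReal (ε / 3) := by
    refine (max_ineq (𝒢 := gridFiltration ℱ F.m) (fun l => F.stronglyMeasurable_err hB.adapted hf l)
      (fun l => (F.integral_err_sq_le hB.adapted hf hFκ (hnoise l).1 (hnoise l).2).1)
      (fun l A hA => F.setIntegral_err hB hf hFκ l hA)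
      (fun l => (F.integral_err_sq_le hB.adapted hf hFκ (hnoise l).1 (hnoise l).2).2) n
      (by positivity : 0 < ε / 4)).trans (ENNReal.ofReal_le_ofReal ?_)
    refine le_trans (le_of_eq ?_) e2
    rw [← hv, ← hnt, ← ht]
    field_simp
    norm_num
  have b2 : Q {ω | ε / 4 < ∑ l ∈ Finset.range n, F.rem A l ω} ≤ ENNReal.ofReal (ε / 3) := by
    have hr := fun l => F.integral_rem_le (C := A) (hnoise l).1 (hnoise l).2
    have hi : Integrable (fun ω => ∑ l ∈ Finset.range n, F.rem A l ω) Q :=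
      integrable_finsetSum _ fun l _ => (hr l).1
    have h0 : ∀ ω, 0 ≤ ∑ l ∈ Finset.range n, F.rem A l ω := fun ω =>
      Finset.sum_nonneg fun l _ => by
        unfold rem
        have : 0 ≤ F.noise l ω ^ 4 := (by decide : Even 4).pow_nonneg _
        positivity
    have hle : ∫ ω, ∑ l ∈ Finset.range n, F.rem A l ω ∂Q ≤
        n * (20 * A ^ 4 * (1 + D) * √t * t) := by
      rw [integral_finsetSum _ fun l _ => (hr l).1]
      refine (Finset.sum_le_sum fun l _ => (hr l).2).trans (le_of_eq ?_)
      rw [Finset.sum_const, Finset.card_range, nsmul_eq_mul]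
    refine (measure_lt_le_of_integral hi h0 (by positivity) hle).trans
      (ENNReal.ofReal_le_ofReal ?_)
    refine le_trans (le_of_eq ?_) e3
    rw [← hnt]
    field_simp
  have hsub : {ω | ¬ (F.itoStep hB.adapted ρ hf).Close T ε ω (fun s => f (E.Y s ω))
      (fun k s => f₁ (E.Y s ω) * E.kap k s ω)
      (fun s => f₁ (E.Y s ω) * E.bet s ω + 1 / 2 * f₂ (E.Y s ω) *
        qcov ρ (fun k => E.kap k s ω) (fun k => E.kap k s ω))} ⊆
      {ω | ∃ L ≤ n, ε / 4 ≤ |∑ l ∈ Finset.range L, F.err ρ f₂ l ω|} ∪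
      {ω | ε / 4 < ∑ l ∈ Finset.range n, F.rem A l ω} ∪
      {ω | ∃ k, ∃ u ≤ (T : ℝ≥0), ∃ v ≤ (T : ℝ≥0), |(u : ℝ) - v| ≤ t ∧
        δ < |W k u ω - W k v ω|} := by
    intro ω hω
    by_contra hcon
    simp only [Set.mem_union, Set.mem_ofPred_eq, not_or, not_exists, not_and, not_lt, not_le] at hcon
    obtain ⟨⟨c1, c2⟩, c3⟩ := hcon
    refine hω ?_
    have := F.itoStep_close hB.adapted hf hA1 hFκ hFβ T hδ0.le (ρ := ρ) (ε := ε) (ω := ω)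
      (fun L hL => (c1 L hL).le) c2 c3 (by
        rw [← hR, ← ht]
        calc _ = K * (δ + t) := by rw [hK]; ring
          _ ≤ K * (δ + δ) := by gcongr
          _ = ε / 4 := by rw [hδ]; field_simp; norm_num)
    rw [hF, refine_kap, refine_bet] at this
    exact this
  refine (measure_mono hsub).trans ((measure_union_le _ _).trans ?_)
  refine (add_le_add ((measure_union_le _ _).trans (add_le_add b1 b2)) e4).trans (le_of_eq ?_)
  rw [← ENNReal.ofReal_add (by positivity) (by positivity),
    ← ENNReal.ofReal_add (by positivity) (by positivity)]
  congr 1; ring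

end Elem

end ItoCalculus

namespace ItoCalculus

open RoughFMM (leb)

/-! ### The Itô formula and the product rule -/

/-- A `C³` function on an open set `U` agrees, near a compact subset of `U`, with a function on
`ℝ` whose derivatives are bounded. -/
lemma exists_smoothBdd {U K : Set ℝ} (hU : IsOpen U) (hK : IsCompact K) (hKU : K ⊆ U)
    {f f₁ f₂ : ℝ → ℝ} (hf : ContDiffOn ℝ 3 f U) (h1 : ∀ x ∈ U, HasDerivAt f (f₁ x) x)
    (h2 : ∀ x ∈ U, HasDerivAt f₁ (f₂ x) x) :
    ∃ g g₁ g₂ C, SmoothBdd g g₁ g₂ C ∧ Set.EqOn g f K ∧ Set.EqOn g₁ f₁ K ∧ Set.EqOn g₂ f₂ K := by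
  obtain ⟨K', hK', hKK', hK'U⟩ := exists_compact_between hK hU hKU
  obtain ⟨χ, hχ1, hχ0, -⟩ := exists_contMDiffMap_one_nhds_of_subset_interior
    (modelWithCornersSelf ℝ ℝ) (n := 3) hK.isClosed hKK'
  have hχ : ContDiff ℝ 3 χ := by
    have := χ.contMDiff.contDiff
    exact_mod_cast this
  set g : ℝ → ℝ := fun x => χ x * f x with hg
  have hgc : ContDiff ℝ 3 g := by
    rw [contDiff_iff_contDiffAt]
    intro x
    by_cases hx : x ∈ U
    · exact hχ.contDiffAt.mul (hf.contDiffAt (hU.mem_nhds hx))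
    · have hx' : x ∈ K'ᶜ := fun h => hx (hK'U h)
      refine (contDiffAt_const (c := (0 : ℝ))).congr_of_eventuallyEq ?_
      filter_upwards [hK'.isClosed.isOpen_compl.mem_nhds hx'] with y hy
      simp [hg, hχ0 y hy]
  have hgs : HasCompactSupport g := HasCompactSupport.intro hK' fun x hx => by
    simp [hg, hχ0 x hx]
  have hc1 : ContDiff ℝ 2 (deriv g) := by
    have : ContDiff ℝ (2 + 1) g := by norm_num; exact hgc
    exact (contDiff_succ_iff_deriv.1 this).2.2
  have hc2 : ContDiff ℝ 1 (deriv (deriv g)) := by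
    have : ContDiff ℝ (1 + 1) (deriv g) := by norm_num; exact hc1
    exact (contDiff_succ_iff_deriv.1 this).2.2
  have hc3 : Continuous (deriv (deriv (deriv g))) := hc2.continuous_deriv le_rfl
  obtain ⟨C1, hC1⟩ := hgs.deriv.exists_bound_of_continuous hc1.continuous
  obtain ⟨C2, hC2⟩ := hgs.deriv.deriv.exists_bound_of_continuous hc2.continuous
  obtain ⟨C3, hC3⟩ := hgs.deriv.deriv.deriv.exists_bound_of_continuous hc3
  have hd1 : ∀ x, HasDerivAt g (deriv g x) x := fun x =>
    (hgc.differentiable (by norm_num) x).hasDerivAt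
  have hd2 : ∀ x, HasDerivAt (deriv g) (deriv (deriv g) x) x := fun x =>
    (hc1.differentiable (by norm_num) x).hasDerivAt
  have hd3 : ∀ x, HasDerivAt (deriv (deriv g)) (deriv (deriv (deriv g)) x) x := fun x =>
    (hc2.differentiable (by norm_num) x).hasDerivAt
  have hev : ∀ x ∈ K, g =ᶠ[𝓝 x] f := by
    intro x hx
    have := hχ1.filter_mono (nhds_le_nhdsSet hx)
    filter_upwards [this] with y hy
    simp [hg, hy]
  have hev1 : ∀ x ∈ K, deriv g =ᶠ[𝓝 x] f₁ := by
    intro x hx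
    filter_upwards [(hev x hx).eventuallyEq_nhds, hU.mem_nhds (hKU hx)] with y hy hyU
    exact (hy.deriv_eq).trans (h1 y hyU).deriv
  refine ⟨g, deriv g, deriv (deriv g), max C1 (max C2 C3), ⟨hd1, hd2, fun x =>
    (hC1 x).trans (le_max_left _ _), fun x => (hC2 x).trans ((le_max_left _ _).trans
    (le_max_right _ _)), fun x y => ?_⟩, fun x hx => (hev x hx).self_of_nhds,
    fun x hx => (hev1 x hx).self_of_nhds,
    fun x hx => (hev1 x hx).deriv_eq.trans (h2 x (hKU hx)).deriv⟩
  exact Convex.norm_image_sub_le_of_norm_hasDerivWithin_le (s := Set.univ)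
    (fun z _ => (hd3 z).hasDerivWithinAt) (fun z _ => (hC3 z).trans ((le_max_right _ _).trans
    (le_max_right _ _))) convex_univ trivial trivial

variable {Ω ι : Type*} [mΩ : MeasurableSpace Ω] {Q : Measure Ω} [IsProbabilityMeasure Q]
  {ℱ : Filtration ℝ≥0 mΩ} {ρ : ι → ι → ℝ} {W : ι → ℝ≥0 → Ω → ℝ} [Fintype ι]

set_option linter.unusedSectionVars false

lemma LUnif.continuous {f : ℕ → ℝ≥0 → ℝ} {g : ℝ≥0 → ℝ} (h : LUnif f g)
    (hf : ∀ n, Continuous (f n)) : Continuous g := by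
  rw [continuous_iff_continuousAt]
  intro t
  have : ContinuousOn g (Set.Iic (t + 1)) :=
    (h (t + 1)).continuousOn (Frequently.of_forall fun n => (hf n).continuousOn)
  exact this.continuousAt (Iic_mem_nhds (lt_add_one t))

lemma LConv.qcov {H : ι → ℕ → ℝ≥0 → ℝ} {H' : ι → ℕ → ℝ≥0 → ℝ} {G G' : ι → ℝ≥0 → ℝ}
    (h : ∀ k, LConv 2 (H k) (G k)) (h' : ∀ k, LConv 2 (H' k) (G' k)) (ρ : ι → ι → ℝ) :
    LConv 1 (fun n s => qcov ρ (fun k => H k n s) (fun k => H' k n s))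
      (fun s => qcov ρ (fun k => G k s) (fun k => G' k s)) :=
  LConv.finset_sum le_rfl _ fun k _ => LConv.finset_sum le_rfl _ fun l _ =>
    ((h k).mul le_rfl (h' l)).const_mul _

namespace IsIto

variable {Y Z : ℝ≥0 → Ω → ℝ} {H G : ι → ℝ≥0 → Ω → ℝ} {b c : ℝ≥0 → Ω → ℝ}

lemma continuous (hB : BM Q ℱ ρ W) (h : IsIto Q ℱ W Y H b) :
    ∀ᵐ ω ∂Q, Continuous fun t => Y t ω := by
  obtain ⟨E, hE⟩ := h
  filter_upwards [hE, hB.continuous] with ω h1 h2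
  exact h1.2.2.continuous fun n => (E n).continuous h2

lemma congr (h : IsIto Q ℱ W Y H b) (hY : ∀ᵐ ω ∂Q, ∀ t, Y t ω = Z t ω)
    (hH : ∀ᵐ ω ∂Q, ∀ k, ∀ᵐ s ∂leb, H k s ω = G k s ω)
    (hb : ∀ᵐ ω ∂Q, ∀ᵐ s ∂leb, b s ω = c s ω) : IsIto Q ℱ W Z G c := by
  obtain ⟨E, hE⟩ := h
  refine ⟨E, ?_⟩
  filter_upwards [hE, hY, hH, hb] with ω h1 h2 h3 h4
  refine ⟨fun k => (h1.1 k).congr (h3 k), h1.2.1.congr h4, ?_⟩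
  rw [← funext h2]
  exact h1.2.2

lemma congr' (h : IsIto Q ℱ W Y H b) (hY : ∀ t ω, Y t ω = Z t ω)
    (hH : ∀ k s ω, H k s ω = G k s ω) (hb : ∀ s ω, b s ω = c s ω) : IsIto Q ℱ W Z G c :=
  h.congr (ae_of_all _ fun ω t => hY t ω) (ae_of_all _ fun ω k => ae_of_all _ fun s => hH k s ω)
    (ae_of_all _ fun ω => ae_of_all _ fun s => hb s ω)

lemma lin (h : IsIto Q ℱ W Y H b) (h' : IsIto Q ℱ W Z G c) (x y : ℝ) :
    IsIto Q ℱ W (fun t ω => x * Y t ω + y * Z t ω) (fun k t ω => x * H k t ω + y * G k t ω)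
      (fun t ω => x * b t ω + y * c t ω) := by
  obtain ⟨E, hE⟩ := h
  obtain ⟨F, hF⟩ := h'
  have hm : ∀ n, ((E n).refine (F n).m).m = ((F n).refine (E n).m).m := fun n => Nat.add_comm _ _
  have hk : ∀ n k s ω, (((E n).refine (F n).m).lin ((F n).refine (E n).m) (hm n) x y).kap k s ω =
      x * (E n).kap k s ω + y * (F n).kap k s ω := by
    intro n k s ω
    rw [← Elem.refine_kap (E n) (F n).m, ← Elem.refine_kap (F n) (E n).m]
    simp only [Elem.kap, ← hm n]
    rfl
  have hb : ∀ n s ω, (((E n).refine (F n).m).lin ((F n).refine (E n).m) (hm n) x y).bet s ω =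
      x * (E n).bet s ω + y * (F n).bet s ω := by
    intro n s ω
    rw [← Elem.refine_bet (E n) (F n).m, ← Elem.refine_bet (F n) (E n).m]
    simp only [Elem.bet, ← hm n]
    rfl
  refine ⟨fun n => ((E n).refine (F n).m).lin ((F n).refine (E n).m) (hm n) x y, ?_⟩
  filter_upwards [hE, hF] with ω h1 h2
  simp only [hk, hb]
  exact ⟨fun k => ((h1.1 k).const_mul x).add one_le_two ((h2.1 k).const_mul y),
    (h1.2.1.const_mul x).add le_rfl (h2.2.1.const_mul y),
    (h1.2.2.const_mul x).add (h2.2.2.const_mul y)⟩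

lemma add (h : IsIto Q ℱ W Y H b) (h' : IsIto Q ℱ W Z G c) :
    IsIto Q ℱ W (fun t ω => Y t ω + Z t ω) (fun k t ω => H k t ω + G k t ω)
      (fun t ω => b t ω + c t ω) :=
  (h.lin h' 1 1).congr' (by simp) (by simp) (by simp)

lemma sub (h : IsIto Q ℱ W Y H b) (h' : IsIto Q ℱ W Z G c) :
    IsIto Q ℱ W (fun t ω => Y t ω - Z t ω) (fun k t ω => H k t ω - G k t ω)
      (fun t ω => b t ω - c t ω) :=
  (h.lin h' 1 (-1)).congr' (by intros; ring) (by intros; ring) (by intros; ring)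

lemma const_mul (h : IsIto Q ℱ W Y H b) (x : ℝ) :
    IsIto Q ℱ W (fun t ω => x * Y t ω) (fun k t ω => x * H k t ω) (fun t ω => x * b t ω) :=
  (h.lin h x 0).congr' (by simp) (by simp) (by simp)

lemma const (hW : ∀ k, StronglyAdapted ℱ (W k)) (x : ℝ) :
    IsIto Q ℱ W (fun _ _ => x) (fun _ _ _ => 0) (fun _ _ => 0) := by
  set E : Elem ℱ W := Elem.ofCoef hW 0 (fun _ _ _ => 0) (fun _ _ => 0) (fun _ => x)
    (fun _ _ => stronglyMeasurable_const) (fun _ => stronglyMeasurable_const)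
    ⟨0, by simp⟩ ⟨0, by simp⟩ stronglyMeasurable_const
  refine ⟨fun _ => E, ae_of_all _ fun ω => ⟨fun k => ?_, ?_, ?_⟩⟩
  · exact LConv.const_seq fun T => MemLp.zero'
  · exact LConv.const_seq fun T => MemLp.zero'
  · have : ∀ u, E.Y u ω = x := fun u => by simp [E, Elem.ofCoef]
    simp only [this]
    intro T
    rw [Metric.tendstoUniformlyOn_iff]
    exact fun ε hε => Eventually.of_forall fun _ _ _ => by simpa using hε

lemma finset_sum {κ : Type*} (hW : ∀ k, StronglyAdapted ℱ (W k)) (S : Finset κ)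
    {Y : κ → ℝ≥0 → Ω → ℝ} {H : κ → ι → ℝ≥0 → Ω → ℝ} {b : κ → ℝ≥0 → Ω → ℝ}
    (h : ∀ i ∈ S, IsIto Q ℱ W (Y i) (H i) (b i)) :
    IsIto Q ℱ W (fun t ω => ∑ i ∈ S, Y i t ω) (fun k t ω => ∑ i ∈ S, H i k t ω)
      (fun t ω => ∑ i ∈ S, b i t ω) := by
  classical
  induction S using Finset.induction_on with
  | empty => simpa using IsIto.const hW 0
  | insert a S ha ih =>
    simp only [Finset.sum_insert ha]
    exact (h a (by simp)).add (ih fun i hi => h i (by simp [hi]))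

/-- **Itô's formula** for a `C³` function on an open set in which the process stays. -/
theorem ito (hB : BM Q ℱ ρ W) (h : IsIto Q ℱ W Y H b) {U : Set ℝ} (hU : IsOpen U)
    (hYU : ∀ᵐ ω ∂Q, ∀ s, Y s ω ∈ U) {f f₁ f₂ : ℝ → ℝ} (hf : ContDiffOn ℝ 3 f U)
    (h1 : ∀ x ∈ U, HasDerivAt f (f₁ x) x) (h2 : ∀ x ∈ U, HasDerivAt f₁ (f₂ x) x) :
    IsIto Q ℱ W (fun s ω => f (Y s ω)) (fun k s ω => f₁ (Y s ω) * H k s ω)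
      (fun s ω => f₁ (Y s ω) * b s ω + 1 / 2 * f₂ (Y s ω) *
        qcov ρ (fun k => H k s ω) (fun k => H k s ω)) := by
  have hYc := h.continuous hB
  obtain ⟨E, hE⟩ := h
  have : LocallyCompactSpace U := hU.locallyCompactSpace
  set X := CompactExhaustion.choice U
  have hKn : ∀ n, IsCompact (Subtype.val '' X n : Set ℝ) := fun n =>
    (X.isCompact n).image continuous_subtype_val
  have hKU : ∀ n, (Subtype.val '' X n : Set ℝ) ⊆ U := by
    rintro n _ ⟨x, _, rfl⟩; exact x.2
  have hex : ∀ K : Set ℝ, IsCompact K → K ⊆ U →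
      ∀ᶠ n in atTop, K ⊆ (Subtype.val '' X n : Set ℝ) := by
    intro K hK hKU
    have hK' : IsCompact (Subtype.val ⁻¹' K : Set U) :=
      Topology.IsInducing.subtypeVal.isCompact_preimage' hK (by simpa using hKU)
    obtain ⟨N, hN⟩ := X.exists_superset_of_isCompact hK'
    filter_upwards [eventually_ge_atTop N] with n hn x hx
    exact ⟨⟨x, hKU hx⟩, X.subset hn (hN hx), rfl⟩
  choose g g₁ g₂ C hg e0 e1 e2 using fun n =>
    exists_smoothBdd hU (hKn n) (hKU n) hf h1 h2
  have hc1 : ContDiffOn ℝ 2 f₁ U :=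
    (hf.deriv_of_isOpen hU (m := 2) (by norm_num)).congr fun x hx => (h1 x hx).deriv.symm
  have hc2 : ContDiffOn ℝ 1 f₂ U :=
    (hc1.deriv_of_isOpen hU (m := 1) (by norm_num)).congr fun x hx => (h2 x hx).deriv.symm
  refine IsIto.of_approx (Y' := fun n s ω => g n ((E n).Y s ω))
    (H' := fun n k s ω => g₁ n ((E n).Y s ω) * (E n).kap k s ω)
    (b' := fun n s ω => g₁ n ((E n).Y s ω) * (E n).bet s ω + 1 / 2 * g₂ n ((E n).Y s ω) *
        qcov ρ (fun k => (E n).kap k s ω) (fun k => (E n).kap k s ω)) ?_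
    fun n ε hε T => (E n).exists_ito hB (hg n) hε T
  filter_upwards [hE, hYc, hYU, hB.continuous] with ω ⟨a1, a2, a3⟩ hc hu hw
  have hEc := fun n => (E n).continuous hw
  have l0 : LUnif (fun n s => g n ((E n).Y s ω)) (fun s => f (Y s ω)) :=
    a3.comp_seq hc hU hu hf.continuousOn fun K hK hKU =>
      (hex K hK hKU).mono fun n hn => (e0 n).mono hn
  have l1 : LUnif (fun n s => g₁ n ((E n).Y s ω)) (fun s => f₁ (Y s ω)) :=
    a3.comp_seq hc hU hu hc1.continuousOn fun K hK hKU =>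
      (hex K hK hKU).mono fun n hn => (e1 n).mono hn
  have l2 : LUnif (fun n s => g₂ n ((E n).Y s ω)) (fun s => f₂ (Y s ω)) :=
    a3.comp_seq hc hU hu hc2.continuousOn fun K hK hKU =>
      (hex K hK hKU).mono fun n hn => (e2 n).mono hn
  have m1 : LConv ∞ (fun n s => g₁ n ((E n).Y s ω)) (fun s => f₁ (Y s ω)) :=
    l1.lconv (hc1.continuousOn.comp_continuous hc hu)
      fun n => ((hg n).continuous₁.comp (hEc n)).aestronglyMeasurable
  have m2 : LConv ∞ (fun n s => g₂ n ((E n).Y s ω)) (fun s => f₂ (Y s ω)) :=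
    l2.lconv (hc2.continuousOn.comp_continuous hc hu)
      fun n => ((hg n).continuous₂.comp (hEc n)).aestronglyMeasurable
  refine ⟨fun k => m1.mul one_le_two (a1 k), ?_, l0⟩
  exact (m1.mul le_rfl a2).add le_rfl
    ((m2.const_mul (1 / 2)).mul le_rfl (LConv.qcov (fun k => a1 k) (fun k => a1 k) ρ))

/-- The product rule, by polarization of Itô's formula for the square. -/
theorem mul (hB : BM Q ℱ ρ W) (h : IsIto Q ℱ W Y H b) (h' : IsIto Q ℱ W Z G c) :
    IsIto Q ℱ W (fun s ω => Y s ω * Z s ω)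
      (fun k s ω => Y s ω * G k s ω + Z s ω * H k s ω)
      (fun s ω => Y s ω * c s ω + Z s ω * b s ω +
        qcov ρ (fun k => H k s ω) (fun k => G k s ω)) := by
  have sq : ∀ {X : ℝ≥0 → Ω → ℝ} {L : ι → ℝ≥0 → Ω → ℝ} {d : ℝ≥0 → Ω → ℝ}, IsIto Q ℱ W X L d →
      IsIto Q ℱ W (fun s ω => X s ω ^ 2) (fun k s ω => 2 * X s ω * L k s ω)
      (fun s ω => 2 * X s ω * d s ω + 1 / 2 * 2 * qcov ρ (fun k => L k s ω) (fun k => L k s ω)) := by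
    intro X L d hX
    refine hX.ito hB isOpen_univ (ae_of_all _ fun _ _ => trivial) (f := fun x => x ^ 2)
      (f₁ := fun x => 2 * x) (f₂ := fun _ => 2) (by fun_prop) (fun x _ => ?_) (fun x _ => ?_)
    · simpa using hasDerivAt_pow 2 x
    · simpa using (hasDerivAt_id x).const_mul 2
  refine ((sq (h.add h')).lin (sq (h.sub h')) (1 / 4) (-(1 / 4))).congr' (fun t ω => by ring)
    (fun k t ω => by ring) fun t ω => ?_
  have e : qcov ρ (fun k => H k t ω + G k t ω) (fun k => H k t ω + G k t ω) -
      qcov ρ (fun k => H k t ω - G k t ω) (fun k => H k t ω - G k t ω) =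
      2 * qcov ρ (fun k => H k t ω) (fun k => G k t ω) +
      2 * qcov ρ (fun k => G k t ω) (fun k => H k t ω) := by
    simp only [qcov, Finset.mul_sum, ← Finset.sum_add_distrib, ← Finset.sum_sub_distrib]
    exact Finset.sum_congr rfl fun k _ => Finset.sum_congr rfl fun l _ => by ring
  have e' : qcov ρ (fun k => G k t ω) (fun k => H k t ω) =
      qcov ρ (fun k => H k t ω) (fun k => G k t ω) := by
    unfold qcov
    rw [Finset.sum_comm]
    refine Finset.sum_congr rfl fun k _ => Finset.sum_congr rfl fun l _ => ?_
    rw [hB.symm l k]; ring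
  rw [e'] at e
  linear_combination (1 / 4) * e

end IsIto

end ItoCalculus

namespace ItoCalculus

open RoughFMM (leb)

/-! ### Time integrals and simple stochastic integrals as Itô processes -/

variable {Ω ι : Type*} [mΩ : MeasurableSpace Ω] {Q : Measure Ω} [IsProbabilityMeasure Q]
  {ℱ : Filtration ℝ≥0 mΩ} {ρ : ι → ι → ℝ} {W : ι → ℝ≥0 → Ω → ℝ} [Fintype ι]

set_option linter.unusedSectionVars false

lemma setIntegral_Iic_add_Ioc {g : ℝ≥0 → ℝ} {a u : ℝ≥0} (h : a ≤ u)
    (hg : IntegrableOn g (Set.Iic u) leb) :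
    ∫ s in Set.Iic u, g s ∂leb = (∫ s in Set.Iic a, g s ∂leb) + ∫ s in Set.Ioc a u, g s ∂leb := by
  rw [← Set.Iic_union_Ioc_eq_Iic h] at hg ⊢
  exact setIntegral_union (Set.disjoint_left.2 fun x hx hx' => not_lt.2 hx hx'.1)
    measurableSet_Ioc hg.left_of_union hg.right_of_union

lemma setIntegral_Iic_zero (g : ℝ≥0 → ℝ) : ∫ s in Set.Iic 0, g s ∂leb = 0 := by
  have : Set.Iic (0 : ℝ≥0) = {0} := by ext x; simp
  rw [this]
  exact setIntegral_measure_zero _ (measure_singleton _)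

namespace Elem

lemma integrableOn_bet (E : Elem ℱ W) (ω : Ω) (T : ℝ≥0) :
    IntegrableOn (fun s => E.bet s ω) (Set.Iic T) leb := by
  obtain ⟨C, -, -, hC⟩ := E.exists_bound
  exact Integrable.of_bound (μ := lebT T) (E.measurable_bet ω).aestronglyMeasurable C
    (ae_of_all _ fun s => hC _ ω)

/-- The stochastic integral part of an elementary Itô process. -/
noncomputable def mart (hW : ∀ k, StronglyAdapted ℱ (W k)) (E : Elem ℱ W) : Elem ℱ W :=
  ofCoef hW E.m E.κ (fun _ _ => 0) (fun _ => 0) E.κ_meas (fun _ => stronglyMeasurable_const)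
    E.κ_bdd ⟨0, by simp⟩ stronglyMeasurable_const

lemma mart_zero (hW : ∀ k, StronglyAdapted ℱ (W k)) (E : Elem ℱ W) (ω : Ω) :
    (E.mart hW).Y 0 ω = 0 := ofCoef_zero hW _ _ _ _ _ _ _ _ _ _

lemma Y_eq (hW : ∀ k, StronglyAdapted ℱ (W k)) (E : Elem ℱ W) (u : ℝ≥0) (ω : Ω) :
    E.Y u ω = E.Y 0 ω + (E.mart hW).Y u ω + ∫ s in Set.Iic u, E.bet s ω ∂leb := by
  have key : ∀ l u, pt E.m l ≤ u → u ≤ pt E.m (l + 1) →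
      E.Y (pt E.m l) ω = E.Y 0 ω + (E.mart hW).Y (pt E.m l) ω +
        ∫ s in Set.Iic (pt E.m l), E.bet s ω ∂leb →
      E.Y u ω = E.Y 0 ω + (E.mart hW).Y u ω + ∫ s in Set.Iic u, E.bet s ω ∂leb := by
    intro l u h1 h2 ih
    have e1 := (E.mart hW).step l ω u h1 h2
    have e2 : (E.mart hW).β l ω = 0 := rfl
    have e3 : ∫ s in Set.Ioc (pt E.m l) u, E.bet s ω ∂leb = E.β l ω * ((u : ℝ) - pt E.m l) := by
      rw [setIntegral_congr_fun (g := fun _ => E.β l ω) measurableSet_Ioc, setIntegral_const,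
        measureReal_def, leb_Ioc, ENNReal.toReal_ofReal (sub_nonneg.2 (by exact_mod_cast h1)),
        smul_eq_mul, mul_comm]
      intro s hs
      simp only [bet, cell_eq hs.1 (hs.2.trans h2)]
    rw [E.step l ω u h1 h2, ih, setIntegral_Iic_add_Ioc h1 (E.integrableOn_bet ω u), e3]
    change (E.mart hW).Y u ω = (E.mart hW).Y (pt E.m l) ω +
      ∑ k, E.κ l k ω * (W k u ω - W k (pt E.m l) ω) + (E.mart hW).β l ω * _ at e1
    rw [e1, e2]
    ring
  have hgrid : ∀ l, E.Y (pt E.m l) ω = E.Y 0 ω + (E.mart hW).Y (pt E.m l) ω +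
        ∫ s in Set.Iic (pt E.m l), E.bet s ω ∂leb := by
    intro l
    induction l with
    | zero => rw [pt_zero, mart_zero, setIntegral_Iic_zero]; ring
    | succ l ih => exact key l _ (pt_mono _ (Nat.le_succ l)) le_rfl ih
  exact key _ u (pt_cell_le _ u) (le_pt_cell_succ _ u) (hgrid _)

end Elem

namespace IsIto

/-- The time integral of a limit of elementary drifts. -/
lemma of_bet (hW : ∀ k, StronglyAdapted ℱ (W k)) {b : ℝ≥0 → Ω → ℝ} (m : ℕ → ℕ)
    (β : ℕ → ℕ → Ω → ℝ) (hβ : ∀ n l, StronglyMeasurable[ℱ (pt (m n) l)] (β n l))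
    (hβb : ∀ n, ∃ C : ℝ, ∀ l ω, |β n l ω| ≤ C)
    (h : ∀ᵐ ω ∂Q, LConv 1 (fun n s => β n (cell (m n) s) ω) fun s => b s ω) :
    IsIto Q ℱ W (fun t ω => ∫ s in Set.Iic t, b s ω ∂leb) (fun _ _ _ => 0) b := by
  set E : ℕ → Elem ℱ W := fun n => Elem.ofCoef hW (m n) (fun _ _ _ => 0) (β n) (fun _ => 0)
    (fun _ _ => stronglyMeasurable_const) (hβ n) ⟨0, by simp⟩ (hβb n) stronglyMeasurable_const
  have hY : ∀ n u ω, (E n).Y u ω = ∫ s in Set.Iic u, (E n).bet s ω ∂leb := by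
    intro n u ω
    have h1 : (E n).Y 0 ω = 0 := Elem.ofCoef_zero hW _ _ _ _ _ _ _ _ _ _
    have h2 : ((E n).mart hW).Y u ω = 0 := by simp [Elem.mart, Elem.ofCoef, E]
    rw [(E n).Y_eq hW, h1, h2]; ring
  refine ⟨E, ?_⟩
  filter_upwards [h] with ω hω
  refine ⟨fun k => LConv.const_seq fun T => MemLp.zero', hω, ?_⟩
  simp only [hY]
  exact LConv.lunif_integral (f := fun n s => (E n).bet s ω) hω
    fun n T => (E n).integrableOn_bet ω T

/-- The clock `∫ (∑ H² + |b|)` of an Itô process. -/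
lemma clock (hW : ∀ k, StronglyAdapted ℱ (W k)) {Y : ℝ≥0 → Ω → ℝ} {H : ι → ℝ≥0 → Ω → ℝ}
    {b : ℝ≥0 → Ω → ℝ} (h : IsIto Q ℱ W Y H b) :
    IsIto Q ℱ W (fun t ω => ∫ s in Set.Iic t, (∑ k, H k s ω ^ 2 + |b s ω|) ∂leb)
      (fun _ _ _ => 0) fun s ω => ∑ k, H k s ω ^ 2 + |b s ω| := by
  obtain ⟨E, hE⟩ := h
  refine of_bet hW (fun n => (E n).m) (fun n l ω => ∑ k, (E n).κ l k ω ^ 2 + |(E n).β l ω|)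
    (fun n l => (Finset.stronglyMeasurable_fun_sum _ fun k _ => ((E n).κ_meas l k).pow 2).add
      ((E n).β_meas l).norm) (fun n => ?_) ?_
  · obtain ⟨C, -, hC, hC'⟩ := (E n).exists_bound
    refine ⟨∑ _k : ι, C ^ 2 + C, fun l ω => ?_⟩
    rw [abs_of_nonneg (by positivity)]
    refine add_le_add (Finset.sum_le_sum fun k _ => ?_) (hC' l ω)
    exact sq_le_sq' (abs_le.1 (hC l k ω)).1 (abs_le.1 (hC l k ω)).2
  · filter_upwards [hE] with ω hω
    have h2 : ∀ k, LConv 1 (fun n s => (E n).kap k s ω ^ 2) (fun s => H k s ω ^ 2) := fun k => by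
      simpa only [sq] using (hω.1 k).mul le_rfl (hω.1 k)
    exact (LConv.finset_sum le_rfl _ fun k _ => h2 k).add le_rfl hω.2.1.abs

end IsIto

/-- Truncation of a real number at level `c`. -/
noncomputable def clamp (c x : ℝ) : ℝ := max (-c) (min c x)

lemma abs_clamp_le {c : ℝ} (hc : 0 ≤ c) (x : ℝ) : |clamp c x| ≤ c := by
  rw [abs_le, clamp]
  exact ⟨le_max_left _ _, max_le (by linarith) (min_le_left _ _)⟩

lemma clamp_eq {c x : ℝ} (h : |x| ≤ c) : clamp c x = x := by
  rw [abs_le] at h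
  rw [clamp, min_eq_right h.2, max_eq_right h.1]

lemma continuous_clamp (c : ℝ) : Continuous (clamp c) := by unfold clamp; fun_prop

lemma abs_pt_cell_sub_le (m : ℕ) (s : ℝ≥0) : |(pt m (cell m s) : ℝ) - s| ≤ (2 ^ m)⁻¹ := by
  have h1 : (pt m (cell m s) : ℝ) ≤ s := by exact_mod_cast pt_cell_le m s
  have h2 : (s : ℝ) ≤ pt m (cell m s + 1) := by exact_mod_cast le_pt_cell_succ m s
  have h3 := pt_succ_sub m (cell m s)
  rw [abs_le]
  constructor <;> linarith [show (0 : ℝ) < (2 ^ m)⁻¹ by positivity]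

lemma tendsto_inv_two_pow : Tendsto (fun m : ℕ => ((2 : ℝ) ^ m)⁻¹) atTop (𝓝 0) := by
  have := tendsto_pow_atTop_nhds_zero_of_lt_one (r := (1 / 2 : ℝ)) (by norm_num) (by norm_num)
  simpa using this

lemma isCompact_Iic (T : ℝ≥0) : IsCompact (Set.Iic T) := by
  rw [← Set.Icc_bot]; exact isCompact_Icc

lemma integrableOn_Iic_of_continuous {h : ℝ≥0 → ℝ} (hc : Continuous h) (T : ℝ≥0) :
    IntegrableOn h (Set.Iic T) leb := by
  obtain ⟨C, hC⟩ := (isCompact_Iic T).exists_bound_of_continuousOn hc.continuousOn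
  exact Integrable.of_bound (μ := lebT T) hc.aestronglyMeasurable C
    ((ae_restrict_iff' measurableSet_Iic).2 (ae_of_all _ hC))

/-- The time integral of a continuous adapted process. -/
lemma IsIto.integral_continuous (hW : ∀ k, StronglyAdapted ℱ (W k)) {Z : ℝ≥0 → Ω → ℝ}
    (hZ : StronglyAdapted ℱ Z) (hc : ∀ᵐ ω ∂Q, Continuous fun t => Z t ω) :
    IsIto Q ℱ W (fun t ω => ∫ s in Set.Iic t, Z s ω ∂leb) (fun _ _ _ => 0) Z := by
  refine IsIto.of_bet hW (fun n => n) (fun n l ω => clamp n (Z (pt n l) ω))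
    (fun n l => (continuous_clamp _).comp_stronglyMeasurable (hZ _))
    (fun n => ⟨n, fun l ω => abs_clamp_le n.cast_nonneg _⟩) ?_
  filter_upwards [hc] with ω hω
  refine LConv.mono le_top (LUnif.lconv ?_ hω fun n =>
    ((measurable_of_countable fun l => clamp n (Z (pt n l) ω)).comp
      (measurable_cell n)).aestronglyMeasurable)
  intro T
  obtain ⟨C, hC⟩ := (isCompact_Iic T).exists_bound_of_continuousOn hω.continuousOn
  have huc := (isCompact_Iic T).uniformContinuousOn_of_continuous hω.continuousOn
  rw [Metric.tendstoUniformlyOn_iff]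
  intro ε hε
  obtain ⟨δ, hδ, hδ'⟩ := Metric.uniformContinuousOn_iff.1 huc ε hε
  filter_upwards [tendsto_inv_two_pow.eventually (gt_mem_nhds hδ),
    eventually_ge_atTop ⌈C⌉₊] with n hn hnC s hs
  have h1 : pt n (cell n s) ≤ T := (pt_cell_le n s).trans hs
  rw [clamp_eq ((hC _ h1).trans ((Nat.le_ceil C).trans (by exact_mod_cast hnC)))]
  refine hδ' _ hs _ h1 ?_
  rw [dist_comm, NNReal.dist_eq]
  exact (abs_pt_cell_sub_le n s).trans_lt hn

/-! ### Averages over preceding grid cells -/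

/-- At a time `s`, the average of `g` over the grid cell that precedes the one that contains `s`;
it is `0` on the first grid cell. -/
noncomputable def prevAvg (g : ℝ≥0 → ℝ) (m l : ℕ) : ℝ :=
  (∫ s in Set.Ioc (pt m (l - 1)) (pt m l), g s ∂leb) * 2 ^ m

lemma lintegral_Iic_pt (f : ℝ≥0 → ℝ≥0∞) (m L : ℕ) :
    ∫⁻ s in Set.Iic (pt m L), f s ∂leb =
      ∑ l ∈ Finset.range L, ∫⁻ s in Set.Ioc (pt m l) (pt m (l + 1)), f s ∂leb := by
  induction L with
  | zero =>
    have : Set.Iic (0 : ℝ≥0) = {0} := by ext x; simp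
    rw [pt_zero, this]
    simp
  | succ L ih =>
    rw [Finset.sum_range_succ, ← ih, ← Set.Iic_union_Ioc_eq_Iic (pt_mono m (Nat.le_succ L))]
    exact lintegral_union measurableSet_Ioc
      (Set.disjoint_left.2 fun x hx hx' => not_lt.2 hx hx'.1)

lemma lintegral_cell (F : ℕ → ℝ≥0∞) (m l : ℕ) :
    ∫⁻ s in Set.Ioc (pt m l) (pt m (l + 1)), F (cell m s) ∂leb = F l * ENNReal.ofReal (2 ^ m)⁻¹ := by
  rw [setLIntegral_congr_fun (g := fun _ => F l) measurableSet_Ioc, setLIntegral_const, leb_Ioc,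
    pt_succ_sub]
  intro s hs
  simp only [cell_eq hs.1 hs.2]

lemma measurable_prevAvg (g : ℝ≥0 → ℝ) (m : ℕ) : Measurable fun s => prevAvg g m (cell m s) :=
  (measurable_of_countable fun l => prevAvg g m l).comp (measurable_cell m)

lemma lintegral_prevAvg_le (g : ℝ≥0 → ℝ) (m L : ℕ) :
    ∫⁻ s in Set.Iic (pt m L), ‖prevAvg g m (cell m s)‖ₑ ∂leb ≤
      ∫⁻ s in Set.Iic (pt m L), ‖g s‖ₑ ∂leb := by
  rw [lintegral_Iic_pt, lintegral_Iic_pt]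
  cases L with
  | zero => simp
  | succ L =>
    rw [Finset.sum_range_succ', Finset.sum_range_succ]
    refine add_le_add (Finset.sum_le_sum fun l _ => ?_) ?_
    · rw [lintegral_cell (fun l => ‖prevAvg g m l‖ₑ)]
      rw [prevAvg, enorm_mul, mul_assoc, Nat.add_sub_cancel]
      have : ‖(2 : ℝ) ^ m‖ₑ * ENNReal.ofReal (2 ^ m)⁻¹ = 1 := by
        rw [← ofReal_norm, ← ENNReal.ofReal_mul (norm_nonneg _), Real.norm_of_nonneg (by positivity),
          mul_inv_cancel₀ (by positivity), ENNReal.ofReal_one]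
      rw [this, mul_one]
      exact enorm_integral_le_lintegral_enorm _
    · rw [lintegral_cell (fun l => ‖prevAvg g m l‖ₑ)]
      simp [prevAvg]

lemma prevAvg_sub {g h : ℝ≥0 → ℝ} {m L : ℕ} (hg : IntegrableOn g (Set.Iic (pt m L)) leb)
    (hh : IntegrableOn h (Set.Iic (pt m L)) leb) {l : ℕ} (hl : l ≤ L) :
    prevAvg (fun s => g s - h s) m l = prevAvg g m l - prevAvg h m l := by
  have hs : Set.Ioc (pt m (l - 1)) (pt m l) ⊆ Set.Iic (pt m L) := fun x hx =>
    hx.2.trans (pt_mono m hl)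
  rw [prevAvg, integral_sub (hg.mono_set hs) (hh.mono_set hs), sub_mul]; rfl

/-- The averages over the preceding cells of a continuous function converge uniformly, apart from
the first cell. -/
lemma abs_prevAvg_sub_le {h : ℝ≥0 → ℝ} (hc : Continuous h) {T : ℝ≥0} {ε δ : ℝ}
    (hδ : ∀ u ≤ T, ∀ v ≤ T, |(u : ℝ) - v| ≤ δ → |h u - h v| ≤ ε) {m : ℕ}
    (hm : 2 * (2 ^ m)⁻¹ ≤ δ) {s : ℝ≥0} (hs : pt m 1 < s) (hsT : s ≤ T) :
    |prevAvg h m (cell m s) - h s| ≤ ε := by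
  set l := cell m s
  obtain ⟨h1, h2⟩ := cell_spec (m := m) (zero_le.trans_lt hs)
  have hl : 1 ≤ l := by
    by_contra h0
    have : l + 1 ≤ 1 := by omega
    exact absurd hs (not_lt.2 (h2.trans (pt_mono m this)))
  obtain ⟨l', hl'⟩ : ∃ l', l = l' + 1 := ⟨l - 1, by omega⟩
  have hpos : (0 : ℝ) < 2 ^ m := by positivity
  have hvol : leb.real (Set.Ioc (pt m (l - 1)) (pt m l)) = (2 ^ m)⁻¹ := by
    rw [measureReal_def, leb_Ioc, hl', Nat.add_sub_cancel, pt_succ_sub,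
      ENNReal.toReal_ofReal (by positivity)]
  have hfin : leb (Set.Ioc (pt m (l - 1)) (pt m l)) ≠ ∞ := by rw [leb_Ioc]; exact ENNReal.ofReal_ne_top
  have hi : IntegrableOn h (Set.Ioc (pt m (l - 1)) (pt m l)) leb :=
    (integrableOn_Iic_of_continuous hc _).mono_set Set.Ioc_subset_Iic_self
  have e : prevAvg h m l - h s =
      (∫ u in Set.Ioc (pt m (l - 1)) (pt m l), (h u - h s) ∂leb) * 2 ^ m := by
    rw [integral_sub hi (integrableOn_const hfin), setIntegral_const, hvol, smul_eq_mul, sub_mul,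
      prevAvg]
    field_simp
  rw [e, abs_mul, abs_of_pos hpos]
  have hle : ‖∫ u in Set.Ioc (pt m (l - 1)) (pt m l), (h u - h s) ∂leb‖ ≤ ε * (2 ^ m)⁻¹ := by
    rw [← hvol]
    refine norm_setIntegral_le_of_norm_le_const hfin.lt_top fun u hu => ?_
    have hus : (u : ℝ) ≤ s := by exact_mod_cast hu.2.trans h1.le
    have hlow : (pt m (l - 1) : ℝ) ≤ u := by exact_mod_cast hu.1.le
    have h2' : (s : ℝ) ≤ pt m (l + 1) := by exact_mod_cast h2
    refine hδ u ((hu.2.trans h1.le).trans hsT) s hsT ?_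
    have e1 := pt_succ_sub m l
    have e2 := pt_succ_sub m l'
    rw [hl'] at e1 hlow h2'
    rw [Nat.add_sub_cancel] at hlow
    rw [abs_le]; constructor <;> linarith
  calc _ ≤ ε * (2 ^ m)⁻¹ * 2 ^ m := by gcongr; exact hle
    _ = ε := by field_simp

end ItoCalculus

namespace ItoCalculus

open RoughFMM (leb)

variable {Ω ι : Type*} [mΩ : MeasurableSpace Ω] {Q : Measure Ω} [IsProbabilityMeasure Q]
  {ℱ : Filtration ℝ≥0 mΩ} {ρ : ι → ι → ℝ} {W : ι → ℝ≥0 → Ω → ℝ} [Fintype ι]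

set_option linter.unusedSectionVars false

/-- The averages over the preceding grid cells converge in `L¹`: they are contractions, and
they converge for continuous functions. -/
lemma tendsto_prevAvg {g : ℝ≥0 → ℝ} {N : ℕ} (hg : IntegrableOn g (Set.Iic (N : ℝ≥0)) leb) :
    Tendsto (fun m => ∫⁻ s in Set.Iic (N : ℝ≥0), ‖prevAvg g m (cell m s) - g s‖ₑ ∂leb) atTop
      (𝓝 0) := by
  rw [ENNReal.tendsto_nhds_zero]
  intro ε hε
  rcases eq_or_ne ε ∞ with rfl | hε'
  · exact Eventually.of_forall fun _ => le_top
  obtain ⟨e, he, rfl⟩ : ∃ e : ℝ, 0 < e ∧ ENNReal.ofReal e = ε :=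
    ⟨ε.toReal, ENNReal.toReal_pos hε.ne' hε', ENNReal.ofReal_toReal hε'⟩
  obtain ⟨h, hhs, hh, hhc, -⟩ := Integrable.exists_hasCompactSupport_lintegral_sub_le
    (μ := lebT N) hg (ε := ENNReal.ofReal (e / 4)) (by simpa using he)
  obtain ⟨C, hC⟩ := hhs.exists_bound_of_continuous hhc
  have hC0 : 0 ≤ C := (norm_nonneg _).trans (hC 0)
  have huc := (isCompact_Iic (N : ℝ≥0)).uniformContinuousOn_of_continuous hhc.continuousOn
  set e' : ℝ := e / (4 * (N + 1)) with he'def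
  have he' : 0 < e' := by positivity
  obtain ⟨δ, hδ, hδ'⟩ := Metric.uniformContinuousOn_iff.1 huc e' he'
  have hlim : Tendsto (fun m : ℕ => C * ((2 : ℝ) ^ m)⁻¹) atTop (𝓝 0) := by
    simpa using tendsto_inv_two_pow.const_mul C
  filter_upwards [tendsto_inv_two_pow.eventually (gt_mem_nhds (show (0 : ℝ) < δ / 4 by linarith)),
    hlim.eventually (gt_mem_nhds (show (0 : ℝ) < e / 4 by linarith))] with m hm hmC
  have hN : (N : ℝ≥0) = pt m (N * 2 ^ m) := (pt_mul_pow m N).symm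
  have hhi : IntegrableOn h (Set.Iic (N : ℝ≥0)) leb := integrableOn_Iic_of_continuous hhc _
  have hsub : IntegrableOn (fun s => g s - h s) (Set.Iic (N : ℝ≥0)) leb := hg.sub hhi
  have m0 : Measurable fun s => prevAvg (fun s => g s - h s) m (cell m s) := measurable_prevAvg _ _
  have m1 : Measurable fun s => prevAvg h m (cell m s) := measurable_prevAvg _ _
  have b1 : ∫⁻ s in Set.Iic (N : ℝ≥0), ‖prevAvg (fun s => g s - h s) m (cell m s)‖ₑ ∂leb ≤
      ENNReal.ofReal (e / 4) := by
    refine le_trans ?_ hh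
    rw [hN]
    exact lintegral_prevAvg_le _ m _
  have b2 : ∫⁻ s in Set.Iic (N : ℝ≥0), ‖prevAvg h m (cell m s) - h s‖ₑ ∂leb ≤
      ENNReal.ofReal (e / 4) + ENNReal.ofReal (e / 4) := by
    have hle : ∀ s ∈ Set.Iic (N : ℝ≥0), ‖prevAvg h m (cell m s) - h s‖ₑ ≤
        ENNReal.ofReal e' + (Set.Iic (pt m 1)).indicator (fun _ => ENNReal.ofReal C) s := by
      intro s hs
      rcases lt_or_ge (pt m 1) s with h1 | h1
      · refine le_add_right ?_
        rw [← ofReal_norm]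
        refine ENNReal.ofReal_le_ofReal (abs_prevAvg_sub_le hhc (δ := δ / 2)
          (fun u hu v hv huv => ?_) (by linarith) h1 hs)
        refine (hδ' u hu v hv ?_).le
        rw [NNReal.dist_eq]; linarith
      · refine le_add_left ?_
        rw [Set.indicator_of_mem (by exact h1)]
        have hc0 : cell m s = 0 := by
          rcases eq_or_ne s 0 with rfl | h0
          · simp
          · exact cell_eq (by simpa using pos_iff_ne_zero.2 h0) (by simpa using h1)
        rw [hc0, ← ofReal_norm]
        simpa [prevAvg] using ENNReal.ofReal_le_ofReal (hC s)
    refine (setLIntegral_mono' measurableSet_Iic hle).trans ?_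
    rw [lintegral_add_left measurable_const, lintegral_indicator measurableSet_Iic]
    simp only [lintegral_const, Measure.restrict_apply_univ, leb_Iic,
      Measure.restrict_apply measurableSet_Iic]
    refine add_le_add ?_ ?_
    · rw [← ENNReal.ofReal_coe_nnreal, ← ENNReal.ofReal_mul he'.le]
      refine ENNReal.ofReal_le_ofReal ?_
      rw [he'def]
      simp only [NNReal.coe_natCast]
      rw [div_mul_eq_mul_div, div_le_div_iff₀ (by positivity) (by norm_num)]
      nlinarith [he, N.cast_nonneg (α := ℝ)]
    · refine (mul_le_mul_right (measure_mono Set.inter_subset_left) _).trans ?_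
      rw [leb_Iic, ← ENNReal.ofReal_coe_nnreal, ← ENNReal.ofReal_mul hC0]
      refine ENNReal.ofReal_le_ofReal ?_
      have := pt_succ_sub m 0
      rw [pt_zero] at this
      simp only [zero_add, NNReal.coe_zero, sub_zero] at this
      rw [this]; exact hmC.le
  have b3 : ∫⁻ s in Set.Iic (N : ℝ≥0), ‖g s - h s‖ₑ ∂leb ≤ ENNReal.ofReal (e / 4) := hh
  have hpt : ∀ s ∈ Set.Iic (N : ℝ≥0), ‖prevAvg g m (cell m s) - g s‖ₑ ≤
      ‖prevAvg (fun s => g s - h s) m (cell m s)‖ₑ + (‖prevAvg h m (cell m s) - h s‖ₑ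
        + ‖g s - h s‖ₑ) := by
    intro s hs
    have hl : cell m s ≤ N * 2 ^ m := by
      have := (pt_cell_le m s).trans hs
      rw [hN] at this
      exact (pt_strictMono m).le_iff_le.1 this
    rw [prevAvg_sub (hN ▸ hg) (hN ▸ hhi) hl]
    have : prevAvg g m (cell m s) - g s = (prevAvg g m (cell m s) - prevAvg h m (cell m s)) +
      ((prevAvg h m (cell m s) - h s) - (g s - h s)) := by ring
    rw [this]
    refine (enorm_add_le _ _).trans ?_
    gcongr
    exact enorm_sub_le
  refine (setLIntegral_mono' measurableSet_Iic hpt).trans ?_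
  have m2 : AEMeasurable (fun s => ‖prevAvg h m (cell m s) - h s‖ₑ) (lebT N) :=
    (m1.sub hhc.measurable).enorm.aemeasurable
  rw [lintegral_add_left m0.enorm, lintegral_add_left' m2]
  refine (add_le_add b1 (add_le_add b2 b3)).trans ?_
  rw [← ENNReal.ofReal_add, ← ENNReal.ofReal_add, ← ENNReal.ofReal_add] <;> try positivity
  exact ENNReal.ofReal_le_ofReal (by linarith)

/-- An adapted process with absolutely continuous paths; nothing is assumed of the joint
measurability of its derivative. -/
lemma IsIto.of_integral (hW : ∀ k, StronglyAdapted ℱ (W k)) {B b : ℝ≥0 → Ω → ℝ}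
    (hB : StronglyAdapted ℱ B) (hb : ∀ᵐ ω ∂Q, ∀ t : ℝ≥0,
      IntegrableOn (fun s => b s ω) (Set.Iic t) leb ∧ B t ω = ∫ s in Set.Iic t, b s ω ∂leb) :
    IsIto Q ℱ W B (fun _ _ _ => 0) b := by
  refine (IsIto.of_bet hW (b := b) (fun n => n)
    (fun n l ω => clamp (4 ^ n) ((B (pt n l) ω - B (pt n (l - 1)) ω) * 2 ^ n))
    (fun n l => (continuous_clamp _).comp_stronglyMeasurable
      (((hB _).sub ((hB _).mono (ℱ.mono (pt_mono n (Nat.sub_le l 1))))).mul_const _))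
    (fun n => ⟨4 ^ n, fun l ω => abs_clamp_le (by positivity) _⟩) ?_).congr ?_
    (ae_of_all _ fun _ _ => ae_of_all _ fun _ => rfl) (ae_of_all _ fun _ => ae_of_all _ fun _ => rfl)
  · filter_upwards [hb] with ω hω
    refine ⟨fun n => ((measurable_of_countable fun l =>
      clamp (4 ^ n) ((B (pt n l) ω - B (pt n (l - 1)) ω) * 2 ^ n)).comp (measurable_cell n)).aestronglyMeasurable,
      fun T => memLp_one_iff_integrable.2 (hω T).1, fun T => ?_⟩
    obtain ⟨N, hN⟩ := exists_nat_ge T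
    obtain ⟨n₀, hn₀⟩ := pow_unbounded_of_one_lt
      (∫ s in Set.Iic (N : ℝ≥0), |b s ω| ∂leb) (one_lt_two (α := ℝ))
    refine tendsto_of_tendsto_of_tendsto_of_le_of_le' tendsto_const_nhds
      (tendsto_prevAvg (hω N).1) (Eventually.of_forall fun _ => zero_le) ?_
    filter_upwards [eventually_ge_atTop n₀] with n hn
    refine (eLpNorm_mono_measure _ (lebT_mono hN)).trans ?_
    rw [eLpNorm_one_eq_lintegral_enorm]
    refine setLIntegral_mono' measurableSet_Iic fun s hs => le_of_eq ?_
    set l := cell n s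
    have hle : pt n (l - 1) ≤ pt n l := pt_mono n (Nat.sub_le l 1)
    have hlN : pt n l ≤ N := (pt_cell_le n s).trans hs
    have e1 : (B (pt n l) ω - B (pt n (l - 1)) ω) * 2 ^ n = prevAvg (fun s => b s ω) n l := by
      rw [(hω _).2, (hω _).2, setIntegral_Iic_add_Ioc hle (hω _).1, prevAvg]
      ring
    have e2 : |prevAvg (fun s => b s ω) n l| ≤ 4 ^ n := by
      have hsub : Set.Ioc (pt n (l - 1)) (pt n l) ⊆ Set.Iic (N : ℝ≥0) := fun x hx => hx.2.trans hlN
      have h1 : |∫ s in Set.Ioc (pt n (l - 1)) (pt n l), b s ω ∂leb| ≤ 2 ^ n :=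
        calc _ ≤ ∫ s in Set.Ioc (pt n (l - 1)) (pt n l), |b s ω| ∂leb :=
              abs_integral_le_integral_abs
          _ ≤ ∫ s in Set.Iic (N : ℝ≥0), |b s ω| ∂leb :=
              setIntegral_mono_set (hω N).1.abs (ae_of_all _ fun _ => abs_nonneg _)
                hsub.eventuallyLE
          _ ≤ 2 ^ n := hn₀.le.trans (pow_le_pow_right₀ one_le_two hn)
      rw [prevAvg, abs_mul, abs_of_pos (show (0 : ℝ) < 2 ^ n by positivity)]
      calc _ ≤ (2 : ℝ) ^ n * 2 ^ n := by gcongr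
        _ = 4 ^ n := by rw [← mul_pow]; norm_num
    simp only [Pi.sub_apply]
    rw [e1, clamp_eq e2]
  · filter_upwards [hb] with ω hω t
    exact (hω t).2.symm

end ItoCalculus

namespace ItoCalculus

open RoughFMM (leb SimpleProcess IsItoIntegral TendstoZeroInProb)

variable {Ω ι : Type*} [mΩ : MeasurableSpace Ω] {Q : Measure Ω} [IsProbabilityMeasure Q]
  {ℱ : Filtration ℝ≥0 mΩ} {ρ : ι → ι → ℝ} {W : ι → ℝ≥0 → Ω → ℝ} [Fintype ι]

set_option linter.unusedSectionVars false

/-! ### Itô integrals as Itô processes -/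

lemma tendsto_eLpNorm_zero_of_bound {α : Type*} [MeasurableSpace α] {μ : Measure α}
    [IsFiniteMeasure μ] {p : ℝ≥0∞} (hp : 1 ≤ p) (hp' : p ≠ ∞) {f : ℕ → α → ℝ} {C : ℝ}
    (hf : ∀ n, AEStronglyMeasurable (f n) μ) (hb : ∀ n x, ‖f n x‖ ≤ C)
    (h : ∀ᵐ x ∂μ, Tendsto (fun n => f n x) atTop (𝓝 0)) :
    Tendsto (fun n => eLpNorm (f n) p μ) atTop (𝓝 0) := by
  have hui : UnifIntegrable f p μ := by
    refine unifIntegrable_of hp hp' hf fun ε _ => ⟨(C + 1).toNNReal, fun n => ?_⟩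
    have : {x | (C + 1).toNNReal ≤ ‖f n x‖₊} = ∅ := by
      ext x
      simp only [Set.mem_ofPred_eq, Set.mem_empty_iff_false, iff_false, not_le]
      rw [← NNReal.coe_lt_coe, Real.coe_toNNReal']
      exact (hb n x).trans_lt (lt_max_of_lt_left (by linarith))
    rw [this]; simp
  have := tendsto_Lp_finite_of_tendsto_ae hp hp' hf (g := fun _ => 0) MemLp.zero' hui h
  refine this.congr fun n => ?_
  congr 1
  ext x; simp

/-- The first point of the grid that is not less than `a`. -/
noncomputable def up (m : ℕ) (a : ℝ≥0) : ℝ≥0 := pt m ⌈a * 2 ^ m⌉₊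

lemma up_mono (m : ℕ) : Monotone (up m) := fun a b h => pt_mono m (Nat.ceil_mono (by gcongr))

lemma up_le_pt_iff {m l : ℕ} {a : ℝ≥0} : up m a ≤ pt m l ↔ a ≤ pt m l := by
  rw [up, (pt_strictMono m).le_iff_le, Nat.ceil_le, pt, le_div_iff₀ (by positivity)]

lemma le_up (m : ℕ) (a : ℝ≥0) : a ≤ up m a := by
  rw [up, pt, le_div_iff₀ (by positivity)]; exact Nat.le_ceil _

lemma up_sub_le (m : ℕ) (a : ℝ≥0) : (up m a : ℝ) - a ≤ (2 ^ m)⁻¹ := by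
  have h1 := Nat.ceil_lt_add_one (show 0 ≤ a * 2 ^ m from zero_le)
  have h2 : ((⌈a * 2 ^ m⌉₊ : ℝ≥0) : ℝ) < ((a * 2 ^ m + 1 : ℝ≥0) : ℝ) := NNReal.coe_lt_coe.2 h1
  rw [up, coe_pt]
  push_cast at h2
  have h3 : (⌈a * 2 ^ m⌉₊ : ℝ) / 2 ^ m ≤ (a * 2 ^ m + 1) / 2 ^ m := by gcongr
  have h4 : ((a : ℝ) * 2 ^ m + 1) / 2 ^ m = a + (2 ^ m)⁻¹ := by field_simp
  linarith

/-- The indicator of `s ≤ a`. -/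
noncomputable def before (a s : ℝ≥0) : ℝ := if s ≤ a then 1 else 0

/-- The indicator of the grid cells `(pt m l, pt m (l + 1)]` that end at or before `up m a`. -/
noncomputable def beforeGrid (a : ℝ≥0) (m l : ℕ) : ℝ := if a ≤ pt m l then 0 else 1

lemma tendsto_beforeGrid (a : ℝ≥0) {s : ℝ≥0} (hs : 0 < s) :
    ∀ᶠ m in atTop, beforeGrid a m (cell m s) = before a s := by
  rcases le_or_gt s a with h | h
  · refine Eventually.of_forall fun m => ?_
    rw [before, if_pos h, beforeGrid, if_neg (not_le.2 ((cell_spec hs).1.trans_le h))]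
  · have h' : (0 : ℝ) < s - a := sub_pos.2 (by exact_mod_cast h)
    filter_upwards [tendsto_inv_two_pow.eventually (gt_mem_nhds h')] with m hm
    have := (abs_le.1 (abs_pt_cell_sub_le m s)).1
    have h2 : a ≤ pt m (cell m s) := by
      rw [← NNReal.coe_le_coe]; linarith
    rw [before, if_neg (not_le.2 h), beforeGrid, if_pos h2]

lemma min_up_sub {B : ℝ≥0 → ℝ} {m l : ℕ} (a : ℝ≥0) {u : ℝ≥0} (h1 : pt m l ≤ u)
    (h2 : u ≤ pt m (l + 1)) :
    B (min u (up m a)) = B (min (pt m l) (up m a)) + beforeGrid a m l * (B u - B (pt m l)) := by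
  by_cases h : a ≤ pt m l
  · have h' := up_le_pt_iff.2 h
    rw [beforeGrid, if_pos h, min_eq_right h', min_eq_right (h'.trans h1)]; ring
  · have h3 : ¬ up m a ≤ pt m l := fun h' => h (up_le_pt_iff.1 h')
    have h4 : pt m (l + 1) ≤ up m a := by
      rw [up, (pt_strictMono m).le_iff_le] at h3 ⊢; omega
    rw [beforeGrid, if_neg h, min_eq_left (not_le.1 h3).le, min_eq_left (h2.trans h4)]; ring

namespace Simple

/-- A simple predictable process, moved to the next points of a dyadic grid. -/
noncomputable def toElem [DecidableEq ι] (hW : ∀ k, StronglyAdapted ℱ (W k)) (k₀ : ι)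
    (K : SimpleProcess ℱ) (m : ℕ) : Elem ℱ W where
  m := m
  κ l k ω := if k = k₀ then
    ∑ i ∈ Finset.range K.n, (beforeGrid (K.t (i + 1)) m l - beforeGrid (K.t i) m l) * K.c i ω else 0
  β _ _ := 0
  Y u ω := ∑ i ∈ Finset.range K.n,
    K.c i ω * (W k₀ (min u (up m (K.t (i + 1)))) ω - W k₀ (min u (up m (K.t i))) ω)
  κ_meas l k := by
    split_ifs
    · refine Finset.stronglyMeasurable_fun_sum _ fun i _ => ?_
      by_cases h : K.t i ≤ pt m l
      · exact ((K.measurable_c i).mono (ℱ.mono h)).const_mul _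
      · have h' : ¬ K.t (i + 1) ≤ pt m l := fun h' => h ((K.mono (Nat.le_succ i)).trans h')
        simp only [beforeGrid, if_neg h, if_neg h', sub_self, zero_mul]
        exact stronglyMeasurable_const
    · exact stronglyMeasurable_const
  β_meas _ := stronglyMeasurable_const
  κ_bdd := by
    choose C hC using K.bounded_c
    refine ⟨∑ i ∈ Finset.range K.n, 1 * C i, fun l k ω => ?_⟩
    have hC0 : ∀ i, 0 ≤ C i := fun i => (abs_nonneg _).trans (hC i ω)
    split_ifs
    · refine (Finset.abs_sum_le_sum_abs _ _).trans (Finset.sum_le_sum fun i _ => ?_)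
      rw [abs_mul]
      refine mul_le_mul ?_ (hC i ω) (abs_nonneg _) zero_le_one
      unfold beforeGrid
      split_ifs <;> norm_num
    · rw [abs_zero]; exact Finset.sum_nonneg fun i _ => by rw [one_mul]; exact hC0 i
  β_bdd := ⟨0, by simp⟩
  Y_adapted u := Finset.stronglyMeasurable_fun_sum _ fun i _ => by
    by_cases h : K.t i ≤ u
    · exact ((K.measurable_c i).mono (ℱ.mono h)).mul
        (((hW k₀ _).mono (ℱ.mono (min_le_left _ _))).sub
          ((hW k₀ _).mono (ℱ.mono (min_le_left _ _))))
    · have h1 : u ≤ up m (K.t i) := (not_le.1 h).le.trans (le_up _ _)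
      have h2 : u ≤ up m (K.t (i + 1)) := h1.trans (up_mono m (K.mono (Nat.le_succ i)))
      simp only [min_eq_left h1, min_eq_left h2, sub_self, mul_zero]
      exact stronglyMeasurable_const
  step l ω u h1 h2 := by
    simp only [min_up_sub (B := fun s => W k₀ s ω) _ h1 h2, ite_mul, zero_mul, Finset.sum_ite_eq',
      Finset.mem_univ, if_true, add_zero, Finset.sum_mul, ← Finset.sum_add_distrib]
    exact Finset.sum_congr rfl fun i _ => by ring

lemma value_eq (K : SimpleProcess ℱ) (s : ℝ≥0) (ω : Ω) : K.value s ω =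
    ∑ i ∈ Finset.range K.n, (before (K.t (i + 1)) s - before (K.t i) s) * K.c i ω := by
  refine Finset.sum_congr rfl fun i _ => ?_
  have := K.mono (Nat.le_succ i)
  by_cases h1 : s ≤ K.t i
  · have h2 := h1.trans this
    rw [Set.indicator_of_notMem (fun h => not_lt.2 h1 h.1)]
    simp [before, h1, h2]
  · by_cases h2 : s ≤ K.t (i + 1)
    · rw [Set.indicator_of_mem (Set.mem_Ioc.2 ⟨not_le.1 h1, h2⟩)]
      simp [before, h1, h2]
    · rw [Set.indicator_of_notMem (fun h => h2 h.2)]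
      simp [before, h1, h2]

lemma measurable_before (a : ℝ≥0) : Measurable (before a) :=
  Measurable.ite measurableSet_Iic measurable_const measurable_const

lemma measurable_value (K : SimpleProcess ℱ) (ω : Ω) : Measurable fun s => K.value s ω := by
  simp only [value_eq]
  exact Finset.measurable_fun_sum _ fun i _ =>
    ((measurable_before _).sub (measurable_before _)).mul_const _

lemma memLp_value (K : SimpleProcess ℱ) (ω : Ω) (T : ℝ≥0) :
    MemLp (fun s => K.value s ω) 2 (lebT T) := by
  refine MemLp.of_bound (measurable_value K ω).aestronglyMeasurable
    (∑ i ∈ Finset.range K.n, |K.c i ω|) (ae_of_all _ fun s => ?_)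
  exact (norm_sum_le _ _).trans (Finset.sum_le_sum fun i _ => norm_indicator_le_norm_self _ _)

/-- Moving the jump times of a simple predictable process to a fine grid changes the process and
its integral little; the change of the process has a bound that does not depend on chance. -/
lemma exists_elem [DecidableEq ι] (hB : BM Q ℱ ρ W) (k₀ : ι) (K : SimpleProcess ℱ) {ε : ℝ}
    (hε : 0 < ε) (T : ℝ≥0) : ∃ E : Elem ℱ W, Q {ω | ¬ E.Close T ε ω (fun s => K.integral (W k₀) s ω)
      (fun k s => if k = k₀ then K.value s ω else 0) fun _ => 0} ≤ ENNReal.ofReal ε := by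
  choose C hC using K.bounded_c
  have hC0 : ∀ i, 0 ≤ |C i| := fun i => abs_nonneg _
  replace hC : ∀ i ω, |K.c i ω| ≤ |C i| := fun i ω => (hC i ω).trans (le_abs_self _)
  set S := ∑ i ∈ Finset.range K.n, |C i| with hS
  have hS0 : 0 ≤ S := Finset.sum_nonneg fun i _ => hC0 i
  set δ : ℝ := ε / (2 * (S + 1)) with hδdef
  have hδ : 0 < δ := by positivity
  set D : ℕ → ℝ≥0 → ℝ := fun m s => ∑ i ∈ Finset.range K.n,
    (|beforeGrid (K.t (i + 1)) m (cell m s) - before (K.t (i + 1)) s| +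
      |beforeGrid (K.t i) m (cell m s) - before (K.t i) s|) * |C i| with hD
  have hDm : ∀ m, Measurable (D m) := fun m => by
    refine Finset.measurable_fun_sum _ fun i _ => Measurable.mul_const ?_ _
    have h1 : ∀ a, Measurable fun s => |beforeGrid a m (cell m s) - before a s| := fun a => by
      have h2 : Measurable fun s => beforeGrid a m (cell m s) :=
        (measurable_of_countable fun l => beforeGrid a m l).comp (measurable_cell m)
      exact (h2.sub (measurable_before a)).norm
    exact (h1 _).add (h1 _)
  have hb1 : ∀ a m s, |beforeGrid a m (cell m s) - before a s| ≤ 1 := fun a m s => by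
    unfold beforeGrid before
    split_ifs <;> norm_num
  have hDb : ∀ m s, ‖D m s‖ ≤ 2 * S := fun m s => by
    rw [Real.norm_of_nonneg (Finset.sum_nonneg fun i _ => by positivity), hS, Finset.mul_sum]
    refine Finset.sum_le_sum fun i _ => ?_
    gcongr
    linarith [hb1 (K.t (i + 1)) m s, hb1 (K.t i) m s]
  have hD0 : ∀ᵐ s ∂leb, ∀ᶠ m in atTop, D m s = 0 := by
    have h0 : ∀ᵐ s ∂leb, s ≠ 0 := by
      rw [ae_iff]; simp
    filter_upwards [h0] with s hs
    have hs := pos_iff_ne_zero.2 hs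
    have := (Finset.eventually_all (Finset.range K.n)).2 fun i _ =>
      (tendsto_beforeGrid (K.t (i + 1)) hs).and (tendsto_beforeGrid (K.t i) hs)
    filter_upwards [this] with m hm
    exact Finset.sum_eq_zero fun i hi => by rw [(hm i hi).1, (hm i hi).2]; simp
  have hlim : Tendsto (fun m => eLpNorm (D m) 2 (lebT T)) atTop (𝓝 0) := by
    refine tendsto_eLpNorm_zero_of_bound one_le_two (by norm_num)
      (fun m => (hDm m).aestronglyMeasurable) hDb ?_
    filter_upwards [ae_restrict_of_ae hD0] with s hs
    exact tendsto_const_nhds.congr' (hs.mono fun m hm => hm.symm)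
  obtain ⟨m, hm1, hm2⟩ := ((ENNReal.tendsto_nhds_zero.1 hlim (ENNReal.ofReal ε) (by simpa)).and
    (hB.modulus T hδ (ε := ENNReal.ofReal ε) (by simpa))).exists
  refine ⟨toElem hB.adapted k₀ K m, le_trans (measure_mono ?_) hm2⟩
  intro ω hω
  by_contra hgood
  simp only [Set.mem_ofPred_eq, not_exists, not_and, not_lt] at hgood
  refine hω ⟨fun u hu => ?_, fun k => ?_, ?_⟩
  · have hinc : ∀ a, |W k₀ (min u (up m a)) ω - W k₀ (min u a) ω| ≤ δ := fun a => by
      refine hgood k₀ _ ((min_le_left _ _).trans hu) _ ((min_le_left _ _).trans hu) ?_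
      have h1 : min u a ≤ min u (up m a) := min_le_min le_rfl (le_up m a)
      rw [abs_of_nonneg (sub_nonneg.2 (by exact_mod_cast h1))]
      refine le_trans ?_ (up_sub_le m a)
      push_cast
      have h3 : (a : ℝ) ≤ up m a := by exact_mod_cast le_up m a
      rcases le_total (u : ℝ) a with h | h
      · rw [min_eq_left h, min_eq_left (h.trans h3)]; linarith
      · rw [min_eq_right h]; linarith [min_le_right (u : ℝ) (up m a)]
    change |∑ i ∈ Finset.range K.n, _ - ∑ i ∈ Finset.range K.n, _| ≤ ε
    rw [← Finset.sum_sub_distrib]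
    calc _ ≤ ∑ i ∈ Finset.range K.n, |C i| * (2 * δ) := by
          refine (Finset.abs_sum_le_sum_abs _ _).trans (Finset.sum_le_sum fun i _ => ?_)
          rw [← mul_sub, abs_mul]
          refine mul_le_mul (hC i ω) ?_ (abs_nonneg _) (hC0 i)
          have h1 := abs_le.1 (hinc (K.t (i + 1)))
          have h2 := abs_le.1 (hinc (K.t i))
          rw [abs_le]; constructor <;> linarith [h1.1, h1.2, h2.1, h2.2]
      _ = S * (2 * δ) := by rw [← Finset.sum_mul]
      _ ≤ ε := by
          rw [hδdef]
          have : S * (2 * (ε / (2 * (S + 1)))) = ε * (S / (S + 1)) := by field_simp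
          rw [this]
          exact mul_le_of_le_one_right hε.le ((div_le_one (by positivity)).2 (by linarith))
  · refine le_trans (eLpNorm_mono_real (g := D m) fun s => ?_) hm1
    simp only [Pi.sub_apply, Elem.kap, toElem]
    by_cases hk : k = k₀
    · simp only [if_pos hk, value_eq, ← Finset.sum_sub_distrib, ← sub_mul]
      refine (norm_sum_le _ _).trans (Finset.sum_le_sum fun i _ => ?_)
      rw [norm_mul]
      refine mul_le_mul ?_ (hC i ω) (abs_nonneg _) (by positivity)
      have e : ∀ a b c d : ℝ, a - b - (c - d) = (a - c) - (b - d) := fun a b c d => by ring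
      rw [e]
      exact norm_sub_le _ _
    · simp only [if_neg hk, sub_self, norm_zero]
      exact Finset.sum_nonneg fun i _ => by positivity
  · have : ((fun s => (toElem hB.adapted k₀ K m).bet s ω) - fun _ => (0 : ℝ)) = 0 := by
      ext s; simp [Elem.bet, toElem]
    rw [this]; simp

end Simple

lemma eLpNorm_two_eq {α : Type*} [MeasurableSpace α] (μ : Measure α) (g : α → ℝ) :
    eLpNorm g 2 μ = (∫⁻ s, ENNReal.ofReal (g s ^ 2) ∂μ) ^ (1 / 2 : ℝ) := by
  rw [eLpNorm_eq_lintegral_rpow_enorm_toReal (by norm_num) (by norm_num)]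
  simp only [ENNReal.toReal_ofNat]
  congr 1
  refine lintegral_congr fun s => ?_
  rw [← ofReal_norm, ENNReal.ofReal_rpow_of_nonneg (norm_nonneg _) (by norm_num)]
  norm_num

lemma aestronglyMeasurable_of_progressive {H : ℝ≥0 → Ω → ℝ} (hH : IsStronglyProgressive ℱ H)
    (ω : Ω) : AEStronglyMeasurable (fun s => H s ω) leb := by
  refine aestronglyMeasurable_of_lebT fun T => ?_
  have h1 : StronglyMeasurable fun s : ℝ≥0 => H (min s T) ω :=
    (hH T).comp_measurable (g := fun s : ℝ≥0 => ((⟨min s T, Set.mem_Iic.2 (min_le_right _ _)⟩ : Set.Iic T), ω))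
      ((Measurable.subtype_mk (measurable_id.min measurable_const)).prodMk measurable_const)
  refine h1.aestronglyMeasurable.congr ((ae_restrict_iff' measurableSet_Iic).2
    (ae_of_all _ fun s hs => ?_))
  simp only [min_eq_left (Set.mem_Iic.1 hs)]

/-- Convergence in probability gives, almost surely, one member of the sequence below `1`. -/
lemma TendstoZeroInProb.exists_lt_one {f : ℕ → Ω → ℝ≥0∞} (h : TendstoZeroInProb Q f) :
    ∀ᵐ ω ∂Q, ∃ n, f n ω < 1 := by
  rw [ae_iff]
  refine le_antisymm (ge_of_tendsto' (h 1 one_pos) fun n => measure_mono fun ω hω => ?_) zero_le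
  simp only [Set.mem_ofPred_eq, not_exists, not_lt] at hω ⊢
  exact hω n

/-- An Itô integral with respect to a component of the Brownian motion is an Itô process. -/
theorem IsIto.of_isItoIntegral [DecidableEq ι] (hB : BM Q ℱ ρ W) (k₀ : ι) {H I : ℝ≥0 → Ω → ℝ}
    (h : IsItoIntegral Q ℱ (W k₀) H I) :
    IsIto Q ℱ W I (fun k s ω => if k = k₀ then H s ω else 0) fun _ _ => 0 := by
  obtain ⟨H', hH', hHH'⟩ := h.progressive
  obtain ⟨K, hK⟩ := h.approx
  have hfin : ∀ᵐ ω ∂Q, ∀ N : ℕ, ∃ n, (∫⁻ s in Set.Iic (N : ℝ≥0),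
      ENNReal.ofReal (((K n).value s ω - H s ω) ^ 2) ∂leb) < 1 :=
    ae_all_iff.2 fun N => TendstoZeroInProb.exists_lt_one (hK N).1
  have hLp : ∀ᵐ ω ∂Q, ∀ T : ℝ≥0, MemLp (fun s => H s ω) 2 (lebT T) := by
    filter_upwards [hHH', hfin] with ω h1 h2 T
    obtain ⟨N, hN⟩ := exists_nat_ge T
    obtain ⟨n, hn⟩ := h2 N
    have hm : AEStronglyMeasurable (fun s => H s ω) leb :=
      (aestronglyMeasurable_of_progressive hH' ω).congr h1
    have h3 := Simple.memLp_value (K n) ω N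
    have h4 : MemLp (fun s => (K n).value s ω - H s ω) 2 (lebT N) := by
      refine ⟨h3.1.sub hm.restrict, ?_⟩
      rw [eLpNorm_two_eq]
      exact ENNReal.rpow_lt_top_of_nonneg (by norm_num) (hn.trans ENNReal.one_lt_top).ne
    have h5 : MemLp (fun s => H s ω) 2 (lebT N) := by
      refine (h3.sub h4).ae_eq (ae_of_all _ fun s => ?_)
      simp
    exact h5.mono_measure (lebT_mono hN)
  refine IsIto.of_approx (Y' := fun _ => I) (H' := fun _ k s ω => if k = k₀ then H s ω else 0)
    (b' := fun _ _ _ => 0) ?_ fun _ ε hε T => ?_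
  · filter_upwards [hLp] with ω hω
    refine ⟨fun k => LConv.const_seq fun T => ?_, LConv.const_seq fun T => MemLp.zero', ?_⟩
    · by_cases hk : k = k₀
      · simpa only [if_pos hk] using hω T
      · simpa only [if_neg hk] using MemLp.zero'
    · intro T
      rw [Metric.tendstoUniformlyOn_iff]
      exact fun ε hε => Eventually.of_forall fun _ _ _ => by simpa using hε
  · have e1 : 0 < ENNReal.ofReal ((ε / 2) ^ 2) := by rw [ENNReal.ofReal_pos]; positivity
    have e2 : 0 < ENNReal.ofReal (ε / 2) := by rw [ENNReal.ofReal_pos]; positivity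
    have e3 : 0 < ENNReal.ofReal (ε / 4) := by rw [ENNReal.ofReal_pos]; positivity
    obtain ⟨n, hn1, hn2⟩ := ((ENNReal.tendsto_nhds_zero.1 ((hK T).1 _ e1) _ e3).and
      (ENNReal.tendsto_nhds_zero.1 ((hK T).2 _ e2) _ e3)).exists
    obtain ⟨E, hE⟩ := Simple.exists_elem hB k₀ (K n) (half_pos hε) T
    refine ⟨E, ?_⟩
    have hadd : ENNReal.ofReal ε = ENNReal.ofReal (ε / 2) +
        (ENNReal.ofReal (ε / 4) + ENNReal.ofReal (ε / 4)) := by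
      rw [← ENNReal.ofReal_add, ← ENNReal.ofReal_add] <;> try positivity
      congr 1; ring
    have hnull : Q {ω | ¬ AEStronglyMeasurable (fun s => H s ω) leb} = 0 := by
      rw [← ae_iff]
      filter_upwards [hHH'] with ω h1
      exact (aestronglyMeasurable_of_progressive hH' ω).congr h1
    rw [hadd, ← add_zero (_ + _ : ℝ≥0∞)]
    refine le_trans (measure_mono ?_) ((measure_union_le _ _).trans
      (add_le_add ((measure_union_le _ _).trans (add_le_add hE ((measure_union_le _ _).trans
        (add_le_add hn1 hn2)))) hnull.le))
    intro ω hω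
    by_contra hgood
    simp only [Set.mem_union, Set.mem_ofPred_eq, not_or, not_not, not_le] at hgood
    obtain ⟨⟨g1, g2, g3⟩, g4⟩ := hgood
    refine hω ⟨fun u hu => ?_, fun k => ?_, ?_⟩
    · have a1 := g1.1 u hu
      have a2 : |(K n).integral (W k₀) u ω - I u ω| < ε / 2 := by
        have := (le_iSup₂ (f := fun s (_ : s ∈ Set.Iic (T : ℝ≥0)) =>
          ENNReal.ofReal |(K n).integral (W k₀) s ω - I s ω|) u hu).trans_lt g3
        exact (ENNReal.ofReal_lt_ofReal_iff (by positivity)).1 this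
      have := abs_sub_le (E.Y u ω) ((K n).integral (W k₀) u ω) (I u ω)
      linarith
    · have a1 := g1.2.1 k
      by_cases hk : k = k₀
      · simp only [if_pos hk] at a1 ⊢
        have e : ((fun s => E.kap k s ω) - fun s => H s ω) =
            ((fun s => E.kap k s ω) - fun s => (K n).value s ω) +
              fun s => (K n).value s ω - H s ω := by
          ext s; simp
        rw [e]
        have hv := (Simple.measurable_value (K n) ω).aestronglyMeasurable (μ := leb)
        refine (eLpNorm_add_le ((E.measurable_kap k ω).aestronglyMeasurable.sub hv.restrict)
          (hv.sub g4).restrict one_le_two).trans ?_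
        have a2 : eLpNorm (fun s => (K n).value s ω - H s ω) 2 (lebT T) ≤
            ENNReal.ofReal (ε / 2) := by
          rw [eLpNorm_two_eq]
          refine (ENNReal.rpow_le_rpow g2.le (by norm_num)).trans ?_
          rw [ENNReal.ofReal_rpow_of_nonneg (by positivity) (by norm_num), ← Real.sqrt_eq_rpow,
            Real.sqrt_sq (by positivity)]
        refine (add_le_add a1 a2).trans ?_
        rw [← ENNReal.ofReal_add] <;> try positivity
        exact ENNReal.ofReal_le_ofReal (by linarith)
      · simp only [if_neg hk] at a1 ⊢
        exact a1.trans (ENNReal.ofReal_le_ofReal (by linarith))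
    · exact g1.2.2.trans (ENNReal.ofReal_le_ofReal (by linarith))

end ItoCalculus

namespace ItoCalculus

open RoughFMM (leb)

/-! ### The martingale property -/

variable {Ω ι : Type*} [mΩ : MeasurableSpace Ω] {Q : Measure Ω} [IsProbabilityMeasure Q]
  {ℱ : Filtration ℝ≥0 mΩ} {ρ : ι → ι → ℝ} {W : ι → ℝ≥0 → Ω → ℝ} [Fintype ι]

set_option linter.unusedSectionVars false

lemma abs_qcov_self_le (ρ : ι → ι → ℝ) (a : ι → ℝ) :
    |qcov ρ a a| ≤ (∑ k, ∑ l, |ρ k l|) * ∑ k, a k ^ 2 := by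
  have h : ∀ k, |a k| ≤ √(∑ k, a k ^ 2) := fun k => by
    rw [← Real.sqrt_sq_eq_abs]
    exact Real.sqrt_le_sqrt (Finset.single_le_sum (f := fun k => a k ^ 2)
      (fun k _ => sq_nonneg _) (Finset.mem_univ k))
  have := abs_qcov_le ρ h h
  rwa [Real.mul_self_sqrt (Finset.sum_nonneg fun k _ => sq_nonneg _)] at this

/-- The Itô isometry for a sum over successive time intervals. -/
lemma BM.integral_sum_sq (hB : BM Q ℱ ρ W) {a : ℕ → ℝ≥0} (ha : Monotone a) {κ : ℕ → ι → Ω → ℝ}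
    {C : ℝ} (hκ : ∀ l k, StronglyMeasurable[ℱ (a l)] (κ l k)) (hC : ∀ l k ω, |κ l k ω| ≤ C) (L : ℕ) :
    MemLp (fun ω => ∑ l ∈ Finset.range L, ∑ k, κ l k ω * (W k (a (l + 1)) ω - W k (a l) ω)) 4 Q ∧
    ∫ ω, (∑ l ∈ Finset.range L, ∑ k, κ l k ω * (W k (a (l + 1)) ω - W k (a l) ω)) ^ 2 ∂Q =
      ∑ l ∈ Finset.range L, ((a (l + 1) : ℝ) - a l) *
        ∫ ω, qcov ρ (fun k => κ l k ω) (fun k => κ l k ω) ∂Q := by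
  obtain ⟨D, -, hD⟩ := hB.exists_moment_bound C
  have hd : ∀ l, MemLp (fun ω => ∑ k, κ l k ω * (W k (a (l + 1)) ω - W k (a l) ω)) 4 Q :=
    fun l => (hD _ _ (ha (Nat.le_succ l)) (κ l) (hκ l) (hC l)).1
  induction L with
  | zero => simp
  | succ L ih =>
    obtain ⟨ih1, ih2⟩ := ih
    set N : Ω → ℝ := fun ω =>
      ∑ l ∈ Finset.range L, ∑ k, κ l k ω * (W k (a (l + 1)) ω - W k (a l) ω) with hN
    set d : Ω → ℝ := fun ω => ∑ k, κ L k ω * (W k (a (L + 1)) ω - W k (a L) ω) with hdd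
    have hNm : StronglyMeasurable[ℱ (a L)] N := by
      refine Finset.stronglyMeasurable_fun_sum _ fun l hl => ?_
      have h1 : a l ≤ a L := ha (Finset.mem_range.1 hl).le
      have h2 : a (l + 1) ≤ a L := ha (Finset.mem_range.1 hl)
      exact Finset.stronglyMeasurable_fun_sum _ fun k _ => ((hκ l k).mono (ℱ.mono h1)).mul
        (((hB.adapted k _).mono (ℱ.mono h2)).sub ((hB.adapted k _).mono (ℱ.mono h1)))
    have hle := ha (Nat.le_succ L)
    have hN2 : MemLp N 2 Q := ih1.mono_exponent (by norm_num)
    have hd2 : MemLp d 2 Q := (hd L).mono_exponent (by norm_num)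
    simp only [Finset.sum_range_succ]
    refine ⟨ih1.add (hd L), ?_⟩
    rw [← ih2]
    have i1 : Integrable (fun ω => N ω ^ 2) Q := hN2.integrable_sq
    have i2 : Integrable (fun ω => N ω * d ω) Q := hN2.integrable_mul hd2
    have i3 : Integrable (fun ω => d ω ^ 2) Q := hd2.integrable_sq
    have i4 : Integrable (fun ω => 2 * (N ω * d ω)) Q := i2.const_mul 2
    have i5 : Integrable (fun ω => N ω ^ 2 + 2 * (N ω * d ω)) Q := i1.add i4
    have i6 : ∀ k, Integrable (fun ω => N ω * κ L k ω * (W k (a (L + 1)) ω - W k (a L) ω)) Q := by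
      intro k
      have h4 : MemLp (fun ω => κ L k ω * (W k (a (L + 1)) ω - W k (a L) ω)) 4 Q := by
        refine (hB.memLp k _ _ hle).of_le_mul (c := C)
          (((hκ L k).mono (ℱ.le _)).aestronglyMeasurable.mul (hB.memLp k _ _ hle).1)
          (ae_of_all _ fun ω => ?_)
        rw [norm_mul]
        gcongr
        exact hC L k ω
      have h2 : Integrable (fun ω => N ω * (κ L k ω * (W k (a (L + 1)) ω - W k (a L) ω))) Q :=
        hN2.integrable_mul (h4.mono_exponent (p := 2) (by norm_num))
      simpa only [mul_assoc] using h2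
    have e0 : ∫ ω, N ω * d ω ∂Q = 0 := by
      have : ∀ ω, N ω * d ω = ∑ k, N ω * κ L k ω * (W k (a (L + 1)) ω - W k (a L) ω) := fun ω => by
        simp only [hdd, Finset.mul_sum, mul_assoc]
      simp only [this]
      rw [integral_finsetSum _ fun k _ => i6 k]
      exact Finset.sum_eq_zero fun k _ => hB.integral_mul_incr hle (hNm.mul (hκ L k)) k
    have e1 := hB.integral_mul_sq_sub hle (hκ L) (hC L) (Z := fun _ => 1) (B := 1)
      stronglyMeasurable_const (by simp)
    simp only [one_mul] at e1
    have i7 : Integrable (fun ω => qcov ρ (fun k => κ L k ω) (fun k => κ L k ω)) Q := by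
      refine Integrable.of_bound ?_ _ (ae_of_all _ fun ω =>
        abs_qcov_le ρ (fun k => hC L k ω) (fun k => hC L k ω))
      exact ((Finset.stronglyMeasurable_fun_sum _ fun k _ => Finset.stronglyMeasurable_fun_sum _
        fun j _ => ((hκ L k).mul (hκ L j)).const_mul _).mono (ℱ.le _)).aestronglyMeasurable
    rw [integral_sub i3 (i7.const_mul _), integral_const_mul, sub_eq_zero] at e1
    have e2 : ∀ ω, (N ω + d ω) ^ 2 = N ω ^ 2 + 2 * (N ω * d ω) + d ω ^ 2 := fun ω => by ring
    change ∫ ω, (N ω + d ω) ^ 2 ∂Q = ∫ ω, N ω ^ 2 ∂Q + _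
    simp only [e2]
    rw [integral_add i5 i3, integral_add i1 i4, integral_const_mul, e0, e1]
    ring

lemma setIntegral_cell (F : ℕ → ℝ) (m L : ℕ) {u : ℝ≥0} (hu : u ≤ pt m L) :
    ∫ s in Set.Iic u, F (cell m s) ∂leb = ∑ l ∈ Finset.range L,
      (((min u (pt m (l + 1)) : ℝ≥0) : ℝ) - (min u (pt m l) : ℝ≥0)) * F l := by
  have hint : ∀ T, IntegrableOn (fun s => F (cell m s)) (Set.Iic T) leb := fun T => by
    have hm : Measurable fun s => F (cell m s) := (measurable_of_countable F).comp (measurable_cell m)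
    refine Integrable.of_bound (μ := lebT T) hm.aestronglyMeasurable
      (∑ l ∈ Finset.range (cell m T + 1), |F l|) ((ae_restrict_iff' measurableSet_Iic).2
        (ae_of_all _ fun s hs => ?_))
    refine Finset.single_le_sum (f := fun l => |F l|) (fun _ _ => abs_nonneg _) ?_
    have : pt m (cell m s) < pt m (cell m T + 1) ∨ s = 0 := by
      rcases eq_or_ne s 0 with h | h
      · exact Or.inr h
      · exact Or.inl ((cell_spec (pos_iff_ne_zero.2 h)).1.trans_le
          ((Set.mem_Iic.1 hs).trans (le_pt_cell_succ m T)))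
    rcases this with h | rfl
    · exact Finset.mem_range.2 ((pt_strictMono m).lt_iff_lt.1 h)
    · simp
  induction L generalizing u with
  | zero =>
    have : u = 0 := by simpa using hu
    subst this
    rw [setIntegral_Iic_zero]; simp
  | succ L ih =>
    rw [Finset.sum_range_succ]
    rcases le_total u (pt m L) with h | h
    · rw [ih h, min_eq_left h, min_eq_left (h.trans (pt_mono _ (Nat.le_succ L)))]
      simp
    · rw [setIntegral_Iic_add_Ioc h (hint u), ih le_rfl, min_eq_left hu, min_eq_right h]
      congr 1
      · refine Finset.sum_congr rfl fun l hl => ?_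
        have h1 : pt m (l + 1) ≤ pt m L := pt_mono _ (by simpa using hl)
        have h2 : pt m l ≤ pt m L := pt_mono _ (by have := Finset.mem_range.1 hl; omega)
        rw [min_eq_right h1, min_eq_right h2, min_eq_right (h1.trans h), min_eq_right (h2.trans h)]
      · rw [setIntegral_congr_fun (g := fun _ => F L) measurableSet_Ioc, setIntegral_const,
          measureReal_def, leb_Ioc, ENNReal.toReal_ofReal (sub_nonneg.2 (by exact_mod_cast h)),
          smul_eq_mul]
        intro s hs
        simp only [cell_eq hs.1 (hs.2.trans hu)]

lemma abs_sub_clamp_le {c : ℝ} (hc : 0 < c) (x : ℝ) : |x - clamp c x| ≤ x ^ 2 / c := by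
  rw [le_div_iff₀ hc, clamp]
  rcases le_total x c with h1 | h1
  · rw [min_eq_right h1]
    rcases le_total (-c) x with h2 | h2
    · rw [max_eq_right h2]; simp; positivity
    · rw [max_eq_left h2, abs_of_nonpos (by linarith)]; nlinarith
  · rw [min_eq_left h1, max_eq_right (by linarith), abs_of_nonneg (by linarith)]; nlinarith

/-- The limit of centred random variables that are bounded in `L²` is centred, if it is bounded. -/
lemma integral_eq_zero_of_tendsto {X : ℕ → Ω → ℝ} {X' : Ω → ℝ} {K B : ℝ}
    (h2 : ∀ n, MemLp (X n) 2 Q) (hK : ∀ n, ∫ ω, X n ω ^ 2 ∂Q ≤ K) (h0 : ∀ n, ∫ ω, X n ω ∂Q = 0)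
    (hlim : ∀ᵐ ω ∂Q, Tendsto (fun n => X n ω) atTop (𝓝 (X' ω))) (hB : ∀ᵐ ω ∂Q, |X' ω| ≤ B) :
    ∫ ω, X' ω ∂Q = 0 := by
  have hbound : ∀ c : ℝ, 0 < c → B ≤ c → |∫ ω, X' ω ∂Q| ≤ K / c := by
    intro c hc hBc
    have hcm : ∀ n, AEStronglyMeasurable (fun ω => clamp c (X n ω)) Q := fun n =>
      (continuous_clamp c).comp_aestronglyMeasurable (h2 n).1
    have hci : ∀ n, Integrable (fun ω => clamp c (X n ω)) Q := fun n =>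
      Integrable.of_bound (hcm n) c (ae_of_all _ fun ω => abs_clamp_le hc.le _)
    have e1 : ∫ ω, X' ω ∂Q = ∫ ω, clamp c (X' ω) ∂Q := by
      refine integral_congr_ae ?_
      filter_upwards [hB] with ω hω
      exact (clamp_eq (hω.trans hBc)).symm
    have t1 : Tendsto (fun n => ∫ ω, clamp c (X n ω) ∂Q) atTop (𝓝 (∫ ω, clamp c (X' ω) ∂Q)) := by
      refine tendsto_integral_of_dominated_convergence (fun _ => c) hcm (integrable_const c)
        (fun n => ae_of_all _ fun ω => abs_clamp_le hc.le _) ?_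
      filter_upwards [hlim] with ω hω
      exact ((continuous_clamp c).tendsto _).comp hω
    rw [e1]
    refine le_of_tendsto' t1.abs fun n => ?_
    have i1 : Integrable (X n) Q := (h2 n).integrable one_le_two
    have e2 : ∫ ω, clamp c (X n ω) ∂Q = - ∫ ω, (X n ω - clamp c (X n ω)) ∂Q := by
      rw [integral_sub i1 (hci n), h0 n]; ring
    rw [e2, abs_neg]
    calc _ ≤ ∫ ω, |X n ω - clamp c (X n ω)| ∂Q := abs_integral_le_integral_abs
      _ ≤ ∫ ω, X n ω ^ 2 / c ∂Q :=
        integral_mono (i1.sub (hci n)).abs ((h2 n).integrable_sq.div_const c)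
          fun ω => abs_sub_clamp_le hc _
      _ ≤ K / c := by rw [integral_div]; gcongr; exact hK n
  have ht : Tendsto (fun c : ℝ => K / c) atTop (𝓝 0) := tendsto_const_nhds.div_atTop tendsto_id
  have := ge_of_tendsto ht ((eventually_gt_atTop 0).mp ((eventually_ge_atTop B).mono
    fun c h1 h2 => hbound c h2 h1))
  exact abs_eq_zero.1 (le_antisymm this (abs_nonneg _))

/-- The increments of an elementary integral are centred given the past. -/
lemma Elem.setIntegral_incr_eq_zero (hB : BM Q ℱ ρ W) (E : Elem ℱ W) (hβ : ∀ l ω, E.β l ω = 0)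
    {s t : ℝ≥0} (hst : s ≤ t) {G : Set Ω} (hG : MeasurableSet[ℱ s] G) :
    ∫ ω, G.indicator (fun ω => E.Y t ω - E.Y s ω) ω ∂Q = 0 := by
  obtain ⟨C, -, hC, -⟩ := E.exists_bound
  set L := cell E.m t + 1
  have htL : t ≤ pt E.m L := le_pt_cell_succ _ _
  set D : ℕ → ι → Ω → ℝ := fun l k ω => (W k (min t (pt E.m (l + 1))) ω - W k (min t (pt E.m l)) ω)
    - (W k (min s (pt E.m (l + 1))) ω - W k (min s (pt E.m l)) ω) with hD
  have e : ∀ ω, G.indicator (fun ω => E.Y t ω - E.Y s ω) ω =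
      ∑ l ∈ Finset.range L, ∑ k, G.indicator (fun _ => 1) ω * E.κ l k ω * D l k ω := by
    intro ω
    by_cases hω : ω ∈ G
    · rw [Set.indicator_of_mem hω, Set.indicator_of_mem hω, E.eq_sum ω L t htL,
        E.eq_sum ω L s (hst.trans htL), add_sub_add_left_eq_sub, ← Finset.sum_sub_distrib]
      refine Finset.sum_congr rfl fun l _ => ?_
      rw [hβ, zero_mul, zero_mul, add_zero, add_zero, ← Finset.sum_sub_distrib]
      exact Finset.sum_congr rfl fun k _ => by simp only [hD]; ring
    · rw [Set.indicator_of_notMem hω, Set.indicator_of_notMem hω]; simp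
  -- every summand is an increment of the Brownian motion times a factor that is known before
  have key : ∀ l k, Integrable (fun ω => G.indicator (fun _ => (1 : ℝ)) ω * E.κ l k ω * D l k ω) Q ∧
      ∫ ω, G.indicator (fun _ => (1 : ℝ)) ω * E.κ l k ω * D l k ω ∂Q = 0 := by
    intro l k
    have hle : pt E.m l ≤ pt E.m (l + 1) := pt_mono _ (Nat.le_succ l)
    have hinc : ∀ a b : ℝ≥0, a ≤ b → s ≤ a → pt E.m l ≤ a →
        (∀ ω, D l k ω = W k b ω - W k a ω) →
        Integrable (fun ω => G.indicator (fun _ => (1 : ℝ)) ω * E.κ l k ω * D l k ω) Q ∧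
        ∫ ω, G.indicator (fun _ => (1 : ℝ)) ω * E.κ l k ω * D l k ω ∂Q = 0 := by
      intro a b hab hsa hla he
      have hZ : StronglyMeasurable[ℱ a] fun ω => G.indicator (fun _ => (1 : ℝ)) ω * E.κ l k ω :=
        (stronglyMeasurable_const.indicator (ℱ.mono hsa _ hG)).mul
          ((E.κ_meas l k).mono (ℱ.mono hla))
      simp only [he]
      refine ⟨?_, hB.integral_mul_incr hab hZ k⟩
      refine (((hB.memLp k a b hab).mono_exponent (p := 1) (by norm_num)).integrable le_rfl).bdd_mul
        (c := 1 * C) (hZ.mono (ℱ.le _)).aestronglyMeasurable (ae_of_all _ fun ω => ?_)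
      rw [norm_mul]
      refine mul_le_mul ?_ (hC l k ω) (norm_nonneg _) zero_le_one
      by_cases hω : ω ∈ G <;> simp [hω]
    have hzero : (∀ ω, D l k ω = 0) →
        Integrable (fun ω => G.indicator (fun _ => (1 : ℝ)) ω * E.κ l k ω * D l k ω) Q ∧
        ∫ ω, G.indicator (fun _ => (1 : ℝ)) ω * E.κ l k ω * D l k ω ∂Q = 0 := fun h => by
      simp [h]
    rcases le_total (pt E.m (l + 1)) s with h1 | h1
    · refine hzero fun ω => ?_
      simp only [hD]
      rw [min_eq_right h1, min_eq_right (hle.trans h1), min_eq_right (h1.trans hst),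
        min_eq_right ((hle.trans h1).trans hst)]; ring
    rcases le_total s (pt E.m l) with h2 | h2
    · rcases le_total t (pt E.m l) with h3 | h3
      · refine hzero fun ω => ?_
        simp only [hD]
        rw [min_eq_left h1, min_eq_left h2, min_eq_left h3, min_eq_left (h3.trans hle)]; ring
      · refine hinc (pt E.m l) (min t (pt E.m (l + 1))) (le_min h3 hle) h2 le_rfl fun ω => ?_
        simp only [hD]
        rw [min_eq_left h1, min_eq_left h2, min_eq_right h3]; ring
    · refine hinc s (min t (pt E.m (l + 1))) (le_min hst h1) le_rfl h2 fun ω => ?_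
      simp only [hD]
      rw [min_eq_left h1, min_eq_right h2, min_eq_right (h2.trans hst)]; ring
  simp only [e]
  rw [integral_finsetSum _ fun l _ => integrable_finsetSum _ fun k _ => (key l k).1]
  refine Finset.sum_eq_zero fun l _ => ?_
  rw [integral_finsetSum _ fun k _ => (key l k).1]
  exact Finset.sum_eq_zero fun k _ => (key l k).2

end ItoCalculus

namespace ItoCalculus

open RoughFMM (leb)

variable {Ω ι : Type*} [mΩ : MeasurableSpace Ω] {Q : Measure Ω} [IsProbabilityMeasure Q]
  {ℱ : Filtration ℝ≥0 mΩ} {ρ : ι → ι → ℝ} {W : ι → ℝ≥0 → Ω → ℝ} [Fintype ι]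

set_option linter.unusedSectionVars false

/-- A sum of nonnegative terms, each of which is dropped if the sum up to it exceeds `c`. -/
lemma sum_truncated_le {x : ℕ → ℝ} (hx : ∀ i, 0 ≤ x i) {c : ℝ} (hc : 0 ≤ c) (L : ℕ) :
    ∑ l ∈ Finset.range L, (if ∑ i ∈ Finset.range (l + 1), x i ≤ c then x l else 0) ≤ c := by
  have h : ∀ L, ∑ l ∈ Finset.range L, (if ∑ i ∈ Finset.range (l + 1), x i ≤ c then x l else 0) ≤
      min c (∑ l ∈ Finset.range L, x l) := by
    intro L
    induction L with
    | zero => simpa using hc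
    | succ L ih =>
      rw [Finset.sum_range_succ]
      split_ifs with h
      · rw [min_eq_right h, Finset.sum_range_succ]
        exact add_le_add (ih.trans (min_le_right _ _)) le_rfl
      · rw [add_zero]
        refine ih.trans (min_le_min le_rfl ?_)
        rw [Finset.sum_range_succ]
        linarith [hx L]
  exact (h L).trans (min_le_left _ _)

namespace Elem

/-- An elementary integral with bounded bracket is bounded in `L²`. -/
lemma integral_sq_le (hB : BM Q ℱ ρ W) (E : Elem ℱ W) (hβ : ∀ l ω, E.β l ω = 0)
    (h0 : ∀ ω, E.Y 0 ω = 0) {u : ℝ≥0} {c : ℝ}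
    (hc : ∀ ω, ∫ s in Set.Iic u, ∑ k, E.kap k s ω ^ 2 ∂leb ≤ c) :
    MemLp (E.Y u) 2 Q ∧ ∫ ω, E.Y u ω ^ 2 ∂Q ≤ (∑ k, ∑ l, |ρ k l|) * c := by
  obtain ⟨C, hC1, hC, -⟩ := E.exists_bound
  set L := cell E.m u + 1
  have huL : u ≤ pt E.m L := le_pt_cell_succ _ _
  set a : ℕ → ℝ≥0 := fun l => min u (pt E.m l) with ha
  have ham : Monotone a := fun i j h => min_le_min le_rfl (pt_mono _ h)
  set κ : ℕ → ι → Ω → ℝ := fun l k ω => if pt E.m l ≤ u then E.κ l k ω else 0 with hκ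
  have hκm : ∀ l k, StronglyMeasurable[ℱ (a l)] (κ l k) := by
    intro l k
    by_cases h : pt E.m l ≤ u
    · have e : a l = pt E.m l := min_eq_right h
      simp only [hκ, if_pos h]; exact (E.κ_meas l k).mono (ℱ.mono e.ge)
    · simp only [hκ, if_neg h]; exact stronglyMeasurable_const
  have hκb : ∀ l k ω, |κ l k ω| ≤ C := fun l k ω => by
    simp only [hκ]; split_ifs
    · exact hC l k ω
    · simp; linarith
  have hY : E.Y u = fun ω => ∑ l ∈ Finset.range L, ∑ k, κ l k ω *
      (W k (a (l + 1)) ω - W k (a l) ω) := by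
    funext ω
    rw [E.eq_sum ω L u huL, h0, zero_add]
    refine Finset.sum_congr rfl fun l _ => ?_
    rw [hβ, zero_mul, add_zero]
    refine Finset.sum_congr rfl fun k _ => ?_
    by_cases h : pt E.m l ≤ u
    · simp only [hκ, if_pos h, ha]
    · have h' : u ≤ pt E.m l := (not_le.1 h).le
      simp only [ha, min_eq_left h', min_eq_left (h'.trans (pt_mono _ (Nat.le_succ l))), sub_self,
        mul_zero]
  obtain ⟨h1, h2⟩ := hB.integral_sum_sq ham hκm hκb L
  rw [hY]
  refine ⟨h1.mono_exponent (by norm_num), ?_⟩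
  rw [h2]
  have hq : ∀ l, StronglyMeasurable fun ω => qcov ρ (fun k => κ l k ω) (fun k => κ l k ω) :=
    fun l => (Finset.stronglyMeasurable_fun_sum _ fun k _ => Finset.stronglyMeasurable_fun_sum _
        fun j _ => ((hκm l k).mul (hκm l j)).const_mul _).mono (ℱ.le _)
  have hi : ∀ l, Integrable (fun ω => qcov ρ (fun k => κ l k ω) (fun k => κ l k ω)) Q := fun l =>
    Integrable.of_bound (hq l).aestronglyMeasurable _ (ae_of_all _ fun ω =>
      abs_qcov_le ρ (fun k => hκb l k ω) (fun k => hκb l k ω))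
  simp only [← integral_const_mul]
  rw [← integral_finsetSum _ fun l _ => (hi l).const_mul _]
  have hle : ∀ ω, ∑ l ∈ Finset.range L, ((a (l + 1) : ℝ) - a l) *
      qcov ρ (fun k => κ l k ω) (fun k => κ l k ω) ≤ (∑ k, ∑ l, |ρ k l|) * c := by
    intro ω
    have h3 := hc ω
    have e : (fun s => ∑ k, E.kap k s ω ^ 2) = fun s =>
      (fun l => ∑ k, E.κ l k ω ^ 2) (cell E.m s) := rfl
    rw [e, setIntegral_cell (fun l => ∑ k, E.κ l k ω ^ 2) E.m L huL] at h3
    refine le_trans ?_ (mul_le_mul_of_nonneg_left h3 (by positivity))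
    rw [Finset.mul_sum]
    refine Finset.sum_le_sum fun l _ => ?_
    have h4 : (0 : ℝ) ≤ (a (l + 1) : ℝ) - a l := sub_nonneg.2 (by exact_mod_cast ham (Nat.le_succ l))
    have h5 : qcov ρ (fun k => κ l k ω) (fun k => κ l k ω) ≤
        (∑ k, ∑ l, |ρ k l|) * ∑ k, E.κ l k ω ^ 2 := by
      refine (le_abs_self _).trans ((abs_qcov_self_le ρ _).trans ?_)
      refine mul_le_mul_of_nonneg_left (Finset.sum_le_sum fun k _ => ?_)
        (Finset.sum_nonneg fun k _ => Finset.sum_nonneg fun l _ => abs_nonneg _)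
      simp only [hκ]; split_ifs
      · exact le_rfl
      · simp; positivity
    calc _ ≤ ((a (l + 1) : ℝ) - a l) * ((∑ k, ∑ l, |ρ k l|) * ∑ k, E.κ l k ω ^ 2) := by gcongr
      _ = _ := by simp only [ha]; ring
  calc _ ≤ ∫ _ω, (∑ k, ∑ l, |ρ k l|) * c ∂Q :=
        integral_mono (integrable_finsetSum _ fun l _ => (hi l).const_mul _) (integrable_const _) hle
    _ = _ := by simp

/-- The bracket up to time `t` at the end of a grid cell. -/
noncomputable def bracket (E : Elem ℱ W) (t : ℝ≥0) (l : ℕ) (ω : Ω) : ℝ :=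
  ∑ i ∈ Finset.range (l + 1), (((min t (pt E.m (i + 1)) : ℝ≥0) : ℝ) - (min t (pt E.m i) : ℝ≥0)) *
    ∑ k, E.κ i k ω ^ 2

lemma stronglyMeasurable_bracket (E : Elem ℱ W) (t : ℝ≥0) (l : ℕ) :
    StronglyMeasurable[ℱ (pt E.m l)] (E.bracket t l) :=
  Finset.stronglyMeasurable_fun_sum _ fun i hi => StronglyMeasurable.const_mul
    (Finset.stronglyMeasurable_fun_sum _ fun k _ => ((E.κ_meas i k).mono
      (ℱ.mono (pt_mono _ (Nat.lt_succ_iff.1 (Finset.mem_range.1 hi))))).pow 2) _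

/-- The stochastic integral part of an elementary Itô process, stopped before its bracket on
`[0, t]` exceeds `c`. -/
noncomputable def trunc (hW : ∀ k, StronglyAdapted ℱ (W k)) (E : Elem ℱ W) (t : ℝ≥0) (c : ℝ) :
    Elem ℱ W :=
  ofCoef hW E.m (fun l k => {ω | E.bracket t l ω ≤ c}.indicator (E.κ l k)) (fun _ _ => 0)
    (fun _ => 0)
    (fun l k => (E.κ_meas l k).indicator
      ((E.stronglyMeasurable_bracket t l).measurableSet_le stronglyMeasurable_const))
    (fun _ => stronglyMeasurable_const)
    (E.κ_bdd.imp fun C h l k ω => by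
      by_cases hω : ω ∈ {ω | E.bracket t l ω ≤ c}
      · rw [Set.indicator_of_mem hω]; exact h l k ω
      · rw [Set.indicator_of_notMem hω, abs_zero]; exact (abs_nonneg _).trans (h l k ω))
    ⟨0, by simp⟩ stronglyMeasurable_const

lemma trunc_zero (hW : ∀ k, StronglyAdapted ℱ (W k)) (E : Elem ℱ W) (t : ℝ≥0) (c : ℝ) (ω : Ω) :
    (E.trunc hW t c).Y 0 ω = 0 := ofCoef_zero hW _ _ _ _ _ _ _ _ _ _

lemma weight_nonneg (m : ℕ) (t : ℝ≥0) (l : ℕ) :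
    (0 : ℝ) ≤ ((min t (pt m (l + 1)) : ℝ≥0) : ℝ) - (min t (pt m l) : ℝ≥0) :=
  sub_nonneg.2 (by exact_mod_cast min_le_min le_rfl (pt_mono m (Nat.le_succ l)))

lemma trunc_bracket_le (hW : ∀ k, StronglyAdapted ℱ (W k)) (E : Elem ℱ W) (t : ℝ≥0) {c : ℝ}
    (hc : 0 ≤ c) (ω : Ω) : ∫ s in Set.Iic t, ∑ k, (E.trunc hW t c).kap k s ω ^ 2 ∂leb ≤ c := by
  have e : (fun s => ∑ k, (E.trunc hW t c).kap k s ω ^ 2) = fun s =>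
      (fun l => ∑ k, {ω | E.bracket t l ω ≤ c}.indicator (E.κ l k) ω ^ 2) (cell E.m s) := rfl
  rw [e, setIntegral_cell (fun l => ∑ k, {ω | E.bracket t l ω ≤ c}.indicator (E.κ l k) ω ^ 2) E.m _
    (le_pt_cell_succ E.m t)]
  refine le_trans (Finset.sum_le_sum fun l _ => ?_) (sum_truncated_le
    (x := fun l => (((min t (pt E.m (l + 1)) : ℝ≥0) : ℝ) - (min t (pt E.m l) : ℝ≥0)) *
      ∑ k, E.κ l k ω ^ 2) (fun l => mul_nonneg (weight_nonneg _ _ _) (by positivity)) hc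
        (cell E.m t + 1))
  by_cases hω : E.bracket t l ω ≤ c
  · have h' : ∑ i ∈ Finset.range (l + 1), (((min t (pt E.m (i + 1)) : ℝ≥0) : ℝ) -
        (min t (pt E.m i) : ℝ≥0)) * ∑ k, E.κ i k ω ^ 2 ≤ c := hω
    rw [if_pos h']
    simp only [Set.indicator_of_mem (show ω ∈ {ω | E.bracket t l ω ≤ c} from hω)]
    exact le_rfl
  · have h' : ¬ ∑ i ∈ Finset.range (l + 1), (((min t (pt E.m (i + 1)) : ℝ≥0) : ℝ) -
        (min t (pt E.m i) : ℝ≥0)) * ∑ k, E.κ i k ω ^ 2 ≤ c := hω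
    rw [if_neg h']
    simp [Set.indicator_of_notMem (show ω ∉ {ω | E.bracket t l ω ≤ c} from hω)]

lemma trunc_eq (hW : ∀ k, StronglyAdapted ℱ (W k)) (E : Elem ℱ W) {t : ℝ≥0} {c : ℝ} {ω : Ω}
    (h : ∫ s in Set.Iic t, ∑ k, E.kap k s ω ^ 2 ∂leb ≤ c) {u : ℝ≥0} (hu : u ≤ t) :
    (E.trunc hW t c).Y u ω = (E.mart hW).Y u ω := by
  have e : (fun s => ∑ k, E.kap k s ω ^ 2) = fun s =>
      (fun l => ∑ k, E.κ l k ω ^ 2) (cell E.m s) := rfl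
  rw [e, setIntegral_cell (fun l => ∑ k, E.κ l k ω ^ 2) E.m _ (le_pt_cell_succ E.m t)] at h
  have hL := hu.trans (le_pt_cell_succ E.m t)
  rw [(E.trunc hW t c).eq_sum ω (cell E.m t + 1) u hL, (E.mart hW).eq_sum ω (cell E.m t + 1) u hL,
    trunc_zero, mart_zero]
  congr 1
  refine Finset.sum_congr rfl fun l hl => ?_
  have hmem : ω ∈ {ω | E.bracket t l ω ≤ c} := by
    refine le_trans (Finset.sum_le_sum_of_subset_of_nonneg ?_ fun i _ _ =>
      mul_nonneg (weight_nonneg _ _ _) (by positivity)) h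
    exact Finset.range_mono (Finset.mem_range.1 hl)
  have hk : ∀ k, (E.trunc hW t c).κ l k ω = E.κ l k ω := fun k => Set.indicator_of_mem hmem _
  simp only [hk]
  rfl

end Elem

namespace IsIto

variable {Y : ℝ≥0 → Ω → ℝ} {H : ι → ℝ≥0 → Ω → ℝ} {b : ℝ≥0 → Ω → ℝ}

/-- The martingale property of `Y - ∫ b` for an Itô process with bounded characteristics. -/
theorem setIntegral_sub_eq_zero (hB : BM Q ℱ ρ W) (h : IsIto Q ℱ W Y H b) {C : ℝ} {s t : ℝ≥0}
    (hst : s ≤ t) (hY : ∀ᵐ ω ∂Q, ∀ u ≤ t, |Y u ω| ≤ C)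
    (hH : ∀ᵐ ω ∂Q, ∫ u in Set.Iic t, ∑ k, H k u ω ^ 2 ∂leb ≤ C)
    (hb : ∀ᵐ ω ∂Q, ∫ u in Set.Iic t, |b u ω| ∂leb ≤ C) {G : Set Ω} (hG : MeasurableSet[ℱ s] G) :
    ∫ ω in G, (Y t ω - Y s ω - ∫ u in Set.Ioc s t, b u ω ∂leb) ∂Q = 0 := by
  obtain ⟨E, hE⟩ := h
  have hW := hB.adapted
  have hGm := ℱ.le s G hG
  have hC : 0 ≤ C := by
    obtain ⟨ω, hω⟩ := hY.exists
    exact (abs_nonneg _).trans (hω t le_rfl)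
  set N : ℕ → Elem ℱ W := fun n => (E n).trunc hW t (C + 1) with hN
  set R := ∑ k, ∑ l, |ρ k l| with hR
  have hR0 : 0 ≤ R := Finset.sum_nonneg fun k _ => Finset.sum_nonneg fun l _ => abs_nonneg _
  have hbr : ∀ n ω, ∀ u ≤ t, ∫ v in Set.Iic u, ∑ k, (N n).kap k v ω ^ 2 ∂leb ≤ C + 1 := by
    intro n ω u hu
    refine le_trans (setIntegral_mono_set ?_ (ae_of_all _ fun v => ?_)
      (Set.Iic_subset_Iic.2 hu).eventuallyLE) ((E n).trunc_bracket_le hW t (by linarith) ω)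
    · obtain ⟨D, -, hD, -⟩ := (N n).exists_bound
      refine Integrable.of_bound (μ := lebT t) (Finset.measurable_fun_sum _ fun k _ =>
        ((N n).measurable_kap k ω).pow_const 2).aestronglyMeasurable (∑ _k : ι, D ^ 2)
        (ae_of_all _ fun v => (norm_sum_le _ _).trans (Finset.sum_le_sum fun k _ => ?_))
      rw [norm_pow]
      exact pow_le_pow_left₀ (norm_nonneg _) (hD _ k ω) 2
    · exact Finset.sum_nonneg fun k _ => sq_nonneg _
  have hL2 : ∀ n, ∀ u ≤ t, MemLp ((N n).Y u) 2 Q ∧ ∫ ω, (N n).Y u ω ^ 2 ∂Q ≤ R * (C + 1) :=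
    fun n u hu => (N n).integral_sq_le hB (fun _ _ => rfl) (fun ω => (E n).trunc_zero hW t _ ω)
      fun ω => hbr n ω u hu
  rw [← integral_indicator hGm]
  refine integral_eq_zero_of_tendsto
    (X := fun n => G.indicator fun ω => (N n).Y t ω - (N n).Y s ω) (K := 4 * (R * (C + 1)))
    (B := C + C + C) (fun n => ?_) (fun n => ?_) (fun n => ?_) ?_ ?_
  · exact ((hL2 n t le_rfl).1.sub (hL2 n s hst).1).indicator hGm
  · have i1 := (hL2 n t le_rfl).1.integrable_sq
    have i2 := (hL2 n s hst).1.integrable_sq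
    have i3 : MemLp (G.indicator fun ω => (N n).Y t ω - (N n).Y s ω) 2 Q :=
      ((hL2 n t le_rfl).1.sub (hL2 n s hst).1).indicator hGm
    calc _ ≤ ∫ ω, (2 * (N n).Y t ω ^ 2 + 2 * (N n).Y s ω ^ 2) ∂Q := by
          refine integral_mono i3.integrable_sq ((i1.const_mul 2).add (i2.const_mul 2)) fun ω => ?_
          by_cases hω : ω ∈ G
          · simp only [Set.indicator_of_mem hω]
            nlinarith [sq_nonneg ((N n).Y t ω + (N n).Y s ω)]
          · simp only [Set.indicator_of_notMem hω, zero_pow two_ne_zero]; positivity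
      _ ≤ 4 * (R * (C + 1)) := by
          rw [integral_add (i1.const_mul 2) (i2.const_mul 2), integral_const_mul,
            integral_const_mul]
          linarith [(hL2 n t le_rfl).2, (hL2 n s hst).2]
  · exact (N n).setIntegral_incr_eq_zero hB (fun _ _ => rfl) hst hG
  · filter_upwards [hE, hH] with ω ⟨a1, a2, a3⟩ a4
    have l1 : LConv 1 (fun n s => ∑ k, (E n).kap k s ω ^ 2) (fun s => ∑ k, H k s ω ^ 2) :=
      LConv.finset_sum le_rfl _ fun k _ => by simpa only [sq] using (a1 k).mul le_rfl (a1 k)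
    have t1 : Tendsto (fun n => ∫ u in Set.Iic t, ∑ k, (E n).kap k u ω ^ 2 ∂leb) atTop
        (𝓝 (∫ u in Set.Iic t, ∑ k, H k u ω ^ 2 ∂leb)) := by
      refine (l1.lunif_integral fun n T => ?_).tendsto t
      obtain ⟨D, -, hD, -⟩ := (E n).exists_bound
      refine Integrable.of_bound (μ := lebT T) (Finset.measurable_fun_sum _ fun k _ =>
        ((E n).measurable_kap k ω).pow_const 2).aestronglyMeasurable (∑ _k : ι, D ^ 2)
        (ae_of_all _ fun v => (norm_sum_le _ _).trans (Finset.sum_le_sum fun k _ => ?_))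
      rw [norm_pow]
      exact pow_le_pow_left₀ (norm_nonneg _) (hD _ k ω) 2
    have hev := t1.eventually (gt_mem_nhds (a4.trans_lt (lt_add_one C)))
    have t2 : ∀ u, Tendsto (fun n => ((E n).mart hW).Y u ω) atTop
        (𝓝 (Y u ω - Y 0 ω - ∫ v in Set.Iic u, b v ω ∂leb)) := by
      intro u
      have := ((a3.tendsto u).sub (a3.tendsto 0)).sub
        ((a2.lunif_integral fun n T => (E n).integrableOn_bet ω T).tendsto u)
      refine this.congr fun n => ?_
      rw [(E n).Y_eq hW u]; ring
    have t3 : Tendsto (fun n => (N n).Y t ω - (N n).Y s ω) atTop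
        (𝓝 (Y t ω - Y s ω - ∫ u in Set.Ioc s t, b u ω ∂leb)) := by
      have e := setIntegral_Iic_add_Ioc hst (a2.integrableOn t)
      have := (t2 t).sub (t2 s)
      rw [e] at this
      have e2 : Y t ω - Y 0 ω - (∫ v in Set.Iic s, b v ω ∂leb + ∫ v in Set.Ioc s t, b v ω ∂leb) -
        (Y s ω - Y 0 ω - ∫ v in Set.Iic s, b v ω ∂leb) =
          Y t ω - Y s ω - ∫ u in Set.Ioc s t, b u ω ∂leb := by ring
      rw [e2] at this
      refine this.congr' (hev.mono fun n hn => ?_)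
      rw [← (E n).trunc_eq hW hn.le le_rfl, ← (E n).trunc_eq hW hn.le hst]
    by_cases hω : ω ∈ G
    · simpa only [Set.indicator_of_mem hω] using t3
    · simpa only [Set.indicator_of_notMem hω] using tendsto_const_nhds
  · filter_upwards [hE, hY, hb] with ω ⟨_, a2, _⟩ a4 a5
    by_cases hω : ω ∈ G
    · simp only [Set.indicator_of_mem hω]
      have h1 : |∫ u in Set.Ioc s t, b u ω ∂leb| ≤ C :=
        calc _ ≤ ∫ u in Set.Ioc s t, |b u ω| ∂leb := abs_integral_le_integral_abs
          _ ≤ ∫ u in Set.Iic t, |b u ω| ∂leb := setIntegral_mono_set (a2.integrableOn t).abs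
              (ae_of_all _ fun _ => abs_nonneg _) Set.Ioc_subset_Iic_self.eventuallyLE
          _ ≤ C := a5
      refine (abs_sub _ _).trans (add_le_add ((abs_sub _ _).trans
        (add_le_add (a4 t le_rfl) (a4 s hst))) h1)
    · rw [Set.indicator_of_notMem hω]; simp; linarith

end IsIto

end ItoCalculus

namespace ItoCalculus

open RoughFMM (leb)

/-! ### Localization by smooth cutoffs -/

/-- A smooth decreasing function that is `1` on `(-∞, 1]` and `0` on `[2, ∞)`. -/
noncomputable def cutoff (x : ℝ) : ℝ := Real.smoothTransition (2 - x)

lemma contDiff_cutoff {n : ℕ∞} : ContDiff ℝ n cutoff :=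
  Real.smoothTransition.contDiff.comp (contDiff_const.sub contDiff_id)

lemma cutoff_eq_one {x : ℝ} (h : x ≤ 1) : cutoff x = 1 :=
  Real.smoothTransition.one_of_one_le (by linarith)

lemma cutoff_eq_zero {x : ℝ} (h : 2 ≤ x) : cutoff x = 0 :=
  Real.smoothTransition.zero_of_nonpos (by linarith)

lemma cutoff_nonneg (x : ℝ) : 0 ≤ cutoff x := Real.smoothTransition.nonneg _

lemma cutoff_le_one (x : ℝ) : cutoff x ≤ 1 := Real.smoothTransition.le_one _

lemma antitone_cutoff : Antitone cutoff := fun x y h =>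
  Real.smoothTransition.monotone (by linarith)

lemma continuous_cutoff : Continuous cutoff := (contDiff_cutoff (n := 0)).continuous

lemma contDiff_deriv_cutoff {n : ℕ} : ContDiff ℝ n (deriv cutoff) := by
  have h : ContDiff ℝ (n + 1) cutoff := by
    have := contDiff_cutoff (n := ((n + 1 : ℕ) : ℕ∞))
    exact_mod_cast this
  exact (contDiff_succ_iff_deriv.1 h).2.2

lemma hasDerivAt_cutoff (x : ℝ) : HasDerivAt cutoff (deriv cutoff x) x :=
  ((contDiff_cutoff (n := 1)).differentiable (by norm_num) x).hasDerivAt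

lemma hasDerivAt_deriv_cutoff (x : ℝ) : HasDerivAt (deriv cutoff) (deriv (deriv cutoff) x) x :=
  ((contDiff_deriv_cutoff (n := 1)).differentiable (by norm_num) x).hasDerivAt

lemma deriv_cutoff_nonpos (x : ℝ) : deriv cutoff x ≤ 0 := antitone_cutoff.deriv_nonpos

lemma deriv_cutoff_of_lt {x : ℝ} (h : x < 1) : deriv cutoff x = 0 := by
  have : cutoff =ᶠ[𝓝 x] fun _ => 1 := by
    filter_upwards [gt_mem_nhds h] with y hy
    exact cutoff_eq_one hy.le
  rw [this.deriv_eq]; simp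

lemma deriv_cutoff_of_ge {x : ℝ} (h : 2 ≤ x) : deriv cutoff x = 0 := by
  refine le_antisymm (deriv_cutoff_nonpos x) ?_
  -- the cutoff is minimal at `x`
  have : IsLocalMin cutoff x := Eventually.of_forall fun y => by
    rw [cutoff_eq_zero h]; exact cutoff_nonneg y
  rw [this.deriv_eq_zero]

lemma exists_deriv_cutoff_bound : ∃ D : ℝ, 0 ≤ D ∧ ∀ x, |deriv cutoff x| ≤ D := by
  obtain ⟨D, hD⟩ := (isCompact_Icc (a := (1 : ℝ)) (b := 2)).exists_bound_of_continuousOn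
    (contDiff_deriv_cutoff (n := 0)).continuous.continuousOn
  refine ⟨D, (norm_nonneg _).trans (hD 1 (by norm_num)), fun x => ?_⟩
  by_cases hx : x ∈ Set.Icc (1 : ℝ) 2
  · exact hD x hx
  · have : deriv cutoff x = 0 := by
      rw [Set.mem_Icc, not_and_or, not_le, not_le] at hx
      exact hx.elim deriv_cutoff_of_lt fun h => deriv_cutoff_of_ge h.le
    rw [this, abs_zero]; exact (norm_nonneg _).trans (hD 1 (by norm_num))

/-- A function that is dominated by the density of a clock, and that vanishes once the clock has
reached `c`, has integral at most `c`. -/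
lemma setIntegral_le_of_clock {a A g : ℝ≥0 → ℝ} (ha : ∀ s, 0 ≤ a s)
    (hint : ∀ T, IntegrableOn a (Set.Iic T) leb) (hA : ∀ t, A t = ∫ s in Set.Iic t, a s ∂leb)
    (hc : Continuous A) {D c : ℝ} (hD : 0 ≤ D) (hc0 : 0 ≤ c) (hg : ∀ s, |g s| ≤ D * a s)
    (hg0 : ∀ s, c ≤ A s → g s = 0) (t : ℝ≥0) : ∫ s in Set.Iic t, |g s| ∂leb ≤ D * c := by
  by_cases hgi : IntegrableOn (fun s => |g s|) (Set.Iic t) leb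
  swap
  · rw [integral_undef hgi]; positivity
  have hle : ∀ u ≤ t, ∫ s in Set.Iic u, |g s| ∂leb ≤ D * A u := fun u hu => by
    rw [hA, ← integral_const_mul]
    exact setIntegral_mono (hgi.mono_set (Set.Iic_subset_Iic.2 hu)) ((hint u).const_mul D) hg
  rcases le_total (A t) c with h | h
  · exact (hle t le_rfl).trans (by gcongr)
  have hmono : Monotone A := fun u v huv => by
    rw [hA, hA]
    exact setIntegral_mono_set (hint v) (ae_of_all _ ha) (Set.Iic_subset_Iic.2 huv).eventuallyLE
  have h0 : A 0 = 0 := by rw [hA, setIntegral_Iic_zero]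
  obtain ⟨u, hu, hu'⟩ := intermediate_value_Icc (zero_le : 0 ≤ t) hc.continuousOn
    (show c ∈ Set.Icc (A 0) (A t) from ⟨h0 ▸ hc0, h⟩)
  have h1 : ∫ s in Set.Ioc u t, |g s| ∂leb = 0 := by
    rw [setIntegral_congr_fun (g := fun _ => 0) measurableSet_Ioc, integral_zero]
    intro s hs
    simp only [hg0 s (hu'.ge.trans (hmono hs.1.le)), abs_zero]
  rw [setIntegral_Iic_add_Ioc hu.2 hgi, h1, add_zero]
  exact (hle u hu.2).trans (by rw [hu'])

variable {Ω ι : Type*} [mΩ : MeasurableSpace Ω] {Q : Measure Ω} [IsProbabilityMeasure Q]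
  {ℱ : Filtration ℝ≥0 mΩ} {ρ : ι → ι → ℝ} {W : ι → ℝ≥0 → Ω → ℝ} [Fintype ι]

set_option linter.unusedSectionVars false

namespace IsIto

variable {Y Z : ℝ≥0 → Ω → ℝ} {H G : ι → ℝ≥0 → Ω → ℝ} {b c : ℝ≥0 → Ω → ℝ}

lemma integrableOn (h : IsIto Q ℱ W Y H b) : ∀ᵐ ω ∂Q, ∀ T : ℝ≥0,
    (∀ k, IntegrableOn (fun s => H k s ω ^ 2) (Set.Iic T) leb) ∧
      IntegrableOn (fun s => b s ω) (Set.Iic T) leb := by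
  obtain ⟨E, hE⟩ := h
  filter_upwards [hE] with ω hω T
  exact ⟨fun k => ((hω.1 k).memLp T).integrable_sq, hω.2.1.integrableOn T⟩

lemma aestronglyMeasurable (h : IsIto Q ℱ W Y H b) (t : ℝ≥0) : AEStronglyMeasurable (Y t) Q := by
  obtain ⟨E, hE⟩ := h
  refine aestronglyMeasurable_of_tendsto_ae atTop
    (fun n => (((E n).Y_adapted t).mono (ℱ.le t)).aestronglyMeasurable) ?_
  filter_upwards [hE] with ω hω
  exact hω.2.2.tendsto t

/-- A smooth function of a process of finite variation. -/
lemma comp_finiteVariation (hB : BM Q ℱ ρ W) (h : IsIto Q ℱ W Y (fun _ _ _ => 0) b)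
    {f f₁ f₂ : ℝ → ℝ} (hf : ContDiff ℝ 3 f) (h1 : ∀ x, HasDerivAt f (f₁ x) x)
    (h2 : ∀ x, HasDerivAt f₁ (f₂ x) x) :
    IsIto Q ℱ W (fun s ω => f (Y s ω)) (fun _ _ _ => 0) fun s ω => f₁ (Y s ω) * b s ω :=
  (h.ito hB isOpen_univ (ae_of_all _ fun _ _ => trivial) hf.contDiffOn (fun x _ => h1 x)
    fun x _ => h2 x).congr' (by simp) (by simp) (by simp [qcov])

lemma cutoff_comp (hB : BM Q ℱ ρ W) (h : IsIto Q ℱ W Y (fun _ _ _ => 0) b) (r : ℝ) :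
    IsIto Q ℱ W (fun s ω => cutoff (r * Y s ω)) (fun _ _ _ => 0)
      fun s ω => r * deriv cutoff (r * Y s ω) * b s ω :=
  (((h.const_mul r).congr' (fun _ _ => rfl) (G := fun _ _ _ => 0) (by simp)
    (fun _ _ => rfl)).comp_finiteVariation hB (by exact_mod_cast contDiff_cutoff (n := 3))
      hasDerivAt_cutoff hasDerivAt_deriv_cutoff).congr' (fun _ _ => rfl) (by simp)
      (fun s ω => by ring)

/-- The integral of the drift is measurable, although the drift need not be jointly measurable. -/
lemma aestronglyMeasurable_setIntegral (hW : ∀ k, StronglyAdapted ℱ (W k))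
    (h : IsIto Q ℱ W Y H b) {s t : ℝ≥0} (hst : s ≤ t) :
    AEStronglyMeasurable (fun ω => ∫ u in Set.Ioc s t, b u ω ∂leb) Q := by
  obtain ⟨E, hE⟩ := h
  have hm : ∀ n, AEStronglyMeasurable (fun ω => ((E n).Y t ω - ((E n).mart hW).Y t ω) -
      ((E n).Y s ω - ((E n).mart hW).Y s ω)) Q := fun n =>
    ((((E n).Y_adapted t).mono (ℱ.le t)).sub
      ((((E n).mart hW).Y_adapted t).mono (ℱ.le t))).aestronglyMeasurable.sub
    ((((E n).Y_adapted s).mono (ℱ.le s)).sub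
      ((((E n).mart hW).Y_adapted s).mono (ℱ.le s))).aestronglyMeasurable
  refine aestronglyMeasurable_of_tendsto_ae atTop hm ?_
  filter_upwards [hE] with ω hω
  have hl := hω.2.1.lunif_integral fun n T => (E n).integrableOn_bet ω T
  have h1 := (hl.tendsto t).sub (hl.tendsto s)
  rw [setIntegral_Iic_add_Ioc hst (hω.2.1.integrableOn t), add_sub_cancel_left] at h1
  refine h1.congr fun n => ?_
  rw [(E n).Y_eq hW t, (E n).Y_eq hW s]
  ring

/-- The drift of `Y cutoff(r A)`, where `A = ∫ a` is a clock for `Y`. -/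
noncomputable def locDrift (Y A b a : ℝ≥0 → Ω → ℝ) (r : ℝ) (u : ℝ≥0) (ω : Ω) : ℝ :=
  Y u ω * (r * deriv cutoff (r * A u ω) * a u ω) + cutoff (r * A u ω) * b u ω

lemma two_le_of_inv_le {r x : ℝ} (hr : 0 < r) (hx : 2 * r⁻¹ ≤ x) : 2 ≤ r * x := by
  have := mul_le_mul_of_nonneg_left hx hr.le
  rwa [mul_left_comm, mul_inv_cancel₀ hr.ne', mul_one] at this

lemma locDrift_of_ge {Y A b a : ℝ≥0 → Ω → ℝ} {r : ℝ} {u : ℝ≥0} {ω : Ω} (hr : 0 < r)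
    (h : 2 * r⁻¹ ≤ A u ω) : locDrift Y A b a r u ω = 0 := by
  have := two_le_of_inv_le hr h
  rw [locDrift, deriv_cutoff_of_ge this, cutoff_eq_zero this]; ring

section Localized

variable {A a : ℝ≥0 → Ω → ℝ} {C D : ℝ} {s t : ℝ≥0}

/-- Multiplication by a smooth cutoff of a clock takes the place of stopping. -/
lemma localized (hB : BM Q ℱ ρ W) (h : IsIto Q ℱ W Y H b)
    (hA : IsIto Q ℱ W A (fun _ _ _ => 0) a) (r : ℝ) :
    IsIto Q ℱ W (fun u ω => Y u ω * cutoff (r * A u ω))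
      (fun k u ω => cutoff (r * A u ω) * H k u ω) (locDrift Y A b a r) :=
  (h.mul hB (hA.cutoff_comp hB r)).congr' (fun _ _ => rfl) (by simp) (by simp [locDrift, qcov])

/-- If the clock dominates the characteristics of a bounded process, then the localized process
has bounded characteristics, and hence the martingale property. -/
lemma setIntegral_localized (hB : BM Q ℱ ρ W) (h : IsIto Q ℱ W Y H b)
    (hA : IsIto Q ℱ W A (fun _ _ _ => 0) a) (ha : ∀ u ω, 0 ≤ a u ω)
    (hAa : ∀ᵐ ω ∂Q, ∀ u, A u ω = ∫ v in Set.Iic u, a v ω ∂leb) (hst : s ≤ t) (hD : 0 ≤ D)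
    (hY : ∀ᵐ ω ∂Q, ∀ u ≤ t, |Y u ω| ≤ C) (hH : ∀ᵐ ω ∂Q, ∀ u ≤ t, ∑ k, H k u ω ^ 2 ≤ D * a u ω)
    (hb : ∀ᵐ ω ∂Q, ∀ u ≤ t, |b u ω| ≤ D * a u ω) {r : ℝ} (hr : 0 < r) {G : Set Ω}
    (hG : MeasurableSet[ℱ s] G) :
    ∫ ω in G, (Y t ω * cutoff (r * A t ω) - Y s ω * cutoff (r * A s ω) -
      ∫ u in Set.Ioc s t, locDrift Y A b a r u ω ∂leb) ∂Q = 0 := by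
  have hAc := hA.continuous hB
  have hai : ∀ᵐ ω ∂Q, ∀ T, IntegrableOn (fun u => a u ω) (Set.Iic T) leb :=
    hA.integrableOn.mono fun ω hω T => (hω T).2
  have hC : 0 ≤ C := by
    obtain ⟨ω, hω⟩ := hY.exists
    exact (abs_nonneg _).trans (hω t le_rfl)
  obtain ⟨D₀, hD₀, hD₀'⟩ := exists_deriv_cutoff_bound
  set K : ℝ := (C * (r * D₀) + D) * (2 * r⁻¹)
  set C' := max C (max (D * (2 * r⁻¹)) K)
  refine (h.localized hB hA r).setIntegral_sub_eq_zero hB (C := C') hst ?_ ?_ ?_ hG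
  · filter_upwards [hY] with ω hω u hu
    rw [abs_mul, abs_of_nonneg (cutoff_nonneg _)]
    exact ((mul_le_of_le_one_right (abs_nonneg _) (cutoff_le_one _)).trans (hω u hu)).trans
      (le_max_left _ _)
  · filter_upwards [hAc, hai, hAa, hH] with ω h2 h3 h4 h5
    refine le_trans ?_ ((le_max_left _ _).trans (le_max_right _ _))
    have := setIntegral_le_of_clock (a := fun s => a s ω) (A := fun s => A s ω)
      (g := fun u => if u ≤ t then ∑ k, (cutoff (r * A u ω) * H k u ω) ^ 2 else 0)
      (D := D) (c := 2 * r⁻¹) (fun s => ha s ω) h3 h4 h2 hD (by positivity)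
      (fun u => ?_) (fun u hu => ?_) t
    · refine le_trans (le_of_eq ?_) this
      refine setIntegral_congr_fun measurableSet_Iic fun u hu => ?_
      simp only [if_pos (Set.mem_Iic.1 hu)]
      exact (abs_of_nonneg (Finset.sum_nonneg fun k _ => sq_nonneg _)).symm
    · split_ifs with hut
      · rw [abs_of_nonneg (Finset.sum_nonneg fun k _ => sq_nonneg _)]
        refine le_trans (Finset.sum_le_sum fun k _ => ?_) (h5 u hut)
        rw [mul_pow]
        exact mul_le_of_le_one_left (sq_nonneg _)
          (pow_le_one₀ (cutoff_nonneg _) (cutoff_le_one _))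
      · rw [abs_zero]; exact mul_nonneg hD (ha u ω)
    · simp [cutoff_eq_zero (two_le_of_inv_le hr hu)]
  · filter_upwards [hY, hAc, hai, hAa, hb] with ω h1 h2 h3 h4 h5
    refine le_trans ?_ ((le_max_right _ _).trans (le_max_right _ _))
    have := setIntegral_le_of_clock (a := fun s => a s ω) (A := fun s => A s ω)
      (g := fun u => if u ≤ t then locDrift Y A b a r u ω else 0)
      (D := C * (r * D₀) + D) (c := 2 * r⁻¹) (fun s => ha s ω) h3 h4 h2 (by positivity)
      (by positivity) (fun u => ?_) (fun u hu => ?_) t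
    · refine le_trans (le_of_eq ?_) this
      refine setIntegral_congr_fun measurableSet_Iic fun u hu => ?_
      simp only [if_pos (Set.mem_Iic.1 hu)]
    · have ha' := ha u ω
      split_ifs with hut
      · refine (abs_add_le _ _).trans ?_
        rw [add_mul]
        refine add_le_add ?_ ?_
        · rw [abs_mul, abs_mul, abs_mul, abs_of_pos hr, abs_of_nonneg ha', mul_assoc C]
          exact mul_le_mul (h1 u hut) (by gcongr; exact hD₀' _) (by positivity) hC
        · rw [abs_mul, abs_of_nonneg (cutoff_nonneg _)]
          exact (mul_le_of_le_one_left (abs_nonneg _) (cutoff_le_one _)).trans (h5 u hut)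
      · rw [abs_zero]; positivity
    · rw [locDrift_of_ge hr hu, ite_self]

end Localized

/-- A bounded Itô process without drift is a martingale. -/
theorem setIntegral_sub_eq_zero_of_bounded (hB : BM Q ℱ ρ W)
    (h : IsIto Q ℱ W Y H fun _ _ => 0) {C : ℝ} {s t : ℝ≥0} (hst : s ≤ t)
    (hY : ∀ᵐ ω ∂Q, ∀ u ≤ t, |Y u ω| ≤ C) {G : Set Ω} (hG : MeasurableSet[ℱ s] G) :
    ∫ ω in G, (Y t ω - Y s ω) ∂Q = 0 := by
  set a : ℝ≥0 → Ω → ℝ := fun s ω => ∑ k, H k s ω ^ 2 with ha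
  set A : ℝ≥0 → Ω → ℝ := fun t ω => ∫ s in Set.Iic t, a s ω ∂leb with hA
  have ha0 : ∀ s ω, 0 ≤ a s ω := fun s ω => Finset.sum_nonneg fun k _ => sq_nonneg _
  have hAI : IsIto Q ℱ W A (fun _ _ _ => 0) a :=
    (h.clock hB.adapted).congr' (by simp [hA, ha]) (by simp) (by simp [ha])
  have hAc := hAI.continuous hB
  have hC : 0 ≤ C := by
    obtain ⟨ω, hω⟩ := hY.exists
    exact (abs_nonneg _).trans (hω t le_rfl)
  obtain ⟨D, hD0, hD⟩ := exists_deriv_cutoff_bound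
  have hai : ∀ᵐ ω ∂Q, ∀ T, IntegrableOn (fun s => a s ω) (Set.Iic T) leb :=
    hAI.integrableOn.mono fun ω hω T => (hω T).2
  set r : ℕ → ℝ := fun m => ((m : ℝ) + 1)⁻¹ with hr
  have hr0 : ∀ m, 0 < r m := fun m => by simp only [hr]; positivity
  set d : ℕ → ℝ≥0 → Ω → ℝ := fun m => locDrift Y A (fun _ _ => 0) a (r m) with hd
  have hZ := fun m => h.localized hB hAI (r m)
  have hz := fun m => h.setIntegral_localized hB hAI ha0 (ae_of_all _ fun _ _ => rfl) hst
    zero_le_one hY (ae_of_all _ fun ω u _ => by simp [ha])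
    (ae_of_all _ fun ω u _ => by simpa using ha0 u ω) (hr0 m) hG
  have hdb : ∀ m, ∀ᵐ ω ∂Q, ∫ u in Set.Iic t, |d m u ω| ∂leb ≤ 2 * C * D := by
    intro m
    have hrm := hr0 m
    filter_upwards [hY, hAc, hai] with ω h1 h2 h3
    have := setIntegral_le_of_clock (a := fun s => a s ω) (A := fun s => A s ω)
      (g := fun s => if s ≤ t then d m s ω else 0) (D := C * (r m * D)) (c := 2 * (r m)⁻¹)
      (fun s => ha0 s ω) h3 (fun _ => rfl) h2 (by positivity) (by positivity) (fun s => ?_)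
      (fun s hs => ?_) t
    · calc ∫ u in Set.Iic t, |d m u ω| ∂leb
          = ∫ u in Set.Iic t, |if u ≤ t then d m u ω else 0| ∂leb :=
            setIntegral_congr_fun measurableSet_Iic fun u hu => by
              simp only [if_pos (Set.mem_Iic.1 hu)]
        _ ≤ C * (r m * D) * (2 * (r m)⁻¹) := this
        _ = 2 * C * D := by have := hrm.ne'; field_simp
    · have := ha0 s ω
      split_ifs with hs
      · simp only [hd, locDrift, mul_zero, add_zero]
        rw [abs_mul, abs_mul, abs_mul, abs_of_pos hrm, abs_of_nonneg this, mul_assoc C]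
        exact mul_le_mul (h1 s hs) (by gcongr; exact hD _) (by positivity) hC
      · rw [abs_zero]; positivity
    · simp only [hd, locDrift_of_ge hrm hs, ite_self]
  have hYφ : ∀ m, ∀ᵐ ω ∂Q, ∀ u ≤ t, |Y u ω * cutoff (r m * A u ω)| ≤ C := fun m => by
    filter_upwards [hY] with ω hω u hu
    rw [abs_mul, abs_of_nonneg (cutoff_nonneg _)]
    exact (mul_le_of_le_one_right (abs_nonneg _) (cutoff_le_one _)).trans (hω u hu)
  have hlim := tendsto_integral_of_dominated_convergence (μ := Q.restrict G)
    (F := fun m ω => Y t ω * cutoff (r m * A t ω) - Y s ω * cutoff (r m * A s ω) -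
      ∫ u in Set.Ioc s t, d m u ω ∂leb)
    (f := fun ω => Y t ω - Y s ω) (fun _ => C + C + 2 * C * D)
    (fun m => ((((hZ m).aestronglyMeasurable t).sub ((hZ m).aestronglyMeasurable s)).sub
      ((hZ m).aestronglyMeasurable_setIntegral hB.adapted hst)).restrict) (integrable_const _)
    (fun m => ?_) ?_
  · simp only [hd, hz] at hlim
    exact (tendsto_nhds_unique hlim tendsto_const_nhds)
  · refine ae_restrict_of_ae ?_
    filter_upwards [hYφ m, hdb m, (hZ m).integrableOn] with ω h1 h2 h3
    have h4 : |∫ u in Set.Ioc s t, d m u ω ∂leb| ≤ 2 * C * D :=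
      calc _ ≤ ∫ u in Set.Ioc s t, |d m u ω| ∂leb := abs_integral_le_integral_abs
        _ ≤ ∫ u in Set.Iic t, |d m u ω| ∂leb := setIntegral_mono_set (h3 t).2.abs
            (ae_of_all _ fun _ => abs_nonneg _) Set.Ioc_subset_Iic_self.eventuallyLE
        _ ≤ _ := h2
    exact (abs_sub _ _).trans (add_le_add ((abs_sub _ _).trans
        (add_le_add (h1 t le_rfl) (h1 s hst))) h4)
  · refine ae_restrict_of_ae ?_
    filter_upwards [hai] with ω h3
    have hmono : ∀ u ≤ t, A u ω ≤ A t ω := fun u hu =>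
      setIntegral_mono_set (h3 t) (ae_of_all _ fun s => ha0 s ω) (Set.Iic_subset_Iic.2 hu).eventuallyLE
    have ht : Tendsto (fun m => r m * A t ω) atTop (𝓝 0) := by
      have : Tendsto r atTop (𝓝 0) := by
        simpa only [hr, one_div] using tendsto_one_div_add_atTop_nhds_zero_nat (𝕜 := ℝ)
      simpa using this.mul_const (A t ω)
    refine tendsto_const_nhds.congr' ?_
    filter_upwards [ht.eventually (gt_mem_nhds one_pos)] with m hm
    have hu : ∀ u ≤ t, r m * A u ω < 1 := fun u hu =>
      (mul_le_mul_of_nonneg_left (hmono u hu) (hr0 m).le).trans_lt hm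
    have e2 : ∫ u in Set.Ioc s t, d m u ω ∂leb = 0 := by
      rw [setIntegral_congr_fun (g := fun _ => 0) measurableSet_Ioc, integral_zero]
      intro u h
      simp only [hd, locDrift, deriv_cutoff_of_lt (hu u h.2)]
      ring
    rw [cutoff_eq_one (hu t le_rfl).le, cutoff_eq_one (hu s hst).le, e2]; ring

end IsIto

end ItoCalculus

namespace ItoCalculus

open RoughFMM (leb SimpleProcess IsItoIntegral TendstoZeroInProb)

/-! ### Recovering Itô integrals in the sense of simple processes -/

variable {Ω : Type*} [mΩ : MeasurableSpace Ω] {Q : Measure Ω} [IsProbabilityMeasure Q]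
  {ℱ : Filtration ℝ≥0 mΩ} {ρ : Unit → Unit → ℝ} {B : ℝ≥0 → Ω → ℝ}

set_option linter.unusedSectionVars false

lemma TendstoZeroInProb.of_ae {f : ℕ → Ω → ℝ≥0∞} (hm : ∀ n, AEMeasurable (f n) Q)
    (h : ∀ᵐ ω ∂Q, Tendsto (fun n => f n ω) atTop (𝓝 0)) : TendstoZeroInProb Q f := by
  have key : ∀ ε : ℝ≥0∞, 0 < ε → ε ≠ ∞ → Tendsto (fun n => Q {ω | ε ≤ f n ω}) atTop (𝓝 0) := by
    intro ε hε hε'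
    have hm' : ∀ n, AEMeasurable (fun ω => min (f n ω) ε) Q := fun n => (hm n).min aemeasurable_const
    have h1 : Tendsto (fun n => ∫⁻ ω, min (f n ω) ε ∂Q) atTop (𝓝 (∫⁻ _ω, 0 ∂Q)) := by
      refine tendsto_lintegral_of_dominated_convergence' (fun _ => ε) hm'
        (fun n => ae_of_all _ fun ω => min_le_right _ _) ?_ ?_
      · simpa using hε'
      · filter_upwards [h] with ω hω
        have := hω.min (tendsto_const_nhds (x := ε))
        simpa using this
    rw [lintegral_zero] at h1
    have h2 : Tendsto (fun n => (∫⁻ ω, min (f n ω) ε ∂Q) / ε) atTop (𝓝 0) := by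
      have := ENNReal.Tendsto.div_const h1 (Or.inr hε.ne')
      simpa using this
    refine tendsto_of_tendsto_of_tendsto_of_le_of_le tendsto_const_nhds h2 (fun _ => zero_le)
      fun n => ?_
    rw [ENNReal.le_div_iff_mul_le (Or.inl hε.ne') (Or.inl hε'), mul_comm]
    refine le_trans (mul_le_mul_right (measure_mono fun ω hω => ?_) _)
      (mul_meas_ge_le_lintegral₀ (hm' n) ε)
    have h3 : ε ≤ f n ω := hω
    exact le_min h3 le_rfl
  intro ε hε
  by_cases hε' : ε = ∞
  · refine tendsto_of_tendsto_of_tendsto_of_le_of_le tendsto_const_nhds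
      (key 1 one_pos ENNReal.one_ne_top) (fun _ => zero_le) fun n => measure_mono fun ω hω => ?_
    have h3 : ε ≤ f n ω := hω
    have h4 : 1 ≤ f n ω := le_trans (by rw [hε']; exact le_top) h3
    exact h4
  · exact key ε hε hε'

/-- The supremum over a compact time interval of a continuous function is one over countably many
times. -/
lemma iSup_Iic_eq {g : ℝ≥0 → ℝ≥0∞} (hg : Continuous g) (t : ℝ≥0) :
    ⨆ s ∈ Set.Iic t, g s = ⨆ i : ℕ, g (min (TopologicalSpace.denseSeq ℝ≥0 i) t) := by
  refine le_antisymm (iSup₂_le fun s hs => ?_) (iSup_le fun i =>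
    le_iSup₂_of_le (min (TopologicalSpace.denseSeq ℝ≥0 i) t) (Set.mem_Iic.2 (min_le_right _ _)) le_rfl)
  set c := ⨆ i : ℕ, g (min (TopologicalSpace.denseSeq ℝ≥0 i) t) with hc
  have hcl : IsClosed {u : ℝ≥0 | g (min u t) ≤ c} :=
    isClosed_le (hg.comp (continuous_id.min continuous_const)) continuous_const
  have hsub : Set.range (TopologicalSpace.denseSeq ℝ≥0) ⊆ {u : ℝ≥0 | g (min u t) ≤ c} := by
    rintro _ ⟨i, rfl⟩
    exact le_iSup (fun i : ℕ => g (min (TopologicalSpace.denseSeq ℝ≥0 i) t)) i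
  have huniv := hcl.closure_subset_iff.2 hsub
  rw [(TopologicalSpace.denseRange_denseSeq ℝ≥0).closure_range] at huniv
  have := huniv (Set.mem_univ s)
  rwa [Set.mem_ofPred_eq, min_eq_left (Set.mem_Iic.1 hs)] at this

namespace Elem

/-- The simple predictable process given by the diffusion coefficients of an elementary process up
to the integer time `n`. -/
noncomputable def toSimple (E : Elem ℱ fun _ : Unit => B) (n : ℕ) : SimpleProcess ℱ where
  n := n * 2 ^ E.m
  t := pt E.m
  mono := pt_mono _
  c l := E.κ l ()
  measurable_c l := E.κ_meas l ()
  bounded_c l := E.κ_bdd.imp fun _ h ω => h l () ω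

lemma toSimple_value (E : Elem ℱ fun _ : Unit => B) {n : ℕ} {s : ℝ≥0} (hs : 0 < s) (hn : s ≤ n)
    (ω : Ω) : (E.toSimple n).value s ω = E.kap () s ω := by
  obtain ⟨h1, h2⟩ := cell_spec (m := E.m) hs
  have hl : cell E.m s < n * 2 ^ E.m := by
    rw [← pt_mul_pow E.m n] at hn
    exact (pt_strictMono E.m).lt_iff_lt.1 (h1.trans_le hn)
  change ∑ l ∈ Finset.range (n * 2 ^ E.m),
    (Set.Ioc (pt E.m l) (pt E.m (l + 1))).indicator (fun _ => E.κ l () ω) s = E.κ (cell E.m s) () ω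
  rw [Finset.sum_eq_single_of_mem (cell E.m s) (Finset.mem_range.2 hl),
    Set.indicator_of_mem (Set.mem_Ioc.2 ⟨h1, h2⟩)]
  intro l _ hne
  exact Set.indicator_of_notMem (fun h => hne (cell_eq h.1 h.2).symm) _

lemma toSimple_integral (hB : StronglyAdapted ℱ B) (E : Elem ℱ fun _ : Unit => B) {n : ℕ}
    {u : ℝ≥0} (hn : u ≤ n) (ω : Ω) :
    (E.toSimple n).integral B u ω = (E.mart fun _ => hB).Y u ω := by
  rw [(E.mart fun _ => hB).eq_sum ω (n * 2 ^ E.m) u (by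
    change u ≤ pt E.m _; rwa [pt_mul_pow]), mart_zero, zero_add]
  refine Finset.sum_congr rfl fun l _ => ?_
  have : (E.mart fun _ => hB).β l ω = 0 := rfl
  rw [this, zero_mul, add_zero, Fintype.sum_unique]
  rfl

end Elem

lemma measurable_progressive {H : ℝ≥0 → Ω → ℝ} (hH : IsStronglyProgressive ℱ H) (t : ℝ≥0) :
    Measurable fun p : ℝ≥0 × Ω => H (min p.1 t) p.2 := by
  have h := ((hH t).mono (sup_le_sup le_rfl (MeasurableSpace.comap_mono (ℱ.le t)) :
    Subtype.instMeasurableSpace.prod (ℱ t) ≤ Subtype.instMeasurableSpace.prod mΩ)).measurable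
  exact h.comp (g := fun p : Set.Iic t × Ω => H p.1 p.2)
    (f := fun p : ℝ≥0 × Ω => ((⟨min p.1 t, Set.mem_Iic.2 (min_le_right _ _)⟩ : Set.Iic t), p.2))
    ((Measurable.subtype_mk (measurable_fst.min measurable_const)).prodMk measurable_snd)

/-- The stochastic integral part of an Itô process that is driven by one Brownian motion is an Itô
integral. -/
theorem IsIto.exists_isItoIntegral (hB : BM Q ℱ ρ fun _ : Unit => B) {Y : ℝ≥0 → Ω → ℝ}
    {H : Unit → ℝ≥0 → Ω → ℝ} {b : ℝ≥0 → Ω → ℝ} (h : IsIto Q ℱ (fun _ : Unit => B) Y H b)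
    (hp : ∃ H' : ℝ≥0 → Ω → ℝ, IsStronglyProgressive ℱ H' ∧
      ∀ᵐ ω ∂Q, ∀ᵐ s ∂leb, H' s ω = H () s ω) :
    ∃ I : ℝ≥0 → Ω → ℝ, IsItoIntegral Q ℱ B (H ()) I ∧
      ∀ᵐ ω ∂Q, ∀ t : ℝ≥0, I t ω = Y t ω - Y 0 ω - ∫ s in Set.Iic t, b s ω ∂leb := by
  obtain ⟨E, hE⟩ := h
  have hBa : StronglyAdapted ℱ B := hB.adapted ()
  set N : ℕ → Elem ℱ fun _ : Unit => B := fun n => (E n).mart fun _ => hBa with hN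
  set I : ℝ≥0 → Ω → ℝ := fun t ω => limUnder atTop fun n => (N n).Y t ω with hI
  have hbet : ∀ᵐ ω ∂Q, LUnif (fun n t => (N n).Y t ω) (fun t => I t ω) ∧
      ∀ t : ℝ≥0, I t ω = Y t ω - Y 0 ω - ∫ s in Set.Iic t, b s ω ∂leb := by
    filter_upwards [hE] with ω ⟨_, a2, a3⟩
    have l1 := a2.lunif_integral fun n T => (E n).integrableOn_bet ω T
    have l0 : LUnif (fun n _ => (E n).Y 0 ω) (fun _ => Y 0 ω) := by
      intro T
      rw [Metric.tendstoUniformlyOn_iff]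
      intro ε hε
      filter_upwards [Metric.tendsto_nhds.1 (a3.tendsto 0) ε hε] with n hn s _
      rwa [dist_comm]
    have l2 := (a3.add (l0.const_mul (-1))).add (l1.const_mul (-1))
    have e1 : (fun n t => (N n).Y t ω) = fun n s => (E n).Y s ω + -1 * (E n).Y 0 ω +
        -1 * ∫ v in Set.Iic s, (E n).bet v ω ∂leb := by
      funext n t
      rw [(E n).Y_eq (fun _ => hBa) t]; simp only [hN]; ring
    have e2 : ∀ t, I t ω = Y t ω + -1 * Y 0 ω + -1 * ∫ s in Set.Iic t, b s ω ∂leb := by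
      intro t
      have := l2.tendsto t
      have e3 := fun n => congrFun (congrFun e1 n) t
      simp only [← e3] at this
      exact this.limUnder_eq
    refine ⟨?_, fun t => by rw [e2 t]; ring⟩
    rw [e1, funext e2]
    exact l2
  have hIc : ∀ᵐ ω ∂Q, Continuous fun t => I t ω := by
    filter_upwards [hbet, hB.continuous] with ω h1 h2
    exact h1.1.continuous fun n => (N n).continuous h2
  have hIa : StronglyAdapted ℱ I := fun t =>
    @StronglyMeasurable.limUnder ℕ Ω ℝ (ℱ t) _ _ atTop _ _ _ _ fun n => (N n).Y_adapted t
  refine ⟨I, ⟨hIa, hIc, hp, fun n => (E n).toSimple n, fun t => ⟨?_, ?_⟩⟩,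
    hbet.mono fun ω hω => hω.2⟩
  · obtain ⟨H', hH', hHH⟩ := hp
    refine TendstoZeroInProb.of_ae (fun n => ?_) ?_
    · have hm : Measurable fun p : ℝ≥0 × Ω => ENNReal.ofReal
          ((((E n).toSimple n).value p.1 p.2 - H' (min p.1 t) p.2) ^ 2) := by
        refine (Measurable.pow_const (Measurable.sub ?_ (measurable_progressive hH' t)) 2).ennreal_ofReal
        simp only [Simple.value_eq]
        exact Finset.measurable_fun_sum _ fun i _ => Measurable.mul
          (((Simple.measurable_before _).comp measurable_fst).sub
            ((Simple.measurable_before _).comp measurable_fst))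
          (((((E n).toSimple n).measurable_c i).mono (ℱ.le _)).measurable.comp measurable_snd)
      refine (hm.lintegral_prod_left' (μ := lebT t)).aemeasurable.congr ?_
      filter_upwards [hHH] with ω hω
      refine lintegral_congr_ae ?_
      filter_upwards [ae_restrict_of_ae hω, ae_restrict_mem measurableSet_Iic] with s h1 h2
      rw [min_eq_left (Set.mem_Iic.1 h2), h1]
    · filter_upwards [hE] with ω ⟨a1, _, _⟩
      have h1 := (a1 ()).tendsto t
      have h2 : Tendsto (fun n => (eLpNorm ((fun s => (E n).kap () s ω) - fun s => H () s ω) 2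
          (lebT t)) ^ (2 : ℝ)) atTop (𝓝 0) := by
        have := (ENNReal.continuous_rpow_const (y := 2)).tendsto 0 |>.comp h1
        simpa [Function.comp_def] using this
      refine h2.congr' ?_
      filter_upwards [eventually_ge_atTop ⌈t⌉₊] with n hn
      have htn : t ≤ n := (Nat.le_ceil t).trans (by exact_mod_cast hn)
      rw [eLpNorm_two_eq, ← ENNReal.rpow_mul]
      norm_num
      refine lintegral_congr_ae ?_
      have h0 : ∀ᵐ s ∂leb, s ≠ 0 := by rw [ae_iff]; simp
      filter_upwards [ae_restrict_of_ae h0, ae_restrict_mem measurableSet_Iic] with s h1 h2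
      rw [(E n).toSimple_value (pos_iff_ne_zero.2 h1) ((Set.mem_Iic.1 h2).trans htn)]
  · have e1 : ∀ᶠ n : ℕ in atTop, ∀ ω, ∀ s ∈ Set.Iic t, ((E n).toSimple n).integral B s ω =
        (N n).Y s ω := by
      filter_upwards [eventually_ge_atTop ⌈t⌉₊] with n hn ω s hs
      have htn : t ≤ n := (Nat.le_ceil t).trans (by exact_mod_cast hn)
      exact (E n).toSimple_integral hBa ((Set.mem_Iic.1 hs).trans htn) ω
    have hlim : TendstoZeroInProb Q fun n ω =>
        ⨆ s ∈ Set.Iic t, ENNReal.ofReal |(N n).Y s ω - I s ω| := by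
      refine TendstoZeroInProb.of_ae (fun n => ?_) ?_
      · have hm : Measurable fun ω => ⨆ i : ℕ, ENNReal.ofReal
            |(N n).Y (min (TopologicalSpace.denseSeq ℝ≥0 i) t) ω -
              I (min (TopologicalSpace.denseSeq ℝ≥0 i) t) ω| := by
          refine Measurable.iSup fun i => Measurable.ennreal_ofReal ?_
          have m1 : ∀ u, Measurable ((N n).Y u) := fun u =>
            (((N n).Y_adapted u).mono (ℱ.le u)).measurable
          have m2 : ∀ u, Measurable (I u) := fun u => ((hIa u).mono (ℱ.le u)).measurable
          exact ((m1 _).sub (m2 _)).norm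
        refine hm.aemeasurable.congr ?_
        filter_upwards [hIc, hB.continuous] with ω h1 h2
        have h3 : Continuous fun s => |(N n).Y s ω - I s ω| :=
          (((N n).continuous h2).sub h1).abs
        exact (iSup_Iic_eq (ENNReal.continuous_ofReal.comp h3) t).symm
      · filter_upwards [hbet] with ω ⟨h1, _⟩
        rw [ENNReal.tendsto_nhds_zero]
        intro ε hε
        rcases eq_or_ne ε ∞ with rfl | hε'
        · exact Eventually.of_forall fun _ => le_top
        filter_upwards [Metric.tendstoUniformlyOn_iff.1 (h1 t) _
          (ENNReal.toReal_pos hε.ne' hε')] with n hn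
        refine iSup₂_le fun s hs => ?_
        rw [← ENNReal.ofReal_toReal hε']
        have := hn s hs
        rw [dist_comm, Real.dist_eq] at this
        exact ENNReal.ofReal_le_ofReal this.le
    intro ε hε
    refine (hlim ε hε).congr' ?_
    filter_upwards [e1] with n hn
    congr 1
    ext ω
    simp only [Set.mem_ofPred_eq]
    have h3 : (⨆ s ∈ Set.Iic t, ENNReal.ofReal |((E n).toSimple n).integral B s ω - I s ω|) =
        ⨆ s ∈ Set.Iic t, ENNReal.ofReal |(N n).Y s ω - I s ω| :=
      biSup_congr fun s hs => by rw [hn ω s hs]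
    rw [h3]

end ItoCalculus

namespace ItoCalculus

open RoughFMM (leb SimpleProcess IsItoIntegral IsStochIntegral IsCorrelatedBM)

/-! ### Correlated Brownian motions and the trivial initial σ-algebra -/

variable {Ω ι : Type*} [mΩ : MeasurableSpace Ω] {Q : Measure Ω} [IsProbabilityMeasure Q]
  {ℱ : Filtration ℝ≥0 mΩ}

lemma integral_pow_four_gaussianReal (v : ℝ≥0) :
    ∫ x, x ^ 4 ∂gaussianReal 0 v = (∫ x, x ^ 4 ∂gaussianReal 0 1) * (v : ℝ) ^ 2 := by
  have h := gaussianReal_map_const_mul (μ := 0) (v := 1) (√(v : ℝ))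
  have e : (NNReal.mk (√(v : ℝ) ^ 2) (sq_nonneg _)) * 1 = v := by
    rw [mul_one]; ext; simp
  rw [mul_zero, e] at h
  rw [← h, integral_map (by fun_prop) (by fun_prop)]
  have h4 : √(v : ℝ) ^ 4 = (v : ℝ) ^ 2 := by
    rw [show (4 : ℕ) = 2 * 2 from rfl, pow_mul, Real.sq_sqrt v.coe_nonneg]
  simp only [mul_pow, h4]
  rw [integral_const_mul, mul_comm]

lemma BM.of_isCorrelatedBM [Fintype ι] [DecidableEq ι] {ρ : Matrix ι ι ℝ} (hρ : ρ.PosSemidef)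
    {W : ι → ℝ≥0 → Ω → ℝ} (h : IsCorrelatedBM Q ℱ ρ W) {κ : Type*} [Countable κ] (e : κ → ι) :
    BM Q ℱ (fun k l => ρ (e k) (e l)) fun k => W (e k) := by
  have hS : ∀ s t : ℝ≥0, s ≤ t → (((t : ℝ) - s) • ρ).PosSemidef := fun s t hst =>
    hρ.smul (sub_nonneg.2 (by exact_mod_cast hst))
  have hlaw : ∀ k, ∀ s t : ℝ≥0, s ≤ t → HasLaw (fun ω => W k t ω - W k s ω)
      (gaussianReal 0 (((t : ℝ) - s) * ρ k k).toNNReal) Q := by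
    intro k s t hst
    have := (measurePreserving_eval_multivariateGaussian (μ := 0) (hS s t hst)
      (i := k)).hasLaw.comp (h.law s t hst)
    simpa [Function.comp_def] using this
  have hmem : ∀ k, ∀ s t : ℝ≥0, s ≤ t → MemLp (fun ω => W k t ω - W k s ω) 4 Q := by
    intro k s t hst
    have h1 := memLp_id_gaussianReal' (μ := 0) (v := (((t : ℝ) - s) * ρ k k).toNNReal) 4
      (by norm_num)
    rw [← (hlaw k s t hst).map_eq] at h1
    exact h1.comp_of_map (hlaw k s t hst).aemeasurable
  have hmean : ∀ k, ∀ s t : ℝ≥0, s ≤ t → ∫ ω, (W k t ω - W k s ω) ∂Q = 0 := by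
    intro k s t hst
    rw [(hlaw k s t hst).integral_eq, integral_id_gaussianReal]
  have hmeas : ∀ k s t, Measurable fun ω => W k t ω - W k s ω := fun k s t =>
    (((h.adapted k t).mono (ℱ.le t)).sub ((h.adapted k s).mono (ℱ.le s))).measurable
  refine ⟨fun k => h.adapted _, ae_all_iff.2 fun k => h.continuous _, fun s t hst => ?_,
    fun k l => ?_, fun k => hmean _, fun k l s t hst => ?_, fun k => hmem _, ?_⟩
  · refine indep_of_indep_of_le_left (h.indep s t hst) ?_
    have : (fun ω k => W (e k) t ω - W (e k) s ω) =
        (fun (x : ι → ℝ) k => x (e k)) ∘ fun ω k => W k t ω - W k s ω := rfl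
    rw [this, ← MeasurableSpace.comap_comp]
    exact MeasurableSpace.comap_mono (measurable_pi_lambda _ fun k => measurable_pi_apply _).comap_le
  · have := hρ.isHermitian.apply (e k) (e l)
    simpa using this.symm
  · have h1 := (h.law s t hst).covariance_fun_comp (f := fun x : EuclideanSpace ℝ ι => x (e k))
      (g := fun x => x (e l)) (by fun_prop) (by fun_prop)
    rw [covariance_eval_multivariateGaussian (hS s t hst)] at h1
    simp only at h1
    rw [covariance_eq_sub ((hmem _ s t hst).mono_exponent (by norm_num))
      ((hmem _ s t hst).mono_exponent (by norm_num)), hmean _ s t hst, zero_mul, sub_zero] at h1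
    simpa using h1
  · refine ⟨∑ k, (∫ x, x ^ 4 ∂gaussianReal 0 1) * ρ k k ^ 2, ?_, fun k s t hst => ?_⟩
    · exact Finset.sum_nonneg fun k _ => mul_nonneg (integral_nonneg fun x => by positivity)
        (sq_nonneg _)
    · have h1 := (hlaw (e k) s t hst).integral_comp (f := fun x => x ^ 4) (by fun_prop)
      rw [integral_pow_four_gaussianReal] at h1
      have h2 : 0 ≤ ((t : ℝ) - s) * ρ (e k) (e k) :=
        mul_nonneg (sub_nonneg.2 (by exact_mod_cast hst)) (hρ.diag_nonneg)
      rw [Real.coe_toNNReal _ h2] at h1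
      have h3 : ∫ ω, (W (e k) t ω - W (e k) s ω) ^ 4 ∂Q =
          (∫ x, x ^ 4 ∂gaussianReal 0 1) * (((t : ℝ) - s) * ρ (e k) (e k)) ^ 2 := h1
      rw [h3, mul_pow, mul_comm (((t : ℝ) - s) ^ 2), ← mul_assoc]
      refine mul_le_mul_of_nonneg_right ?_ (sq_nonneg _)
      exact Finset.single_le_sum (f := fun k => (∫ x, x ^ 4 ∂gaussianReal 0 1) * ρ k k ^ 2)
        (fun k _ => mul_nonneg (integral_nonneg fun x => by positivity) (sq_nonneg _))
        (Finset.mem_univ (e k))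

/-- An `ℱ 0`-measurable random variable is constant, as `ℱ 0` is trivial. -/
lemma exists_ae_eq_const
    (hℱ : ∀ A : Set Ω, MeasurableSet[ℱ 0] A ↔ MeasurableSet A ∧ (Q A = 0 ∨ Q A = 1))
    {f : Ω → ℝ} (hf : StronglyMeasurable[ℱ 0] f) : ∃ c, ∀ᵐ ω ∂Q, f ω = c := by
  have := Filter.exists_eventuallyEq_const_of_forall_separating (l := ae Q) (f := f)
    MeasurableSet fun U hU => ?_
  · obtain ⟨c, hc⟩ := this
    exact ⟨c, hc⟩
  · obtain ⟨h1, h2⟩ := (hℱ _).1 (hf.measurable hU)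
    rcases h2 with h2 | h2
    · right; exact measure_eq_zero_iff_ae_notMem.1 h2
    · left; exact (prob_compl_eq_zero_iff h1).2 h2

/-- An almost sure event contains one in the initial σ-algebra. -/
lemma exists_measurableSet_of_ae
    (hℱ : ∀ A : Set Ω, MeasurableSet[ℱ 0] A ↔ MeasurableSet A ∧ (Q A = 0 ∨ Q A = 1)) {p : Ω → Prop} (hp : ∀ᵐ ω ∂Q, p ω) :
    ∃ G : Set Ω, MeasurableSet[ℱ 0] G ∧ (∀ᵐ ω ∂Q, ω ∈ G) ∧ ∀ ω ∈ G, p ω := by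
  obtain ⟨t, ht1, ht2, ht3⟩ := exists_measurable_superset_of_null hp
  have h3 : ∀ᵐ ω ∂Q, ω ∈ tᶜ := measure_eq_zero_iff_ae_notMem.1 ht3
  refine ⟨tᶜ, (hℱ _).2 ⟨ht2.compl, Or.inr ((prob_compl_eq_one_iff ht2).2 ht3)⟩, h3, fun ω hω => ?_⟩
  by_contra hn
  exact hω (ht1 hn)

/-- A process that differs from its initial value, an almost sure constant, by a stochastic
integral is an Itô process. -/
theorem IsIto.of_isStochIntegral [Fintype ι] [DecidableEq ι] {ρ : ι → ι → ℝ}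
    {W : ι → ℝ≥0 → Ω → ℝ} (hB : BM Q ℱ ρ W) (k₀ : ι) {a H X R : ℝ≥0 → Ω → ℝ}
    (h : IsStochIntegral Q ℱ (W k₀) a H X) (hR : StronglyAdapted ℱ R) {c : ℝ}
    (hc : ∀ᵐ ω ∂Q, R 0 ω = c) (hRX : ∀ᵐ ω ∂Q, ∀ t, R t ω = R 0 ω + X t ω) :
    IsIto Q ℱ W R (fun k s ω => if k = k₀ then H s ω else 0) fun s ω => H s ω * a s ω := by
  obtain ⟨I, hI, hint, hX⟩ := h
  have h1 := IsIto.of_isItoIntegral hB k₀ hI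
  have h2 : IsIto Q ℱ W (fun t ω => R t ω - c - I t ω) (fun _ _ _ => 0)
      fun s ω => H s ω * a s ω := by
    refine IsIto.of_integral hB.adapted
      (fun t => ((hR t).sub stronglyMeasurable_const).sub (hI.adapted t)) ?_
    filter_upwards [hint, hX, hc, hRX] with ω a1 a2 a3 a4 t
    refine ⟨a1 t, ?_⟩
    rw [a4 t, a3, a2 t]; ring
  exact ((h1.add h2).add (IsIto.const hB.adapted c)).congr' (fun t ω => by ring)
    (fun k s ω => by simp) (fun s ω => by simp)

end ItoCalculus

namespace ItoCalculus

open RoughFMM (leb)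

/-! ### A barrier estimate -/

variable {Ω ι : Type*} [mΩ : MeasurableSpace Ω] {Q : Measure Ω} [IsProbabilityMeasure Q]
  {ℱ : Filtration ℝ≥0 mΩ} {ρ : ι → ι → ℝ} {W : ι → ℝ≥0 → Ω → ℝ} [Fintype ι]

set_option linter.unusedSectionVars false

lemma ofReal_integral_le_lintegral {α : Type*} [MeasurableSpace α] {μ : Measure α} (f : α → ℝ) :
    ENNReal.ofReal (∫ x, f x ∂μ) ≤ ∫⁻ x, ENNReal.ofReal (f x) ∂μ := by
  by_cases hf : Integrable f μ
  · calc ENNReal.ofReal (∫ x, f x ∂μ) ≤ ENNReal.ofReal (∫ x, max (f x) 0 ∂μ) :=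
          ENNReal.ofReal_le_ofReal (integral_mono hf hf.pos_part fun x => le_max_left _ _)
      _ = ∫⁻ x, ENNReal.ofReal (max (f x) 0) ∂μ :=
          ofReal_integral_eq_lintegral_ofReal hf.pos_part (ae_of_all _ fun x => le_max_right _ _)
      _ = _ := by simp [ENNReal.ofReal_max]
  · simp [integral_undef hf]

/-- Fatou's lemma for a convergent sequence with bounded integrals. -/
lemma lintegral_le_of_tendsto_of_le {α : Type*} [MeasurableSpace α] {μ : Measure α}
    {f : ℕ → α → ℝ≥0∞} {g : α → ℝ≥0∞} {c : ℝ≥0∞} (hf : ∀ n, AEMeasurable (f n) μ)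
    (hfg : ∀ᵐ x ∂μ, Tendsto (fun n => f n x) atTop (𝓝 (g x))) (hc : ∀ n, ∫⁻ x, f n x ∂μ ≤ c) :
    ∫⁻ x, g x ∂μ ≤ c :=
  calc ∫⁻ x, g x ∂μ = ∫⁻ x, liminf (fun n => f n x) atTop ∂μ :=
        lintegral_congr_ae (hfg.mono fun x hx => hx.liminf_eq.symm)
    _ ≤ liminf (fun n => ∫⁻ x, f n x ∂μ) atTop := lintegral_liminf_le' hf
    _ ≤ c := (liminf_le_liminf (Eventually.of_forall hc)).trans_eq (liminf_const c)

/-- The reverse Fatou lemma, for a sequence with a bounded majorant and an upper limit that need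
not be measurable. -/
lemma lintegral_le_of_tendsto_of_le_lintegral {f g : ℕ → Ω → ℝ≥0∞} {f' g' : Ω → ℝ≥0∞} {c : ℝ≥0∞}
    (hc : c ≠ ∞) (hf : ∀ n, AEMeasurable (f n) Q) (hg : ∀ n, AEMeasurable (g n) Q)
    (hgc : ∀ n, ∀ᵐ ω ∂Q, g n ω ≤ c)
    (hff : ∀ᵐ ω ∂Q, Tendsto (fun n => f n ω) atTop (𝓝 (f' ω)))
    (hgg : ∀ᵐ ω ∂Q, limsup (fun n => g n ω) atTop ≤ g' ω)
    (hfg : ∀ n, ∫⁻ ω, f n ω ∂Q ≤ ∫⁻ ω, g n ω ∂Q) : ∫⁻ ω, f' ω ∂Q ≤ ∫⁻ ω, g' ω ∂Q := by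
  have hmk : ∀ᵐ ω ∂Q, ∀ n, g n ω = (hg n).mk (g n) ω := ae_all_iff.2 fun n => (hg n).ae_eq_mk
  calc ∫⁻ ω, f' ω ∂Q = ∫⁻ ω, liminf (fun n => f n ω) atTop ∂Q :=
        lintegral_congr_ae (hff.mono fun x hx => hx.liminf_eq.symm)
    _ ≤ liminf (fun n => ∫⁻ ω, f n ω ∂Q) atTop := lintegral_liminf_le' hf
    _ ≤ liminf (fun n => ∫⁻ ω, g n ω ∂Q) atTop := liminf_le_liminf (Eventually.of_forall hfg)
    _ ≤ limsup (fun n => ∫⁻ ω, g n ω ∂Q) atTop := liminf_le_limsup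
    _ = limsup (fun n => ∫⁻ ω, (hg n).mk (g n) ω ∂Q) atTop := by
        congr 1; ext n; exact lintegral_congr_ae (hg n).ae_eq_mk
    _ ≤ ∫⁻ ω, limsup (fun n => (hg n).mk (g n) ω) atTop ∂Q := by
        refine limsup_lintegral_le (fun _ => c) (fun n => (hg n).measurable_mk) (fun n => ?_)
          (by simpa using hc)
        filter_upwards [hgc n, hmk] with ω h1 h2
        exact (h2 n).symm.le.trans h1
    _ ≤ ∫⁻ ω, g' ω ∂Q := by
        refine lintegral_mono_ae ?_
        filter_upwards [hgg, hmk] with ω h1 h2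
        simpa only [← h2] using h1

namespace IsIto

variable {S J Ψ b : ℝ≥0 → Ω → ℝ} {H : ι → ℝ≥0 → Ω → ℝ} {C L s₀ : ℝ} {t : ℝ≥0} {G : Ω → ℝ≥0∞}

/-- The process `S - L` is switched off once the nondecreasing process `J = ∫ Ψ` becomes positive.
-/
lemma switched (hB : BM Q ℱ ρ W) (hS : IsIto Q ℱ W S H b)
    (hJ : IsIto Q ℱ W J (fun _ _ _ => 0) Ψ) (n : ℝ) (L : ℝ) :
    IsIto Q ℱ W (fun u ω => (S u ω - L) * cutoff (n * J u ω) + L)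
      (fun k u ω => cutoff (n * J u ω) * H k u ω)
      (locDrift (fun u ω => S u ω - L) J b Ψ n) :=
  ((((hS.sub (IsIto.const hB.adapted L)).congr' (G := H) (c := b) (fun _ _ => rfl) (by simp)
    (by simp)).localized hB hJ n).add (IsIto.const hB.adapted L)).congr' (fun _ _ => rfl)
    (by simp) (by simp)

/-- **Barrier estimate.** Let `S` be a bounded nonnegative Itô process that is at least `L` whenever
`Ψ` is positive. Then `S` has to climb from its starting point to `L` before `J = ∫ Ψ` becomes
positive, so that the probability of this event is controlled by the drift of `S` up to then. -/
theorem measure_pos_le (hB : BM Q ℱ ρ W) (hS : IsIto Q ℱ W S H b)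
    (hJ : IsIto Q ℱ W J (fun _ _ _ => 0) Ψ) (hΨ : ∀ u ω, 0 ≤ Ψ u ω)
    (hJΨ : ∀ᵐ ω ∂Q, ∀ u, J u ω = ∫ v in Set.Iic u, Ψ v ω ∂leb)
    (hSC : ∀ᵐ ω ∂Q, ∀ u, 0 ≤ S u ω ∧ S u ω ≤ C) (hL : 0 ≤ L) (hLC : L ≤ C)
    (hLS : ∀ᵐ ω ∂Q, ∀ u, 0 < Ψ u ω → L ≤ S u ω) (hS0 : ∀ᵐ ω ∂Q, S 0 ω ≤ s₀)
    (hG : ∀ᵐ ω ∂Q, ∫⁻ u in Set.Iic t, (if J u ω = 0 then ENNReal.ofReal (b u ω) else 0) ∂leb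
      ≤ G ω) :
    ENNReal.ofReal L * Q {ω | 0 < J t ω} ≤ ENNReal.ofReal s₀ + ∫⁻ ω, G ω ∂Q := by
  set a : ℝ≥0 → Ω → ℝ := fun u ω => (∑ k, H k u ω ^ 2 + |b u ω|) + Ψ u ω with ha
  set A : ℝ≥0 → Ω → ℝ := fun u ω =>
    (∫ s in Set.Iic u, (∑ k, H k s ω ^ 2 + |b s ω|) ∂leb) + J u ω with hA
  have hH0 : ∀ u ω, 0 ≤ ∑ k, H k u ω ^ 2 := fun u ω => Finset.sum_nonneg fun k _ => sq_nonneg _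
  have ha0 : ∀ u ω, 0 ≤ a u ω := fun u ω =>
    add_nonneg (add_nonneg (hH0 u ω) (abs_nonneg _)) (hΨ u ω)
  have hcl := hS.clock hB.adapted
  have hAI : IsIto Q ℱ W A (fun _ _ _ => 0) a :=
    (hcl.add hJ).congr' (fun _ _ => rfl) (by simp) fun _ _ => rfl
  have hAa : ∀ᵐ ω ∂Q, ∀ u, A u ω = ∫ v in Set.Iic u, a v ω ∂leb := by
    filter_upwards [hcl.integrableOn, hJ.integrableOn, hJΨ] with ω h1 h2 h3 u
    simp only [hA, ha, h3 u]
    exact (integral_add (h1 u).2 (h2 u).2).symm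
  have hAc := hAI.continuous hB
  have hJc := hJ.continuous hB
  have hai : ∀ᵐ ω ∂Q, ∀ T, IntegrableOn (fun u => a u ω) (Set.Iic T) leb :=
    hAI.integrableOn.mono fun ω hω T => (hω T).2
  have hJ0 : ∀ᵐ ω ∂Q, ∀ u, 0 ≤ J u ω := hJΨ.mono fun ω h u => by
    rw [h u]; exact integral_nonneg fun s => hΨ s ω
  have hC : 0 ≤ C := hL.trans hLC
  obtain ⟨D₀, hD₀, hD₀'⟩ := exists_deriv_cutoff_bound
  -- `d n` is the drift of the process `U n`, which is switched off when `J` exceeds `1 / n`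
  set U : ℕ → ℝ≥0 → Ω → ℝ := fun n u ω => (S u ω - L) * cutoff (n * J u ω) + L with hU
  set d : ℕ → ℝ≥0 → Ω → ℝ := fun n => locDrift (fun u ω => S u ω - L) J b Ψ n with hd
  have hUI : ∀ n : ℕ, IsIto Q ℱ W (U n) (fun k u ω => cutoff (n * J u ω) * H k u ω) (d n) :=
    fun n => hS.switched hB hJ n L
  have hUb : ∀ n : ℕ, ∀ᵐ ω ∂Q, ∀ u, L * (1 - cutoff (n * J u ω)) ≤ U n u ω ∧ 0 ≤ U n u ω ∧
      U n u ω ≤ C := fun n => by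
    filter_upwards [hSC] with ω h u
    have h0 := cutoff_nonneg (n * J u ω)
    have h1 := cutoff_le_one (n * J u ω)
    have h2 := mul_nonneg (h u).1 h0
    have h3 := mul_nonneg hL (sub_nonneg.2 h1)
    have h4 := mul_le_mul_of_nonneg_right (h u).2 h0
    have h5 := mul_le_mul_of_nonneg_right hLC (sub_nonneg.2 h1)
    simp only [hU]
    refine ⟨?_, ?_, ?_⟩ <;> nlinarith
  have hdle : ∀ n, ∀ᵐ ω ∂Q, ∀ u, d n u ω ≤ cutoff (n * J u ω) * b u ω := fun n => by
    filter_upwards [hLS] with ω h u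
    simp only [hd, locDrift]
    have : (S u ω - L) * (n * deriv cutoff (n * J u ω) * Ψ u ω) ≤ 0 := by
      rcases (hΨ u ω).eq_or_lt with h0 | h0
      · simp [← h0]
      · exact mul_nonpos_of_nonneg_of_nonpos (sub_nonneg.2 (h u h0))
          (mul_nonpos_of_nonpos_of_nonneg (mul_nonpos_of_nonneg_of_nonpos n.cast_nonneg
            (deriv_cutoff_nonpos _)) h0.le)
    linarith
  have hdabs : ∀ n, ∀ᵐ ω ∂Q, ∀ u, |d n u ω| ≤ (C * (n * D₀) + 1) * a u ω := fun n => by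
    filter_upwards [hSC] with ω h u
    have hΨa : Ψ u ω ≤ a u ω := by
      have := hH0 u ω; have := abs_nonneg (b u ω); simp only [ha]; linarith
    have hba : |b u ω| ≤ a u ω := by
      have := hH0 u ω; have := hΨ u ω; simp only [ha]; linarith
    refine (abs_add_le _ _).trans ?_
    beta_reduce
    rw [add_mul, one_mul]
    refine add_le_add ?_ ?_
    · rw [abs_mul, abs_mul, abs_mul, abs_of_nonneg (Nat.cast_nonneg (α := ℝ) n), abs_of_nonneg (hΨ u ω),
        mul_assoc C]
      refine mul_le_mul ?_ ?_ (mul_nonneg (by positivity) (hΨ u ω)) hC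
      · rw [abs_le]; constructor <;> linarith [h u]
      · exact mul_le_mul (mul_le_mul_of_nonneg_left (hD₀' _) n.cast_nonneg) hΨa (hΨ u ω)
          (by positivity)
    · rw [abs_mul, abs_of_nonneg (cutoff_nonneg _)]
      exact (mul_le_of_le_one_left (abs_nonneg _) (cutoff_le_one _)).trans hba
  -- the drift of the localized process
  set δ : ℝ → ℕ → ℝ≥0 → Ω → ℝ := fun r n => locDrift (U n) A (d n) a r with hδ
  have hδle : ∀ r, 0 < r → ∀ n, ∀ᵐ ω ∂Q, ∀ u,
      δ r n u ω ≤ cutoff (r * A u ω) * (cutoff (n * J u ω) * b u ω) := by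
    intro r hr n
    filter_upwards [hUb n, hdle n] with ω h1 h2 u
    have h4 : U n u ω * (r * deriv cutoff (r * A u ω) * a u ω) ≤ 0 :=
      mul_nonpos_of_nonneg_of_nonpos (h1 u).2.1 (mul_nonpos_of_nonpos_of_nonneg
        (mul_nonpos_of_nonneg_of_nonpos hr.le (deriv_cutoff_nonpos _)) (ha0 u ω))
    have h5 := mul_le_mul_of_nonneg_left (h2 u) (cutoff_nonneg (r * A u ω))
    simp only [hδ, locDrift]; linarith
  have hδle₁ : ∀ r, 0 < r → ∀ n, ∀ᵐ ω ∂Q, ENNReal.ofReal (∫ u in Set.Ioc 0 t, δ r n u ω ∂leb) ≤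
      ∫⁻ u in Set.Iic t, ENNReal.ofReal (cutoff (n * J u ω) * b u ω) ∂leb := by
    intro r hr n
    filter_upwards [hδle r hr n] with ω h
    refine (ofReal_integral_le_lintegral _).trans
      ((lintegral_mono_set Set.Ioc_subset_Iic_self).trans (lintegral_mono fun u => ?_))
    refine (ENNReal.ofReal_le_ofReal (h u)).trans ?_
    rw [ENNReal.ofReal_mul (cutoff_nonneg _)]
    exact mul_le_of_le_one_left zero_le (ENNReal.ofReal_le_one.2 (cutoff_le_one _))
  have hδle₂ : ∀ r, 0 < r → ∀ n, ∀ᵐ ω ∂Q, ENNReal.ofReal (∫ u in Set.Ioc 0 t, δ r n u ω ∂leb) ≤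
      ENNReal.ofReal (1 * (2 * r⁻¹)) := by
    intro r hr n
    filter_upwards [hδle r hr n, hAa, hai, hAc, hS.integrableOn] with ω h h3 h4 h5 h6
    have hle := setIntegral_le_of_clock (a := fun s => a s ω) (A := fun s => A s ω)
      (g := fun u => cutoff (r * A u ω) * b u ω) (c := 2 * r⁻¹) (D := 1)
      (fun s => ha0 s ω) h4 h3 h5 zero_le_one (by positivity) (fun u => ?_)
      (fun u hu => by rw [cutoff_eq_zero (two_le_of_inv_le hr hu), zero_mul]) t
    · have hint : IntegrableOn (fun u => cutoff (r * A u ω) * b u ω) (Set.Iic t) leb :=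
        (h6 t).2.abs.mono' ((continuous_cutoff.comp
          (continuous_const.mul h5)).aestronglyMeasurable.mul (h6 t).2.aestronglyMeasurable)
          (ae_of_all _ fun u => by
            rw [Real.norm_eq_abs, abs_mul, abs_of_nonneg (cutoff_nonneg _)]
            exact mul_le_of_le_one_left (abs_nonneg _) (cutoff_le_one _))
      refine (ofReal_integral_le_lintegral _).trans ?_
      refine le_trans ?_ (ENNReal.ofReal_le_ofReal hle)
      rw [ofReal_integral_eq_lintegral_ofReal hint.abs (ae_of_all _ fun _ => abs_nonneg _)]
      refine (lintegral_mono_set Set.Ioc_subset_Iic_self).trans (lintegral_mono fun u => ?_)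
      refine ENNReal.ofReal_le_ofReal ((h u).trans ((le_abs_self _).trans ?_))
      rw [abs_mul, abs_mul, abs_mul, abs_of_nonneg (cutoff_nonneg _),
        abs_of_nonneg (cutoff_nonneg _)]
      exact mul_le_mul_of_nonneg_left (mul_le_of_le_one_left (abs_nonneg _) (cutoff_le_one _))
        (cutoff_nonneg _)
    · rw [abs_mul, abs_of_nonneg (cutoff_nonneg _), one_mul]
      refine (mul_le_of_le_one_left (abs_nonneg _) (cutoff_le_one _)).trans ?_
      have := hH0 u ω; have := hΨ u ω; simp only [ha]; linarith
  have hδb : ∀ r, 0 < r → ∀ n : ℕ, ∀ᵐ ω ∂Q,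
      |∫ u in Set.Ioc 0 t, δ r n u ω ∂leb| ≤ (C * (r * D₀) + (C * (n * D₀) + 1)) * (2 * r⁻¹) := by
    intro r hr n
    filter_upwards [hUb n, hdabs n, hAa, hai, hAc,
      ((hUI n).localized hB hAI r).integrableOn] with ω h1 h2 h3 h4 h5 h6
    refine abs_integral_le_integral_abs.trans ((setIntegral_mono_set (h6 t).2.abs
      (ae_of_all _ fun _ => abs_nonneg _) Set.Ioc_subset_Iic_self.eventuallyLE).trans ?_)
    refine setIntegral_le_of_clock (a := fun s => a s ω) (A := fun s => A s ω)
      (fun s => ha0 s ω) h4 h3 h5 (by positivity) (by positivity) (fun u => ?_)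
      (fun u hu => locDrift_of_ge hr hu) t
    refine (abs_add_le _ _).trans ?_
    rw [add_mul (C * (r * D₀))]
    refine add_le_add ?_ ?_
    · rw [abs_mul, abs_mul, abs_mul, abs_of_pos hr, abs_of_nonneg (ha0 u ω), mul_assoc C,
        abs_of_nonneg (h1 u).2.1]
      exact mul_le_mul (h1 u).2.2 (mul_le_mul_of_nonneg_right
        (mul_le_mul_of_nonneg_left (hD₀' _) hr.le) (ha0 u ω))
        (mul_nonneg (mul_nonneg hr.le (abs_nonneg _)) (ha0 u ω)) hC
    · rw [abs_mul, abs_of_nonneg (cutoff_nonneg _)]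
      exact (mul_le_of_le_one_left (abs_nonneg _) (cutoff_le_one _)).trans (h2 u)
  -- the inequality for the localized processes
  have hmeasδ : ∀ r n, AEStronglyMeasurable (fun ω => ∫ u in Set.Ioc 0 t, δ r n u ω ∂leb) Q :=
    fun r n => ((hUI n).localized hB hAI r).aestronglyMeasurable_setIntegral hB.adapted zero_le
  have hmain : ∀ r, 0 < r → ∀ n : ℕ,
      ∫⁻ ω, ENNReal.ofReal (L * (1 - cutoff (n * J t ω)) * cutoff (r * A t ω)) ∂Q ≤
        ∫⁻ ω, (ENNReal.ofReal s₀ + ENNReal.ofReal (∫ u in Set.Ioc 0 t, δ r n u ω ∂leb)) ∂Q := by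
    intro r hr n
    have hz := (hUI n).setIntegral_localized hB hAI ha0 hAa (zero_le : 0 ≤ t) (C := C)
      (D := C * (n * D₀) + 1) (by positivity)
      ((hUb n).mono fun ω h u _ => abs_le.2 ⟨by linarith [h u], (h u).2.2⟩)
      (ae_of_all _ fun ω u _ => ?_) ((hdabs n).mono fun ω h u _ => h u) hr MeasurableSet.univ
    · have hm1 := ((hUI n).localized hB hAI r).aestronglyMeasurable
      have hb1 : ∀ u, ∀ᵐ ω ∂Q, 0 ≤ U n u ω * cutoff (r * A u ω) ∧
          U n u ω * cutoff (r * A u ω) ≤ C := fun u => by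
        filter_upwards [hUb n] with ω h
        exact ⟨mul_nonneg (h u).2.1 (cutoff_nonneg _),
          (mul_le_of_le_one_right (h u).2.1 (cutoff_le_one _)).trans (h u).2.2⟩
      have hi1 : ∀ u, Integrable (fun ω => U n u ω * cutoff (r * A u ω)) Q := fun u =>
        (integrable_const C).mono' (hm1 u) ((hb1 u).mono fun ω h => by
          rw [Real.norm_eq_abs, abs_of_nonneg h.1]; exact h.2)
      have hi2 : Integrable (fun ω => ∫ u in Set.Ioc 0 t, δ r n u ω ∂leb) Q :=
        (integrable_const _).mono' (hmeasδ r n) (hδb r hr n)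
      have hs : ∀ᵐ ω ∂Q, U n 0 ω * cutoff (r * A 0 ω) ≤ s₀ := by
        filter_upwards [hS0, hJΨ, hAa] with ω h1 h2 h3
        simp only [hU]
        rw [h2 0, h3 0, setIntegral_Iic_zero, setIntegral_Iic_zero, mul_zero, mul_zero,
          cutoff_eq_one zero_le_one]
        linarith
      rw [Measure.restrict_univ] at hz
      have hz' : ∫ ω, U n t ω * cutoff (r * A t ω) ∂Q = ∫ ω, (U n 0 ω * cutoff (r * A 0 ω) +
          ∫ u in Set.Ioc 0 t, δ r n u ω ∂leb) ∂Q := by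
        rw [← sub_eq_zero, ← hz]
        refine (integral_sub (hi1 t) ((hi1 0).add hi2)).symm.trans
          (integral_congr_ae (ae_of_all _ fun ω => ?_))
        simp only [hδ, Pi.add_apply]; ring
      calc _ ≤ ∫⁻ ω, ENNReal.ofReal (U n t ω * cutoff (r * A t ω)) ∂Q := by
            refine lintegral_mono_ae ?_
            filter_upwards [hUb n] with ω h
            exact ENNReal.ofReal_le_ofReal
              (mul_le_mul_of_nonneg_right (h t).1 (cutoff_nonneg _))
        _ = ENNReal.ofReal (∫ ω, U n t ω * cutoff (r * A t ω) ∂Q) :=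
            (ofReal_integral_eq_lintegral_ofReal (hi1 t) ((hb1 t).mono fun ω h => h.1)).symm
        _ ≤ ∫⁻ ω, ENNReal.ofReal (U n 0 ω * cutoff (r * A 0 ω) +
              ∫ u in Set.Ioc 0 t, δ r n u ω ∂leb) ∂Q := by
            rw [hz']; exact ofReal_integral_le_lintegral _
        _ ≤ _ := by
            refine lintegral_mono_ae ?_
            filter_upwards [hs] with ω h
            exact ENNReal.ofReal_add_le.trans (by gcongr)
    · calc ∑ k, (cutoff (n * J u ω) * H k u ω) ^ 2 ≤ ∑ k, H k u ω ^ 2 := by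
            refine Finset.sum_le_sum fun k _ => ?_
            rw [mul_pow]
            exact mul_le_of_le_one_left (sq_nonneg _)
              (pow_le_one₀ (cutoff_nonneg _) (cutoff_le_one _))
        _ ≤ a u ω := by
            have := hΨ u ω; have := abs_nonneg (b u ω); simp only [ha]; linarith
        _ ≤ _ := le_mul_of_one_le_left (ha0 u ω) (by
            have : 0 ≤ C * (n * D₀) := by positivity
            linarith)
  -- switching off as soon as `J` becomes positive
  have hlim1 : ∀ r, 0 < r → ∫⁻ ω, (if 0 < J t ω then ENNReal.ofReal (L * cutoff (r * A t ω)) else 0)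
      ∂Q ≤ ∫⁻ ω, (ENNReal.ofReal s₀ + G ω) ∂Q := by
    intro r hr
    have hφ : ∀ {x : ℝ}, 0 ≤ x →
        Tendsto (fun n : ℕ => cutoff (n * x)) atTop (𝓝 (if x = 0 then 1 else 0)) := by
      intro x hx
      rcases hx.eq_or_lt with rfl | hx
      · simp [cutoff_eq_one zero_le_one]
      · rw [if_neg hx.ne']
        refine tendsto_const_nhds.congr' ?_
        filter_upwards [(tendsto_natCast_atTop_atTop.atTop_mul_const hx).eventually_ge_atTop 2]
          with n hn using (cutoff_eq_zero hn).symm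
    refine lintegral_le_of_tendsto_of_le_lintegral
      (c := ENNReal.ofReal s₀ + ENNReal.ofReal (1 * (2 * r⁻¹)))
      (ENNReal.add_ne_top.2 ⟨ENNReal.ofReal_ne_top, ENNReal.ofReal_ne_top⟩) (fun n => ?_)
      (fun n => ((hmeasδ r n).aemeasurable.ennreal_ofReal.const_add _))
      (fun n => (hδle₂ r hr n).mono fun ω h => by gcongr) ?_ ?_ (hmain r hr)
    · have h1 := continuous_cutoff.comp_aestronglyMeasurable
        ((hJ.aestronglyMeasurable t).const_mul (n : ℝ))
      have h2 := continuous_cutoff.comp_aestronglyMeasurable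
        ((hAI.aestronglyMeasurable t).const_mul r)
      exact (((aestronglyMeasurable_const.sub h1).const_mul L).mul h2).aemeasurable.ennreal_ofReal
    · filter_upwards [hJ0] with ω h0
      have h1 := (((hφ (h0 t)).const_sub 1).const_mul L).mul_const (cutoff (r * A t ω))
      convert ENNReal.tendsto_ofReal h1 using 2
      rcases (h0 t).eq_or_lt with h | h
      · simp [← h]
      · simp [h, h.ne']
    · filter_upwards [hG, hJ0, hJc, hS.integrableOn, ae_all_iff.2 (hδle₁ r hr)]
        with ω h1 h2 h3 h4 h5
      have h6 : Tendsto (fun n : ℕ => ∫⁻ u in Set.Iic t,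
          ENNReal.ofReal (cutoff (n * J u ω) * b u ω) ∂leb) atTop (𝓝 (∫⁻ u in Set.Iic t,
          (if J u ω = 0 then ENNReal.ofReal (b u ω) else 0) ∂leb)) := by
        refine tendsto_lintegral_of_dominated_convergence'
          (fun u => ENNReal.ofReal |b u ω|) (fun n => ?_) (fun n => ae_of_all _ fun u => ?_) ?_
          (ae_of_all _ fun u => ?_)
        · exact ((continuous_cutoff.comp (continuous_const.mul h3)).aestronglyMeasurable.mul
            (h4 t).2.aestronglyMeasurable).aemeasurable.ennreal_ofReal
        · refine ENNReal.ofReal_le_ofReal ((le_abs_self _).trans ?_)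
          rw [abs_mul, abs_of_nonneg (cutoff_nonneg _)]
          exact mul_le_of_le_one_left (abs_nonneg _) (cutoff_le_one _)
        · exact (h4 t).2.abs.lintegral_lt_top.ne
        · convert ENNReal.tendsto_ofReal ((hφ (h2 u)).mul_const (b u ω)) using 2
          split_ifs <;> simp
      calc limsup (fun n : ℕ => ENNReal.ofReal s₀ +
            ENNReal.ofReal (∫ u in Set.Ioc 0 t, δ r n u ω ∂leb)) atTop
          ≤ limsup (fun n : ℕ => ENNReal.ofReal s₀ + ∫⁻ u in Set.Iic t,
            ENNReal.ofReal (cutoff (n * J u ω) * b u ω) ∂leb) atTop :=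
            limsup_le_limsup (Eventually.of_forall fun n => add_le_add le_rfl (h5 n))
        _ = ENNReal.ofReal s₀ + ∫⁻ u in Set.Iic t,
          (if J u ω = 0 then ENNReal.ofReal (b u ω) else 0) ∂leb :=
            (h6.const_add _).limsup_eq
        _ ≤ _ := by gcongr
  -- removing the localization
  have hJm : NullMeasurableSet {ω | 0 < J t ω} Q :=
    nullMeasurableSet_lt aemeasurable_const (hJ.aestronglyMeasurable t).aemeasurable
  have hr : Tendsto (fun m : ℕ => ((m : ℝ) + 1)⁻¹) atTop (𝓝 0) := by
    simpa only [one_div] using tendsto_one_div_add_atTop_nhds_zero_nat (𝕜 := ℝ)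
  have hlim2 : ∫⁻ ω, {ω | 0 < J t ω}.indicator (fun _ => ENNReal.ofReal L) ω ∂Q ≤
      ∫⁻ ω, (ENNReal.ofReal s₀ + G ω) ∂Q := by
    refine lintegral_le_of_tendsto_of_le (f := fun m : ℕ => {ω | 0 < J t ω}.indicator
      fun ω => ENNReal.ofReal (L * cutoff (((m : ℝ) + 1)⁻¹ * A t ω))) (fun m => ?_)
      (ae_of_all _ fun ω => ?_) fun m => hlim1 ((m : ℝ) + 1)⁻¹ (by positivity)
    · exact (((continuous_cutoff.comp_aestronglyMeasurable ((hAI.aestronglyMeasurable t).const_mul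
        _)).const_mul L).aemeasurable.ennreal_ofReal).indicator₀ hJm
    · by_cases h : 0 < J t ω
      · simp only [Set.indicator, Set.mem_ofPred_eq, h, if_true]
        have := (continuous_cutoff.tendsto _).comp (hr.mul_const (A t ω))
        rw [zero_mul, cutoff_eq_one zero_le_one] at this
        simpa using ENNReal.tendsto_ofReal (this.const_mul L)
      · simp [Set.indicator, h]
  rw [lintegral_indicator_const₀ hJm, lintegral_add_left measurable_const,
    lintegral_const, measure_univ, mul_one] at hlim2
  exact hlim2

end IsIto

end ItoCalculus

namespace ItoCalculus

open RoughFMM (leb SimpleProcess IsItoIntegral TendstoZeroInProb)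

/-! ### The exponential of a Wiener integral -/

variable {Ω ι : Type*} [mΩ : MeasurableSpace Ω] {Q : Measure Ω} [IsProbabilityMeasure Q]
  {ℱ : Filtration ℝ≥0 mΩ} {ρ : ι → ι → ℝ} {W : ι → ℝ≥0 → Ω → ℝ} [Fintype ι]

set_option linter.unusedSectionVars false

lemma IsItoIntegral.ae_zero {B H I : ℝ≥0 → Ω → ℝ} (h : IsItoIntegral Q ℱ B H I) :
    ∀ᵐ ω ∂Q, I 0 ω = 0 := by
  obtain ⟨K, hK⟩ := h.approx
  have h0 : ∀ n : ℕ, Q {ω | ENNReal.ofReal ((n : ℝ) + 1)⁻¹ ≤ ENNReal.ofReal |I 0 ω|} = 0 := by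
    intro n
    have := (hK 0).2 (ENNReal.ofReal ((n : ℝ) + 1)⁻¹) (ENNReal.ofReal_pos.2 (by positivity))
    have e : ∀ m ω, (⨆ s ∈ Set.Iic (0 : ℝ≥0), ENNReal.ofReal |(K m).integral B s ω - I s ω|) =
        ENNReal.ofReal |I 0 ω| := by
      intro m ω
      have : Set.Iic (0 : ℝ≥0) = {0} := by ext x; simp
      simp [this, SimpleProcess.integral]
    simp only [e] at this
    exact tendsto_nhds_unique tendsto_const_nhds this
  have h1 : ∀ᵐ ω ∂Q, ∀ n : ℕ, ¬ ENNReal.ofReal ((n : ℝ) + 1)⁻¹ ≤ ENNReal.ofReal |I 0 ω| :=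
    ae_all_iff.2 fun n => measure_eq_zero_iff_ae_notMem.1 (h0 n)
  filter_upwards [h1] with ω hω
  by_contra hne
  obtain ⟨n, hn⟩ := exists_nat_one_div_lt (abs_pos.2 hne)
  exact hω n (ENNReal.ofReal_le_ofReal (by rw [← one_div]; exact hn.le))

lemma qcov_single [DecidableEq ι] (ρ : ι → ι → ℝ) (k₀ l₀ : ι) (x y : ℝ) :
    qcov ρ (fun k => if k = k₀ then x else 0) (fun k => if k = l₀ then y else 0) =
      ρ k₀ l₀ * (x * y) := by
  simp [qcov, ite_mul, mul_ite]

section Damped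

variable {ε : ℝ}

lemma hasDerivAt_dampedExp (hε : 0 < ε) (y : ℝ) :
    HasDerivAt (fun y => Real.exp y / (1 + ε * Real.exp y))
      (Real.exp y / (1 + ε * Real.exp y) ^ 2) y := by
  have hp : 1 + ε * Real.exp y ≠ 0 := by positivity
  refine ((Real.hasDerivAt_exp y).fun_div
    (((Real.hasDerivAt_exp y).const_mul ε).const_add 1) hp).congr_deriv ?_
  field_simp
  ring

lemma hasDerivAt_deriv_dampedExp (hε : 0 < ε) (y : ℝ) :
    HasDerivAt (fun y => Real.exp y / (1 + ε * Real.exp y) ^ 2)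
      (Real.exp y * (1 - ε * Real.exp y) / (1 + ε * Real.exp y) ^ 3) y := by
  have hp : 1 + ε * Real.exp y ≠ 0 := by positivity
  refine ((Real.hasDerivAt_exp y).fun_div
    ((((Real.hasDerivAt_exp y).const_mul ε).const_add 1).fun_pow 2)
    (pow_ne_zero 2 hp)).congr_deriv ?_
  field_simp
  ring

end Damped

/-- The stochastic exponential of a Wiener integral is a supermartingale. As the exponential is
unbounded, Itô's formula is applied to `e^y / (1 + ε e^y)`, and `ε` tends to `0`. -/
theorem lintegral_exp_le_one [DecidableEq ι] (hB : BM Q ℱ ρ W) {k₀ : ι} (hρ : ρ k₀ k₀ = 1)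
    {k : ℝ≥0 → ℝ} {I : ℝ≥0 → Ω → ℝ} (h : IsItoIntegral Q ℱ (W k₀) (fun s _ => k s) I)
    (t : ℝ≥0) :
    ∫⁻ ω, ENNReal.ofReal (Real.exp (I t ω - 1 / 2 * ∫ s in Set.Iic t, k s ^ 2 ∂leb)) ∂Q ≤ 1 := by
  set K : ℝ≥0 → ℝ := fun t => ∫ s in Set.Iic t, k s ^ 2 ∂leb with hK
  have hI := IsIto.of_isItoIntegral hB k₀ h
  have hKI : IsIto Q ℱ W (fun t _ => K t) (fun _ _ _ => 0) fun s _ => k s ^ 2 :=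
    (hI.clock hB.adapted).congr' (fun t ω => by simp [hK]) (by simp) (fun s ω => by simp)
  have hk : IntegrableOn (fun s => k s ^ 2) (Set.Iic t) leb := by
    obtain ⟨ω, hω⟩ := hKI.integrableOn.exists
    exact (hω t).2
  have hY : IsIto Q ℱ W (fun t ω => I t ω - 1 / 2 * K t)
      (fun k' s _ => if k' = k₀ then k s else 0) fun s _ => -(1 / 2 * k s ^ 2) :=
    (hI.sub (hKI.const_mul (1 / 2))).congr' (fun _ _ => rfl) (by simp) (by simp)
  set ε : ℕ → ℝ := fun n => ((n : ℝ) + 1)⁻¹ with hε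
  have hε0 : ∀ n, 0 < ε n := fun n => by simp only [hε]; positivity
  have hlim : Tendsto ε atTop (𝓝 0) := by
    simpa only [hε, one_div] using tendsto_one_div_add_atTop_nhds_zero_nat (𝕜 := ℝ)
  set p : ℕ → ℝ → ℝ := fun n y => Real.exp y / (1 + ε n * Real.exp y) with hp
  have hp0 : ∀ n y, 0 ≤ p n y := fun n y => by have := hε0 n; simp only [hp]; positivity
  have hpε : ∀ n y, p n y ≤ (ε n)⁻¹ := fun n y => by
    have := hε0 n
    have := Real.exp_pos y
    simp only [hp]
    rw [div_le_iff₀ (by positivity), mul_add, ← mul_assoc, inv_mul_cancel₀ (hε0 n).ne']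
    have : 0 < (ε n)⁻¹ := inv_pos.2 (hε0 n)
    linarith
  set p₁ : ℕ → ℝ → ℝ := fun n y => Real.exp y / (1 + ε n * Real.exp y) ^ 2 with hp₁
  set p₂ : ℕ → ℝ → ℝ := fun n y =>
    Real.exp y * (1 - ε n * Real.exp y) / (1 + ε n * Real.exp y) ^ 3 with hp₂
  have hp₁0 : ∀ n y, 0 ≤ p₁ n y := fun n y => by have := hε0 n; simp only [hp₁]; positivity
  have hp₁ε : ∀ n y, p₁ n y ≤ (ε n)⁻¹ := fun n y => by
    refine le_trans ?_ (hpε n y)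
    have := mul_pos (hε0 n) (Real.exp_pos y)
    simp only [hp, hp₁]
    exact div_le_div_of_nonneg_left (Real.exp_pos y).le (by positivity)
      (le_self_pow₀ (by linarith) two_ne_zero)
  have hp₂p : ∀ n y, |p₂ n y| ≤ p₁ n y := fun n y => by
    have h0 := mul_pos (hε0 n) (Real.exp_pos y)
    simp only [hp₁, hp₂]
    rw [abs_div, abs_mul, abs_of_pos (Real.exp_pos y),
      abs_of_pos (show 0 < (1 + ε n * Real.exp y) ^ 3 by positivity),
      div_le_div_iff₀ (by positivity) (by positivity)]
    have h1 : |1 - ε n * Real.exp y| ≤ 1 + ε n * Real.exp y := by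
      rw [abs_le]; constructor <;> linarith
    calc Real.exp y * |1 - ε n * Real.exp y| * (1 + ε n * Real.exp y) ^ 2
        ≤ Real.exp y * (1 + ε n * Real.exp y) * (1 + ε n * Real.exp y) ^ 2 := by gcongr
      _ = _ := by ring
  have hpI : ∀ n, IsIto Q ℱ W (fun t ω => p n (I t ω - 1 / 2 * K t))
      (fun k' s ω => p₁ n (I s ω - 1 / 2 * K s) * if k' = k₀ then k s else 0)
      fun s ω => 1 / 2 * k s ^ 2 * (p₂ n (I s ω - 1 / 2 * K s) - p₁ n (I s ω - 1 / 2 * K s)) := by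
    intro n
    have hcd : ContDiff ℝ 3 (p n) := Real.contDiff_exp.div
      (contDiff_const.add (contDiff_const.mul Real.contDiff_exp)) fun y => by
        have := mul_pos (hε0 n) (Real.exp_pos y); positivity
    refine (hY.ito hB isOpen_univ (ae_of_all _ fun _ _ => trivial) hcd.contDiffOn
      (fun y _ => hasDerivAt_dampedExp (hε0 n) y)
      fun y _ => hasDerivAt_deriv_dampedExp (hε0 n) y).congr' (fun _ _ => rfl) (fun _ _ _ => rfl)
      fun s ω => ?_
    rw [qcov_single, hρ]
    ring
  have hle : ∀ n, ∫⁻ ω, ENNReal.ofReal (p n (I t ω - 1 / 2 * K t)) ∂Q ≤ 1 := by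
    intro n
    set b : ℝ≥0 → Ω → ℝ := fun s ω =>
      1 / 2 * k s ^ 2 * (p₂ n (I s ω - 1 / 2 * K s) - p₁ n (I s ω - 1 / 2 * K s)) with hb
    have hb0 : ∀ s ω, b s ω ≤ 0 := fun s ω =>
      mul_nonpos_of_nonneg_of_nonpos (by positivity)
        (sub_nonpos.2 ((le_abs_self _).trans (hp₂p n _)))
    have hbb : ∀ s ω, |b s ω| ≤ (ε n)⁻¹ * k s ^ 2 := fun s ω => by
      have h1 := hp₂p n (I s ω - 1 / 2 * K s)
      have h2 := hp₁ε n (I s ω - 1 / 2 * K s)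
      have h3 := abs_le.1 h1
      simp only [hb]
      rw [abs_mul, abs_of_nonneg (by positivity : 0 ≤ 1 / 2 * k s ^ 2)]
      calc _ ≤ 1 / 2 * k s ^ 2 * (2 * (ε n)⁻¹) := by
            refine mul_le_mul_of_nonneg_left ?_ (by positivity)
            rw [abs_le]; constructor <;> linarith
        _ = _ := by ring
    have hbi : ∀ᵐ ω ∂Q, IntegrableOn (fun s => b s ω) (Set.Iic t) leb :=
      (hpI n).integrableOn.mono fun ω hω => (hω t).2
    have hbt : ∀ᵐ ω ∂Q, ∫ u in Set.Iic t, |b u ω| ∂leb ≤ (ε n)⁻¹ * K t := by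
      filter_upwards [hbi] with ω h1
      rw [hK, ← integral_const_mul]
      exact integral_mono h1.abs (hk.const_mul _) fun s => hbb s ω
    have hz := (hpI n).setIntegral_sub_eq_zero hB (zero_le : 0 ≤ t)
      (C := max (ε n)⁻¹ (max ((ε n)⁻¹ ^ 2 * K t) ((ε n)⁻¹ * K t)))
      (ae_of_all _ fun ω u _ => ?_) (ae_of_all _ fun ω => ?_)
      (hbt.mono fun ω h => h.trans ((le_max_right _ _).trans (le_max_right _ _)))
      MeasurableSet.univ
    · rw [Measure.restrict_univ] at hz
      have hm := (hpI n).aestronglyMeasurable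
      have hi1 : ∀ u, Integrable (fun ω => p n (I u ω - 1 / 2 * K u)) Q := fun u =>
        (integrable_const (ε n)⁻¹).mono' (hm u) (ae_of_all _ fun ω => by
          rw [Real.norm_eq_abs, abs_of_nonneg (hp0 n _)]; exact hpε n _)
      have hi2 : Integrable (fun ω => ∫ u in Set.Ioc 0 t, b u ω ∂leb) Q :=
        (integrable_const ((ε n)⁻¹ * K t)).mono'
          ((hpI n).aestronglyMeasurable_setIntegral hB.adapted zero_le) (by
          filter_upwards [hbt, hbi] with ω h1 h2
          exact abs_integral_le_integral_abs.trans ((setIntegral_mono_set h2.abs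
            (ae_of_all _ fun _ => abs_nonneg _) Set.Ioc_subset_Iic_self.eventuallyLE).trans h1))
      have hle : ∫ ω, (p n (I t ω - 1 / 2 * K t) - p n (I 0 ω - 1 / 2 * K 0)) ∂Q ≤ 0 := by
        rw [← hz]
        refine integral_mono ((hi1 t).sub (hi1 0)) (((hi1 t).sub (hi1 0)).sub hi2) fun ω => ?_
        have : ∫ u in Set.Ioc 0 t, b u ω ∂leb ≤ 0 := integral_nonpos fun u => hb0 u ω
        simp only
        linarith
      rw [integral_sub (hi1 t) (hi1 0)] at hle
      have h0 : ∫ ω, p n (I 0 ω - 1 / 2 * K 0) ∂Q ≤ 1 := by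
        have : ∀ᵐ ω ∂Q, p n (I 0 ω - 1 / 2 * K 0) ≤ 1 := by
          filter_upwards [IsItoIntegral.ae_zero h] with ω h0
          simp only [hK, hp]
          rw [h0, setIntegral_Iic_zero, mul_zero, sub_zero, Real.exp_zero, mul_one]
          exact div_le_one_of_le₀ (by linarith [hε0 n]) (by linarith [hε0 n])
        simpa using integral_mono_ae (hi1 0) (integrable_const 1) this
      rw [← ofReal_integral_eq_lintegral_ofReal (hi1 t) (ae_of_all _ fun ω => hp0 n _)]
      exact ENNReal.ofReal_le_one.2 (by linarith)
    · rw [abs_of_nonneg (hp0 n _)]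
      exact (hpε n _).trans (le_max_left _ _)
    · refine le_trans ?_ ((le_max_left _ _).trans (le_max_right _ _))
      rw [hK, ← integral_const_mul]
      refine integral_mono_of_nonneg (ae_of_all _ fun s =>
        Finset.sum_nonneg fun _ _ => sq_nonneg _) (hk.const_mul _) (ae_of_all _ fun s => ?_)
      simp only [mul_pow, ite_pow, ne_eq, OfNat.ofNat_ne_zero, not_false_eq_true, zero_pow,
        mul_ite, mul_zero, Finset.sum_ite_eq', Finset.mem_univ, if_true]
      exact mul_le_mul_of_nonneg_right (pow_le_pow_left₀ (hp₁0 n _) (hp₁ε n _) 2) (sq_nonneg _)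
  refine lintegral_le_of_tendsto_of_le
    (fun n => ((hpI n).aestronglyMeasurable t).aemeasurable.ennreal_ofReal)
    (ae_of_all _ fun ω => ENNReal.tendsto_ofReal ?_) hle
  have := (tendsto_const_nhds (x := Real.exp (I t ω - 1 / 2 * K t))).div
    ((hlim.mul_const (Real.exp (I t ω - 1 / 2 * K t))).const_add 1) (by simp)
  simp only [zero_mul, add_zero, div_one] at this
  exact this

end ItoCalculus

namespace ItoCalculus

open RoughFMM (leb IsItoIntegral IsStochIntegral IsCorrelatedBM Model)

/-! ### Positivity of the forward rates -/

/-- The function `log (1 + 1 / x)`; the barrier function is its value at `r ^ 2 + e`. -/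
noncomputable def logGap (x : ℝ) : ℝ := Real.log (x + 1) - Real.log x

lemma logGap_nonneg {x : ℝ} (hx : 0 < x) : 0 ≤ logGap x :=
  sub_nonneg.2 (Real.log_le_log hx (by linarith))

lemma logGap_anti {x y : ℝ} (hx : 0 < x) (hxy : x ≤ y) : logGap y ≤ logGap x := by
  have hy := hx.trans_le hxy
  have : Real.log ((y + 1) * x) ≤ Real.log ((x + 1) * y) :=
    Real.log_le_log (by positivity) (by linarith)
  rw [Real.log_mul (by positivity) hx.ne', Real.log_mul (by positivity) hy.ne'] at this
  unfold logGap
  linarith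

lemma tendsto_logGap : Tendsto (fun n : ℕ => logGap (2 * ((n : ℝ) + 1)⁻¹)) atTop atTop := by
  have h1 : Tendsto (fun n : ℕ => Real.log (((n : ℝ) + 1) * 2⁻¹)) atTop atTop :=
    Real.tendsto_log_atTop.comp ((tendsto_natCast_atTop_atTop.atTop_add
      (tendsto_const_nhds (x := (1 : ℝ)))).atTop_mul_const (by norm_num))
  refine tendsto_atTop_mono (fun n => ?_) h1
  have h2 : ((n : ℝ) + 1) * 2⁻¹ = (2 * ((n : ℝ) + 1)⁻¹)⁻¹ := by rw [mul_inv, inv_inv, mul_comm]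
  have h3 : (0 : ℝ) < 2 * ((n : ℝ) + 1)⁻¹ := by positivity
  rw [h2, Real.log_inv, logGap]
  have := Real.log_nonneg (show (1 : ℝ) ≤ 2 * ((n : ℝ) + 1)⁻¹ + 1 by linarith)
  linarith

section Barrier

variable {e : ℝ}

/-- The first derivative of `r ↦ logGap (r ^ 2 + e)`. -/
noncomputable def barrier₁ (e r : ℝ) : ℝ := 2 * r / (r ^ 2 + e + 1) - 2 * r / (r ^ 2 + e)

/-- The second derivative of `r ↦ logGap (r ^ 2 + e)`. -/
noncomputable def barrier₂ (e r : ℝ) : ℝ :=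
  (2 / (r ^ 2 + e + 1) - 4 * r ^ 2 / (r ^ 2 + e + 1) ^ 2) -
    (2 / (r ^ 2 + e) - 4 * r ^ 2 / (r ^ 2 + e) ^ 2)

lemma hasDerivAt_barrier (he : 0 < e) (r : ℝ) :
    HasDerivAt (fun r => logGap (r ^ 2 + e)) (barrier₁ e r) r := by
  have h := ((hasDerivAt_pow 2 r).add_const e)
  refine (((h.add_const 1).log (by positivity)).fun_sub (h.log (by positivity))).congr_deriv ?_
  simp [barrier₁]

lemma hasDerivAt_barrier₁ (he : 0 < e) (r : ℝ) :
    HasDerivAt (barrier₁ e) (barrier₂ e r) r := by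
  have h := ((hasDerivAt_pow 2 r).add_const e)
  have h2 := (hasDerivAt_id r).const_mul 2
  refine ((h2.fun_div (h.add_const 1) (by positivity)).fun_sub
    (h2.fun_div h (by positivity))).congr_deriv ?_
  have h3 : r ^ 2 + e ≠ 0 := by positivity
  have h4 : r ^ 2 + e + 1 ≠ 0 := by positivity
  simp only [barrier₂, id]
  field_simp
  ring

lemma contDiff_barrier (he : 0 < e) : ContDiff ℝ 3 fun r => logGap (r ^ 2 + e) := by
  unfold logGap
  exact (((contDiff_id.pow 2).add contDiff_const).add contDiff_const).log
    (fun x => by simp only [id]; positivity) |>.sub (((contDiff_id.pow 2).add contDiff_const).log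
    fun x => by simp only [id]; positivity)

lemma abs_mul_barrier₁_le (he : 0 < e) {r : ℝ} (hr : 0 < r) : |barrier₁ e r| * r ≤ 2 := by
  have key : ∀ x, r ^ 2 ≤ x → 0 ≤ 2 * r / x * r ∧ 2 * r / x * r ≤ 2 := fun x hx => by
    have : 0 < x := (by positivity : 0 < r ^ 2).trans_le hx
    refine ⟨by positivity, ?_⟩
    rw [div_mul_eq_mul_div, div_le_iff₀ this]
    nlinarith
  have h1 := key (r ^ 2 + e + 1) (by linarith)
  have h2 := key (r ^ 2 + e) (by linarith)
  calc |barrier₁ e r| * r = |barrier₁ e r * r| := by rw [abs_mul, abs_of_pos hr]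
    _ ≤ 2 := by rw [barrier₁, sub_mul, abs_le]; constructor <;> linarith

lemma abs_mul_barrier₂_le (he : 0 < e) (r : ℝ) : |barrier₂ e r| * r ^ 2 ≤ 6 := by
  have key : ∀ x, 0 < x → r ^ 2 ≤ x → -4 ≤ (2 / x - 4 * r ^ 2 / x ^ 2) * r ^ 2 ∧
      (2 / x - 4 * r ^ 2 / x ^ 2) * r ^ 2 ≤ 2 := fun x hx h => by
    have e1 : (2 / x - 4 * r ^ 2 / x ^ 2) * r ^ 2 = 2 * (r ^ 2 / x) - 4 * (r ^ 2 / x) ^ 2 := by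
      field_simp
    have h1 : r ^ 2 / x ≤ 1 := div_le_one_of_le₀ h hx.le
    have h2 : 0 ≤ r ^ 2 / x := by positivity
    rw [e1]
    constructor <;> nlinarith
  have h1 := key (r ^ 2 + e + 1) (by positivity) (by linarith)
  have h2 := key (r ^ 2 + e) (by positivity) (by linarith)
  calc |barrier₂ e r| * r ^ 2 = |barrier₂ e r * r ^ 2| := by
        rw [abs_mul, abs_of_nonneg (sq_nonneg r)]
    _ ≤ 6 := by rw [barrier₂, sub_mul, abs_le]; constructor <;> linarith

end Barrier

/-- If the integral of a nonnegative continuous function vanishes, then so does the function. -/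
lemma eq_zero_of_setIntegral_eq_zero {f : ℝ≥0 → ℝ} (hf : Continuous f) (h0 : ∀ s, 0 ≤ f s)
    {u : ℝ≥0} (hu : 0 < u) (h : ∫ s in Set.Iic u, f s ∂leb = 0) {s : ℝ≥0} (hs : s ≤ u) :
    f s = 0 := by
  have hae : ∀ᵐ s ∂leb.restrict (Set.Iic u), f s = 0 :=
    (integral_eq_zero_iff_of_nonneg h0 (integrableOn_Iic_of_continuous hf u)).1 h
  have hcl : IsClosed {s | f s = 0} := isClosed_eq hf continuous_const
  have hlt : Set.Iio u ⊆ {s | f s = 0} := by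
    intro s hs
    rw [← hcl.closure_eq, mem_closure_iff_nhds]
    intro t ht
    obtain ⟨w, hw, hwt⟩ := exists_Ico_subset_of_mem_nhds ht ⟨u, hs⟩
    have hsv : s < min w u := lt_min hw hs
    by_contra hne
    have hz : leb (Set.Ioo s (min w u)) = 0 := by
      rw [ae_restrict_iff' measurableSet_Iic] at hae
      exact measure_eq_zero_iff_ae_notMem.2 (hae.mono fun x hx hx' => hne ⟨x, hwt ⟨hx'.1.le,
        hx'.2.trans_le (min_le_left _ _)⟩, hx (Set.mem_Iic.2
          (hx'.2.le.trans (min_le_right _ _)))⟩)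
    have h1 := leb_Ioc s (min w u)
    have h2 : leb (Set.Ioc s (min w u)) ≤ leb (Set.Ioo s (min w u)) + leb {min w u} := by
      refine (measure_mono fun x hx => ?_).trans (measure_union_le _ _)
      rcases hx.2.eq_or_lt with h | h
      · exact Or.inr h
      · exact Or.inl ⟨hx.1, h⟩
    rw [hz, measure_singleton, add_zero, h1, nonpos_iff_eq_zero, ENNReal.ofReal_eq_zero] at h2
    have : (s : ℝ) < (min w u : ℝ≥0) := by exact_mod_cast hsv
    linarith
  have : s ∈ closure (Set.Iio u) := by rw [closure_Iio' (a := u) ⟨0, Set.mem_Iio.2 hu⟩]; exact hs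
  exact hcl.closure_subset_iff.2 hlt this

section Modification

variable {Ω : Type*} [mΩ : MeasurableSpace Ω] {Q : Measure Ω} [IsProbabilityMeasure Q]
  {ℱ : Filtration ℝ≥0 mΩ}

/-- As `ℱ 0` contains the null sets, exceptional paths may be replaced by constant ones. -/
lemma exists_modification
    (hℱ : ∀ A : Set Ω, MeasurableSet[ℱ 0] A ↔ MeasurableSet A ∧ (Q A = 0 ∨ Q A = 1))
    {R : ℝ≥0 → Ω → ℝ} (hR : StronglyAdapted ℱ R) {U : Set ℝ} {x : ℝ} (hx : x ∈ U)
    (h : ∀ᵐ ω ∂Q, (Continuous fun t => R t ω) ∧ ∀ t, R t ω ∈ U) :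
    ∃ R' : ℝ≥0 → Ω → ℝ, StronglyAdapted ℱ R' ∧ (∀ ω, Continuous fun t => R' t ω) ∧
      (∀ ω t, R' t ω ∈ U) ∧ ∀ᵐ ω ∂Q, ∀ t, R t ω = R' t ω := by
  classical
  obtain ⟨G, hG, hG1, hG2⟩ := exists_measurableSet_of_ae hℱ h
  refine ⟨fun t => G.piecewise (R t) fun _ => x, fun t =>
    (hR t).piecewise (ℱ.mono zero_le _ hG) stronglyMeasurable_const, fun ω => ?_, fun ω t => ?_,
    hG1.mono fun ω hω t => by simp [hω]⟩
  · by_cases hω : ω ∈ G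
    · simpa [hω] using (hG2 ω hω).1
    · simpa [hω] using continuous_const
  · by_cases hω : ω ∈ G
    · simpa [hω] using (hG2 ω hω).2 t
    · simpa [hω] using hx

end Modification

section Coefficients

variable {N : ℕ} {Ω : Type*} (M : Model N)

lemma θ_pos (i : Fin N) : 0 < M.θ i :=
  sub_pos.2 (by exact_mod_cast M.T_strictMono i.castSucc_lt_succ)

lemma γ_nonneg (i : Fin N) (t : ℝ≥0) : 0 ≤ M.γ i t := by
  have := θ_pos M i
  unfold Model.θ at this
  unfold Model.γ
  split_ifs with h1 h2
  · exact zero_le_one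
  · have : (t : ℝ) ≤ M.T i.succ := by exact_mod_cast h2
    exact div_nonneg (by linarith) (by linarith)
  · exact le_rfl

lemma γ_le_one (i : Fin N) (t : ℝ≥0) : M.γ i t ≤ 1 := by
  have := θ_pos M i
  unfold Model.θ at this
  unfold Model.γ
  split_ifs with h1 h2
  · exact le_rfl
  · have : (M.T i.castSucc : ℝ) ≤ t := by exact_mod_cast (not_le.1 h1).le
    exact div_le_one_of_le₀ (by linarith) (by linarith)
  · exact zero_le_one

/-- The linear growth bound of the volatility functions, with a common constant. -/
lemma exists_linear_bound (hη : ∀ i, BddAbove ((fun r : ℝ => M.η i r / r) '' Set.Ioi 0)) :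
    ∃ C : ℝ, 0 ≤ C ∧ ∀ i r, 0 < r → M.η i r ≤ C * r := by
  choose c hc using hη
  refine ⟨∑ i, |c i|, Finset.sum_nonneg fun i _ => abs_nonneg _, fun i r hr => ?_⟩
  have h1 := hc i ⟨r, hr, rfl⟩
  have h2 : |c i| ≤ ∑ i, |c i| :=
    Finset.single_le_sum (f := fun i => |c i|) (fun i _ => abs_nonneg _) (Finset.mem_univ i)
  exact (div_le_iff₀ hr).1 (h1.trans ((le_abs_self _).trans h2))

variable {M} {R V : Fin N → ℝ≥0 → Ω → ℝ} {C : ℝ}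

lemma abs_vol_le (hC : ∀ i r, 0 < r → M.η i r ≤ C * r) {i : Fin N} {u : ℝ≥0} {ω : Ω}
    (hR : 0 < R i u ω) : |M.vol R V i u ω| ≤ C * R i u ω * √(V i u ω) := by
  unfold Model.vol
  rw [abs_mul, abs_mul, abs_of_nonneg (γ_nonneg M i u), abs_of_pos (M.η_pos i _ hR),
    abs_of_nonneg (Real.sqrt_nonneg _)]
  refine mul_le_mul_of_nonneg_right ?_ (Real.sqrt_nonneg _)
  exact (mul_le_of_le_one_left (M.η_pos i _ hR).le (γ_le_one M i u)).trans (hC i _ hR)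

lemma abs_driftTerm_le (hC0 : 0 ≤ C) (hC : ∀ i r, 0 < r → M.η i r ≤ C * r) {i : Fin N}
    {k : Fin (N + 1)} {u : ℝ≥0} {ω : Ω} (hR : 0 < R i u ω) :
    |M.driftTerm R V i k u ω| ≤ C * |M.ρ i.succ k| * √(V i u ω) := by
  have hθ := θ_pos M i
  have h1 : 0 < 1 + M.θ i * R i u ω := by positivity
  unfold Model.driftTerm
  rw [abs_mul, abs_mul, abs_of_pos (by positivity : 0 < M.θ i / (1 + M.θ i * R i u ω))]
  calc M.θ i / (1 + M.θ i * R i u ω) * |M.vol R V i u ω| * |M.ρ i.succ k|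
      ≤ M.θ i / (1 + M.θ i * R i u ω) * (C * R i u ω * √(V i u ω)) * |M.ρ i.succ k| := by
        refine mul_le_mul_of_nonneg_right ?_ (abs_nonneg _)
        exact mul_le_mul_of_nonneg_left (abs_vol_le hC hR) (by positivity)
    _ = M.θ i * R i u ω / (1 + M.θ i * R i u ω) * (C * |M.ρ i.succ k| * √(V i u ω)) := by ring
    _ ≤ 1 * (C * |M.ρ i.succ k| * √(V i u ω)) := by
        refine mul_le_mul_of_nonneg_right (div_le_one_of_le₀ ?_ h1.le) (by positivity)
        linarith
    _ = _ := one_mul _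

/-- This is where the sign of the correlations enters: the variance drifts downwards. -/
lemma driftBar_nonpos (hρ : ∀ i : Fin N, M.ρ 0 i.succ ≤ 0) {u : ℝ≥0} {ω : Ω}
    (hR : ∀ i, 0 < R i u ω) : M.driftBar R V u ω ≤ 0 := by
  refine Finset.sum_nonpos fun i _ => ?_
  have hθ := θ_pos M i
  have hRi := hR i
  have h1 : M.ρ i.succ 0 ≤ 0 := by
    have := M.ρ_posSemidef.isHermitian.apply i.succ 0
    rw [← this]; exact hρ i
  refine mul_nonpos_of_nonneg_of_nonpos (mul_nonneg (by positivity) ?_) h1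
  exact mul_nonneg (mul_nonneg (γ_nonneg M i u) (M.η_pos i _ (hR i)).le) (Real.sqrt_nonneg _)

/-- The drift of `∑ i, logGap (R i ^ 2 + e)` is bounded by the variances, uniformly in `e`. -/
lemma exists_barrier_drift_bound
    (hη : ∀ i, BddAbove ((fun r : ℝ => M.η i r / r) '' Set.Ioi 0)) :
    ∃ D : ℝ, 0 ≤ D ∧ ∀ (R V : Fin N → ℝ≥0 → Ω → ℝ) (e : ℝ) (u : ℝ≥0) (ω : Ω), 0 < e →
      (∀ i, 0 < R i u ω) →
      ∑ i, (barrier₁ e (R i u ω) * (M.vol R V i u ω * M.driftDagger R V i u ω) +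
        1 / 2 * barrier₂ e (R i u ω) * M.vol R V i u ω ^ 2) ≤ D * ∑ i, √(V i u ω) ^ 2 := by
  obtain ⟨C, hC0, hC⟩ := exists_linear_bound M hη
  set P := ∑ k, ∑ l, |M.ρ k l| with hP
  have hPρ : ∀ k l, |M.ρ k l| ≤ P := fun k l =>
    (Finset.single_le_sum (f := fun l => |M.ρ k l|) (fun l _ => abs_nonneg _)
      (Finset.mem_univ l)).trans (Finset.single_le_sum (f := fun k => ∑ l, |M.ρ k l|)
        (fun k _ => Finset.sum_nonneg fun l _ => abs_nonneg _) (Finset.mem_univ k))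
  have hP0 : 0 ≤ P := Finset.sum_nonneg fun k _ => Finset.sum_nonneg fun l _ => abs_nonneg _
  refine ⟨2 * C ^ 2 * P * N + 3 * C ^ 2, by positivity, fun R V e u ω he hR => ?_⟩
  set v : Fin N → ℝ := fun i => √(V i u ω) with hv
  have hv0 : ∀ i, 0 ≤ v i := fun i => Real.sqrt_nonneg _
  have h1 : ∀ i, |barrier₁ e (R i u ω) * M.vol R V i u ω| ≤ 2 * C * v i := fun i => by
    rw [abs_mul]
    calc _ ≤ |barrier₁ e (R i u ω)| * (C * R i u ω * v i) :=
          mul_le_mul_of_nonneg_left (abs_vol_le hC (hR i)) (abs_nonneg _)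
      _ = |barrier₁ e (R i u ω)| * R i u ω * (C * v i) := by ring
      _ ≤ 2 * (C * v i) := mul_le_mul_of_nonneg_right (abs_mul_barrier₁_le he (hR i))
          (mul_nonneg hC0 (hv0 i))
      _ = _ := by ring
  have h2 : ∀ i, |M.driftDagger R V i u ω| ≤ C * P * ∑ l, v l := fun i => by
    refine (Finset.abs_sum_le_sum_abs _ _).trans ?_
    rw [Finset.mul_sum]
    refine (Finset.sum_le_sum_of_subset_of_nonneg (Finset.subset_univ _)
      fun l _ _ => abs_nonneg _).trans (Finset.sum_le_sum fun l _ => ?_)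
    exact (abs_driftTerm_le hC0 hC (hR l)).trans (mul_le_mul_of_nonneg_right
      (mul_le_mul_of_nonneg_left (hPρ _ _) hC0) (hv0 l))
  have h3 : ∀ i, |barrier₂ e (R i u ω)| * M.vol R V i u ω ^ 2 ≤ 6 * C ^ 2 * v i ^ 2 := fun i => by
    calc _ ≤ |barrier₂ e (R i u ω)| * (C * R i u ω * v i) ^ 2 := by
          rw [← sq_abs (M.vol R V i u ω)]
          exact mul_le_mul_of_nonneg_left (pow_le_pow_left₀ (abs_nonneg _)
            (abs_vol_le hC (hR i)) 2) (abs_nonneg _)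
      _ = |barrier₂ e (R i u ω)| * R i u ω ^ 2 * (C ^ 2 * v i ^ 2) := by ring
      _ ≤ 6 * (C ^ 2 * v i ^ 2) :=
          mul_le_mul_of_nonneg_right (abs_mul_barrier₂_le he _) (by positivity)
      _ = _ := by ring
  have h4 : (∑ l, v l) ^ 2 ≤ N * ∑ l, v l ^ 2 := by
    simpa using sq_sum_le_card_mul_sum_sq (s := Finset.univ) (f := v)
  have hs0 : 0 ≤ ∑ l, v l := Finset.sum_nonneg fun l _ => hv0 l
  calc _ ≤ ∑ i, (2 * C * v i * (C * P * ∑ l, v l) + 3 * C ^ 2 * v i ^ 2) := by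
        refine Finset.sum_le_sum fun i _ => add_le_add ?_ ?_
        · rw [← mul_assoc]
          refine (le_abs_self _).trans ?_
          rw [abs_mul]
          exact mul_le_mul (h1 i) (h2 i) (abs_nonneg _)
            (mul_nonneg (by positivity) (hv0 i))
        · have := mul_le_mul_of_nonneg_right (le_abs_self (barrier₂ e (R i u ω)))
            (sq_nonneg (M.vol R V i u ω))
          have := h3 i
          rw [mul_assoc]
          linarith
    _ = 2 * C ^ 2 * P * (∑ l, v l) ^ 2 + 3 * C ^ 2 * ∑ i, v i ^ 2 := by
        rw [Finset.sum_add_distrib, ← Finset.sum_mul, ← Finset.mul_sum, ← Finset.mul_sum]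
        ring
    _ ≤ 2 * C ^ 2 * P * (N * ∑ l, v l ^ 2) + 3 * C ^ 2 * ∑ i, v i ^ 2 := by
        gcongr
    _ = _ := by ring

end Coefficients

end ItoCalculus

namespace ItoCalculus

open RoughFMM (leb IsItoIntegral IsStochIntegral IsCorrelatedBM Model)

section Variance

variable {N : ℕ} {Ω : Type*} [mΩ : MeasurableSpace Ω] {Q : Measure Ω} [IsProbabilityMeasure Q]
  {ℱ : Filtration ℝ≥0 mΩ} {M : Model N} {W : Fin (N + 1) → ℝ≥0 → Ω → ℝ}
  {R V : Fin N → ℝ≥0 → Ω → ℝ}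

lemma setIntegral_kernel_sq (j : Fin N) (t : ℝ≥0) :
    ∫ s in Set.Iic t, (if s < t then M.ζ j ((t : ℝ) - (s : ℝ)) else 0) ^ 2 ∂leb =
      ∫ s in (0 : ℝ)..t, M.ζ j ((t : ℝ) - s) ^ 2 := by
  rw [← setIntegral_leb_Iic (fun s => M.ζ j ((t : ℝ) - s) ^ 2)]
  refine setIntegral_congr_ae measurableSet_Iic ?_
  filter_upwards [measure_eq_zero_iff_ae_notMem.1 (measure_singleton (μ := leb) t)] with s hs hs'
  have : s < t := lt_of_le_of_ne (Set.mem_Iic.1 hs') hs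
  simp [this]

/-- As long as the drift of the common volatility factor is nonpositive, the variance is dominated
by the forward variance curve, in mean. -/
lemma lintegral_variance_le (hsol : M.IsSolution Q ℱ W R V) (j : Fin N) (t : ℝ≥0)
    {p : Ω → Prop} [DecidablePred p]
    (hp : ∀ᵐ ω ∂Q, p ω → ∀ s < t, M.driftBar R V s ω ≤ 0) :
    ∫⁻ ω, (if p ω then ENNReal.ofReal (V j t ω) else 0) ∂Q ≤ ENNReal.ofReal (M.ξ j t) := by
  have hB := BM.of_isCorrelatedBM M.ρ_posSemidef hsol.brownian id
  obtain ⟨Y, ⟨I, hI, hint, hY⟩, hV⟩ := hsol.eq_V j t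
  set k : ℝ≥0 → ℝ := fun s => if s < t then M.ζ j ((t : ℝ) - (s : ℝ)) else 0 with hk
  have hexp := lintegral_exp_le_one (k := k) hB (M.ρ_diag 0) hI t
  rw [setIntegral_kernel_sq] at hexp
  have hξ := M.ξ_pos j t
  calc ∫⁻ ω, (if p ω then ENNReal.ofReal (V j t ω) else 0) ∂Q
      ≤ ∫⁻ ω, ENNReal.ofReal (M.ξ j t) * ENNReal.ofReal (Real.exp (I t ω - 1 / 2 *
          ∫ s in (0 : ℝ)..t, M.ζ j ((t : ℝ) - s) ^ 2)) ∂Q := by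
        refine lintegral_mono_ae ?_
        filter_upwards [hp, hY, hV, hsol.pos_V j t] with ω h1 h2 h3 h4
        split_ifs with h
        · rw [← ENNReal.ofReal_mul hξ.le]
          refine ENNReal.ofReal_le_ofReal ?_
          rw [← Real.exp_log h4, h3, h2 t, sub_add, sub_eq_add_neg, Real.exp_add,
            Real.exp_log hξ]
          refine mul_le_mul_of_nonneg_left (Real.exp_le_exp.2 ?_) hξ.le
          have : ∫ s in Set.Iic t, M.kernel j t s ω * M.driftBar R V s ω ∂leb ≤ 0 := by
            refine integral_nonpos fun s => ?_
            simp only [Model.kernel]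
            split_ifs with hs
            · exact mul_nonpos_of_nonneg_of_nonpos
                (M.ζ_pos j _ (sub_pos.2 (by exact_mod_cast hs))).le (h1 h s hs)
            · simp
          linarith
        · exact zero_le
    _ = ENNReal.ofReal (M.ξ j t) * ∫⁻ ω, ENNReal.ofReal (Real.exp (I t ω - 1 / 2 *
          ∫ s in (0 : ℝ)..t, M.ζ j ((t : ℝ) - s) ^ 2)) ∂Q :=
        lintegral_const_mul' _ _ ENNReal.ofReal_ne_top
    _ ≤ ENNReal.ofReal (M.ξ j t) * 1 := by gcongr
    _ = _ := mul_one _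

/-- The equation of a forward rate, as an Itô process driven by `W`. -/
lemma isIto_rate (hℱ : ∀ A : Set Ω, MeasurableSet[ℱ 0] A ↔ MeasurableSet A ∧ (Q A = 0 ∨ Q A = 1))
    (hsol : M.IsSolution Q ℱ W R V) (j : Fin N) :
    IsIto Q ℱ W (R j) (fun k s ω => if k = j.succ then M.vol R V j s ω else 0)
      fun s ω => M.vol R V j s ω * M.driftDagger R V j s ω := by
  obtain ⟨X, hX, hRX⟩ := hsol.eq_R j
  obtain ⟨c, hc⟩ := exists_ae_eq_const hℱ (hsol.adapted_R j 0)
  exact IsIto.of_isStochIntegral (BM.of_isCorrelatedBM M.ρ_posSemidef hsol.brownian id) j.succ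
    hX (hsol.adapted_R j) hc hRX

set_option maxHeartbeats 1000000 in
/-- The forward rates stay positive. If one of them came close to `0`, the barrier function
`∑ i, log (1 + 1 / (R i ^ 2 + e))` would have to become large, but its drift is controlled by the
variances, which are bounded in mean as long as the rates are positive. -/
theorem ae_rate_pos
    (hℱ : ∀ A : Set Ω, MeasurableSet[ℱ 0] A ↔ MeasurableSet A ∧ (Q A = 0 ∨ Q A = 1))
    (hsol : M.IsSolution Q ℱ W R V) (hR0 : ∀ i, ∀ᵐ ω ∂Q, 0 < R i 0 ω)
    (hη : ∀ i, BddAbove ((fun r : ℝ => M.η i r / r) '' Set.Ioi 0))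
    (hρ : ∀ i : Fin N, M.ρ 0 i.succ ≤ 0) : ∀ᵐ ω ∂Q, ∀ i t, 0 < R i t ω := by
  classical
  have hB := BM.of_isCorrelatedBM M.ρ_posSemidef hsol.brownian id
  choose R' hR'a hR'c _ hRR' using fun i => exists_modification hℱ (hsol.adapted_R i)
    (Set.mem_univ (1 : ℝ)) ((hsol.continuous_R i).mono fun ω h => ⟨h, fun _ => Set.mem_univ _⟩)
  have hRR : ∀ᵐ ω ∂Q, ∀ i t, R i t ω = R' i t ω := ae_all_iff.2 hRR'
  have hIto : ∀ i, IsIto Q ℱ W (R' i) (fun k s ω => if k = i.succ then M.vol R V i s ω else 0)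
      fun s ω => M.vol R V i s ω * M.driftDagger R V i s ω := fun i =>
    (isIto_rate hℱ hsol i).congr (hRR' i) (ae_of_all _ fun ω k => ae_of_all _ fun s => rfl)
      (ae_of_all _ fun ω => ae_of_all _ fun s => rfl)
  choose c hc using fun i => exists_ae_eq_const hℱ (hsol.adapted_R i 0)
  have hc0 : ∀ i, 0 < c i := fun i => by
    obtain ⟨ω, h1, h2⟩ := ((hc i).and (hR0 i)).exists
    rwa [← h1]
  obtain ⟨D, hD, hDb⟩ := exists_barrier_drift_bound (Ω := Ω) hη
  -- `J e u` is positive as soon as one of the rates has been below `√e` in absolute value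
  set Ψ : ℝ → ℝ≥0 → Ω → ℝ := fun e u ω => ∑ i, max 0 (e - R' i u ω ^ 2) with hΨ
  set J : ℝ → ℝ≥0 → Ω → ℝ := fun e u ω => ∫ s in Set.Iic u, Ψ e s ω ∂leb with hJ
  have hΨ0 : ∀ e u ω, 0 ≤ Ψ e u ω := fun e u ω => Finset.sum_nonneg fun i _ => le_max_left _ _
  have hΨc : ∀ e ω, Continuous fun u => Ψ e u ω := fun e ω =>
    continuous_finsetSum _ fun i _ => continuous_const.max (continuous_const.sub
      ((hR'c i ω).pow 2))
  have hΨa : ∀ e, StronglyAdapted ℱ (Ψ e) := fun e u =>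
    Finset.stronglyMeasurable_fun_sum _ fun i _ =>
      (continuous_const.max (continuous_const.sub (continuous_pow 2)) :
        Continuous fun x : ℝ => max 0 (e - x ^ 2)).comp_stronglyMeasurable (hR'a i u)
  have hJI : ∀ e, IsIto Q ℱ W (J e) (fun _ _ _ => 0) (Ψ e) := fun e =>
    IsIto.integral_continuous hB.adapted (hΨa e) (ae_of_all _ fun ω => hΨc e ω)
  have hΨm : ∀ e, Measurable fun p : ℝ≥0 × Ω => Ψ e p.1 p.2 := fun e =>
    (measurable_uncurry_of_continuous_of_measurable (u := Ψ e) (fun ω => hΨc e ω)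
      fun u => ((hΨa e u).mono (ℱ.le u)).measurable)
  have hJm : ∀ e, Measurable fun p : ℝ≥0 × Ω => J e p.1 p.2 := fun e => by
    have h1 : Measurable fun q : (ℝ≥0 × Ω) × ℝ≥0 => if q.2 ≤ q.1.1 then Ψ e q.2 q.1.2 else 0 :=
      Measurable.ite (measurableSet_le measurable_snd measurable_fst.fst)
        ((hΨm e).comp (measurable_snd.prodMk measurable_fst.snd)) measurable_const
    have h2 : (fun p : ℝ≥0 × Ω => J e p.1 p.2) = fun p : ℝ≥0 × Ω =>
        ∫ s, (if s ≤ p.1 then Ψ e s p.2 else 0) ∂leb := by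
      funext p
      simp only [hJ]
      rw [← integral_indicator measurableSet_Iic]
      rfl
    rw [h2]
    exact (h1.stronglyMeasurable.integral_prod_right' (ν := leb)).measurable
  -- while `J e` vanishes, no rate comes close to `0`, and by continuity all of them are positive
  have hJ0 : ∀ᵐ ω ∂Q, ∀ e u, 0 < e → 0 < u → J e u ω = 0 → ∀ s ≤ u, ∀ i, 0 < R i s ω := by
    filter_upwards [hRR, ae_all_iff.2 hR0] with ω h1 h2 e u he hu hJu s hs i
    have hne : ∀ v ≤ u, R' i v ω ≠ 0 := fun v hv h => by
      have h3 := eq_zero_of_setIntegral_eq_zero (hΨc e ω) (fun s => hΨ0 e s ω) hu hJu hv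
      rw [hΨ, Finset.sum_eq_zero_iff_of_nonneg fun i _ => le_max_left _ _] at h3
      have h4 := h3 i (Finset.mem_univ i)
      rw [h] at h4
      have := le_max_right 0 (e - 0 ^ 2)
      norm_num at this h4
      linarith
    rw [h1]
    by_contra! hle
    have h5 := h2 i
    rw [h1] at h5
    obtain ⟨v, hv, hv'⟩ := intermediate_value_Icc' (zero_le : 0 ≤ s) (hR'c i ω).continuousOn
      (show (0 : ℝ) ∈ Set.Icc (R' i s ω) (R' i 0 ω) from ⟨hle, h5.le⟩)
    exact hne v (hv.2.trans hs) hv'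
  -- the barrier estimate
  have hbar : ∀ t : ℝ≥0, ∃ B : ℝ≥0∞, B ≠ ∞ ∧ ∀ e, 0 < e →
      ENNReal.ofReal (logGap (2 * e)) * Q {ω | 0 < J e t ω} ≤ B := by
    intro t
    refine ⟨ENNReal.ofReal (∑ i, logGap (c i ^ 2)) +
      ENNReal.ofReal D * ∑ i, ∫⁻ u in Set.Iic t, ENNReal.ofReal (M.ξ i u) ∂leb, ?_, fun e he => ?_⟩
    · refine ENNReal.add_ne_top.2 ⟨ENNReal.ofReal_ne_top, ENNReal.mul_ne_top ENNReal.ofReal_ne_top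
        (ENNReal.sum_ne_top.2 fun i _ => ?_)⟩
      exact (integrableOn_Iic_of_continuous (M.ξ_continuous i) t).lintegral_lt_top.ne
    have hS := IsIto.finset_sum (Q := Q) hB.adapted Finset.univ fun i _ => (hIto i).ito hB isOpen_univ
      (ae_of_all _ fun _ _ => trivial) (contDiff_barrier he).contDiffOn
      (fun r _ => hasDerivAt_barrier he r) fun r _ => hasDerivAt_barrier₁ he r
    have hgap : ∀ i u ω, 0 ≤ logGap (R' i u ω ^ 2 + e) ∧ logGap (R' i u ω ^ 2 + e) ≤ logGap e :=
      fun i u ω => ⟨logGap_nonneg (by positivity), logGap_anti he (by nlinarith [sq_nonneg (R' i u ω)])⟩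
    have hL0 : 0 ≤ logGap (2 * e) := logGap_nonneg (by positivity)
    have he0 : 0 ≤ logGap e := logGap_nonneg he
    -- only the values at `u ≤ t` matter; `min u t` makes `F` jointly measurable, since `V i` is
    -- progressively measurable
    set F : ℝ≥0 → Ω → ℝ≥0∞ := fun u ω =>
      if J e u ω = 0 then ENNReal.ofReal D * ∑ i, ENNReal.ofReal (V i (min u t) ω) else 0 with hF
    refine (hS.measure_pos_le hB (hJI e) (hΨ0 e) (ae_of_all _ fun ω u => rfl)
      (C := N * logGap e + logGap (2 * e)) (L := logGap (2 * e))
      (s₀ := ∑ i, logGap (c i ^ 2)) (t := t) (G := fun ω => ∫⁻ u in Set.Iic t, F u ω ∂leb)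
      (ae_of_all _ fun ω u => ⟨Finset.sum_nonneg fun i _ => (hgap i u ω).1, ?_⟩) hL0
      (le_add_of_nonneg_left (by positivity)) (ae_of_all _ fun ω u hu => ?_) ?_ ?_).trans
      (add_le_add le_rfl ?_)
    · calc ∑ i, logGap (R' i u ω ^ 2 + e) ≤ ∑ i : Fin N, logGap e :=
            Finset.sum_le_sum fun i _ => (hgap i u ω).2
        _ ≤ _ := by simpa using hL0
    · obtain ⟨i, -, hi⟩ := Finset.exists_ne_zero_of_sum_ne_zero hu.ne'
      have h1 : R' i u ω ^ 2 ≤ e := by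
        by_contra! h
        exact hi (max_eq_left (by linarith))
      exact (logGap_anti (by positivity) (by linarith)).trans
        (Finset.single_le_sum (f := fun i => logGap (R' i u ω ^ 2 + e))
          (fun i _ => (hgap i u ω).1) (Finset.mem_univ i))
    · filter_upwards [hRR, ae_all_iff.2 hc] with ω h1 h2
      refine Finset.sum_le_sum fun i _ => ?_
      rw [← h1, h2]
      have := hc0 i
      exact logGap_anti (by positivity) (by linarith)
    · filter_upwards [hJ0, hRR] with ω h1 h2
      refine lintegral_mono_ae ?_
      refine (ae_restrict_iff' measurableSet_Iic).2 ?_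
      filter_upwards [measure_eq_zero_iff_ae_notMem.1 (measure_singleton (μ := leb) 0)] with u hu hut
      have hut : u ≤ t := hut
      simp only [hF]
      split_ifs with h
      swap
      · exact le_rfl
      have h3 := hDb R V e u ω he fun i => h1 e u he (pos_iff_ne_zero.2 hu) h u le_rfl i
      simp only [qcov_single, min_eq_left hut]
      calc _ ≤ ENNReal.ofReal (D * ∑ i, √(V i u ω) ^ 2) := by
            refine ENNReal.ofReal_le_ofReal (le_trans (le_of_eq ?_) h3)
            refine Finset.sum_congr rfl fun i _ => ?_
            rw [h2, id, M.ρ_diag]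
            ring
        _ = _ := by
            rw [ENNReal.ofReal_mul hD, ENNReal.ofReal_sum_of_nonneg fun i _ => sq_nonneg _]
            refine congrArg _ (Finset.sum_congr rfl fun i _ => ?_)
            rw [Real.sq_sqrt', ENNReal.ofReal_max, ENNReal.ofReal_zero, max_eq_left zero_le]
    · have hVm : ∀ i, Measurable fun p : ℝ≥0 × Ω => V i (min p.1 t) p.2 := fun i =>
        measurable_progressive (hsol.progressive_V i) t
      have hFm : Measurable fun p : Ω × ℝ≥0 => F p.2 p.1 :=
        Measurable.ite (((hJm e).comp measurable_swap) (measurableSet_singleton 0))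
          (measurable_const.mul (Finset.measurable_fun_sum _ fun i _ =>
            ((hVm i).comp measurable_swap).ennreal_ofReal)) measurable_const
      rw [lintegral_lintegral_swap hFm.aemeasurable, Finset.mul_sum]
      simp_rw [← lintegral_const_mul' _ _ ENNReal.ofReal_ne_top]
      rw [← lintegral_finsetSum' _ fun i _ => ?_]
      · refine lintegral_mono_ae ?_
        refine (ae_restrict_iff' measurableSet_Iic).2 ?_
        filter_upwards [measure_eq_zero_iff_ae_notMem.1 (measure_singleton (μ := leb) 0)]
          with u hu hut
        have hut : u ≤ t := hut
        have hmV : ∀ i, Measurable fun ω => if J e u ω = 0 then ENNReal.ofReal (V i u ω) else 0 :=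
          fun i => Measurable.ite (((hJm e).comp measurable_prodMk_left) (measurableSet_singleton 0))
            (by simpa [min_eq_left hut] using
              ((hVm i).comp (measurable_prodMk_left (x := u))).ennreal_ofReal) measurable_const
        calc ∫⁻ ω, F u ω ∂Q = ∫⁻ ω, ∑ i, ENNReal.ofReal D *
              (if J e u ω = 0 then ENNReal.ofReal (V i u ω) else 0) ∂Q := by
              refine lintegral_congr fun ω => ?_
              simp only [hF, min_eq_left hut]
              split_ifs <;> simp [Finset.mul_sum]
          _ = ∑ i, ENNReal.ofReal D *
              ∫⁻ ω, (if J e u ω = 0 then ENNReal.ofReal (V i u ω) else 0) ∂Q := by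
              rw [lintegral_finsetSum _ fun i _ => (hmV i).const_mul _]
              exact Finset.sum_congr rfl fun i _ => lintegral_const_mul _ (hmV i)
          _ ≤ _ := by
              refine Finset.sum_le_sum fun i _ => mul_le_mul_right ?_ _
              refine lintegral_variance_le hsol i u ?_
              filter_upwards [hJ0] with ω h1 h2 s hs
              exact driftBar_nonpos hρ fun i => h1 e u he (pos_iff_ne_zero.2 hu) h2 s hs.le i
      · exact ((M.ξ_continuous i).measurable.ennreal_ofReal.const_mul _).aemeasurable
  -- the bound does not depend on `e`, while the barrier tends to infinity as `e` tends to `0`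
  have hT : ∀ t : ℝ≥0, 0 < t → ∀ᵐ ω ∂Q, ∃ n : ℕ, J ((n : ℝ) + 1)⁻¹ t ω = 0 := by
    intro t ht
    obtain ⟨B, hB, hBb⟩ := hbar t
    have hq : ∀ n : ℕ, ENNReal.ofReal (logGap (2 * ((n : ℝ) + 1)⁻¹)) *
        Q {ω | ∀ n : ℕ, 0 < J ((n : ℝ) + 1)⁻¹ t ω} ≤ B := fun n =>
      (mul_le_mul_right (measure_mono (by
        intro ω hω
        simp only [Set.mem_ofPred_eq] at hω ⊢
        exact hω n)) _).trans
        (hBb ((n : ℝ) + 1)⁻¹ (by positivity))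
    have h0 : Q {ω | ∀ n : ℕ, 0 < J ((n : ℝ) + 1)⁻¹ t ω} = 0 := by
      by_contra hne
      have := ENNReal.Tendsto.mul_const (ENNReal.tendsto_ofReal_atTop.comp tendsto_logGap)
        (b := Q {ω | ∀ n : ℕ, 0 < J ((n : ℝ) + 1)⁻¹ t ω}) (Or.inl ENNReal.top_ne_zero)
      rw [ENNReal.top_mul hne] at this
      exact hB (top_le_iff.1 (le_of_tendsto' this hq))
    filter_upwards [measure_eq_zero_iff_ae_notMem.1 h0] with ω hω
    by_contra! h
    exact hω fun n => lt_of_le_of_ne (integral_nonneg fun s => hΨ0 _ s ω) (h n).symm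
  have hT' : ∀ᵐ ω ∂Q, ∀ m : ℕ, ∃ n : ℕ, J ((n : ℝ) + 1)⁻¹ ((m : ℝ≥0) + 1) ω = 0 :=
    ae_all_iff.2 fun m => hT _ (by positivity)
  filter_upwards [hT', hJ0] with ω h1 h2 i t
  obtain ⟨m, hm⟩ := exists_nat_ge t
  obtain ⟨n, hn⟩ := h1 m
  exact h2 _ _ (by positivity) (by positivity) hn t (hm.trans (le_add_of_nonneg_right zero_le_one)) i

end Variance

end ItoCalculus

namespace ItoCalculus

open RoughFMM (leb IsItoIntegral IsStochIntegral IsCorrelatedBM Model)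

/-! ### The exponential representation of the forward rates -/

section Exponential

set_option linter.unusedSectionVars false

variable {N : ℕ} {Ω : Type*} [mΩ : MeasurableSpace Ω] {Q : Measure Ω} [IsProbabilityMeasure Q]
  {ℱ : Filtration ℝ≥0 mΩ} {M : Model N} {W : Fin (N + 1) → ℝ≥0 → Ω → ℝ}
  {R V : Fin N → ℝ≥0 → Ω → ℝ}

lemma measurable_uncurry_progressive {H : ℝ≥0 → Ω → ℝ} (hH : IsStronglyProgressive ℱ H) :
    Measurable fun p : ℝ≥0 × Ω => H p.1 p.2 := by
  refine measurable_of_tendsto_metrizable (fun n : ℕ => measurable_progressive hH (n : ℝ≥0))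
    (tendsto_pi_nhds.2 fun p => tendsto_const_nhds.congr' ?_)
  filter_upwards [eventually_ge_atTop ⌈p.1⌉₊] with n hn
  rw [min_eq_left ((Nat.le_ceil p.1).trans (by exact_mod_cast hn))]

lemma ae_ae_pos {X : ℝ≥0 → Ω → ℝ} (hX : IsStronglyProgressive ℱ X)
    (h : ∀ t, ∀ᵐ ω ∂Q, 0 < X t ω) : ∀ᵐ ω ∂Q, ∀ᵐ s ∂leb, 0 < X s ω :=
  (Measure.ae_ae_comm (μ := leb) (ν := Q) (p := fun s ω => 0 < X s ω)
    (measurableSet_lt measurable_const (measurable_uncurry_progressive hX))).1 (ae_of_all _ h)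

lemma measurable_γ (M : Model N) (j : Fin N) : Measurable (M.γ j) := by
  unfold Model.γ
  exact Measurable.ite (measurableSet_le measurable_id measurable_const) measurable_const
    (Measurable.ite (measurableSet_le measurable_id measurable_const)
      ((measurable_const.sub NNReal.continuous_coe.measurable).div_const _) measurable_const)

/-- The relative volatility of a forward rate is progressively measurable. -/
lemma exists_progressive_relative_vol
    (hℱ : ∀ A : Set Ω, MeasurableSet[ℱ 0] A ↔ MeasurableSet A ∧ (Q A = 0 ∨ Q A = 1))
    (hsol : M.IsSolution Q ℱ W R V) (hR : ∀ᵐ ω ∂Q, ∀ i t, 0 < R i t ω) (j : Fin N) :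
    ∃ H' : ℝ≥0 → Ω → ℝ, IsStronglyProgressive ℱ H' ∧
      ∀ᵐ ω ∂Q, ∀ᵐ s ∂leb, H' s ω = M.η j (R j s ω) / R j s ω * M.γ j s * √(V j s ω) := by
  classical
  obtain ⟨R', hR'a, hR'c, hR'p, hRR'⟩ := exists_modification hℱ (hsol.adapted_R j)
    (Set.mem_Ioi.2 (zero_lt_one' ℝ)) (U := Set.Ioi 0) (by
      filter_upwards [hsol.continuous_R j, hR] with ω h1 h2
      exact ⟨h1, fun t => Set.mem_Ioi.2 (h2 j t)⟩)
  set g : ℝ → ℝ := (Set.Ioi 0).piecewise (fun r => M.η j r / r) fun _ => 0 with hg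
  have hgm : Measurable g :=
    ContinuousOn.measurable_piecewise ((M.η_continuousOn j).div continuousOn_id fun r hr =>
      (Set.mem_Ioi.1 hr).ne') continuousOn_const measurableSet_Ioi
  refine ⟨fun s ω => g (R' s ω) * M.γ j s * √(V j s ω), fun t => ?_, ?_⟩
  · have h1 := (hR'a.isStronglyProgressive_of_continuous hR'c t).measurable
    have h2 := (hsol.progressive_V j t).measurable
    have h3 : Measurable[Subtype.instMeasurableSpace.prod (ℱ t)]
        fun p : Set.Iic t × Ω => M.γ j p.1 :=
      (measurable_γ M j).comp (measurable_subtype_coe.comp (@measurable_fst _ _ _ (ℱ t)))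
    exact (((hgm.comp h1).mul h3).mul h2.sqrt).stronglyMeasurable
  · filter_upwards [hRR'] with ω h
    refine ae_of_all _ fun s => ?_
    have h0 : R j s ω ∈ Set.Ioi 0 := by rw [h s]; exact hR'p ω s
    simp only [hg]
    rw [← h s, Set.piecewise_eq_of_mem _ _ _ h0]

/-- Itô's formula for the logarithm of a forward rate. -/
theorem exists_exponential_representation
    (hℱ : ∀ A : Set Ω, MeasurableSet[ℱ 0] A ↔ MeasurableSet A ∧ (Q A = 0 ∨ Q A = 1))
    (hsol : M.IsSolution Q ℱ W R V) (hR : ∀ᵐ ω ∂Q, ∀ i t, 0 < R i t ω) (j : Fin N) :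
    ∃ X : ℝ≥0 → Ω → ℝ,
      M.IsIntegralDagger Q ℱ W R V j
        (fun s ω => M.η j (R j s ω) / R j s ω * M.γ j s * √(V j s ω)) X ∧
      ∀ᵐ ω ∂Q, ∀ t : ℝ≥0,
        IntegrableOn (fun s => (M.η j (R j s ω) / R j s ω * M.γ j s) ^ 2 * V j s ω)
          (Set.Iic t) leb ∧
        R j t ω = R j 0 ω * Real.exp (X t ω - 1 / 2 *
          (∫ s in Set.Iic t, (M.η j (R j s ω) / R j s ω * M.γ j s) ^ 2 * V j s ω ∂leb)) := by
  set h : ℝ≥0 → Ω → ℝ := fun s ω => M.η j (R j s ω) / R j s ω * M.γ j s * √(V j s ω) with hh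
  have hB := BM.of_isCorrelatedBM M.ρ_posSemidef hsol.brownian fun _ : Unit => j.succ
  obtain ⟨X₀, hX₀, hRX⟩ := hsol.eq_R j
  obtain ⟨c, hc⟩ := exists_ae_eq_const hℱ (hsol.adapted_R j 0)
  have hRI := IsIto.of_isStochIntegral hB () hX₀ (hsol.adapted_R j) hc hRX
  have hlog : IsIto Q ℱ (fun _ : Unit => W j.succ) (fun s ω => Real.log (R j s ω))
      (fun _ s ω => h s ω)
      fun s ω => h s ω * M.driftDagger R V j s ω - 1 / 2 * h s ω ^ 2 := by
    refine (hRI.ito hB isOpen_Ioi (hR.mono fun ω hω s => Set.mem_Ioi.2 (hω j s))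
      (f := Real.log) (f₁ := fun x => x⁻¹) (f₂ := fun x => -(x ^ 2)⁻¹)
      (fun x hx => (Real.contDiffAt_log.2 (Set.mem_Ioi.1 hx).ne').contDiffWithinAt)
      (fun x hx => Real.hasDerivAt_log (Set.mem_Ioi.1 hx).ne')
      (fun x hx => hasDerivAt_inv (Set.mem_Ioi.1 hx).ne')).congr (ae_of_all _ fun ω t => rfl)
      (ae_of_all _ fun ω k => ae_of_all _ fun s => ?_)
      (ae_of_all _ fun ω => ae_of_all _ fun s => ?_)
    · simp only [hh, Model.vol, if_true]; ring
    · rw [qcov_single, M.ρ_diag]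
      simp only [hh, Model.vol]; ring
  have hint := hlog.integrableOn
  obtain ⟨I, hI, hIeq⟩ := IsIto.exists_isItoIntegral hB hlog
    (exists_progressive_relative_vol hℱ hsol hR j)
  have hVsq : ∀ᵐ ω ∂Q, ∀ᵐ s ∂leb,
      h s ω ^ 2 = (M.η j (R j s ω) / R j s ω * M.γ j s) ^ 2 * V j s ω := by
    filter_upwards [ae_ae_pos (hsol.progressive_V j) (hsol.pos_V j)] with ω h1
    filter_upwards [h1] with s h2
    rw [hh, mul_pow, Real.sq_sqrt h2.le]
  have hi : ∀ᵐ ω ∂Q, ∀ t : ℝ≥0,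
      IntegrableOn (fun s => h s ω * M.driftDagger R V j s ω) (Set.Iic t) leb := by
    filter_upwards [hint] with ω h1 t
    refine ((h1 t).2.add (((h1 t).1 ()).const_mul (1 / 2))).congr (ae_of_all _ fun s => ?_)
    simp only [Pi.add_apply]; ring
  refine ⟨fun t ω => I t ω + ∫ s in Set.Iic t, h s ω * M.driftDagger R V j s ω ∂leb,
    ⟨I, hI, hi, ae_of_all _ fun ω t => rfl⟩, ?_⟩
  filter_upwards [hint, hIeq, hVsq, hi, hR] with ω h1 h2 h3 h4 h5 t
  have hsq : IntegrableOn (fun s => h s ω ^ 2) (Set.Iic t) leb := (h1 t).1 ()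
  refine ⟨hsq.congr (ae_restrict_of_ae h3), ?_⟩
  rw [← setIntegral_congr_ae measurableSet_Iic (h3.mono fun s hs _ => hs)]
  have h6 : ∫ s in Set.Iic t, (h s ω * M.driftDagger R V j s ω - 1 / 2 * h s ω ^ 2) ∂leb =
      (∫ s in Set.Iic t, h s ω * M.driftDagger R V j s ω ∂leb) -
        1 / 2 * ∫ s in Set.Iic t, h s ω ^ 2 ∂leb := by
    have := integral_sub (h4 t) (hsq.const_mul (1 / 2))
    rw [integral_const_mul] at this
    exact this
  have h7 := h2 t
  rw [h6] at h7
  have h8 : I t ω + (∫ s in Set.Iic t, h s ω * M.driftDagger R V j s ω ∂leb) -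
      1 / 2 * ∫ s in Set.Iic t, h s ω ^ 2 ∂leb = Real.log (R j t ω) - Real.log (R j 0 ω) := by
    rw [h7]; ring
  rw [h8, Real.exp_sub, Real.exp_log (h5 j t), Real.exp_log (h5 j 0)]
  have := (h5 j 0).ne'
  field_simp

/-- The exponential of the equation for the variance. -/
lemma exists_variance_representation (hsol : M.IsSolution Q ℱ W R V) (j : Fin N) (t : ℝ≥0) :
    ∃ Y : ℝ≥0 → Ω → ℝ,
      M.IsIntegralBar Q ℱ W R V (M.kernel j t) Y ∧
      ∀ᵐ ω ∂Q, V j t ω = M.ξ j t * Real.exp (Y t ω - 1 / 2 *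
        (∫ s in (0 : ℝ)..t, M.ζ j ((t : ℝ) - s) ^ 2)) := by
  obtain ⟨Y, hY, hV⟩ := hsol.eq_V j t
  refine ⟨Y, hY, ?_⟩
  filter_upwards [hV, hsol.pos_V j t] with ω h1 h2
  rw [← Real.exp_log h2, h1, sub_add, sub_eq_add_neg, Real.exp_add, Real.exp_log (M.ξ_pos j t),
    neg_sub]

end Exponential

end ItoCalculus

namespace ItoCalculus

open RoughFMM (leb IsItoIntegral IsStochIntegral IsCorrelatedBM Model)

/-! ### Bounded martingales -/

section Abstract

variable {Ω ι : Type*} [mΩ : MeasurableSpace Ω] {Q : Measure Ω} [IsProbabilityMeasure Q]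
  {ℱ : Filtration ℝ≥0 mΩ} {ρ : ι → ι → ℝ} {W : ι → ℝ≥0 → Ω → ℝ} [Fintype ι]

set_option linter.unusedSectionVars false

/-- Two densities that have the same integrals over the sets of a sub-σ-algebra give the same
integrals of the functions that are measurable with respect to it. -/
lemma lintegral_mul_eq_of_setLIntegral_eq {m : MeasurableSpace Ω} (hm : m ≤ mΩ) {f g φ : Ω → ℝ≥0∞}
    (hf : AEMeasurable f Q) (hg : AEMeasurable g Q)
    (hfg : ∀ G, MeasurableSet[m] G → ∫⁻ ω in G, f ω ∂Q = ∫⁻ ω in G, g ω ∂Q)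
    (hφ : Measurable[m] φ) {G : Set Ω} (hG : MeasurableSet[m] G) :
    ∫⁻ ω in G, f ω * φ ω ∂Q = ∫⁻ ω in G, g ω * φ ω ∂Q := by
  have htrim : (Q.withDensity f).trim hm = (Q.withDensity g).trim hm := by
    refine @Measure.ext _ m _ _ fun A hA => ?_
    rw [trim_measurableSet_eq hm hA, trim_measurableSet_eq hm hA, withDensity_apply _ (hm _ hA),
      withDensity_apply _ (hm _ hA), hfg A hA]
  have hφG : Measurable[m] (G.indicator φ) := hφ.indicator hG
  have h := congrArg (fun μ => @lintegral Ω m μ (G.indicator φ)) htrim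
  simp only [lintegral_trim hm hφG] at h
  have hφ' : AEMeasurable (G.indicator φ) Q := (hφG.mono hm le_rfl).aemeasurable
  rw [lintegral_withDensity_eq_lintegral_mul₀ hf hφ',
    lintegral_withDensity_eq_lintegral_mul₀ hg hφ'] at h
  rw [← lintegral_indicator (hm _ hG), ← lintegral_indicator (hm _ hG)]
  simpa only [Pi.mul_apply, ← Set.indicator_mul_right] using h

namespace IsIto

variable {Y : ℝ≥0 → Ω → ℝ} {H : ι → ℝ≥0 → Ω → ℝ}

/-- The second moment of a bounded Itô process without drift does not change as long as its
diffusion coefficient vanishes. -/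
lemma integral_sq_sub_eq_zero (hB : BM Q ℱ ρ W) (h : IsIto Q ℱ W Y H fun _ _ => 0) {C : ℝ}
    {s t : ℝ≥0} (hst : s ≤ t) (hY : ∀ᵐ ω ∂Q, ∀ u, |Y u ω| ≤ C)
    (hH : ∀ ω, ∀ u ∈ Set.Ioc s t, ∀ k, H k u ω = 0) :
    ∫ ω, (Y t ω ^ 2 - Y s ω ^ 2) ∂Q = 0 := by
  set a : ℝ≥0 → Ω → ℝ := fun s ω => ∑ k, H k s ω ^ 2 with ha
  set A : ℝ≥0 → Ω → ℝ := fun t ω => ∫ s in Set.Iic t, a s ω ∂leb with hA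
  have ha0 : ∀ s ω, 0 ≤ a s ω := fun s ω => Finset.sum_nonneg fun k _ => sq_nonneg _
  have hAI : IsIto Q ℱ W A (fun _ _ _ => 0) a :=
    (h.clock hB.adapted).congr' (by simp [hA, ha]) (by simp) (by simp [ha])
  have hai : ∀ᵐ ω ∂Q, ∀ T, IntegrableOn (fun s => a s ω) (Set.Iic T) leb :=
    hAI.integrableOn.mono fun ω hω T => (hω T).2
  have hC : 0 ≤ C := by
    obtain ⟨ω, hω⟩ := hY.exists
    exact (abs_nonneg _).trans (hω t)
  have hZ : IsIto Q ℱ W (fun u ω => Y u ω ^ 2) (fun k u ω => 2 * (Y u ω * H k u ω))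
      fun u ω => qcov ρ (fun k => H k u ω) fun k => H k u ω :=
    (h.mul hB h).congr' (fun _ _ => by ring) (fun _ _ _ => by ring) fun _ _ => by ring
  set P := ∑ k, ∑ l, |ρ k l| with hP
  have hP0 : 0 ≤ P := Finset.sum_nonneg fun k _ => Finset.sum_nonneg fun l _ => abs_nonneg _
  set r : ℕ → ℝ := fun m => ((m : ℝ) + 1)⁻¹ with hr
  have hr0 : ∀ m, 0 < r m := fun m => by simp only [hr]; positivity
  have hz : ∀ m, ∫ ω, (Y t ω ^ 2 * cutoff (r m * A t ω) - Y s ω ^ 2 * cutoff (r m * A s ω)) ∂Q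
      = 0 := fun m => by
    have := hZ.setIntegral_localized hB hAI ha0 (ae_of_all _ fun _ _ => rfl) hst
      (C := C ^ 2) (D := 4 * C ^ 2 + P) (by positivity)
      (hY.mono fun ω hω u _ => by
        rw [abs_pow]; exact pow_le_pow_left₀ (abs_nonneg _) (hω u) 2)
      (hY.mono fun ω hω u _ => ?_) (ae_of_all _ fun ω u _ => ?_) (hr0 m) MeasurableSet.univ
    · rw [Measure.restrict_univ] at this
      rw [← this]
      refine integral_congr_ae (ae_of_all _ fun ω => ?_)
      have : ∫ u in Set.Ioc s t, locDrift (fun u ω => Y u ω ^ 2) A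
          (fun u ω => qcov ρ (fun k => H k u ω) fun k => H k u ω) a (r m) u ω ∂leb = 0 := by
        rw [setIntegral_congr_fun (g := fun _ => 0) measurableSet_Ioc, integral_zero]
        intro u hu
        have h0 := hH ω u hu
        simp [locDrift, ha, qcov, h0]
      simp only [this, sub_zero]
    · calc ∑ k, (2 * (Y u ω * H k u ω)) ^ 2 = 4 * |Y u ω| ^ 2 * a u ω := by
            rw [ha, sq_abs, Finset.mul_sum]
            exact Finset.sum_congr rfl fun k _ => by ring
        _ ≤ 4 * C ^ 2 * a u ω := by
            refine mul_le_mul_of_nonneg_right ?_ (ha0 u ω)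
            have := pow_le_pow_left₀ (abs_nonneg _) (hω u) 2
            linarith
        _ ≤ _ := by
            have := mul_nonneg hP0 (ha0 u ω)
            linarith
    · refine (abs_qcov_self_le ρ _).trans ?_
      have : 0 ≤ 4 * C ^ 2 * a u ω := mul_nonneg (by positivity) (ha0 u ω)
      simp only [ha] at this ⊢
      linarith
  have hYφ : ∀ m u, ∀ᵐ ω ∂Q, |Y u ω ^ 2 * cutoff (r m * A u ω)| ≤ C ^ 2 := fun m u => by
    filter_upwards [hY] with ω hω
    rw [abs_mul, abs_of_nonneg (cutoff_nonneg _), abs_pow]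
    exact (mul_le_of_le_one_right (by positivity) (cutoff_le_one _)).trans
      (pow_le_pow_left₀ (abs_nonneg _) (hω u) 2)
  have hm := fun m u => (hZ.localized hB hAI (r m)).aestronglyMeasurable u
  have hlim := tendsto_integral_of_dominated_convergence (μ := Q)
    (F := fun m ω => Y t ω ^ 2 * cutoff (r m * A t ω) - Y s ω ^ 2 * cutoff (r m * A s ω))
    (f := fun ω => Y t ω ^ 2 - Y s ω ^ 2) (fun _ => C ^ 2 + C ^ 2)
    (fun m => (hm m t).sub (hm m s)) (integrable_const _)
    (fun m => by
      filter_upwards [hYφ m t, hYφ m s] with ω h1 h2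
      exact (abs_sub _ _).trans (add_le_add h1 h2))
    (ae_of_all _ fun ω => by
      have hr' : Tendsto r atTop (𝓝 0) := by
        simpa only [hr, one_div] using tendsto_one_div_add_atTop_nhds_zero_nat (𝕜 := ℝ)
      have key : ∀ u, Tendsto (fun m => Y u ω ^ 2 * cutoff (r m * A u ω)) atTop
          (𝓝 (Y u ω ^ 2)) := fun u => by
        have := (continuous_cutoff.tendsto _).comp (hr'.mul_const (A u ω))
        rw [zero_mul, cutoff_eq_one zero_le_one] at this
        simpa using this.const_mul (Y u ω ^ 2)
      exact (key t).sub (key s))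
  simp only [hz] at hlim
  exact tendsto_nhds_unique hlim tendsto_const_nhds

/-- A bounded nonnegative Itô process without drift is constant as long as its diffusion coefficient
vanishes. -/
theorem ae_eq_of_diffusion_eq_zero (hB : BM Q ℱ ρ W) (h : IsIto Q ℱ W Y H fun _ _ => 0)
    (hYa : StronglyAdapted ℱ Y) {C : ℝ}
    {s t : ℝ≥0} (hst : s ≤ t) (hY : ∀ᵐ ω ∂Q, ∀ u, 0 ≤ Y u ω ∧ Y u ω ≤ C)
    (hH : ∀ ω, ∀ u ∈ Set.Ioc s t, ∀ k, H k u ω = 0) : ∀ᵐ ω ∂Q, Y t ω = Y s ω := by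
  have hYabs : ∀ᵐ ω ∂Q, ∀ u, |Y u ω| ≤ C := hY.mono fun ω hω u => by
    rw [abs_of_nonneg (hω u).1]; exact (hω u).2
  have hm := h.aestronglyMeasurable
  have hi : ∀ u, Integrable (Y u) Q := fun u =>
    (integrable_const C).mono' (hm u) (hYabs.mono fun ω hω => hω u)
  have hi2 : ∀ u v, Integrable (fun ω => Y u ω * Y v ω) Q := fun u v =>
    (integrable_const (C * C)).mono' ((hm u).mul (hm v)) (hYabs.mono fun ω hω => by
      rw [Real.norm_eq_abs, abs_mul]
      exact mul_le_mul (hω u) (hω v) (abs_nonneg _) ((abs_nonneg _).trans (hω u)))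
  have hY0 : ∀ u, 0 ≤ᵐ[Q] Y u := fun u => hY.mono fun ω hω => (hω u).1
  have hcross : ∫ ω, Y t ω * Y s ω ∂Q = ∫ ω, Y s ω * Y s ω ∂Q := by
    have h1 := lintegral_mul_eq_of_setLIntegral_eq (Q := Q) (ℱ.le s)
      (hm t).aemeasurable.ennreal_ofReal (hm s).aemeasurable.ennreal_ofReal (fun G hG => ?_)
      (hYa s).measurable.ennreal_ofReal MeasurableSet.univ
    · rw [Measure.restrict_univ] at h1
      have e : ∀ u, ∫⁻ ω, ENNReal.ofReal (Y u ω) * ENNReal.ofReal (Y s ω) ∂Q =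
          ENNReal.ofReal (∫ ω, Y u ω * Y s ω ∂Q) := fun u => by
        rw [ofReal_integral_eq_lintegral_ofReal (hi2 u s)
          (hY.mono fun ω hω => mul_nonneg (hω u).1 (hω s).1)]
        refine lintegral_congr_ae (hY.mono fun ω hω => ?_)
        exact (ENNReal.ofReal_mul (hω u).1).symm
      rw [e, e] at h1
      have e0 : ∀ u, 0 ≤ ∫ ω, Y u ω * Y s ω ∂Q := fun u =>
        integral_nonneg_of_ae (hY.mono fun ω hω => mul_nonneg (hω u).1 (hω s).1)
      exact (ENNReal.ofReal_eq_ofReal_iff (e0 t) (e0 s)).1 h1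
    · have h2 := h.setIntegral_sub_eq_zero_of_bounded hB hst (hYabs.mono fun ω hω u _ => hω u) hG
      rw [integral_sub (hi t).integrableOn (hi s).integrableOn, sub_eq_zero] at h2
      rw [← ofReal_integral_eq_lintegral_ofReal (hi t).integrableOn (ae_restrict_of_ae (hY0 t)),
        ← ofReal_integral_eq_lintegral_ofReal (hi s).integrableOn (ae_restrict_of_ae (hY0 s)), h2]
  have hsq := h.integral_sq_sub_eq_zero hB hst hYabs hH
  have hz : ∫ ω, (Y t ω - Y s ω) ^ 2 ∂Q = 0 := by
    have e : ∀ ω, (Y t ω - Y s ω) ^ 2 =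
        (Y t ω ^ 2 - Y s ω ^ 2) - 2 * (Y t ω * Y s ω - Y s ω * Y s ω) := fun ω => by ring
    have i1 : Integrable (fun ω => Y t ω ^ 2 - Y s ω ^ 2) Q := by
      simp only [sq]; exact (hi2 t t).sub (hi2 s s)
    have i2 : Integrable (fun ω => 2 * (Y t ω * Y s ω - Y s ω * Y s ω)) Q :=
      ((hi2 t s).sub (hi2 s s)).const_mul 2
    simp only [e]
    rw [integral_sub i1 i2, hsq, integral_const_mul, integral_sub (hi2 t s) (hi2 s s), hcross]
    ring
  have hi3 : Integrable (fun ω => (Y t ω - Y s ω) ^ 2) Q := by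
    have : (fun ω => (Y t ω - Y s ω) ^ 2) = fun ω =>
        Y t ω * Y t ω - 2 * (Y t ω * Y s ω) + Y s ω * Y s ω := by funext ω; ring
    rw [this]
    exact ((hi2 t t).sub ((hi2 t s).const_mul 2)).add (hi2 s s)
  filter_upwards [(integral_eq_zero_iff_of_nonneg (fun ω => sq_nonneg _) hi3).1 hz] with ω hω
  exact sub_eq_zero.1 (pow_eq_zero_iff two_ne_zero |>.1 hω)

end IsIto

end Abstract

end ItoCalculus

namespace ItoCalculus

open RoughFMM (leb IsItoIntegral IsStochIntegral IsCorrelatedBM Model)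

/-! ### Bond prices and the forward measure -/

section Bond

variable {N : ℕ} {Ω : Type*} [mΩ : MeasurableSpace Ω] {Q : Measure Ω} [IsProbabilityMeasure Q]
  {ℱ : Filtration ℝ≥0 mΩ} {M : Model N} {W : Fin (N + 1) → ℝ≥0 → Ω → ℝ}
  {R V : Fin N → ℝ≥0 → Ω → ℝ}

set_option linter.unusedSectionVars false

/-- The discounted price of the bond that matures at the `n`-th tenor date. -/
noncomputable def bond (M : Model N) (R : Fin N → ℝ≥0 → Ω → ℝ) (n : ℕ) (t : ℝ≥0) (ω : Ω) : ℝ :=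
  ∏ i ∈ Finset.univ.filter (fun i : Fin N => (i : ℕ) < n), (1 + M.θ i * R i t ω)⁻¹

lemma filter_lt_succ (j : Fin N) : Finset.univ.filter (fun i : Fin N => (i : ℕ) < j + 1) =
    insert j (Finset.univ.filter fun i : Fin N => (i : ℕ) < j) := by
  ext i
  simp only [Finset.mem_filter, Finset.mem_univ, true_and, Finset.mem_insert, Nat.lt_succ_iff_lt_or_eq,
    Fin.ext_iff]
  exact or_comm

lemma Iic_eq_filter (j : Fin N) :
    Finset.Iic j = Finset.univ.filter fun i : Fin N => (i : ℕ) < j + 1 := by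
  ext i
  simp only [Finset.mem_Iic, Finset.mem_filter, Finset.mem_univ, true_and, Fin.le_def]
  omega

lemma discountedBond_eq (j : Fin N) (t : ℝ≥0) (ω : Ω) :
    M.discountedBond R j t ω = bond M R (j + 1) t ω := by
  rw [Model.discountedBond, bond, Iic_eq_filter]

lemma bond_succ (j : Fin N) (t : ℝ≥0) (ω : Ω) :
    bond M R (j + 1) t ω = bond M R j t ω * (1 + M.θ j * R j t ω)⁻¹ := by
  rw [bond, filter_lt_succ, Finset.prod_insert (by simp), mul_comm]
  rfl

lemma bond_pos {ω : Ω} (h : ∀ i t, 0 < R i t ω) (n : ℕ) (t : ℝ≥0) : 0 < bond M R n t ω :=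
  Finset.prod_pos fun i _ => by have := θ_pos M i; have := h i t; positivity

lemma bond_le_one {ω : Ω} (h : ∀ i t, 0 < R i t ω) (n : ℕ) (t : ℝ≥0) : bond M R n t ω ≤ 1 :=
  Finset.prod_le_one (fun i _ => by have := θ_pos M i; have := h i t; positivity) fun i _ => by
    have := mul_pos (θ_pos M i) (h i t)
    exact inv_le_one_of_one_le₀ (by linarith)

/-- The rate times the bond is a portfolio of two bonds. -/
lemma rate_mul_bond {ω : Ω} (h : ∀ i t, 0 < R i t ω) (j : Fin N) (t : ℝ≥0) :
    R j t ω * bond M R (j + 1) t ω = (M.θ j)⁻¹ * (bond M R j t ω - bond M R (j + 1) t ω) := by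
  have hθ := θ_pos M j
  have := mul_pos hθ (h j t)
  have h1 : 1 + M.θ j * R j t ω ≠ 0 := by positivity
  have h2 := inv_mul_cancel₀ h1
  have h3 := inv_mul_cancel₀ hθ.ne'
  rw [bond_succ]
  linear_combination ((M.θ j)⁻¹ * bond M R j t ω) * h2 -
    R j t ω * bond M R j t ω * (1 + M.θ j * R j t ω)⁻¹ * h3

lemma measurable_bond (hsol : M.IsSolution Q ℱ W R V) (n : ℕ) (t : ℝ≥0) :
    Measurable[ℱ t] (bond M R n t) :=
  Finset.measurable_fun_prod _ fun i _ =>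
    (((hsol.adapted_R i t).measurable.const_mul (M.θ i)).const_add 1).inv

lemma qcov_sum_single {ι κ : Type*} [Fintype ι] [DecidableEq ι] (ρ : ι → ι → ℝ) (S : Finset κ)
    (f : κ → ι) (x : κ → ℝ) (l₀ : ι) (y : ℝ) :
    qcov ρ (fun k => ∑ i ∈ S, if k = f i then x i else 0) (fun k => if k = l₀ then y else 0) =
      ∑ i ∈ S, ρ (f i) l₀ * (x i * y) := by
  simp only [qcov, mul_ite, mul_zero, Finset.sum_ite_eq', Finset.mem_univ, if_true]
  simp only [Finset.sum_mul, Finset.mul_sum]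
  rw [Finset.sum_comm]
  refine Finset.sum_congr rfl fun i _ => ?_
  simp [ite_mul, mul_ite]

/-- The volatility of `1 + θ i * R i`, relative to its value. -/
noncomputable def bondVol (M : Model N) (R V : Fin N → ℝ≥0 → Ω → ℝ) (i : Fin N) (t : ℝ≥0) (ω : Ω) :
    ℝ :=
  M.θ i * (1 + M.θ i * R i t ω)⁻¹ * M.vol R V i t ω

/-- The factors of a bond price do have a drift. It compensates the covariation with the product of
the preceding factors. -/
lemma isIto_bondFactor
    (hℱ : ∀ A : Set Ω, MeasurableSet[ℱ 0] A ↔ MeasurableSet A ∧ (Q A = 0 ∨ Q A = 1))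
    (hsol : M.IsSolution Q ℱ W R V) (hR : ∀ᵐ ω ∂Q, ∀ i t, 0 < R i t ω) (j : Fin N) :
    IsIto Q ℱ W (fun t ω => (1 + M.θ j * R j t ω)⁻¹)
      (fun k t ω => if k = j.succ then -((1 + M.θ j * R j t ω)⁻¹ * bondVol M R V j t ω) else 0)
      fun t ω => -((1 + M.θ j * R j t ω)⁻¹ * bondVol M R V j t ω) *
        ∑ i ∈ Finset.univ.filter (fun i : Fin N => (i : ℕ) < j),
          bondVol M R V i t ω * M.ρ i.succ j.succ := by
  have hB := BM.of_isCorrelatedBM M.ρ_posSemidef hsol.brownian id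
  have hθ := θ_pos M j
  have hd : ∀ x : ℝ, HasDerivAt (fun x => 1 + M.θ j * x) (M.θ j) x := fun x => by
    simpa using ((hasDerivAt_id x).const_mul (M.θ j)).const_add 1
  have hU : ∀ x ∈ Set.Ioi (0 : ℝ), 1 + M.θ j * x ≠ 0 := fun x hx => by
    have := Set.mem_Ioi.1 hx; positivity
  refine ((isIto_rate hℱ hsol j).ito hB isOpen_Ioi (hR.mono fun ω hω s => Set.mem_Ioi.2 (hω j s))
    (f := fun x => (1 + M.θ j * x)⁻¹) (f₁ := fun x => -M.θ j / (1 + M.θ j * x) ^ 2)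
    (f₂ := fun x => 2 * M.θ j ^ 2 / (1 + M.θ j * x) ^ 3)
    ((contDiff_const.add (contDiff_const.mul contDiff_id)).contDiffOn.inv hU)
    (fun x hx => (hd x).fun_inv (hU x hx)) fun x hx => ?_).congr (ae_of_all _ fun ω t => rfl)
    (ae_of_all _ fun ω k => ae_of_all _ fun s => ?_) ?_
  · refine ((hasDerivAt_const x (-M.θ j)).fun_div ((hd x).fun_pow 2)
      (pow_ne_zero 2 (hU x hx))).congr_deriv ?_
    have := hU x hx
    field_simp
    ring
  · split_ifs
    · rw [bondVol, div_eq_mul_inv, ← inv_pow]; ring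
    · ring
  · filter_upwards [hR] with ω hω
    refine ae_of_all _ fun s => ?_
    have h1 := hU _ (Set.mem_Ioi.2 (hω j s))
    rw [qcov_single]
    simp only [id, M.ρ_diag, Model.driftDagger, Iic_eq_filter]
    rw [filter_lt_succ, Finset.sum_insert (by simp)]
    have e : ∀ i, M.driftTerm R V i j.succ s ω = bondVol M R V i s ω * M.ρ i.succ j.succ :=
      fun i => by rw [Model.driftTerm, bondVol]; ring
    simp only [e, M.ρ_diag]
    generalize ∑ i ∈ Finset.univ.filter (fun i : Fin N => (i : ℕ) < j),
      bondVol M R V i s ω * M.ρ i.succ j.succ = x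
    rw [bondVol]
    field_simp
    ring

/-- The discounted bond prices have no drift. -/
theorem isIto_bond
    (hℱ : ∀ A : Set Ω, MeasurableSet[ℱ 0] A ↔ MeasurableSet A ∧ (Q A = 0 ∨ Q A = 1))
    (hsol : M.IsSolution Q ℱ W R V) (hR : ∀ᵐ ω ∂Q, ∀ i t, 0 < R i t ω) {n : ℕ} (hn : n ≤ N) :
    IsIto Q ℱ W (bond M R n)
      (fun k t ω => ∑ i ∈ Finset.univ.filter (fun i : Fin N => (i : ℕ) < n),
        if k = i.succ then -(bond M R n t ω * bondVol M R V i t ω) else 0)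
      fun _ _ => 0 := by
  have hB := BM.of_isCorrelatedBM M.ρ_posSemidef hsol.brownian id
  induction n with
  | zero =>
    exact (IsIto.const hB.adapted 1).congr' (fun t ω => by simp [bond]) (by simp) (by simp)
  | succ n ih =>
    have hj := isIto_bondFactor hℱ hsol hR ⟨n, hn⟩
    refine ((ih (by omega)).mul hB hj).congr' (fun t ω => ?_) (fun k t ω => ?_) fun t ω => ?_
    · exact (bond_succ ⟨n, hn⟩ t ω).symm
    · have e := filter_lt_succ (⟨n, hn⟩ : Fin N)
      have e' := bond_succ (M := M) (R := R) ⟨n, hn⟩ t ω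
      simp only at e e'
      rw [e, Finset.sum_insert (by simp), e', Finset.mul_sum]
      refine congrArg₂ _ ?_ (Finset.sum_congr rfl fun i _ => ?_)
      · split_ifs <;> ring
      · split_ifs <;> ring
    · rw [qcov_sum_single]
      simp only [id, mul_zero, add_zero, Finset.mul_sum, ← Finset.sum_add_distrib]
      exact Finset.sum_eq_zero fun i _ => by ring

/-- Discounted bond prices are martingales, as bounded Itô processes without drift. -/
lemma setIntegral_bond_eq
    (hℱ : ∀ A : Set Ω, MeasurableSet[ℱ 0] A ↔ MeasurableSet A ∧ (Q A = 0 ∨ Q A = 1))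
    (hsol : M.IsSolution Q ℱ W R V) (hR : ∀ᵐ ω ∂Q, ∀ i t, 0 < R i t ω) {n : ℕ} (hn : n ≤ N)
    {s t : ℝ≥0} (hst : s ≤ t) {G : Set Ω} (hG : MeasurableSet[ℱ s] G) :
    ∫ ω in G, bond M R n t ω ∂Q = ∫ ω in G, bond M R n s ω ∂Q := by
  have hB := BM.of_isCorrelatedBM M.ρ_posSemidef hsol.brownian id
  have h := isIto_bond hℱ hsol hR hn
  have hi : ∀ u, IntegrableOn (bond M R n u) G Q := fun u =>
    ((integrable_const (1 : ℝ)).mono' (h.aestronglyMeasurable u) (hR.mono fun ω hω => by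
      rw [Real.norm_eq_abs, abs_of_pos (bond_pos hω n u)]; exact bond_le_one hω n u)).integrableOn
  rw [← sub_eq_zero, ← integral_sub (hi t) (hi s)]
  exact h.setIntegral_sub_eq_zero_of_bounded hB hst (C := 1) (hR.mono fun ω hω u _ => by
    rw [abs_of_pos (bond_pos hω n u)]; exact bond_le_one hω n u) hG

/-- Discounted bond prices do not move after maturity. -/
lemma ae_bond_eq_of_le
    (hℱ : ∀ A : Set Ω, MeasurableSet[ℱ 0] A ↔ MeasurableSet A ∧ (Q A = 0 ∨ Q A = 1))
    (hsol : M.IsSolution Q ℱ W R V) (hR : ∀ᵐ ω ∂Q, ∀ i t, 0 < R i t ω) (j : Fin N) {t : ℝ≥0}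
    (ht : M.T j.succ ≤ t) :
    ∀ᵐ ω ∂Q, bond M R (j + 1) t ω = bond M R (j + 1) (M.T j.succ) ω := by
  have hB := BM.of_isCorrelatedBM M.ρ_posSemidef hsol.brownian id
  refine (isIto_bond hℱ hsol hR j.isLt).ae_eq_of_diffusion_eq_zero hB
    (fun t => (measurable_bond hsol _ t).stronglyMeasurable) ht (C := 1)
    (hR.mono fun ω hω u => ⟨(bond_pos hω _ u).le, bond_le_one hω _ u⟩) fun ω u hu k => ?_
  refine Finset.sum_eq_zero fun i hi => ?_
  have hij : i ≤ j := by
    have := (Finset.mem_filter.1 hi).2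
    exact Fin.le_def.2 (by omega)
  have h1 : M.T i.succ < u :=
    (M.T_strictMono.monotone (Fin.succ_le_succ_iff.2 hij)).trans_lt hu.1
  have h2 : M.T i.castSucc < u := (M.T_strictMono i.castSucc_lt_succ).trans h1
  have h3 : M.γ i u = 0 := by
    rw [Model.γ, if_neg (not_le.2 h2), if_neg (not_le.2 h1)]
  simp [bondVol, Model.vol, h3]

/-- The density of the forward measure may be replaced by the bond price at the current time. -/
lemma setLIntegral_bond_mul_eq
    (hℱ : ∀ A : Set Ω, MeasurableSet[ℱ 0] A ↔ MeasurableSet A ∧ (Q A = 0 ∨ Q A = 1))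
    (hsol : M.IsSolution Q ℱ W R V) (hR : ∀ᵐ ω ∂Q, ∀ i t, 0 < R i t ω) (j : Fin N) {t : ℝ≥0}
    {φ : Ω → ℝ≥0∞} (hφ : Measurable[ℱ t] φ) {G : Set Ω} (hG : MeasurableSet[ℱ t] G) :
    ∫⁻ ω in G, ENNReal.ofReal (bond M R (j + 1) (M.T j.succ) ω) * φ ω ∂Q =
      ∫⁻ ω in G, ENNReal.ofReal (bond M R (j + 1) t ω) * φ ω ∂Q := by
  rcases le_total (M.T j.succ) t with ht | ht
  · refine lintegral_congr_ae (ae_restrict_of_ae ?_)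
    filter_upwards [ae_bond_eq_of_le hℱ hsol hR j ht] with ω hω
    rw [hω]
  · have hm : ∀ u, Measurable (bond M R (j + 1) u) := fun u =>
      (measurable_bond hsol _ u).mono (ℱ.le u) le_rfl
    have hi : ∀ u, Integrable (bond M R (j + 1) u) Q := fun u =>
      (integrable_const (1 : ℝ)).mono' (hm u).aestronglyMeasurable (hR.mono fun ω hω => by
        rw [Real.norm_eq_abs, abs_of_pos (bond_pos hω _ u)]; exact bond_le_one hω _ u)
    refine lintegral_mul_eq_of_setLIntegral_eq (ℱ.le t) (hm _).ennreal_ofReal.aemeasurable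
      (hm _).ennreal_ofReal.aemeasurable (fun A hA => ?_) hφ hG
    have e : ∀ u, ∫⁻ ω in A, ENNReal.ofReal (bond M R (j + 1) u ω) ∂Q =
        ENNReal.ofReal (∫ ω in A, bond M R (j + 1) u ω ∂Q) := fun u =>
      (ofReal_integral_eq_lintegral_ofReal (hi u).integrableOn
        (ae_restrict_of_ae (hR.mono fun ω hω => (bond_pos hω _ u).le))).symm
    rw [e, e, setIntegral_bond_eq hℱ hsol hR j.isLt ht hA]

lemma setLIntegral_bond_mul_rate
    (hsol : M.IsSolution Q ℱ W R V) (hR : ∀ᵐ ω ∂Q, ∀ i t, 0 < R i t ω) (j : Fin N) (t : ℝ≥0)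
    (G : Set Ω) :
    ∫⁻ ω in G, ENNReal.ofReal (bond M R (j + 1) t ω) * ENNReal.ofReal (R j t ω) ∂Q =
      ENNReal.ofReal ((M.θ j)⁻¹ *
        ((∫ ω in G, bond M R j t ω ∂Q) - ∫ ω in G, bond M R (j + 1) t ω ∂Q)) := by
  have hi : ∀ n, Integrable (bond M R n t) Q := fun n =>
    (integrable_const (1 : ℝ)).mono'
      ((measurable_bond hsol n t).mono (ℱ.le t) le_rfl).aestronglyMeasurable
      (hR.mono fun ω hω => by
        rw [Real.norm_eq_abs, abs_of_pos (bond_pos hω _ t)]; exact bond_le_one hω _ t)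
  rw [← integral_sub (hi _).integrableOn (hi _).integrableOn, ← integral_const_mul,
    ofReal_integral_eq_lintegral_ofReal]
  · refine lintegral_congr_ae (ae_restrict_of_ae (hR.mono fun ω hω => ?_))
    beta_reduce
    rw [← rate_mul_bond hω, mul_comm (R j t ω), ENNReal.ofReal_mul (bond_pos hω _ t).le]
  · exact (((hi _).sub (hi _)).const_mul _).integrableOn
  · refine ae_restrict_of_ae (hR.mono fun ω hω => ?_)
    beta_reduce
    rw [← rate_mul_bond hω]
    exact mul_nonneg (hω j t).le (bond_pos hω _ t).le

/-- The integral of a forward rate over `G` with respect to the forward measure, up to the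
normalization, does not change with time. -/
lemma setLIntegral_rate_eq
    (hℱ : ∀ A : Set Ω, MeasurableSet[ℱ 0] A ↔ MeasurableSet A ∧ (Q A = 0 ∨ Q A = 1))
    (hsol : M.IsSolution Q ℱ W R V) (hR : ∀ᵐ ω ∂Q, ∀ i t, 0 < R i t ω) (j : Fin N) {s t : ℝ≥0}
    (hst : s ≤ t) {G : Set Ω} (hG : MeasurableSet[ℱ s] G) :
    ∫⁻ ω in G, ENNReal.ofReal (bond M R (j + 1) (M.T j.succ) ω) * ENNReal.ofReal (R j t ω) ∂Q =
      ∫⁻ ω in G, ENNReal.ofReal (bond M R (j + 1) (M.T j.succ) ω) * ENNReal.ofReal (R j s ω) ∂Q := by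
  have hRm : ∀ u, Measurable[ℱ u] fun ω => ENNReal.ofReal (R j u ω) := fun u =>
    (hsol.adapted_R j u).measurable.ennreal_ofReal
  rw [setLIntegral_bond_mul_eq hℱ hsol hR j (hRm t) (ℱ.mono hst _ hG),
    setLIntegral_bond_mul_eq hℱ hsol hR j (hRm s) hG,
    setLIntegral_bond_mul_rate hsol hR j t G,
    setLIntegral_bond_mul_rate hsol hR j s G,
    setIntegral_bond_eq hℱ hsol hR j.isLt.le hst hG, setIntegral_bond_eq hℱ hsol hR j.isLt hst hG]

/-- By the martingale property of the bonds, the forward measure has total mass one, and the forward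
rate is a martingale with respect to it. -/
theorem forwardMeasure_martingale
    (hℱ : ∀ A : Set Ω, MeasurableSet[ℱ 0] A ↔ MeasurableSet A ∧ (Q A = 0 ∨ Q A = 1))
    (hsol : M.IsSolution Q ℱ W R V) (hR : ∀ᵐ ω ∂Q, ∀ i t, 0 < R i t ω) (j : Fin N) :
    IsProbabilityMeasure (M.forwardMeasure Q R j) ∧
      Martingale (R j) ℱ (M.forwardMeasure Q R j) := by
  have hbm : ∀ u, Measurable (bond M R (j + 1) u) := fun u =>
    (measurable_bond hsol _ u).mono (ℱ.le u) le_rfl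
  obtain ⟨ℓ, hℓ⟩ := exists_ae_eq_const hℱ
    (measurable_bond hsol (R := R) (j + 1) 0).stronglyMeasurable
  have hℓ0 : 0 < ℓ := by
    obtain ⟨ω, h1, h2⟩ := (hℓ.and hR).exists
    rw [← h1]; exact bond_pos h2 _ _
  set Z : Ω → ℝ≥0∞ := fun ω => ENNReal.ofReal ℓ⁻¹ * ENNReal.ofReal (bond M R (j + 1) (M.T j.succ) ω)
    with hZ
  have hZm : Measurable Z := (hbm _).ennreal_ofReal.const_mul _
  have hμ : M.forwardMeasure Q R j = Q.withDensity Z := by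
    refine withDensity_congr_ae ?_
    filter_upwards [hℓ] with ω h1
    rw [discountedBond_eq, discountedBond_eq, h1, ENNReal.ofReal_mul (inv_nonneg.2 hℓ0.le)]
  rw [hμ]
  have hone : ∫⁻ ω, Z ω ∂Q = 1 := by
    rw [hZ, lintegral_const_mul _ (hbm _).ennreal_ofReal]
    have h1 := setLIntegral_bond_mul_eq hℱ hsol hR j (t := 0) (φ := fun _ => 1) measurable_const
      MeasurableSet.univ
    simp only [mul_one, Measure.restrict_univ] at h1
    rw [h1, lintegral_congr_ae (hℓ.mono fun ω hω => congrArg ENNReal.ofReal hω), lintegral_const,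
      measure_univ, mul_one, ← ENNReal.ofReal_mul (inv_nonneg.2 hℓ0.le), inv_mul_cancel₀ hℓ0.ne',
      ENNReal.ofReal_one]
  have hprob : IsProbabilityMeasure (Q.withDensity Z) :=
    ⟨by rw [withDensity_apply _ MeasurableSet.univ, Measure.restrict_univ, hone]⟩
  refine ⟨hprob, hsol.adapted_R j, fun s t hst => ?_⟩
  have hRm : ∀ u, Measurable (R j u) := fun u =>
    ((hsol.adapted_R j u).mono (ℱ.le u)).measurable
  have hac : ∀ᵐ ω ∂Q.withDensity Z, ∀ i t, 0 < R i t ω :=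
    (withDensity_absolutelyContinuous Q Z).ae_le hR
  -- integrals of the rates with respect to the forward measure
  have hint : ∀ u {G : Set Ω}, MeasurableSet G →
      ∫⁻ ω in G, ENNReal.ofReal (R j u ω) ∂Q.withDensity Z = ENNReal.ofReal ℓ⁻¹ *
        ∫⁻ ω in G, ENNReal.ofReal (bond M R (j + 1) (M.T j.succ) ω) *
          ENNReal.ofReal (R j u ω) ∂Q := fun u G hG => by
    rw [setLIntegral_withDensity_eq_setLIntegral_mul _ hZm (hRm u).ennreal_ofReal hG,
      ← lintegral_const_mul' _ _ ENNReal.ofReal_ne_top]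
    exact lintegral_congr fun ω => by simp only [hZ, Pi.mul_apply, mul_assoc]
  have hfin : ∀ u, Integrable (R j u) (Q.withDensity Z) := fun u => by
    refine ⟨(hRm u).aestronglyMeasurable, ?_⟩
    rw [hasFiniteIntegral_iff_ofReal (hac.mono fun ω hω => (hω j u).le)]
    have h1 := hint u MeasurableSet.univ
    rw [setLIntegral_bond_mul_eq hℱ hsol hR j (hsol.adapted_R j u).measurable.ennreal_ofReal
      MeasurableSet.univ, setLIntegral_bond_mul_rate hsol hR j u Set.univ,
      Measure.restrict_univ] at h1
    rw [h1]
    exact ENNReal.mul_lt_top ENNReal.ofReal_lt_top ENNReal.ofReal_lt_top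
  refine (ae_eq_condExp_of_forall_setIntegral_eq (ℱ.le s) (hfin t)
    (fun G _ _ => (hfin s).integrableOn) (fun G hG _ => ?_)
    (hsol.adapted_R j s).aestronglyMeasurable).symm
  have e : ∀ u, ∫ ω in G, R j u ω ∂Q.withDensity Z =
      (∫⁻ ω in G, ENNReal.ofReal (R j u ω) ∂Q.withDensity Z).toReal := fun u =>
    integral_eq_lintegral_of_nonneg_ae (ae_restrict_of_ae (hac.mono fun ω hω => (hω j u).le))
      (hRm u).aestronglyMeasurable
  rw [e, e, hint t (ℱ.le s _ hG), hint s (ℱ.le s _ hG),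
    setLIntegral_rate_eq hℱ hsol hR j hst hG]

end Bond

end ItoCalculus

theorem proposition1 {N : ℕ} {Ω : Type*} [mΩ : MeasurableSpace Ω]
    (Q : Measure Ω) [IsProbabilityMeasure Q] (ℱ : Filtration ℝ≥0 mΩ)
    (hℱ : ∀ A : Set Ω, MeasurableSet[ℱ 0] A ↔ MeasurableSet A ∧ (Q A = 0 ∨ Q A = 1))
    (M : RoughFMM.Model N) (W : Fin (N + 1) → ℝ≥0 → Ω → ℝ) (R V : Fin N → ℝ≥0 → Ω → ℝ)
    (hsol : M.IsSolution Q ℱ W R V)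
    (hR0 : ∀ i, ∀ᵐ ω ∂Q, 0 < R i 0 ω)
    (hη : ∀ i, BddAbove ((fun r : ℝ => M.η i r / r) '' Set.Ioi 0))
    (hρ : ∀ i : Fin N, M.ρ 0 i.succ ≤ 0)
    (j : Fin N) :
    (∃ X : ℝ≥0 → Ω → ℝ,
      M.IsIntegralDagger Q ℱ W R V j
        (fun s ω => M.η j (R j s ω) / R j s ω * M.γ j s * √(V j s ω)) X ∧
      ∀ᵐ ω ∂Q, ∀ t : ℝ≥0,
        IntegrableOn (fun s => (M.η j (R j s ω) / R j s ω * M.γ j s) ^ 2 * V j s ω)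
          (Set.Iic t) RoughFMM.leb ∧
        R j t ω = R j 0 ω * Real.exp (X t ω - 1 / 2 *
          (∫ s in Set.Iic t, (M.η j (R j s ω) / R j s ω * M.γ j s) ^ 2 * V j s ω
            ∂(RoughFMM.leb)))) ∧
    (∀ t : ℝ≥0, ∃ Y : ℝ≥0 → Ω → ℝ,
      M.IsIntegralBar Q ℱ W R V (M.kernel j t) Y ∧
      ∀ᵐ ω ∂Q, V j t ω = M.ξ j t * Real.exp (Y t ω - 1 / 2 *
        (∫ s in (0 : ℝ)..t, M.ζ j ((t : ℝ) - s) ^ 2))) ∧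
    IsProbabilityMeasure (M.forwardMeasure Q R j) ∧
    Martingale (R j) ℱ (M.forwardMeasure Q R j) := by
  have hR := ItoCalculus.ae_rate_pos hℱ hsol hR0 hη hρ
  exact ⟨ItoCalculus.exists_exponential_representation hℱ hsol hR j,
    ItoCalculus.exists_variance_representation hsol j,
    ItoCalculus.forwardMeasure_martingale hℱ hsol hR j⟩
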